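/- Let $X$ be a spectrally negative Lévy process, $X_0=0$, on a filtered probability space, with Laplace exponent $$\psi_X(\theta)=\gamma\theta+\tfrac12\sigma^2\theta^2-\int_{(0,\infty)}\bigl(1-e^{-\theta z}-\theta z1_{\{0<z<1\}}\bigr)\Pi(dz),\qquad \theta\ge 0,$$ and let $q,\delta,S>0$. Put $c=\gamma+\int_{(0,1)}z\,\Pi(dz)$, $\psi_Y(\theta)=\psi_X(\theta)-\delta\theta$, $\Phi(q)=\sup\{\theta\ge0:\psi_X(\theta)=q\}$, $\phi(q)=\sup\{\theta\ge0:\psi_Y(\theta)=q\}$. Let $W=W^{(q)}$ be the $q$-scale function of $X$, i.e. the nonnegative function vanishing on $(-\infty,0)$, continuous and strictly increasing on $[0,\infty)$, with $\int_0^\infty e^{-\theta x}W(x)\,dx=1/(\psi_X(\theta)-q)$ for $\theta>\Phi(q)$, and let $\mathbf W=\mathbf W^{(q)}$ be the $q$-scale function of $Y_t=X_t-\delta t$. Assume $$\sigma>0,\quad \phi(q)<\frac{2\delta}{\sigma^2},\quad \Pi(0,\infty)<\infty,\quad S<\frac{c}{\Pi(0,\infty)+q},$$ and that $\Pi$ has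 a completely monotone density on $(0,\infty)$. For $b\ge0$ let $U^b$ with $U^b_t=x+X_t-\delta\int_0^t1_{\{U^b_s>b\}}ds$ be the surplus process under the threshold dividend strategy at level $b$, $\tau=\inf\{t>0:U^b_t<0\}$, and $$V_b^S(x)=\mathbb E\Bigl[\int_0^{\tau}e^{-qt}\,\delta 1_{\{U^b_t>b\}}\,dt+S\,e^{-q\tau}1_{\{\tau<\infty,\;U^b_\tau=0\}}\Bigr].$$ Let $$A_S(b)=\frac{\int_b^\infty e^{-\phi(q)y}\bigl(1-S\frac{\sigma^2}{2}W''(y)\bigr)dy}{\int_b^\infty e^{-\phi(q)y}W'(y)\,dy},\qquad b^*=b^*_S=\inf\{b\ge0:A_S'(b)\le0\}$$ (right derivative at $b=0$, $\inf\emptyset=\infty$), and suppose $b^*>0$. Then $b^*<\infty$, and the following hold. (1) There is a finite measure $\xi$ on $(0,\infty)$ with $\mathbf W(x)=\phi'(q)e^{\phi(q)x}-\int_{(0,\infty)}e^{-xt}\,\xi(dt)$ for all $x>0$, and for this measure $$V^{S\prime}_{b^*}(x)=\int_{(0,\infty)}e^{-xz}p_S(z)\,\xi(dz)\qquad\text{for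 all }x>b^*$$ (the derivative exists and the integral converges absolutely), where $$p_S(z)=-S\frac{\sigma^2}{2}\Bigl(z^2+\delta\frac{2}{\sigma^2}z+\delta z\int_0^{b^*}e^{zy}W''(y)\,dy\Bigr)+\delta e^{b^*z}+A_S(b^*)\Bigl(z-\delta z\int_0^{b^*}e^{zy}W'(y)\,dy\Bigr).$$ (2) $p_S$ is concave on $[0,\infty)$. (3) $V^S_{b^*}$ is twice differentiable on $(b^*,\infty)$, the finite limit $V^{S\prime\prime}_{b^*}(b^*+)$ exists, and there is $\beta\in(0,\infty)$ such that $$V^{S\prime\prime}_{b^*}(x)\le e^{-(x-b^*)\beta}\,V^{S\prime\prime}_{b^*}(b^*+)\qquad\text{for all }x>b^*.$$ -/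

import Mathlib

open MeasureTheory ProbabilityTheory Filter Topology
open scoped NNReal ENNReal

noncomputable section

/-- The numerical data: the triplet `(γ, σ, ν)` of the surplus process (`ν` is the image of the
jump measure under `x ↦ -x`, so it lives on `(0, ∞)`), the discount rate `q`, the maximal dividend
rate `δ` and the terminal value `S` paid when the surplus creeps to `0`. -/
structure DividendData where
  γ : ℝ
  σ : ℝ
  ν : Measure ℝ
  q : ℝ
  δ : ℝ
  S : ℝ

/-- `ψ(θ) = γθ + σ²θ²/2 - ∫_{(0,∞)} (1 - e^{-θz} - θ z 1_{0<z<1}) ν(dz)`. -/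
def laplaceExponent (γ σ : ℝ) (ν : Measure ℝ) (θ : ℝ) : ℝ :=
  γ * θ + 1 / 2 * σ ^ 2 * θ ^ 2
    - ∫ z in Set.Ioi (0 : ℝ),
        (1 - Real.exp (-θ * z) - θ * (Set.Ioo (0 : ℝ) 1).indicator (fun y => y) z) ∂ν

/-- `sup {θ ≥ 0 : ψ(θ) = q}`, the right inverse of the Laplace exponent. -/
def rightInverse (γ σ : ℝ) (ν : Measure ℝ) (q : ℝ) : ℝ :=
  sSup {θ : ℝ | 0 ≤ θ ∧ laplaceExponent γ σ ν θ = q}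

/-- The defining properties of the `q`-scale function of a spectrally negative Lévy process with
triplet `(γ, σ, ν)`. They determine `W` uniquely, by injectivity of the Laplace transform. -/
structure IsScaleFunction (γ σ : ℝ) (ν : Measure ℝ) (q : ℝ) (W : ℝ → ℝ) : Prop where
  eq_zero : ∀ x < 0, W x = 0
  nonneg : ∀ x, 0 ≤ W x
  continuousOn : ContinuousOn W (Set.Ici 0)
  strictMonoOn : StrictMonoOn W (Set.Ici 0)
  laplace : ∀ θ, rightInverse γ σ ν q < θ →
    ∫ x in Set.Ioi (0 : ℝ), Real.exp (-θ * x) * W x = 1 / (laplaceExponent γ σ ν θ - q)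

/-- The `q`-scale function. -/
def scaleFunction (γ σ : ℝ) (ν : Measure ℝ) (q : ℝ) : ℝ → ℝ :=
  Classical.epsilon (IsScaleFunction γ σ ν q)

/-- `ν` is concentrated on `(0, ∞)` and has there a completely monotone density. -/
def HasCompletelyMonotoneDensity (ν : Measure ℝ) : Prop :=
  ∃ ρ : ℝ → ℝ, ContDiffOn ℝ (⊤ : ℕ∞) ρ (Set.Ioi 0) ∧
    (∀ n : ℕ, ∀ x > 0, 0 ≤ (-1) ^ n * iteratedDeriv n ρ x) ∧
    ν = (volume.restrict (Set.Ioi (0 : ℝ))).withDensity (fun x => ENNReal.ofReal (ρ x))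

/-- `X` is a spectrally negative Lévy process with triplet `(γ, σ, ν)`, started at `0`, relative to
the filtration `𝓕`: adapted, càdlàg with no positive jumps, with stationary increments that are
independent of the past, and with `E[exp (θ X_t)] = exp (t ψ(θ))` for `θ ≥ 0`. -/
structure IsSpectrallyNegativeLevy {Ω : Type*} {mΩ : MeasurableSpace Ω} (P : Measure Ω)
    (𝓕 : Filtration ℝ≥0 mΩ) (γ σ : ℝ) (ν : Measure ℝ) (X : ℝ≥0 → Ω → ℝ) : Prop where
  adapted : ∀ t, Measurable[𝓕 t] (X t)
  zero : ∀ᵐ ω ∂P, X 0 ω = 0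
  right_cont : ∀ᵐ ω ∂P, ∀ t, ContinuousWithinAt (fun s => X s ω) (Set.Ici t) t
  left_lim : ∀ᵐ ω ∂P, ∀ t, ∃ l, Tendsto (fun s => X s ω) (𝓝[<] t) (𝓝 l) ∧ X t ω ≤ l
  indep : ∀ s t, s ≤ t →
    Indep (MeasurableSpace.comap (fun ω => X t ω - X s ω) inferInstance) (𝓕 s) P
  stationary : ∀ s t, IdentDistrib (fun ω => X (s + t) ω - X s ω) (X t) P P
  laplace : ∀ t : ℝ≥0, ∀ θ : ℝ, 0 ≤ θ →
    ∫ ω, Real.exp (θ * X t ω) ∂P = Real.exp (t * laplaceExponent γ σ ν θ)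

/-- `U` is the surplus process, started at `x`, under the threshold strategy at level `b`:
`U_t = x + X_t - δ ∫_0^t 1_{U_s > b} ds`. -/
structure IsThresholdSurplus {Ω : Type*} {mΩ : MeasurableSpace Ω} (P : Measure Ω)
    (𝓕 : Filtration ℝ≥0 mΩ) (X : ℝ≥0 → Ω → ℝ) (δ b x : ℝ) (U : ℝ≥0 → Ω → ℝ) : Prop where
  adapted : ∀ t, Measurable[𝓕 t] (U t)
  eq : ∀ᵐ ω ∂P, ∀ t : ℝ≥0,
    U t ω = x + X t ω - ∫ s in (0 : ℝ)..t, (if b < U s.toNNReal ω then δ else 0)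

/-- Ruin time `inf {t > 0 : u_t < 0}` of a path, with `inf ∅ = ∞`. -/
def ruinTime (u : ℝ≥0 → ℝ) : ℝ≥0∞ :=
  ⨅ (t : ℝ≥0) (_ : 0 < t ∧ u t < 0), (t : ℝ≥0∞)

namespace DividendData

variable (M : DividendData)

/-- The drift `c = γ + ∫_{(0,1)} z ν(dz)`. -/
def c : ℝ := M.γ + ∫ z in Set.Ioo (0 : ℝ) 1, z ∂M.ν

/-- The right inverse, at `r`, of the Laplace exponent of `Y_t = X_t - δt`. -/
def φ (r : ℝ) : ℝ := rightInverse (M.γ - M.δ) M.σ M.ν r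

/-- The `q`-scale function of `X`. -/
def W : ℝ → ℝ := scaleFunction M.γ M.σ M.ν M.q

/-- The `q`-scale function of `Y_t = X_t - δt`. -/
def WY : ℝ → ℝ := scaleFunction (M.γ - M.δ) M.σ M.ν M.q

/-- The standing assumptions on the data. -/
structure Standing : Prop where
  q_pos : 0 < M.q
  δ_pos : 0 < M.δ
  S_pos : 0 < M.S
  σ_pos : 0 < M.σ
  φ_lt : M.φ M.q < 2 * M.δ / M.σ ^ 2
  finite : IsFiniteMeasure M.ν
  density : HasCompletelyMonotoneDensity M.ν
  S_lt : M.S < M.c / (M.ν.real (Set.Ioi 0) + M.q)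

/-- The function `A_S`. -/
def A (b : ℝ) : ℝ :=
  (∫ y in Set.Ioi b, Real.exp (-M.φ M.q * y)
      * (1 - M.S * (M.σ ^ 2 / 2) * deriv (deriv M.W) y))
    / ∫ y in Set.Ioi b, Real.exp (-M.φ M.q * y) * deriv M.W y

/-- The threshold `b*_S = inf {b ≥ 0 : A_S'(b) ≤ 0}` in `[0, ∞]`, with `inf ∅ = ∞`; at `b = 0` the
derivative is the right derivative. -/
def bStar : ℝ≥0∞ :=
  ⨅ (b : ℝ≥0) (_ : derivWithin M.A (Set.Ici 0) b ≤ 0), (b : ℝ≥0∞)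

/-- Discounted dividends, paid at rate `δ` while the surplus path `u` exceeds `b`, up to and
including ruin, plus the discounted terminal value `S` if `u` equals `0` at the ruin time. -/
def payoff (b : ℝ) (u : ℝ≥0 → ℝ) : ℝ :=
  (∫ t in {t : ℝ | 0 ≤ t ∧ ENNReal.ofReal t ≤ ruinTime u},
      Real.exp (-M.q * t) * (if b < u t.toNNReal then M.δ else 0))
    + (if ruinTime u < ⊤ ∧ u (ruinTime u).toNNReal = 0 then
        M.S * Real.exp (-M.q * (ruinTime u).toReal) else 0)

/-- The value function of the threshold strategy at level `b`, where `U x` is the corresponding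
surplus process started at `x`. -/
def value {Ω : Type*} {mΩ : MeasurableSpace Ω} (P : Measure Ω) (b : ℝ)
    (U : ℝ → ℝ≥0 → Ω → ℝ) (x : ℝ) : ℝ :=
  ∫ ω, M.payoff b (fun t => U x t ω) ∂P

/-- The function `p_S`, for the threshold level `b`. -/
def p (b z : ℝ) : ℝ :=
  -M.S * (M.σ ^ 2 / 2) *
      (z ^ 2 + M.δ * (2 / M.σ ^ 2) * z
        + M.δ * z * ∫ y in (0 : ℝ)..b, Real.exp (z * y) * deriv (deriv M.W) y)
    + M.δ * Real.exp (b * z)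
    + M.A b * (z - M.δ * z * ∫ y in (0 : ℝ)..b, Real.exp (z * y) * deriv M.W y)

end DividendData

end

open MeasureTheory ProbabilityTheory Filter Topology
open scoped NNReal ENNReal

noncomputable section

/-! ### Uniqueness of Laplace transforms -/

/-! Complete monotonicity makes the scale functions explicit. By Bernstein's theorem the tail of the
jump measure is the Laplace transform of a measure `μ`, so that `ψ(θ) = cθ + σ²θ²/2 - θ ∫ μ(dt)/(θ +
t)`. Dividing `ψ - q` by `θ - φ`, where `φ` is its positive root, leaves `σ²/2 · (θ + a - ∫ η(dt)/(θ
+ t))`, and the reciprocal of the bracket is again a Stieltjes transform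
(`exists_stieltjes_inverse`, by the spectral theorem for a bordered multiplication operator).
Partial fractions turn this into `1/(ψ - q) = m/(θ - φ) - ∫ ξ(dt)/(θ + t)`, that is `W(x) = m e^{φx}
- ∫ e^{-xt} ξ(dt)` with `m = φ'(q)`. This is `exists_scaleRepr`; it is applied to `X`, giving `(Φ,
ζ)`, and to `Y`, giving `(φ, ξ)`.

The threshold is characterised by smooth fit. `A_S` is a quotient of tail integrals, and `A_S'` has
the sign of `A_S - r` with `r = (1 - Sσ²/2 W'')/W'`. Since `r` attains its maximum, `A_S ≤ r`
somewhere and `b*` is finite; at `b*` the two agree, and before `b*` the function `A_S` increases,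
so `r ≤ A_S(b*)` there. For `v₀ = Sσ²/2 W' + A_S(b*) W` this says `v₀'(b*) = 1` and `v₀' ≥ 1` on
`[0, b*]` (`Standing.exists_smoothFit`).

The candidate for the value function is `v₀` up to `b*`, and beyond it `v₀` plus `δ` times the
convolution of the scale function of `Y` with `v₀'(b* + ·) - 1`. It solves the integro-differential
equation of the threshold strategy, and it is twice continuously differentiable because of `v₀'(b*)
= 1`. Above `b*` its derivative contains a term in `e^{φx}` whose coefficient is a multiple of
`∫_{b*}^∞ e^{-φy} (1 - v₀'(y)) dy`; the definition of `A_S` makes this integral vanish. What remains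
is `∫ e^{-xz} p_S(z) ξ(dz)` (`SmoothFit.thresholdValue_one_eq`), and it follows that the candidate
and its first two derivatives are bounded.

That the candidate is the value function (`DividendData.value_eq`) rests on Dynkin's formula up to
ruin, obtained without stochastic integration. The Laplace exponent identifies the law of an
increment of `X` as a Gaussian law convolved with a compound Poisson law, whence the generator as a
small-time limit. The integral over `[0, τ]` of the difference quotient of `e^{-qs} f(U_s)` leaves
along each path only averages near `τ` and near `0`; in expectation, independence of the increments
turns the same integral into one of the generator. The formula is applied to extensions of the
candidate to the negative axis decaying like `e^{Nx}`. As `N → ∞`, ruin by a jump contributes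
nothing and creeping contributes `S`.

The remaining claims are read off `p_S`. Writing `e^{bz} - 1` as `∫_0^b z e^{zy} dy` shows that
`p_S` is a concave quadratic plus `δ ∫_0^{b*} z e^{zy} (1 - v₀'(y)) dy`, concave since `z e^{zy}` is
convex on the half-line and `v₀' ≥ 1`. As `p_S(0) = δ > 0` and `p_S` takes negative values, it
changes sign once, at some `β`. In `v''(x) = -∫ e^{-xz} z p_S(z) ξ(dz)` a comparison of `e^{-(x -
x')z}` with `e^{-(x - x')β}` on the two sides of `β` gives the exponential bound. -/

/-- A finite measure on `ℝ` is determined by its one-sided exponential moments. -/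
theorem MeasureTheory.Measure.ext_of_integral_exp_eq {μ μ' : Measure ℝ} [IsFiniteMeasure μ]
    [IsFiniteMeasure μ'] {θ₀ : ℝ} (hμ : ∀ θ ≥ 0, Integrable (fun x => Real.exp (θ * x)) μ)
    (hμ' : ∀ θ ≥ 0, Integrable (fun x => Real.exp (θ * x)) μ')
    (h : ∀ θ > θ₀, ∫ x, Real.exp (θ * x) ∂μ = ∫ x, Real.exp (θ * x) ∂μ') : μ = μ' := by
  have sub : ∀ m : Measure ℝ, (∀ θ ≥ 0, Integrable (fun x => Real.exp (θ * x)) m) →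
      {z : ℂ | 0 < z.re} ⊆ {z | z.re ∈ interior (integrableExpSet id m)} := by
    intro m hm z hz
    refine mem_interior_iff_mem_nhds.2 (mem_of_superset (Ioi_mem_nhds hz) fun t ht => ?_)
    exact hm t (le_of_lt ht)
  -- Identity theorem on the open right half-plane. The accumulation point `max θ₀ 0 + 1` lies in
  -- the half-plane and beyond `θ₀`, where the hypothesis gives agreement.
  have eqOn : Set.EqOn (complexMGF id μ) (complexMGF id μ') {z : ℂ | 0 < z.re} := by
    have hopen : IsPreconnected {z : ℂ | 0 < z.re} := (convex_halfSpace_re_gt 0).isPreconnected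
    refine (analyticOnNhd_complexMGF.mono (sub μ hμ)).eqOn_of_preconnected_of_frequently_eq
      (analyticOnNhd_complexMGF.mono (sub μ' hμ')) hopen
      (z₀ := ((max θ₀ 0 + 1 : ℝ) : ℂ)) (by simp; positivity) ?_
    have hk : Tendsto (fun n : ℕ => ((max θ₀ 0 + 1 + 1 / ((n : ℝ) + 1) : ℝ) : ℂ)) atTop
        (𝓝[≠] ((max θ₀ 0 + 1 : ℝ) : ℂ)) := by
      refine tendsto_nhdsWithin_iff.2 ⟨?_, ?_⟩
      · refine (Complex.continuous_ofReal.tendsto _).comp ?_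
        simpa using tendsto_one_div_add_atTop_nhds_zero_nat.const_add (max θ₀ 0 + 1 : ℝ)
      · refine Eventually.of_forall fun n => ?_
        simp only [Set.mem_compl_iff, Set.mem_singleton_iff, Complex.ofReal_inj]
        have : (0 : ℝ) < 1 / ((n : ℝ) + 1) := by positivity
        linarith
    refine hk.frequently (Frequently.of_forall fun n => ?_)
    rw [complexMGF_ofReal, complexMGF_ofReal]
    have : (0 : ℝ) < 1 / ((n : ℝ) + 1) := by positivity
    have h1 := le_max_left θ₀ 0
    exact congrArg Complex.ofReal (h (max θ₀ 0 + 1 + 1 / ((n : ℝ) + 1)) (by linarith))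
  -- The imaginary axis may be the boundary of the region of analyticity, so the characteristic
  -- function is reached as a limit from the right, dominated by `1 + e^x`.
  have lim : ∀ (m : Measure ℝ) [IsFiniteMeasure m],
      (∀ θ ≥ 0, Integrable (fun x => Real.exp (θ * x)) m) → ∀ t : ℝ,
      Tendsto (fun n : ℕ => complexMGF id m ((1 / ((n : ℝ) + 1) : ℝ) + t * Complex.I)) atTop
        (𝓝 (charFun m t)) := by
    intro m _ hm t
    rw [← complexMGF_id_mul_I]
    refine tendsto_integral_of_dominated_convergence (fun x => 1 + Real.exp (1 * x)) ?_
      ((integrable_const 1).add (hm 1 zero_le_one)) ?_ ?_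
    · exact fun n => (by fun_prop : Continuous _).aestronglyMeasurable
    · refine fun n => Eventually.of_forall fun x => ?_
      have h0 : (0 : ℝ) < 1 / ((n : ℝ) + 1) := by positivity
      have h1 : 1 / ((n : ℝ) + 1) ≤ 1 := by
        rw [div_le_one (by positivity)]; linarith [(Nat.cast_nonneg n : (0 : ℝ) ≤ n)]
      rw [Complex.norm_exp]
      have : (((1 / ((n : ℝ) + 1) : ℝ) + t * Complex.I) * ((id x : ℝ) : ℂ)).re
          = 1 / ((n : ℝ) + 1) * x := by
        rw [Complex.re_mul_ofReal, Complex.add_re, Complex.ofReal_re]; simp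
      rw [this]
      rcases le_total 0 x with hx | hx
      · have := Real.exp_le_exp.2 (mul_le_mul_of_nonneg_right h1 hx)
        linarith
      · have := Real.exp_le_one_iff.2 (mul_nonpos_of_nonneg_of_nonpos h0.le hx)
        linarith [Real.exp_pos (1 * x)]
    · refine Eventually.of_forall fun x => ?_
      have hc : Continuous fun r : ℝ => Complex.exp (((r : ℂ) + t * Complex.I) * (id x : ℝ)) := by
        fun_prop
      simpa [Function.comp_def] using (hc.tendsto 0).comp tendsto_one_div_add_atTop_nhds_zero_nat
  refine Measure.ext_of_charFun (funext fun t => tendsto_nhds_unique (lim μ hμ t) ?_)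
  refine (lim μ' hμ' t).congr fun n => ?_
  refine (eqOn ?_).symm
  simp only [Set.mem_ofPred_eq, Complex.add_re, Complex.ofReal_re, Complex.mul_re, Complex.I_re,
    mul_zero, Complex.ofReal_im, Complex.I_im, mul_one, sub_self, add_zero]
  positivity

/-- The Laplace transform of a function on `(0, ∞)`. -/
def laplaceTransform (f : ℝ → ℝ) (θ : ℝ) : ℝ := ∫ x in Set.Ioi (0 : ℝ), Real.exp (-θ * x) * f x

/-- The integral defining the Laplace transform at `θ` converges absolutely. -/
def LaplaceIntegrable (f : ℝ → ℝ) (θ : ℝ) : Prop :=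
  IntegrableOn (fun x => Real.exp (-θ * x) * f x) (Set.Ioi 0)

theorem LaplaceIntegrable.mono {f : ℝ → ℝ} {θ θ' : ℝ} (h : LaplaceIntegrable f θ) (hθ : θ ≤ θ') :
    LaplaceIntegrable f θ' := by
  have : LaplaceIntegrable f θ' ↔ IntegrableOn
      (fun x => Real.exp (-(θ' - θ) * x) * (Real.exp (-θ * x) * f x)) (Set.Ioi 0) := by
    unfold LaplaceIntegrable
    refine integrableOn_congr_fun (fun x _ => ?_) measurableSet_Ioi
    rw [← mul_assoc, ← Real.exp_add]; congr 2; ring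
  rw [this]
  refine Integrable.bdd_mul (c := 1) h (by fun_prop : Continuous _).aestronglyMeasurable ?_
  refine (ae_restrict_iff' measurableSet_Ioi).2 (Eventually.of_forall fun x hx => ?_)
  rw [Real.norm_eq_abs, abs_of_pos (Real.exp_pos _), Real.exp_le_one_iff]
  have := mul_nonneg (sub_nonneg.2 hθ) (le_of_lt hx)
  linarith

/-- Tilting gives the integrable `g = e^{-θ₀x} f`. Its positive and negative parts define finite
measures, reflected to the negative axis so that `e^{θx}` is bounded for `θ ≥ 0`. A vanishing
transform equates their exponential moments, hence the two parts, and parts that are never nonzero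
together are then both zero. -/
theorem ae_eq_zero_of_laplaceTransform_eq_zero {f : ℝ → ℝ} {θ₀ : ℝ}
    (hf : LaplaceIntegrable f θ₀) (h : ∀ θ > θ₀, laplaceTransform f θ = 0) :
    ∀ᵐ x ∂(volume.restrict (Set.Ioi (0 : ℝ))), f x = 0 := by
  set g : ℝ → ℝ := fun x => Real.exp (-θ₀ * x) * f x with hg
  have hgi : Integrable g (volume.restrict (Set.Ioi (0 : ℝ))) := hf
  set M : (ℝ → ℝ) → Measure ℝ := fun k =>
    ((volume.restrict (Set.Ioi (0 : ℝ))).withDensity fun x => ENNReal.ofReal (k x)).map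
      (fun x => -x) with hM
  have fin : ∀ k, Integrable k (volume.restrict (Set.Ioi (0 : ℝ))) → IsFiniteMeasure (M k) := by
    intro k hk
    have := isFiniteMeasure_withDensity_ofReal hk.2
    exact Measure.isFiniteMeasure_map _ _
  have key : ∀ k, Integrable k (volume.restrict (Set.Ioi (0 : ℝ))) → ∀ θ ≥ 0,
      Integrable (fun x => Real.exp (-θ * x) * max (k x) 0)
          (volume.restrict (Set.Ioi (0 : ℝ))) ∧
      Integrable (fun x => Real.exp (θ * x)) (M k) ∧
      ∫ x, Real.exp (θ * x) ∂(M k)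
        = ∫ x in Set.Ioi (0 : ℝ), Real.exp (-θ * x) * max (k x) 0 := by
    intro k hk θ hθ
    have i1 : Integrable (fun x => Real.exp (-θ * x) * max (k x) 0)
        (volume.restrict (Set.Ioi (0 : ℝ))) := by
      refine Integrable.bdd_mul (c := 1) hk.pos_part
        (by fun_prop : Continuous _).aestronglyMeasurable ?_
      refine (ae_restrict_iff' measurableSet_Ioi).2 (Eventually.of_forall fun x hx => ?_)
      rw [Real.norm_eq_abs, abs_of_pos (Real.exp_pos _), Real.exp_le_one_iff]
      have := mul_nonneg hθ (le_of_lt hx)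
      linarith
    have e : ∀ x, (ENNReal.ofReal (k x)).toReal • Real.exp (θ * -x)
        = Real.exp (-θ * x) * max (k x) 0 := by
      intro x; rw [ENNReal.toReal_ofReal', smul_eq_mul, mul_comm]; congr 2; ring
    refine ⟨i1, ?_, ?_⟩
    · rw [hM, integrable_map_measure (by fun_prop : Continuous _).aestronglyMeasurable
        (by fun_prop), integrable_withDensity_iff_integrable_smul₀' hk.1.aemeasurable.ennreal_ofReal
        (by simp)]
      exact i1.congr (Eventually.of_forall fun x => (e x).symm)
    · rw [hM, integral_map (by fun_prop) (by fun_prop : Continuous _).aestronglyMeasurable,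
        integral_withDensity_eq_integral_toReal_smul₀ hk.1.aemeasurable.ennreal_ofReal (by simp)]
      exact integral_congr_ae (Eventually.of_forall e)
  have := fin g hgi
  have := fin (fun x => -g x) hgi.neg
  have eqM : M g = M (fun x => -g x) := by
    refine Measure.ext_of_integral_exp_eq (θ₀ := 0) (fun θ hθ => (key g hgi θ hθ).2.1)
      (fun θ hθ => (key (fun x => -g x) hgi.neg θ hθ).2.1) fun θ hθ => ?_
    rw [(key g hgi θ hθ.le).2.2, (key (fun x => -g x) hgi.neg θ hθ.le).2.2, ← sub_eq_zero,
      ← integral_sub (key g hgi θ hθ.le).1 (key (fun x => -g x) hgi.neg θ hθ.le).1]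
    refine Eq.trans ?_ (h (θ₀ + θ) (by linarith))
    refine integral_congr_ae (Eventually.of_forall fun x => ?_)
    simp only
    rw [← mul_sub]
    have : max (g x) 0 - max (-g x) 0 = g x := by
      rcases le_total 0 (g x) with h0 | h0
      · rw [max_eq_left h0, max_eq_right (by linarith)]; simp
      · rw [max_eq_right h0, max_eq_left (by linarith)]; simp
    rw [this, hg, ← mul_assoc, ← Real.exp_add]
    congr 2; ring
  have eqD : (volume.restrict (Set.Ioi (0 : ℝ))).withDensity (fun x => ENNReal.ofReal (g x))
      = (volume.restrict (Set.Ioi (0 : ℝ))).withDensity (fun x => ENNReal.ofReal (-g x)) := by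
    have := congrArg (fun m => Measure.map (fun x : ℝ => -x) m) eqM
    simpa [hM, Measure.map_map measurable_neg measurable_neg, Function.comp_def] using this
  have hgm : AEMeasurable (fun x => ENNReal.ofReal (-g x)) (volume.restrict (Set.Ioi (0 : ℝ))) :=
    hgi.neg.1.aemeasurable.ennreal_ofReal
  rw [withDensity_eq_iff hgi.1.aemeasurable.ennreal_ofReal hgm
    (by simpa using (hgi.lintegral_lt_top).ne)] at eqD
  filter_upwards [eqD] with x hx
  have hx0 : g x = 0 := by
    rcases le_total 0 (g x) with h0 | h0
    · rw [ENNReal.ofReal_of_nonpos (by linarith : -g x ≤ 0)] at hx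
      exact le_antisymm (ENNReal.ofReal_eq_zero.1 hx) h0
    · rw [ENNReal.ofReal_of_nonpos h0] at hx
      have := ENNReal.ofReal_eq_zero.1 hx.symm
      linarith
  rcases mul_eq_zero.1 hx0 with h0 | h0
  · exact absurd h0 (Real.exp_pos _).ne'
  · exact h0

theorem eqOn_of_ae_eq_Ioi {f g : ℝ → ℝ} {a : ℝ} (hf : ContinuousOn f (Set.Ioi a))
    (hg : ContinuousOn g (Set.Ioi a))
    (h : ∀ᵐ x ∂(volume.restrict (Set.Ioi a)), f x = g x) : Set.EqOn f g (Set.Ioi a) :=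
  Measure.eqOn_open_of_ae_eq h isOpen_Ioi hf hg

/-- Injectivity of the Laplace transform on continuous functions. -/
theorem eqOn_of_laplaceTransform_eq {f g : ℝ → ℝ} {θ₀ : ℝ}
    (hf : ContinuousOn f (Set.Ioi 0)) (hg : ContinuousOn g (Set.Ioi 0))
    (hfi : LaplaceIntegrable f θ₀) (hgi : LaplaceIntegrable g θ₀)
    (h : ∀ θ > θ₀, laplaceTransform f θ = laplaceTransform g θ) :
    Set.EqOn f g (Set.Ioi 0) := by
  refine eqOn_of_ae_eq_Ioi hf hg ?_
  have hi : LaplaceIntegrable (fun x => f x - g x) θ₀ := by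
    unfold LaplaceIntegrable at *
    simp_rw [mul_sub]
    exact hfi.sub hgi
  refine (ae_eq_zero_of_laplaceTransform_eq_zero hi fun θ hθ => ?_).mono fun x hx => sub_eq_zero.1 hx
  unfold laplaceTransform
  simp_rw [mul_sub]
  rw [integral_sub (hfi.mono hθ.le) (hgi.mono hθ.le), sub_eq_zero]
  exact h θ hθ

/-- The convolution `∫_0^x f(t) g(x - t) dt` of functions on `(0, ∞)`. -/
def halfConv (f g : ℝ → ℝ) (x : ℝ) : ℝ := ∫ t in (0 : ℝ)..x, f t * g (x - t)

theorem exp_mul_halfConv (f g : ℝ → ℝ) (θ x : ℝ) :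
    Real.exp (-θ * x) * halfConv f g x = ∫ t in (0 : ℝ)..x,
      (Real.exp (-θ * t) * f t) * (Real.exp (-θ * (x - t)) * g (x - t)) := by
  rw [halfConv, ← intervalIntegral.integral_const_mul]
  refine intervalIntegral.integral_congr fun t _ => ?_
  have : Real.exp (-θ * x) = Real.exp (-θ * t) * Real.exp (-θ * (x - t)) := by
    rw [← Real.exp_add]; congr 1; ring
  simp only [this]; ring

theorem LaplaceIntegrable.halfConv {f g : ℝ → ℝ} {θ : ℝ} (hf : LaplaceIntegrable f θ)
    (hg : LaplaceIntegrable g θ) : LaplaceIntegrable (halfConv f g) θ := by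
  have := integrable_posConvolution hf hg (ContinuousLinearMap.mul ℝ ℝ)
  refine (this.integrableOn (s := Set.Ioi 0)).congr_fun (fun x hx => ?_) measurableSet_Ioi
  simp only [posConvolution, Set.indicator_of_mem hx, ContinuousLinearMap.mul_apply']
  exact (exp_mul_halfConv f g θ x).symm

theorem laplaceTransform_halfConv {f g : ℝ → ℝ} {θ : ℝ} (hf : LaplaceIntegrable f θ)
    (hg : LaplaceIntegrable g θ) :
    laplaceTransform (halfConv f g) θ = laplaceTransform f θ * laplaceTransform g θ := by
  have := integral_posConvolution hf hg (ContinuousLinearMap.mul ℝ ℝ)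
  simp only [ContinuousLinearMap.mul_apply'] at this
  rw [laplaceTransform, laplaceTransform, laplaceTransform, ← this]
  simp_rw [exp_mul_halfConv]

theorem laplaceTransform_deriv {f f' : ℝ → ℝ} {θ : ℝ} (hc : ContinuousWithinAt f (Set.Ici 0) 0)
    (hd : ∀ x > 0, HasDerivAt f (f' x) x) (hf : LaplaceIntegrable f θ)
    (hf' : LaplaceIntegrable f' θ) :
    laplaceTransform f' θ = θ * laplaceTransform f θ - f 0 := by
  set F : ℝ → ℝ := fun x => Real.exp (-θ * x) * f x with hF
  have hFd : ∀ x ∈ Set.Ioi (0 : ℝ), HasDerivAt F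
      (-θ * (Real.exp (-θ * x) * f x) + Real.exp (-θ * x) * f' x) x := by
    intro x hx
    have h1 : HasDerivAt (fun x : ℝ => Real.exp (-θ * x)) (Real.exp (-θ * x) * (-θ * 1)) x :=
      ((hasDerivAt_id x).const_mul (-θ)).exp
    exact (h1.mul (hd x hx)).congr_deriv (by ring)
  have hi : IntegrableOn (fun x => -θ * (Real.exp (-θ * x) * f x) + Real.exp (-θ * x) * f' x)
      (Set.Ioi 0) := (hf.const_mul (-θ)).add hf'
  -- A function that is integrable together with its derivative vanishes at infinity, so no growth
  -- bound on `f` is needed for the boundary term.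
  have hlim : Tendsto F atTop (𝓝 0) :=
    tendsto_zero_of_hasDerivAt_of_integrableOn_Ioi hFd hi hf
  have := integral_Ioi_of_hasDerivAt_of_tendsto (f := F) (a := 0) (m := 0)
    ((by fun_prop : Continuous fun x => Real.exp (-θ * x)).continuousWithinAt.mul hc) hFd hi hlim
  rw [integral_add (hf.const_mul (-θ)) hf', integral_const_mul] at this
  simp only [hF, mul_zero, Real.exp_zero, one_mul, zero_sub] at this
  unfold laplaceTransform
  linarith

/-! ### Bernstein's theorem for the tail of a completely monotone density -/

/-- Used with `u = x / y` to replace the kernel of Taylor's formula at infinity by an exponential,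
uniformly. For `u ≤ 1`, Bernoulli's inequality for `(1 - u²)^n` and `1 - u² ≤ (1 - u) e^u` bound the
gap by `n u² e^{-nu}`, and `x² e^{-x} ≤ 2`. For `u ≥ 1` the exponential alone is small. -/
theorem abs_max_one_sub_pow_sub_exp_le (n : ℕ) (hn : 1 ≤ n) (u : ℝ) (hu : 0 ≤ u) :
    |(max (1 - u) 0) ^ n - Real.exp (-(n * u))| ≤ 2 / n := by
  have hn0 : (0 : ℝ) < n := by exact_mod_cast hn
  have hexp : Real.exp (-(n * u)) = Real.exp (-u) ^ n := by
    rw [← Real.exp_nat_mul]; congr 1; ring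
  have hle : (max (1 - u) 0) ^ n ≤ Real.exp (-(n * u)) := by
    rw [hexp]
    refine pow_le_pow_left₀ (le_max_right _ _) (max_le ?_ (Real.exp_pos _).le) n
    have := Real.add_one_le_exp (-u); linarith
  rw [abs_sub_comm, abs_of_nonneg (sub_nonneg.2 hle)]
  rcases le_total u 1 with h1 | h1
  · rw [max_eq_left (by linarith)]
    have hB : 1 - n * u ^ 2 ≤ (1 - u ^ 2) ^ n := by
      have := one_add_mul_le_pow (a := -u ^ 2) (by nlinarith) n
      calc 1 - n * u ^ 2 = 1 + n * (-u ^ 2) := by ring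
        _ ≤ (1 + -u ^ 2) ^ n := this
        _ = _ := by ring
    have h2 : (1 - u ^ 2) ^ n ≤ (1 - u) ^ n * Real.exp (n * u) := by
      have : Real.exp (n * u) = Real.exp u ^ n := by rw [← Real.exp_nat_mul]
      rw [this, ← mul_pow]
      refine pow_le_pow_left₀ (by nlinarith) ?_ n
      have := mul_le_mul_of_nonneg_left (Real.add_one_le_exp u) (sub_nonneg.2 h1)
      nlinarith
    have h3 : Real.exp (-(n * u)) * Real.exp (n * u) = 1 := by
      rw [← Real.exp_add]; simp
    have h4 : Real.exp (-(n * u)) - (1 - u) ^ n ≤ n * u ^ 2 * Real.exp (-(n * u)) := by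
      have := mul_le_mul_of_nonneg_right (hB.trans h2) (Real.exp_pos (-(n * u))).le
      rw [mul_assoc, mul_comm (Real.exp (n * u)), h3] at this
      linarith
    refine h4.trans ?_
    have h5 : (n * u) ^ 2 / 2 ≤ Real.exp (n * u) := by
      have := Real.quadratic_le_exp_of_nonneg (mul_nonneg hn0.le hu)
      have := mul_nonneg hn0.le hu
      linarith
    have h6 : (n * u) ^ 2 / 2 * Real.exp (-(n * u)) ≤ 1 := by
      have := mul_le_mul_of_nonneg_right h5 (Real.exp_pos (-(n * u))).le
      linarith
    rw [le_div_iff₀ hn0]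
    nlinarith
  · have h0 : 0 ≤ max (1 - u) 0 ^ n := pow_nonneg (le_max_right _ _) _
    have h5 : 1 + n * u ≤ Real.exp (n * u) := by linarith [Real.add_one_le_exp (n * u)]
    have h6 : (n : ℝ) ≤ Real.exp (n * u) := by nlinarith
    have : Real.exp (-(n * u)) ≤ 1 / n := by
      rw [Real.exp_neg, ← one_div]
      exact one_div_le_one_div_of_le hn0 h6
    have h7 : (1 : ℝ) / n ≤ 2 / n := by gcongr; norm_num
    linarith

/-- A decreasing nonnegative differentiable function on `(0, ∞)` that is integrable at infinity
tends to `0`, and its derivative is integrable at infinity. -/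
theorem tendsto_zero_and_integrableOn_deriv {f g : ℝ → ℝ} (hd : ∀ x > 0, HasDerivAt f (-g x) x)
    (hf : ∀ x > 0, 0 ≤ f x) (hg : ∀ x > 0, 0 ≤ g x) (hi : IntegrableOn f (Set.Ioi 1)) :
    Tendsto f atTop (𝓝 0) ∧ IntegrableOn g (Set.Ioi 1) := by
  have hanti : AntitoneOn f (Set.Ioi 0) := by
    refine antitoneOn_of_deriv_nonpos (convex_Ioi 0)
      (fun x hx => (hd x hx).continuousAt.continuousWithinAt)
      (fun x hx => (hd x (by simpa using hx)).differentiableAt.differentiableWithinAt) ?_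
    intro x hx
    rw [interior_Ioi] at hx
    rw [(hd x hx).deriv]
    linarith [hg x hx]
  have hm : Antitone fun y => f (max y 1) := fun a b hab =>
    hanti (Set.mem_Ioi.2 (lt_max_of_lt_right one_pos)) (Set.mem_Ioi.2 (lt_max_of_lt_right one_pos))
      (max_le_max_right 1 hab)
  have hlim : Tendsto f atTop (𝓝 (⨅ y, f (max y 1))) := by
    refine (tendsto_atTop_ciInf hm ⟨0, ?_⟩).congr' ?_
    · rintro _ ⟨y, rfl⟩; exact hf _ (lt_max_of_lt_right one_pos)
    · filter_upwards [eventually_ge_atTop 1] with y hy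
      rw [max_eq_left hy]
  have hgi : IntegrableOn (fun x => -g x) (Set.Ioi 1) :=
    integrableOn_Ioi_deriv_of_nonpos' (fun x hx => hd x (zero_lt_one.trans_le hx))
      (fun x hx => by linarith [hg x (zero_lt_one.trans hx)]) hlim
  exact ⟨tendsto_zero_of_hasDerivAt_of_integrableOn_Ioi
    (fun x hx => hd x (zero_lt_one.trans hx)) hgi hi, by simpa using hgi.neg⟩

theorem lintegral_Ioo_pow_div_factorial (n : ℕ) {x s : ℝ} (hxs : x ≤ s) :
    ∫⁻ y in Set.Ioo x s, ENNReal.ofReal ((y - x) ^ n / n.factorial)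
      = ENNReal.ofReal ((s - x) ^ (n + 1) / (n + 1).factorial) := by
  rw [← ofReal_integral_eq_lintegral_ofReal]
  · congr 1
    rw [← integral_Ioc_eq_integral_Ioo, ← intervalIntegral.integral_of_le hxs,
      intervalIntegral.integral_div,
      intervalIntegral.integral_comp_sub_right (fun y => y ^ n) x, integral_pow]
    rw [Nat.factorial_succ]
    push_cast
    rw [sub_self, zero_pow (Nat.succ_ne_zero n), sub_zero, div_div]
  · exact ((by fun_prop : Continuous fun y : ℝ => (y - x) ^ n / n.factorial).integrableOn_Icc).mono_set
      Set.Ioo_subset_Icc_self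
  · refine (ae_restrict_iff' measurableSet_Ioo).2 (Eventually.of_forall fun y hy => ?_)
    have : 0 ≤ y - x := by linarith [hy.1]
    simp only [Pi.zero_apply]
    positivity

section Bernstein

variable {r : ℕ → ℝ → ℝ}

/-- Taylor's formula at infinity for a completely monotone function. -/
theorem lintegral_Ioi_completelyMonotone_succ (hd : ∀ n, ∀ x > 0, HasDerivAt (r n) (-r (n + 1) x) x)
    (hr : ∀ n, ∀ x > 0, 0 ≤ r n x) (hi : IntegrableOn (r 0) (Set.Ioi 1)) (n : ℕ) {x : ℝ}
    (hx : 0 ≤ x) :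
    ∫⁻ y in Set.Ioi x, ENNReal.ofReal (r n y) * ENNReal.ofReal ((y - x) ^ n / n.factorial)
      = ∫⁻ y in Set.Ioi x, ENNReal.ofReal (r (n + 1) y)
          * ENNReal.ofReal ((y - x) ^ (n + 1) / (n + 1).factorial) := by
  have hint : ∀ n, IntegrableOn (r n) (Set.Ioi 1) := by
    intro n
    induction n with
    | zero => exact hi
    | succ n ih => exact (tendsto_zero_and_integrableOn_deriv (hd n) (hr n) (hr (n + 1)) ih).2
  have hlim : ∀ n, Tendsto (r n) atTop (𝓝 0) := fun n =>
    (tendsto_zero_and_integrableOn_deriv (hd n) (hr n) (hr (n + 1)) (hint n)).1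
  -- Every `r n` tends to `0` at infinity, so it is the integral of its successor over the tail.
  have htail : ∀ y > 0, ENNReal.ofReal (r n y) = ∫⁻ s in Set.Ioi y, ENNReal.ofReal (r (n + 1) s) := by
    intro y hy
    have hdn : ∀ s ∈ Set.Ici y, HasDerivAt (fun s => -r n s) (r (n + 1) s) s := fun s hs =>
      (hd n s (hy.trans_le hs)).neg.congr_deriv (neg_neg _)
    have hpos : ∀ s ∈ Set.Ioi y, 0 ≤ r (n + 1) s := fun s hs => hr _ s (hy.trans hs)
    have hl : Tendsto (fun s => -r n s) atTop (𝓝 0) := by simpa using (hlim n).neg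
    have h1 := integral_Ioi_of_hasDerivAt_of_nonneg' hdn hpos hl
    rw [← ofReal_integral_eq_lintegral_ofReal (integrableOn_Ioi_deriv_of_nonneg' hdn hpos hl)
      ((ae_restrict_iff' measurableSet_Ioi).2 (Eventually.of_forall hpos)), h1]
    simp
  have hmeas : ∀ n, Measurable fun s => (Set.Ioi (0 : ℝ)).indicator
      (fun s => ENNReal.ofReal (r n s)) s := by
    intro n
    have hc : ContinuousOn (r n) (Set.Ioi 0) :=
      fun s hs => (hd n s hs).continuousAt.continuousWithinAt
    have : Measurable ((Set.Ioi (0 : ℝ)).indicator (r n)) := by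
      rw [← Set.piecewise_eq_indicator]
      exact hc.measurable_piecewise continuousOn_const measurableSet_Ioi
    have e : (fun s => (Set.Ioi (0 : ℝ)).indicator (fun s => ENNReal.ofReal (r n s)) s)
        = fun s => ENNReal.ofReal ((Set.Ioi (0 : ℝ)).indicator (r n) s) := by
      funext s; by_cases hs : s ∈ Set.Ioi (0 : ℝ) <;> simp [hs]
    rw [e]; exact this.ennreal_ofReal
  set R := fun s => (Set.Ioi (0 : ℝ)).indicator (fun s => ENNReal.ofReal (r (n + 1) s)) s with hR
  set k : ℝ → ℝ≥0∞ := fun y => ENNReal.ofReal ((y - x) ^ n / n.factorial) with hk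
  have hkm : Measurable k := by fun_prop
  -- Tonelli on the region `x < y < s`: integrating the power in `y` first raises its degree by one.
  -- The indicator in `R` supplies measurability, since nothing is known about `r` off the
  -- half-line.
  calc ∫⁻ y in Set.Ioi x, ENNReal.ofReal (r n y) * k y
      = ∫⁻ y in Set.Ioi x, ∫⁻ s in Set.Ioi x, {p : ℝ × ℝ | p.1 < p.2}.indicator
          (fun p => R p.2 * k p.1) (y, s) := by
        refine setLIntegral_congr_fun measurableSet_Ioi fun y hy => ?_
        have hy0 : 0 < y := lt_of_le_of_lt hx hy
        rw [htail y hy0, ← lintegral_mul_const'' _ ?_]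
        · have : ∀ s, {p : ℝ × ℝ | p.1 < p.2}.indicator (fun p => R p.2 * k p.1) (y, s)
              = (Set.Ioi y).indicator (fun s => R s * k y) s := by
            intro s; simp [Set.indicator]
          simp_rw [this]
          rw [setLIntegral_indicator measurableSet_Ioi, Set.inter_eq_left.2 (Set.Ioi_subset_Ioi hy.le)]
          refine setLIntegral_congr_fun measurableSet_Ioi fun s hs => ?_
          have hs0 : 0 < s := hy0.trans hs
          simp [hR, hs0]
        · refine ContinuousOn.aemeasurable ?_ measurableSet_Ioi
          exact fun s hs => (ENNReal.continuous_ofReal.continuousAt.comp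
            (hd (n + 1) s (hy0.trans hs)).continuousAt).continuousWithinAt
    _ = ∫⁻ s in Set.Ioi x, ∫⁻ y in Set.Ioi x, {p : ℝ × ℝ | p.1 < p.2}.indicator
          (fun p => R p.2 * k p.1) (y, s) := by
        refine lintegral_lintegral_swap (Measurable.aemeasurable ?_)
        refine Measurable.indicator ?_ (measurableSet_lt measurable_fst measurable_snd)
        exact ((hmeas (n + 1)).comp measurable_snd).mul (hkm.comp measurable_fst)
    _ = _ := by
        refine setLIntegral_congr_fun measurableSet_Ioi fun s hs => ?_
        have hs0 : 0 < s := lt_of_le_of_lt hx hs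
        have : ∀ y, {p : ℝ × ℝ | p.1 < p.2}.indicator (fun p => R p.2 * k p.1) (y, s)
            = (Set.Iio s).indicator (fun y => R s * k y) y := by
          intro y; simp [Set.indicator]
        simp_rw [this]
        rw [setLIntegral_indicator measurableSet_Iio, Set.inter_comm, Set.Ioi_inter_Iio,
          lintegral_const_mul _ hkm, hk, lintegral_Ioo_pow_div_factorial n (le_of_lt hs)]
        simp [hR, hs0]

end Bernstein

/-- **Bernstein's theorem** for the tail of a finite measure with completely monotone density. -/
theorem HasCompletelyMonotoneDensity.exists_tail_eq {ν : Measure ℝ} [IsFiniteMeasure ν]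
    (h : HasCompletelyMonotoneDensity ν) :
    ∃ μ : Measure ℝ, IsFiniteMeasure μ ∧ μ (Set.Iic 0) = 0 ∧
      ∀ x > 0, ν.real (Set.Ioi x) = ∫ t, Real.exp (-x * t) ∂μ := by
  obtain ⟨ρ, hρc, hρ, hν⟩ := h
  set r : ℕ → ℝ → ℝ := fun n x => (-1) ^ n * iteratedDeriv n ρ x with hr
  have hd : ∀ n, ∀ x > 0, HasDerivAt (r n) (-r (n + 1) x) x := by
    intro n x hx
    have h1 : DifferentiableOn ℝ (iteratedDerivWithin n ρ (Set.Ioi 0)) (Set.Ioi 0) :=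
      hρc.differentiableOn_iteratedDerivWithin (by exact_mod_cast ENat.natCast_lt_top n)
        isOpen_Ioi.uniqueDiffOn
    have h2 : DifferentiableAt ℝ (iteratedDeriv n ρ) x := by
      refine ((h1 x hx).differentiableAt (Ioi_mem_nhds hx)).congr_of_eventuallyEq ?_
      filter_upwards [Ioi_mem_nhds hx] with y hy
      exact (iteratedDerivWithin_of_isOpen isOpen_Ioi hy).symm
    refine (h2.hasDerivAt.const_mul ((-1) ^ n)).congr_deriv ?_
    simp only [hr, iteratedDeriv_succ, pow_succ]
    ring
  have hr0 : ∀ n, ∀ x > 0, 0 ≤ r n x := fun n x hx => hρ n x hx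
  have hνIoi : ∀ x ≥ 0, ν (Set.Ioi x) = ∫⁻ y in Set.Ioi x, ENNReal.ofReal (ρ y) := by
    intro x hx
    rw [hν, withDensity_apply _ measurableSet_Ioi, Measure.restrict_restrict measurableSet_Ioi,
      Set.inter_eq_left.2 (Set.Ioi_subset_Ioi hx)]
  have hr0ρ : r 0 = ρ := by funext x; simp [hr]
  have hi : IntegrableOn (r 0) (Set.Ioi 1) := by
    refine ⟨?_, ?_⟩
    · exact ContinuousOn.aestronglyMeasurable
        (fun s hs => (hd 0 s (zero_lt_one.trans hs)).continuousAt.continuousWithinAt)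
        measurableSet_Ioi
    · rw [hasFiniteIntegral_iff_ofReal ((ae_restrict_iff' measurableSet_Ioi).2
        (Eventually.of_forall fun s hs => hr0 0 s (zero_lt_one.trans hs))), hr0ρ,
        ← hνIoi 1 zero_le_one]
      exact measure_lt_top _ _
  have taylor : ∀ n, ∀ x ≥ 0, ∫⁻ y in Set.Ioi x, ENNReal.ofReal (r n y)
      * ENNReal.ofReal ((y - x) ^ n / n.factorial) = ν (Set.Ioi x) := by
    intro n x hx
    induction n with
    | zero => simp [hνIoi x hx, hr0ρ]
    | succ n ih => rw [← ih, lintegral_Ioi_completelyMonotone_succ hd hr0 hi n hx]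
  set lam := ν (Set.Ioi 0) with hlam
  rcases eq_or_ne lam 0 with h0 | h0
  · refine ⟨0, inferInstance, by simp, fun x hx => ?_⟩
    have : ν (Set.Ioi x) = 0 := measure_mono_null (Set.Ioi_subset_Ioi hx.le) h0
    simp [Measure.real, this]
  have hlamt : lam ≠ ∞ := measure_ne_top _ _
  -- Relative to these measures of constant mass, Taylor's formula reads `ν(x, ∞) = ∫ (1 - x/y)₊^n
  -- dκ_n`, and the integrand is close to `e^{-nx/y}`.
  set κ : ℕ → Measure ℝ := fun n => (volume.restrict (Set.Ioi 0)).withDensity fun y =>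
    ENNReal.ofReal (r n y) * ENNReal.ofReal (y ^ n / n.factorial) with hκ
  have hκmass : ∀ n, κ n Set.univ = lam := by
    intro n
    rw [hκ, withDensity_apply _ MeasurableSet.univ, Measure.restrict_univ, hlam, ← taylor n 0 le_rfl]
    simp
  have hκfin : ∀ n, IsFiniteMeasure (κ n) := fun n =>
    ⟨by rw [hκmass]; exact lt_top_iff_ne_top.2 hlamt⟩
  have hκpos : ∀ n, ∀ᵐ y ∂(κ n), 0 < y := by
    intro n
    exact (withDensity_absolutelyContinuous _ _).ae_le (ae_restrict_mem measurableSet_Ioi)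
  have hmden : ∀ n, AEMeasurable (fun y => ENNReal.ofReal (r n y)
      * ENNReal.ofReal (y ^ n / n.factorial)) (volume.restrict (Set.Ioi 0)) := by
    intro n
    refine AEMeasurable.mul (AEMeasurable.ennreal_ofReal ?_) (by fun_prop)
    exact ContinuousOn.aemeasurable
      (fun s hs => (hd n s hs).continuousAt.continuousWithinAt) measurableSet_Ioi
  -- For `n = 0` the power is `1` even where the positive part vanishes, so that case yields the
  -- total mass instead.
  have hκint : ∀ n, ∀ x > 0, ∫ y, (max (1 - x / y) 0) ^ n ∂(κ n) = if n = 0 then lam.toReal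
      else ν.real (Set.Ioi x) := by
    intro n x hx
    split_ifs with hn
    · subst hn; simp [Measure.real, hκmass]
    rw [integral_eq_lintegral_of_nonneg_ae
      (Eventually.of_forall fun y => pow_nonneg (le_max_right _ _) _)
      (by fun_prop), Measure.real]
    congr 1
    rw [hκ, lintegral_withDensity_eq_lintegral_mul₀ (hmden n) (by fun_prop), ← taylor n x hx.le,
      ← lintegral_indicator measurableSet_Ioi, ← lintegral_indicator measurableSet_Ioi]
    refine lintegral_congr fun y => ?_
    by_cases hy : y ∈ Set.Ioi 0
    · have hy0 : (0 : ℝ) < y := hy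
      rw [Set.indicator_of_mem hy]
      simp only [Pi.mul_apply]
      by_cases hxy : y ∈ Set.Ioi x
      · have hxy' : x < y := hxy
        rw [Set.indicator_of_mem hxy, mul_assoc, ← ENNReal.ofReal_mul (by positivity)]
        congr 2
        have : x / y < 1 := (div_lt_one hy0).2 hxy'
        rw [max_eq_left (by linarith), div_mul_eq_mul_div, ← mul_pow]
        congr 2
        field_simp
      · have hxy' : y ≤ x := not_lt.1 hxy
        rw [Set.indicator_of_notMem hxy]
        have : 1 ≤ x / y := (one_le_div hy0).2 hxy'
        rw [max_eq_right (by linarith), zero_pow hn]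
        simp
    · rw [Set.indicator_of_notMem hy, Set.indicator_of_notMem]
      exact fun hc => hy (hx.trans hc)
  have hκexp : ∀ n ≥ 1, ∀ x > 0, |ν.real (Set.Ioi x) - ∫ y, Real.exp (-(n * (x / y))) ∂(κ n)|
      ≤ 2 / n * lam.toReal := by
    intro n hn x hx
    have h1 := hκint n x hx
    rw [if_neg (by omega)] at h1
    have hb1 : Integrable (fun y => (max (1 - x / y) 0) ^ n) (κ n) := by
      refine Integrable.of_bound (C := 1) (by fun_prop) ?_
      filter_upwards [hκpos n] with y hy
      rw [Real.norm_eq_abs, abs_of_nonneg (pow_nonneg (le_max_right _ _) _)]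
      refine pow_le_one₀ (le_max_right _ _) (max_le ?_ zero_le_one)
      have : 0 < x / y := by positivity
      linarith
    have hb2 : Integrable (fun y => Real.exp (-(n * (x / y)))) (κ n) := by
      refine Integrable.of_bound (C := 1) (by fun_prop) ?_
      filter_upwards [hκpos n] with y hy
      rw [Real.norm_eq_abs, abs_of_pos (Real.exp_pos _), Real.exp_le_one_iff]
      have : 0 < x / y := by positivity
      have : (0 : ℝ) ≤ n * (x / y) := by positivity
      linarith
    rw [← h1, ← integral_sub hb1 hb2, ← Real.norm_eq_abs]
    refine (norm_integral_le_of_norm_le_const (C := 2 / n) ?_).trans ?_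
    · filter_upwards [hκpos n] with y hy
      rw [Real.norm_eq_abs]
      exact abs_max_one_sub_pow_sub_exp_le n hn _ (by positivity)
    · rw [Measure.real, hκmass]
  -- In the variable `s = e^{-n/y}` the kernel `e^{-nx/y}` becomes `s^x`, independent of `n`, and
  -- the state space becomes compact: a limit point exists without any tightness estimate.
  set s : ℕ → ℝ → unitInterval := fun n y => Set.projIcc 0 1 zero_le_one (Real.exp (-(n / y)))
    with hs
  have hsm : ∀ n, Measurable (s n) := fun n =>
    continuous_projIcc.measurable.comp (by fun_prop)
  have hsv : ∀ n, ∀ y > 0, (s n y : ℝ) = Real.exp (-(n / y)) := by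
    intro n y hy
    have h1 : Real.exp (-(n / y)) ∈ Set.Icc (0 : ℝ) 1 := by
      refine ⟨(Real.exp_pos _).le, Real.exp_le_one_iff.2 ?_⟩
      have : (0 : ℝ) ≤ n / y := by positivity
      linarith
    rw [hs]; simp only; rw [Set.projIcc_of_mem _ h1]
  have hPprob : ∀ n, IsProbabilityMeasure (lam⁻¹ • (κ n).map (s n)) := by
    intro n
    refine ⟨?_⟩
    rw [Measure.smul_apply, Measure.map_apply (hsm n) MeasurableSet.univ, Set.preimage_univ, hκmass,
      smul_eq_mul, ENNReal.inv_mul_cancel h0 hlamt]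
  set P : ℕ → ProbabilityMeasure unitInterval := fun n => ⟨lam⁻¹ • (κ n).map (s n), hPprob n⟩ with hP
  obtain ⟨Q, -, hQ⟩ := isCompact_univ.exists_mapClusterPt (f := atTop) (u := P) (by simp)
  have hgc : ∀ x : ℝ, 0 < x → Continuous fun u : unitInterval => (u : ℝ) ^ x := by
    intro x hx
    exact (Real.continuous_rpow_const hx.le).comp continuous_subtype_val
  have hPint : ∀ n, ∀ x > 0, ∫ u, (u : ℝ) ^ x ∂(P n : Measure unitInterval)
      = lam.toReal⁻¹ * ∫ y, Real.exp (-(n * (x / y))) ∂(κ n) := by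
    intro n x hx
    simp only [hP, ProbabilityMeasure.coe_mk]
    rw [integral_smul_measure, integral_map (hsm n).aemeasurable (hgc x hx).aestronglyMeasurable,
      ENNReal.toReal_inv, smul_eq_mul]
    congr 1
    refine integral_congr_ae ?_
    filter_upwards [hκpos n] with y hy
    rw [hsv n y hy, ← Real.exp_mul]
    congr 1; field_simp
  have hlam0 : 0 < lam.toReal := ENNReal.toReal_pos h0 hlamt
  have hPlim : ∀ x > 0, Tendsto (fun n => ∫ u, (u : ℝ) ^ x ∂(P n : Measure unitInterval)) atTop
      (𝓝 (lam.toReal⁻¹ * ν.real (Set.Ioi x))) := by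
    intro x hx
    simp_rw [fun n => hPint n x hx]
    refine Tendsto.const_mul _ ?_
    rw [tendsto_iff_norm_sub_tendsto_zero]
    have hz : Tendsto (fun n : ℕ => 2 / (n : ℝ) * lam.toReal) atTop (𝓝 0) := by
      simpa using (tendsto_const_div_atTop_nhds_zero_nat (2 : ℝ)).mul_const lam.toReal
    refine squeeze_zero' (Eventually.of_forall fun n => norm_nonneg _) ?_ hz
    filter_upwards [eventually_ge_atTop 1] with n hn
    rw [Real.norm_eq_abs, abs_sub_comm]
    exact hκexp n hn x hx
  have hQint : ∀ x > 0, ∫ u, (u : ℝ) ^ x ∂(Q : Measure unitInterval)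
      = lam.toReal⁻¹ * ν.real (Set.Ioi x) := by
    intro x hx
    have hcont : Continuous fun p : ProbabilityMeasure unitInterval =>
        ∫ u, (u : ℝ) ^ x ∂(p : Measure unitInterval) := by
      have := ProbabilityMeasure.continuous_iff_forall_continuous_integral.1
        (continuous_id (X := ProbabilityMeasure unitInterval))
        (BoundedContinuousFunction.mkOfCompact ⟨_, hgc x hx⟩)
      simpa using this
    have hcl : MapClusterPt (∫ u, (u : ℝ) ^ x ∂(Q : Measure unitInterval)) atTop
        (fun n => ∫ u, (u : ℝ) ^ x ∂(P n : Measure unitInterval)) :=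
      hQ.continuousAt_comp hcont.continuousAt
    have : ClusterPt (∫ u, (u : ℝ) ^ x ∂(Q : Measure unitInterval))
        (𝓝 (lam.toReal⁻¹ * ν.real (Set.Ioi x))) := ClusterPt.mono hcl (hPlim x hx)
    exact eq_of_nhds_neBot this
  have hlogm : Measurable fun u : unitInterval => -Real.log u := by fun_prop
  have hposm : MeasurableSet {u : unitInterval | 0 < (u : ℝ)} :=
    measurableSet_lt measurable_const measurable_subtype_coe
  -- Substitution `u = e^{-t}`. The point `u = 0`, which stands for `t = ∞`, may be dropped because
  -- `0^x = 0` for `x > 0`.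
  set μ : Measure ℝ := lam • ((Q : Measure unitInterval).restrict {u | 0 < (u : ℝ)}).map
    (fun u : unitInterval => -Real.log u) with hμ
  have hμfin : IsFiniteMeasure μ := by
    refine ⟨?_⟩
    rw [hμ, Measure.smul_apply, smul_eq_mul]
    exact ENNReal.mul_lt_top (lt_top_iff_ne_top.2 hlamt) (measure_lt_top _ _)
  have hμint : ∀ x > 0, ν.real (Set.Ioi x) = ∫ t, Real.exp (-x * t) ∂μ := by
    intro x hx
    rw [hμ, integral_smul_measure, integral_map hlogm.aemeasurable
      (by fun_prop : Continuous fun t : ℝ => Real.exp (-x * t)).aestronglyMeasurable, smul_eq_mul]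
    have e : ∫ u in {u : unitInterval | 0 < (u : ℝ)}, Real.exp (-x * -Real.log u)
          ∂(Q : Measure unitInterval)
        = ∫ u in {u : unitInterval | 0 < (u : ℝ)}, (u : ℝ) ^ x ∂(Q : Measure unitInterval) := by
      refine setIntegral_congr_fun hposm fun u hu => ?_
      have hu0 : 0 < (u : ℝ) := hu
      simp only [Real.rpow_def_of_pos hu0]
      congr 1; ring
    rw [e, setIntegral_eq_integral_of_forall_compl_eq_zero, hQint x hx,
      mul_inv_cancel_left₀ hlam0.ne']
    intro u hu
    have : (u : ℝ) = 0 := le_antisymm (not_lt.1 hu) u.2.1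
    rw [this, Real.zero_rpow hx.ne']
  have hμneg : ∀ᵐ t ∂μ, 0 ≤ t := by
    refine Measure.ae_smul_measure ?_ _
    rw [ae_map_iff hlogm.aemeasurable measurableSet_Ici]
    refine Eventually.of_forall fun u => ?_
    have := Real.log_nonpos u.2.1 u.2.2
    linarith
  have hμle : ∀ x > 0, μ.real {0} ≤ ν.real (Set.Ioi x) := by
    intro x hx
    rw [hμint x hx]
    have : μ.real {0} = ∫ t in {0}, Real.exp (-x * t) ∂μ := by
      rw [integral_singleton]; simp
    rw [this]
    refine setIntegral_le_integral ?_ (Eventually.of_forall fun t => (Real.exp_pos _).le)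
    refine Integrable.of_bound (C := 1) (by fun_prop) ?_
    filter_upwards [hμneg] with t ht
    rw [Real.norm_eq_abs, abs_of_pos (Real.exp_pos _), Real.exp_le_one_iff]
    nlinarith
  -- An atom at `0` would bound every tail `ν(x, ∞)` from below, but the tails tend to `0`.
  have hμ0 : μ {0} = 0 := by
    have hl : Tendsto (fun x : ℝ => ν.real (Set.Ioi x)) atTop (𝓝 0) := by
      have h1 : Tendsto (fun x : ℝ => ν (Set.Ioi x)) atTop (𝓝 0) := by
        have := tendsto_measure_iInter_atTop (μ := ν) (s := fun x : ℝ => Set.Ioi x)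
          (fun x => measurableSet_Ioi.nullMeasurableSet) (fun a b hab => Set.Ioi_subset_Ioi hab)
          ⟨0, measure_ne_top _ _⟩
        have e : ⋂ x : ℝ, Set.Ioi x = ∅ := by
          ext y; simp only [Set.mem_iInter, Set.mem_Ioi, Set.mem_empty_iff_false, iff_false,
            not_forall, not_lt]
          exact ⟨y, le_rfl⟩
        rwa [e, measure_empty] at this
      exact (ENNReal.tendsto_toReal ENNReal.zero_ne_top).comp h1
    have : μ.real {0} ≤ 0 := ge_of_tendsto hl (by
      filter_upwards [eventually_gt_atTop 0] with x hx using hμle x hx)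
    have h2 : μ.real {0} = 0 := le_antisymm this measureReal_nonneg
    exact (measureReal_eq_zero_iff).1 h2
  refine ⟨μ, hμfin, ?_, hμint⟩
  rw [← Set.Iio_union_right]
  refine measure_union_null ?_ hμ0
  simpa [ae_iff, Set.Iio] using hμneg

/-! ### Spectral measures and Stieltjes functions -/

section Spectral

open CompactlySupported

variable {H : Type*} [NormedAddCommGroup H] [InnerProductSpace ℂ H] [CompleteSpace H]

theorem continuous_comp_projIcc (g : unitInterval → ℝ) (hg : Continuous g) :
    Continuous fun s : ℝ => g (Set.projIcc 0 1 zero_le_one s) :=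
  hg.comp continuous_projIcc

theorem spectrum_subset_Icc {T : H →L[ℂ] H} (h0 : 0 ≤ T) (h1 : T ≤ 1) :
    spectrum ℝ T ⊆ Set.Icc 0 1 := fun x hx =>
  ⟨spectrum_nonneg_of_nonneg h0 hx,
    (CFC.le_one_iff (R := ℝ) T (IsSelfAdjoint.of_nonneg h0)).1 h1 x hx⟩

/-- The positive functional `g ↦ ⟪x, g(T) x⟫` on `C([0, 1])`. -/
def spectralFunctional (T : H →L[ℂ] H) (x : H) : C_c(unitInterval, ℝ) →ₚ[ℝ] ℝ :=
  PositiveLinearMap.mk₀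
    { toFun := fun g => (inner ℂ x (cfc (fun s : ℝ => g (Set.projIcc 0 1 zero_le_one s)) T x)).re
      map_add' := by
        intro f g
        have hf := continuous_comp_projIcc f f.continuous
        have hg := continuous_comp_projIcc g g.continuous
        simp only [CompactlySupportedContinuousMap.coe_add, Pi.add_apply]
        rw [cfc_add (R := ℝ) (a := T) _ _ hf.continuousOn hg.continuousOn]
        simp
      map_smul' := by
        intro c f
        have hf := continuous_comp_projIcc f f.continuous
        simp only [CompactlySupportedContinuousMap.coe_smul, Pi.smul_apply]
        rw [cfc_smul (R := ℝ) (a := T) c _ hf.continuousOn]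
        simp [inner_smul_right_eq_smul] }
    (by
      intro g hg
      have h : (0 : H →L[ℂ] H) ≤ cfc (fun s : ℝ => g (Set.projIcc 0 1 zero_le_one s)) T :=
        cfc_nonneg fun s _ => hg _
      exact ((ContinuousLinearMap.nonneg_iff_isPositive _).1 h).re_inner_nonneg_right x)

/-- Riesz–Markov for the positive functional `spectralFunctional`. The spectrum lies in `[0, 1]`, so
the constant extension of `g` outside the interval does not affect the functional calculus. -/
theorem exists_spectralMeasure {T : H →L[ℂ] H} (h0 : 0 ≤ T) (h1 : T ≤ 1) (x : H) :
    ∃ κ : Measure unitInterval, IsFiniteMeasure κ ∧ ∀ g : ℝ → ℝ, ContinuousOn g (Set.Icc 0 1) →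
      ∫ s, g s ∂κ = (inner ℂ x (cfc g T x)).re := by
  refine ⟨RealRMK.rieszMeasure (spectralFunctional T x), inferInstance, fun g hg => ?_⟩
  set f : C_c(unitInterval, ℝ) := ⟨⟨fun s => g s, hg.domRestrict⟩, HasCompactSupport.of_compactSpace _⟩
  have := RealRMK.integral_rieszMeasure (spectralFunctional T x) f
  refine this.trans ?_
  change (inner ℂ x (cfc (fun s : ℝ => g (Set.projIcc (0 : ℝ) 1 zero_le_one s)) T x)).re = _
  congr 3
  refine cfc_congr fun s hs => ?_
  rw [Set.projIcc_of_mem _ (spectrum_subset_Icc h0 h1 hs)]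

/-- The function of `T` on the left is `(1 + (θ - 1)T)⁻¹ T`, so the linear equation `hv` determines
its value at `e`. Under `s = 1/(1 + t)` the symbol `s / (1 + (θ - 1)s)` is `1/(θ + t)`: if `T = (1 +
L)⁻¹`, this is the resolvent `(θ + L)⁻¹`. -/
theorem inner_cfc_resolvent {T : H →L[ℂ] H} (h0 : 0 ≤ T) (h1 : T ≤ 1) {e v : H} {θ : ℝ} (hθ : 0 < θ)
    (hv : v + (θ - 1) • T v = T e) : cfc (fun s : ℝ => s / (1 + (θ - 1) * s)) T e = v := by
  have hT : IsSelfAdjoint T := IsSelfAdjoint.of_nonneg h0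
  have hpos : ∀ s ∈ spectrum ℝ T, 1 + (θ - 1) * s ≠ 0 := by
    intro s hs
    obtain ⟨a, b⟩ := spectrum_subset_Icc h0 h1 hs
    rcases eq_or_lt_of_le b with rfl | b
    · linarith
    · nlinarith [mul_nonneg hθ.le a]
  have hc1 : ContinuousOn (fun s : ℝ => 1 / (1 + (θ - 1) * s)) (spectrum ℝ T) :=
    ContinuousOn.div continuousOn_const (by fun_prop) hpos
  have hc2 : ContinuousOn (fun s : ℝ => s / (1 + (θ - 1) * s)) (spectrum ℝ T) :=
    ContinuousOn.div continuousOn_id (by fun_prop) hpos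
  set R := cfc (fun s : ℝ => 1 / (1 + (θ - 1) * s)) T with hR
  have e1 : cfc (fun s : ℝ => s / (1 + (θ - 1) * s)) T = R * T := by
    conv_rhs => rw [← cfc_id' ℝ T]
    rw [hR, cfc_id' ℝ T, ← cfc_id' ℝ T, cfc_id' ℝ T]
    have := cfc_mul (R := ℝ) (fun s : ℝ => 1 / (1 + (θ - 1) * s)) (fun s => s) T hc1 continuousOn_id
    rw [cfc_id' ℝ T] at this
    rw [← this]
    congr 1; funext s; ring
  have e2 : R + (θ - 1) • (R * T) = 1 := by
    have hc3 : ContinuousOn (fun s : ℝ => (θ - 1) • (s / (1 + (θ - 1) * s))) (spectrum ℝ T) :=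
      hc2.const_smul (θ - 1)
    rw [← e1, hR, ← cfc_smul (R := ℝ) (a := T) (θ - 1) _ hc2,
      ← cfc_add (R := ℝ) (a := T) _ _ hc1 hc3, ← cfc_one ℝ T]
    refine cfc_congr fun s hs => ?_
    have := hpos s hs
    simp only [smul_eq_mul, Pi.one_apply]
    field_simp
  have e3 := congrArg (fun A : H →L[ℂ] H => A v) e2
  simp only [add_apply, smul_apply, one_apply_eq_self] at e3
  rw [e1]
  change R (T e) = v
  rw [← hv, map_add, ContinuousLinearMap.map_smul_of_tower R (θ - 1) (T v)]
  exact e3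

end Spectral

section Multiplication

variable {m : Measure ℝ} {k : ℝ → ℝ} {C : ℝ}

theorem memLp_ofReal_mul (hk : Measurable k) (hC : ∀ t, |k t| ≤ C) {f : ℝ → ℂ} (hf : MemLp f 2 m) :
    MemLp (fun t => (k t : ℂ) * f t) 2 m := by
  refine MemLp.of_le_mul (c := C) hf
    ((Complex.measurable_ofReal.comp hk).aestronglyMeasurable.mul hf.1)
    (Eventually.of_forall fun t => ?_)
  rw [norm_mul, Complex.norm_real]
  exact mul_le_mul_of_nonneg_right (hC t) (norm_nonneg _)

/-- Multiplication by a bounded real function on `L²`. -/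
def mulOp (m : Measure ℝ) (hk : Measurable k) (hC : ∀ t, |k t| ≤ C) :
    Lp ℂ 2 m →L[ℂ] Lp ℂ 2 m :=
  LinearMap.mkContinuous
    { toFun := fun f => (memLp_ofReal_mul hk hC (Lp.memLp f)).toLp
      map_add' := by
        intro f g
        rw [← MemLp.toLp_add]
        refine MemLp.toLp_congr _ _ ?_
        filter_upwards [Lp.coeFn_add f g] with t ht
        simp only [Pi.add_apply] at ht ⊢
        rw [← mul_add, ← ht]
      map_smul' := by
        intro c f
        rw [RingHom.id_apply, ← MemLp.toLp_const_smul]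
        refine MemLp.toLp_congr _ _ ?_
        filter_upwards [Lp.coeFn_smul c f] with t ht
        simp only [Pi.smul_apply, smul_eq_mul] at ht ⊢
        rw [mul_left_comm, ← ht] } C
    (by
      intro f
      refine Lp.norm_le_mul_norm_of_ae_le_mul ?_
      filter_upwards [MemLp.coeFn_toLp (memLp_ofReal_mul hk hC (Lp.memLp f))] with t ht
      change ‖((memLp_ofReal_mul hk hC (Lp.memLp f)).toLp : ℝ → ℂ) t‖ ≤ _
      rw [ht, norm_mul, Complex.norm_real]
      exact mul_le_mul_of_nonneg_right (hC t) (norm_nonneg _))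

theorem coeFn_mulOp (hk : Measurable k) (hC : ∀ t, |k t| ≤ C) (f : Lp ℂ 2 m) :
    mulOp m hk hC f =ᵐ[m] fun t => (k t : ℂ) * f t :=
  MemLp.coeFn_toLp (memLp_ofReal_mul hk hC (Lp.memLp f))

theorem mulOp_toLp (hk : Measurable k) (hC : ∀ t, |k t| ≤ C) {a : ℝ → ℝ}
    (ha : MemLp (fun t => (a t : ℂ)) 2 m) (hka : MemLp (fun t => ((k t * a t : ℝ) : ℂ)) 2 m) :
    mulOp m hk hC ha.toLp = hka.toLp := by
  refine Lp.ext ?_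
  filter_upwards [ha.coeFn_toLp, hka.coeFn_toLp, coeFn_mulOp hk hC ha.toLp] with t h1 h2 h3
  rw [h3, h2, h1]; push_cast; rfl

theorem inner_mulOp_left (hk : Measurable k) (hC : ∀ t, |k t| ≤ C) (f g : Lp ℂ 2 m) :
    inner ℂ (mulOp m hk hC f) g = inner ℂ f (mulOp m hk hC g) := by
  rw [L2.inner_def, L2.inner_def]
  refine integral_congr_ae ?_
  filter_upwards [coeFn_mulOp hk hC f, coeFn_mulOp hk hC g] with t h1 h2
  rw [h1, h2]
  simp only [RCLike.inner_apply, map_mul, Complex.conj_ofReal]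
  ring

theorem isSymmetric_mulOp (hk : Measurable k) (hC : ∀ t, |k t| ≤ C) :
    (mulOp m hk hC : Lp ℂ 2 m →ₗ[ℂ] Lp ℂ 2 m).IsSymmetric :=
  fun f g => inner_mulOp_left hk hC f g

theorem inner_toLp_ofReal {a b : ℝ → ℝ} (ha : MemLp (fun t => (a t : ℂ)) 2 m)
    (hb : MemLp (fun t => (b t : ℂ)) 2 m) :
    inner ℂ ha.toLp hb.toLp = ((∫ t, a t * b t ∂m : ℝ) : ℂ) := by
  rw [L2.inner_def]
  refine Eq.trans ?_ integral_ofReal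
  refine integral_congr_ae ?_
  filter_upwards [ha.coeFn_toLp, hb.coeFn_toLp] with t h1 h2
  rw [h1, h2]
  simp [mul_comm]

theorem mulOp_mulOp_self (hk : Measurable k) (hC : ∀ t, |k t| ≤ C) {l : ℝ → ℝ} (hl : Measurable l)
    (hlC : ∀ t, |l t| ≤ C) (hkl : ∀ t, l t ^ 2 = k t) (f : Lp ℂ 2 m) :
    mulOp m hl hlC (mulOp m hl hlC f) = mulOp m hk hC f := by
  refine Lp.ext ?_
  filter_upwards [coeFn_mulOp hk hC f, coeFn_mulOp hl hlC f,
    coeFn_mulOp hl hlC (mulOp m hl hlC f)] with t h1 h2 h3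
  rw [h1, h3, h2, ← hkl]
  push_cast; ring

theorem inner_mulOp_self (hk : Measurable k) (hC : ∀ t, |k t| ≤ C) {l : ℝ → ℝ} (hl : Measurable l)
    (hlC : ∀ t, |l t| ≤ C) (hkl : ∀ t, l t ^ 2 = k t) (f : Lp ℂ 2 m) :
    inner ℂ (mulOp m hk hC f) f = ((‖mulOp m hl hlC f‖ ^ 2 : ℝ) : ℂ) := by
  rw [← mulOp_mulOp_self hk hC hl hlC hkl, inner_mulOp_left, inner_self_eq_norm_sq_to_K]
  simp

theorem isPositive_mulOp (hk : Measurable k) (hC : ∀ t, |k t| ≤ C) {l : ℝ → ℝ} (hl : Measurable l)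
    (hlC : ∀ t, |l t| ≤ C) (hkl : ∀ t, l t ^ 2 = k t) : (mulOp m hk hC).IsPositive := by
  refine ContinuousLinearMap.isPositive_def.2 ⟨isSymmetric_mulOp hk hC, fun f => ?_⟩
  rw [ContinuousLinearMap.reApplyInnerSelf_apply, inner_mulOp_self hk hC hl hlC hkl]
  simp only [RCLike.re_to_complex, Complex.ofReal_re]
  positivity

end Multiplication

/-- The reciprocal of `θ + a - ∫ η(dt) / (θ + t)` is a Stieltjes function. -/
theorem exists_stieltjes_inverse {η : Measure ℝ} [IsFiniteMeasure η] (hη : η (Set.Iic 0) = 0)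
    {a : ℝ} (hi : Integrable (fun t => 1 / t) η) (ha : ∫ t, 1 / t ∂η < a) :
    ∃ κ : Measure ℝ, IsFiniteMeasure κ ∧ κ (Set.Iic 0) = 0 ∧
      ∀ θ > 0, ∫ t, 1 / (θ + t) ∂κ = 1 / (θ + a - ∫ t, 1 / (θ + t) ∂η) := by
  have hpos : ∀ᵐ t ∂η, 0 < t := by
    rw [ae_iff]; simpa [Set.Iic] using hη
  -- `L²(m)` models `ℂ ⊕ L²(η)`; any atom off `(0, ∞)` would do. On it consider `L(f₀, f) = (a f₀ -
  -- ∫ f dη, t f - f₀)`. By the Schur complement, `⟪e, (θ + L)⁻¹ e⟫` for the unit vector `e` of the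
  -- atom is the right-hand side sought. To avoid the unbounded `L`, the proof works with its
  -- resolvent at `1`.
  set m : Measure ℝ := Measure.dirac (-1) + η with hm
  have hsplit : ∀ g : ℝ → ℝ, Integrable g η → ∫ t, g t ∂m = g (-1) + ∫ t, g t ∂η := by
    intro g hg
    rw [hm, integral_add_measure (integrable_dirac (by simp)) hg, integral_dirac]
  have hbdd : ∀ g : ℝ → ℝ, Measurable g → ∀ C, (∀ t, |g t| ≤ C) → MemLp (fun t => (g t : ℂ)) 2 m :=
    fun g hg C hC => MemLp.of_bound (Complex.measurable_ofReal.comp hg).aestronglyMeasurable C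
      (Eventually.of_forall fun t => by rw [Complex.norm_real]; exact hC t)
  have hint : ∀ θ > 0, Integrable (fun t => 1 / (θ + t)) η := by
    intro θ hθ
    refine Integrable.of_bound (C := 1 / θ) (by fun_prop : Measurable _).aestronglyMeasurable ?_
    filter_upwards [hpos] with t ht
    rw [Real.norm_eq_abs, abs_of_pos (by positivity)]
    exact one_div_le_one_div_of_le hθ (by linarith)
  have hle : ∀ θ > 0, ∫ t, 1 / (θ + t) ∂η ≤ ∫ t, 1 / t ∂η := by
    intro θ hθ
    refine integral_mono_ae (hint θ hθ) hi ?_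
    filter_upwards [hpos] with t ht
    exact one_div_le_one_div_of_le ht (by linarith)
  set k : ℝ → ℝ := fun t => if 0 < t then 1 / (1 + t) else 0 with hk
  set l : ℝ → ℝ := fun t => if 0 < t then √(1 / (1 + t)) else 0 with hl
  set w : ℝ → ℝ := fun t => if 0 < t then √(t / (1 + t)) else 1 with hw
  set w2 : ℝ → ℝ := fun t => if 0 < t then t / (1 + t) else 1 with hw2
  set u : ℝ → ℝ := fun t => if 0 < t then 1 / (1 + t) else 1 with hu
  set u' : ℝ → ℝ := fun t => if 0 < t then √(1 / (t * (1 + t))) else 1 with hu'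
  set e : ℝ → ℝ := fun t => if 0 < t then 0 else 1 with he
  have mk : Measurable k := Measurable.ite measurableSet_Ioi (by fun_prop) (by fun_prop)
  have ml : Measurable l := Measurable.ite measurableSet_Ioi (by fun_prop) (by fun_prop)
  have mw : Measurable w := Measurable.ite measurableSet_Ioi (by fun_prop) (by fun_prop)
  have mw2 : Measurable w2 := Measurable.ite measurableSet_Ioi (by fun_prop) (by fun_prop)
  have mu : Measurable u := Measurable.ite measurableSet_Ioi (by fun_prop) (by fun_prop)
  have mu' : Measurable u' := Measurable.ite measurableSet_Ioi (by fun_prop) (by fun_prop)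
  have me : Measurable e := Measurable.ite measurableSet_Ioi (by fun_prop) (by fun_prop)
  have hfrac : ∀ t : ℝ, 0 < t → 0 ≤ 1 / (1 + t) ∧ 1 / (1 + t) ≤ 1 := fun t ht =>
    ⟨by positivity, by rw [div_le_one (by positivity)]; linarith⟩
  have hfrac2 : ∀ t : ℝ, 0 < t → 0 ≤ t / (1 + t) ∧ t / (1 + t) ≤ 1 := fun t ht =>
    ⟨by positivity, by rw [div_le_one (by positivity)]; linarith⟩
  have bk : ∀ t, |k t| ≤ 1 := by
    intro t; simp only [hk]; split_ifs with h
    · rw [abs_of_nonneg (hfrac t h).1]; exact (hfrac t h).2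
    · simp
  have bl : ∀ t, |l t| ≤ 1 := by
    intro t; simp only [hl]; split_ifs with h
    · rw [abs_of_nonneg (Real.sqrt_nonneg _)]; exact Real.sqrt_le_one.2 (hfrac t h).2
    · simp
  have bw : ∀ t, |w t| ≤ 1 := by
    intro t; simp only [hw]; split_ifs with h
    · rw [abs_of_nonneg (Real.sqrt_nonneg _)]; exact Real.sqrt_le_one.2 (hfrac2 t h).2
    · simp
  have bw2 : ∀ t, |w2 t| ≤ 1 := by
    intro t; simp only [hw2]; split_ifs with h
    · rw [abs_of_nonneg (hfrac2 t h).1]; exact (hfrac2 t h).2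
    · simp
  have bu : ∀ t, |u t| ≤ 1 := by
    intro t; simp only [hu]; split_ifs with h
    · rw [abs_of_nonneg (hfrac t h).1]; exact (hfrac t h).2
    · simp
  have be : ∀ t, |e t| ≤ 1 := by
    intro t; simp only [he]; split_ifs <;> simp
  have hlk : ∀ t, l t ^ 2 = k t := by
    intro t; simp only [hl, hk]; split_ifs with h
    · exact Real.sq_sqrt (hfrac t h).1
    · simp
  have hww : ∀ t, w t ^ 2 = w2 t := by
    intro t; simp only [hw, hw2]; split_ifs with h
    · exact Real.sq_sqrt (hfrac2 t h).1
    · simp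
  have hkw : ∀ t, k t + w2 t = 1 := by
    intro t; simp only [hk, hw2]; split_ifs with h
    · have : (1 + t) ≠ 0 := by positivity
      field_simp
    · simp
  have huw : ∀ t, w t * u' t = u t := by
    intro t; simp only [hu, hu', hw]; split_ifs with h
    · rw [← Real.sqrt_mul (hfrac2 t h).1]
      have : t / (1 + t) * (1 / (t * (1 + t))) = (1 / (1 + t)) ^ 2 := by
        field_simp
      rw [this, Real.sqrt_sq (hfrac t h).1]
    · simp
  have hu'sq : ∀ t, u' t * u' t = if 0 < t then 1 / (t * (1 + t)) else 1 := by
    intro t; simp only [hu']; split_ifs with h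
    · exact Real.mul_self_sqrt (by positivity)
    · simp
  have hi2 : Integrable (fun t => 1 / (t * (1 + t))) η := by
    refine Integrable.mono hi (by fun_prop : Measurable _).aestronglyMeasurable ?_
    filter_upwards [hpos] with t ht
    rw [Real.norm_eq_abs, Real.norm_eq_abs, abs_of_pos (by positivity), abs_of_pos (by positivity)]
    exact one_div_le_one_div_of_le ht (by nlinarith)
  have hiu' : Integrable (fun t => u' t * u' t) η := by
    refine hi2.congr ?_
    filter_upwards [hpos] with t ht
    rw [hu'sq, if_pos ht]
  have Lu' : MemLp (fun t => (u' t : ℂ)) 2 m := by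
    have mm : AEStronglyMeasurable (fun t => (u' t : ℂ)) m :=
      (Complex.measurable_ofReal.comp mu').aestronglyMeasurable
    rw [memLp_two_iff_integrable_sq_norm mm]
    have : (fun t => ‖(u' t : ℂ)‖ ^ 2) = fun t => u' t * u' t := by
      funext t; rw [Complex.norm_real, Real.norm_eq_abs, sq_abs, sq]
    rw [this, hm, integrable_add_measure]
    exact ⟨integrable_dirac (by simpa using ENNReal.mul_lt_top enorm_lt_top enorm_lt_top), hiu'⟩
  have Lu : MemLp (fun t => (u t : ℂ)) 2 m := hbdd u mu 1 bu
  have Le : MemLp (fun t => (e t : ℂ)) 2 m := hbdd e me 1 be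
  -- The Schur complement of `1 + L`.
  set d : ℝ := 1 + a - ∫ t, 1 / (1 + t) ∂η with hd
  have hd1 : 1 + ∫ t, 1 / (t * (1 + t)) ∂η ≤ d := by
    have : ∫ t, 1 / t ∂η = ∫ t, 1 / (1 + t) ∂η + ∫ t, 1 / (t * (1 + t)) ∂η := by
      rw [← integral_add (hint 1 one_pos) hi2]
      refine integral_congr_ae ?_
      filter_upwards [hpos] with t ht
      field_simp
      ring
    rw [hd]; linarith
  have hd0 : 0 < d := by
    have : 0 ≤ ∫ t, 1 / (t * (1 + t)) ∂η := integral_nonneg_of_ae (by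
      filter_upwards [hpos] with t ht
      simp only [Pi.zero_apply]; positivity)
    linarith
  set U : Lp ℂ 2 m := Lu.toLp with hU
  set K : Lp ℂ 2 m →L[ℂ] Lp ℂ 2 m := mulOp m mk bk with hK
  -- Solving `(1 + L) f = g` by elimination of the second component gives this explicit form of `(1
  -- + L)⁻¹`: multiplication by `1/(1 + t)` off the atom plus a rank-one term.
  set T : Lp ℂ 2 m →L[ℂ] Lp ℂ 2 m := K + ((1 / d : ℝ) : ℂ) • InnerProductSpace.rankOne ℂ U U
    with hT
  have hTapp : ∀ f, T f = K f + ((1 / d : ℝ) : ℂ) • (inner ℂ U f • U) := by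
    intro f; simp [hT]
  have hT0 : 0 ≤ T := by
    rw [ContinuousLinearMap.nonneg_iff_isPositive]
    refine (isPositive_mulOp mk bk ml bl hlk).add
      ((InnerProductSpace.isPositive_rankOne_self U).smul_of_nonneg ?_)
    exact_mod_cast (by positivity : 0 ≤ 1 / d)
  -- Nonnegativity of `L` in disguise. The form of `1 - T` is `‖w f‖² - |⟪u, f⟫|²/d` with `w² = 1 -
  -- k`. As `u = w u'`, Cauchy–Schwarz reduces it to `‖u'‖² ≤ d`, which is where the bound on `∫ 1/t
  -- dη` enters.
  have hT1 : T ≤ 1 := by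
    rw [ContinuousLinearMap.le_def, ContinuousLinearMap.isPositive_iff_complex]
    intro f
    have h1 : f = K f + mulOp m mw2 bw2 f := by
      refine Lp.ext ?_
      filter_upwards [Lp.coeFn_add (K f) (mulOp m mw2 bw2 f), coeFn_mulOp mk bk f,
        coeFn_mulOp mw2 bw2 f] with t e1 e2 e3
      rw [e1, Pi.add_apply, e2, e3, ← add_mul, ← Complex.ofReal_add, hkw, Complex.ofReal_one, one_mul]
    have h2 : U = mulOp m mw bw Lu'.toLp := by
      rw [mulOp_toLp mw bw Lu' (by simpa only [huw] using Lu)]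
      exact MemLp.toLp_congr _ _ (Eventually.of_forall fun t => by simp only [huw])
    set W := mulOp m mw bw f with hW
    have h3 : inner ℂ ((1 - T) f) f = ((‖W‖ ^ 2 - 1 / d * ‖inner ℂ U f‖ ^ 2 : ℝ) : ℂ) := by
      have : (1 - T) f = mulOp m mw2 bw2 f - ((1 / d : ℝ) : ℂ) • (inner ℂ U f • U) := by
        rw [sub_apply, one_apply_eq_self, hTapp]
        nth_rewrite 1 [h1]
        abel
      rw [this, inner_sub_left, inner_mulOp_self mw2 bw2 mw bw hww, inner_smul_left,
        inner_smul_left, Complex.conj_ofReal, Complex.conj_mul']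
      push_cast; rfl
    have h4 : ‖inner ℂ U f‖ ^ 2 ≤ d * ‖W‖ ^ 2 := by
      rw [h2, inner_mulOp_left]
      have h5 := norm_inner_le_norm (𝕜 := ℂ) Lu'.toLp W
      have h6 : ‖Lu'.toLp‖ ^ 2 ≤ d := by
        have : inner ℂ Lu'.toLp Lu'.toLp = ((‖Lu'.toLp‖ ^ 2 : ℝ) : ℂ) := by
          rw [inner_self_eq_norm_sq_to_K]; simp
        rw [inner_toLp_ofReal, Complex.ofReal_inj] at this
        rw [← this, hsplit _ hiu']
        refine le_trans (le_of_eq ?_) hd1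
        rw [hu'sq, if_neg (by norm_num)]
        congr 1
        refine integral_congr_ae ?_
        filter_upwards [hpos] with t ht
        rw [hu'sq, if_pos ht]
      calc ‖inner ℂ Lu'.toLp W‖ ^ 2 ≤ (‖Lu'.toLp‖ * ‖W‖) ^ 2 :=
            pow_le_pow_left₀ (norm_nonneg _) h5 2
        _ = ‖Lu'.toLp‖ ^ 2 * ‖W‖ ^ 2 := by ring
        _ ≤ d * ‖W‖ ^ 2 := mul_le_mul_of_nonneg_right h6 (sq_nonneg _)
    rw [h3]
    refine ⟨by rw [RCLike.re_to_complex, Complex.ofReal_re], ?_⟩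
    simp only [RCLike.re_to_complex, Complex.ofReal_re]
    rw [sub_nonneg, one_div, inv_mul_le_iff₀ hd0]
    exact h4
  obtain ⟨κ, hκfin, hκ⟩ := exists_spectralMeasure hT0 hT1 Le.toLp
  have hD : ∀ θ > 0, 0 < θ + a - ∫ t, 1 / (θ + t) ∂η := fun θ hθ => by
    linarith [hle θ hθ]
  have key : ∀ θ > 0, ∫ s : unitInterval, (s : ℝ) / (1 + (θ - 1) * s) ∂κ
      = 1 / (θ + a - ∫ t, 1 / (θ + t) ∂η) := by
    intro θ hθ
    set D := θ + a - ∫ t, 1 / (θ + t) ∂η with hDdef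
    have hD0 : 0 < D := hD θ hθ
    -- This is `(θ + L)⁻¹ e`, found by the same elimination; its component at the atom is the value
    -- `1 / D` to be represented.
    set v : ℝ → ℝ := fun t => if 0 < t then 1 / D * (1 / (θ + t)) else 1 / D with hv
    have mv : Measurable v := Measurable.ite measurableSet_Ioi (by fun_prop) (by fun_prop)
    have bv : ∀ t, |v t| ≤ 1 / D * (1 / θ) + 1 / D := by
      intro t; simp only [hv]; split_ifs with h
      · rw [abs_of_nonneg (by positivity)]
        have : 1 / (θ + t) ≤ 1 / θ := one_div_le_one_div_of_le hθ (by linarith)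
        have := mul_le_mul_of_nonneg_left this (by positivity : 0 ≤ 1 / D)
        have : 0 < 1 / D := by positivity
        linarith
      · rw [abs_of_nonneg (by positivity)]
        have : 0 < 1 / D * (1 / θ) := by positivity
        linarith
    have Lv : MemLp (fun t => (v t : ℂ)) 2 m := hbdd v mv _ bv
    have hin : Integrable (fun t => 1 / (1 + t) * (1 / (θ + t))) η := by
      refine (hint θ hθ).bdd_mul (c := 1) (by fun_prop : Measurable _).aestronglyMeasurable ?_
      filter_upwards [hpos] with t ht
      rw [Real.norm_eq_abs, abs_of_nonneg (hfrac t ht).1]; exact (hfrac t ht).2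
    have hUe : inner ℂ U Le.toLp = 1 := by
      rw [hU, inner_toLp_ofReal, hsplit, ← Complex.ofReal_one, Complex.ofReal_inj]
      · have : ∫ t, u t * e t ∂η = 0 := by
          rw [← integral_zero ℝ ℝ (μ := η)]
          refine integral_congr_ae ?_
          filter_upwards [hpos] with t ht
          simp [he, ht]
        rw [this]; simp only [hu, he]; norm_num
      · refine (integrable_zero ℝ ℝ η).congr ?_
        filter_upwards [hpos] with t ht
        simp [he, ht]
    have hUv0 : ∫ t, u t * v t ∂m = 1 / D * (1 + ∫ t, 1 / (1 + t) * (1 / (θ + t)) ∂η) := by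
      have e1 : ∀ᵐ t ∂η, 1 / D * (1 / (1 + t) * (1 / (θ + t))) = u t * v t := by
        filter_upwards [hpos] with t ht
        simp only [hu, hv, if_pos ht]; ring
      rw [hsplit _ ((hin.const_mul (1 / D)).congr e1), ← integral_congr_ae e1, integral_const_mul]
      simp only [hu, hv]; norm_num; ring
    have hUv : (θ - 1) * ∫ t, u t * v t ∂m = 1 - d / D := by
      have : (θ - 1) * ∫ t, 1 / (1 + t) * (1 / (θ + t)) ∂η
          = ∫ t, 1 / (1 + t) ∂η - ∫ t, 1 / (θ + t) ∂η := by
        rw [← integral_const_mul, ← integral_sub (hint 1 one_pos) (hint θ hθ)]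
        refine integral_congr_ae ?_
        filter_upwards [hpos] with t ht
        have h1 : (1 + t) ≠ 0 := by positivity
        have h2 : (θ + t) ≠ 0 := by positivity
        field_simp
        ring
      rw [hUv0]
      have e2 : (θ - 1) * (1 / D * (1 + ∫ t, 1 / (1 + t) * (1 / (θ + t)) ∂η))
          = 1 / D * ((θ - 1) + (θ - 1) * ∫ t, 1 / (1 + t) * (1 / (θ + t)) ∂η) := by ring
      rw [e2, this]
      have e3 : θ - 1 + (∫ t, 1 / (1 + t) ∂η - ∫ t, 1 / (θ + t) ∂η) = D - d := by
        rw [hDdef, hd]; ring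
      rw [e3]; field_simp
    have heq : Lv.toLp + (θ - 1) • T Lv.toLp = T Le.toLp := by
      rw [hTapp, hTapp, hUe, hU, inner_toLp_ofReal]
      refine Lp.ext ?_
      filter_upwards [Lp.coeFn_add Lv.toLp ((θ - 1) • (K Lv.toLp + ((1 / d : ℝ) : ℂ) •
          (((∫ t, u t * v t ∂m : ℝ) : ℂ) • Lu.toLp))),
        Lp.coeFn_smul (θ - 1) (K Lv.toLp + ((1 / d : ℝ) : ℂ) •
          (((∫ t, u t * v t ∂m : ℝ) : ℂ) • Lu.toLp)),
        Lp.coeFn_add (K Lv.toLp) (((1 / d : ℝ) : ℂ) •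
          (((∫ t, u t * v t ∂m : ℝ) : ℂ) • Lu.toLp)),
        Lp.coeFn_smul ((1 / d : ℝ) : ℂ) (((∫ t, u t * v t ∂m : ℝ) : ℂ) • Lu.toLp),
        Lp.coeFn_smul ((∫ t, u t * v t ∂m : ℝ) : ℂ) Lu.toLp,
        Lp.coeFn_add (K Le.toLp) (((1 / d : ℝ) : ℂ) • ((1 : ℂ) • Lu.toLp)),
        Lp.coeFn_smul ((1 / d : ℝ) : ℂ) ((1 : ℂ) • Lu.toLp),
        Lp.coeFn_smul (1 : ℂ) Lu.toLp, coeFn_mulOp mk bk Lv.toLp, coeFn_mulOp mk bk Le.toLp,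
        Lv.coeFn_toLp, Le.coeFn_toLp, Lu.coeFn_toLp] with t a1 a2 a3 a4 a5 a6 a7 a8 a9 a10 a11 a12 a13
      rw [a1, a6, Pi.add_apply, Pi.add_apply, a2, a7, Pi.smul_apply, Pi.smul_apply, a3, a8,
        Pi.add_apply, Pi.smul_apply, a4, Pi.smul_apply, a5, Pi.smul_apply, a9, a10, a11, a12, a13]
      simp only [smul_eq_mul, one_mul]
      rw [Complex.real_smul]
      norm_cast
      have hr : v t + (θ - 1) * (k t * v t) + 1 / d * (1 - d / D) * u t = k t * e t + 1 / d * u t := by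
        have hdD : 1 / d * (1 - d / D) = 1 / d - 1 / D := by field_simp
        rw [hdD]
        simp only [hv, hk, he, hu]
        split_ifs with h
        · have h1 : (1 + t) ≠ 0 := by positivity
          have h2 : (θ + t) ≠ 0 := by positivity
          field_simp
          ring
        · ring
      rw [← hUv] at hr
      linarith
    have hg : ContinuousOn (fun s : ℝ => s / (1 + (θ - 1) * s)) (Set.Icc 0 1) := by
      refine ContinuousOn.div continuousOn_id (by fun_prop) fun s hs => ?_
      obtain ⟨x1, x2⟩ := hs
      rcases eq_or_lt_of_le x2 with rfl | x2
      · linarith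
      · nlinarith [mul_nonneg hθ.le x1]
    rw [hκ _ hg, inner_cfc_resolvent hT0 hT1 hθ heq, inner_toLp_ofReal, hsplit, Complex.ofReal_re]
    · have : ∫ t, e t * v t ∂η = 0 := by
        rw [← integral_zero ℝ ℝ (μ := η)]
        refine integral_congr_ae ?_
        filter_upwards [hpos] with t ht
        simp [he, ht]
      rw [this]; simp only [he, hv]; norm_num
    · refine (integrable_zero ℝ ℝ η).congr ?_
      filter_upwards [hpos] with t ht
      simp [he, ht]
  have hsm : Measurable fun s : unitInterval => 1 / (s : ℝ) - 1 := by fun_prop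
  have hposm : MeasurableSet {u : unitInterval | 0 < (u : ℝ)} :=
    measurableSet_lt measurable_const measurable_subtype_coe
  -- The inverse of `s = 1/(1 + t)`. At `s = 0`, that is `t = ∞`, the integrand vanishes and the
  -- mass may be discarded.
  set κ' : Measure ℝ := (κ.restrict {s | 0 < (s : ℝ)}).map (fun s : unitInterval => 1 / (s : ℝ) - 1)
    with hκ'
  have hfin' : IsFiniteMeasure κ' := Measure.isFiniteMeasure_map _ _
  have hκ'int : ∀ θ > 0, ∫ t, 1 / (θ + t) ∂κ' = 1 / (θ + a - ∫ t, 1 / (θ + t) ∂η) := by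
    intro θ hθ
    rw [hκ', integral_map hsm.aemeasurable (by fun_prop : Measurable _).aestronglyMeasurable,
      ← key θ hθ]
    have e1 : ∀ s ∈ {s : unitInterval | 0 < (s : ℝ)}, 1 / (θ + (1 / (s : ℝ) - 1))
        = (s : ℝ) / (1 + (θ - 1) * s) := by
      intro s hs
      have hs0 : 0 < (s : ℝ) := hs
      have h1 : 0 < 1 + (θ - 1) * (s : ℝ) := by
        rcases eq_or_lt_of_le s.2.2 with h | h
        · rw [h]; linarith
        · nlinarith
      have h2 : θ + (1 / (s : ℝ) - 1) = (1 + (θ - 1) * s) / s := by field_simp; ring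
      rw [h2, one_div_div]
    rw [setIntegral_congr_fun hposm e1]
    refine setIntegral_eq_integral_of_forall_compl_eq_zero fun s hs => ?_
    have : (s : ℝ) = 0 := le_antisymm (not_lt.1 hs) s.2.1
    rw [this, zero_div]
  have hneg : ∀ᵐ t ∂κ', 0 ≤ t := by
    rw [ae_map_iff hsm.aemeasurable measurableSet_Ici]
    refine (ae_restrict_iff' hposm).2 (Eventually.of_forall fun s hs => ?_)
    have hs0 : 0 < (s : ℝ) := hs
    have : 1 ≤ 1 / (s : ℝ) := (one_le_div hs0).2 s.2.2
    linarith
  -- An atom at `0` would make the transform blow up like `1/θ` as `θ ↓ 0`, whereas the strict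
  -- inequality `ha` keeps it bounded.
  have hzero : κ' {0} = 0 := by
    have hb : ∀ θ > 0, κ'.real {0} ≤ θ * (1 / (a - ∫ t, 1 / t ∂η)) := by
      intro θ hθ
      have h1 : κ'.real {0} * (1 / θ) ≤ ∫ t, 1 / (θ + t) ∂κ' := by
        have : κ'.real {0} * (1 / θ) = ∫ t in {0}, 1 / (θ + t) ∂κ' := by
          rw [integral_singleton]; simp
        rw [this]
        refine setIntegral_le_integral ?_ ?_
        · refine Integrable.of_bound (C := 1 / θ) (by fun_prop : Measurable _).aestronglyMeasurable ?_
          filter_upwards [hneg] with t ht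
          rw [Real.norm_eq_abs, abs_of_pos (by positivity)]
          exact one_div_le_one_div_of_le hθ (by linarith)
        · filter_upwards [hneg] with t ht
          simp only [Pi.zero_apply]; positivity
      have h2 : ∫ t, 1 / (θ + t) ∂κ' ≤ 1 / (a - ∫ t, 1 / t ∂η) := by
        rw [hκ'int θ hθ]
        exact one_div_le_one_div_of_le (by linarith) (by linarith [hle θ hθ])
      have h3 := h1.trans h2
      rw [mul_one_div, div_le_iff₀ hθ] at h3
      linarith
    have hl : Tendsto (fun θ : ℝ => θ * (1 / (a - ∫ t, 1 / t ∂η))) (𝓝[>] 0) (𝓝 0) := by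
      have : Continuous fun θ : ℝ => θ * (1 / (a - ∫ t, 1 / t ∂η)) := by fun_prop
      simpa using (this.tendsto 0).mono_left nhdsWithin_le_nhds
    have : κ'.real {0} ≤ 0 := ge_of_tendsto hl (by
      filter_upwards [self_mem_nhdsWithin] with θ hθ using hb θ hθ)
    exact (measureReal_eq_zero_iff).1 (le_antisymm this measureReal_nonneg)
  refine ⟨κ', hfin', ?_, hκ'int⟩
  rw [← Set.Iio_union_right]
  refine measure_union_null ?_ hzero
  simpa [ae_iff, Set.Iio] using hneg

/-! ### The Laplace exponent and the scale function -/

theorem integrable_withDensity_ofReal {κ : Measure ℝ} {w : ℝ → ℝ} (hw : Measurable w)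
    (h0 : ∀ᵐ t ∂κ, 0 ≤ w t) {g : ℝ → ℝ} :
    Integrable g (κ.withDensity fun t => ENNReal.ofReal (w t))
      ↔ Integrable (fun t => w t * g t) κ := by
  rw [integrable_withDensity_iff_integrable_smul₀' hw.aemeasurable.ennreal_ofReal (by simp)]
  refine integrable_congr ?_
  filter_upwards [h0] with t ht
  rw [ENNReal.toReal_ofReal ht, smul_eq_mul]

theorem integral_withDensity_ofReal {κ : Measure ℝ} {w : ℝ → ℝ} (hw : Measurable w)
    (h0 : ∀ᵐ t ∂κ, 0 ≤ w t) (g : ℝ → ℝ) :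
    ∫ t, g t ∂(κ.withDensity fun t => ENNReal.ofReal (w t)) = ∫ t, w t * g t ∂κ := by
  rw [integral_withDensity_eq_integral_toReal_smul₀ hw.aemeasurable.ennreal_ofReal (by simp)]
  refine integral_congr_ae ?_
  filter_upwards [h0] with t ht
  simp only [ENNReal.toReal_ofReal ht, smul_eq_mul]

theorem ae_pos_of_Iic_zero {κ : Measure ℝ} (h : κ (Set.Iic 0) = 0) : ∀ᵐ t ∂κ, 0 < t := by
  rw [ae_iff]; simpa [Set.Iic] using h

/-- Fatou's lemma as a criterion for integrability. -/
theorem integrable_of_tendsto_of_integral_le {κ : Measure ℝ} {g : ℕ → ℝ → ℝ} {f : ℝ → ℝ} {C : ℝ}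
    (hg : ∀ n, Integrable (g n) κ) (h0 : ∀ n, ∀ᵐ t ∂κ, 0 ≤ g n t) (hC : ∀ n, ∫ t, g n t ∂κ ≤ C)
    (hlim : ∀ᵐ t ∂κ, Tendsto (fun n => g n t) atTop (𝓝 (f t))) : Integrable f κ := by
  have hm : AEStronglyMeasurable f κ :=
    aestronglyMeasurable_of_tendsto_ae atTop (fun n => (hg n).1) hlim
  refine ⟨hm, ?_⟩
  have h1 : ∫⁻ t, ‖f t‖ₑ ∂κ ≤ liminf (fun n => ∫⁻ t, ‖g n t‖ₑ ∂κ) atTop := by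
    refine (lintegral_congr_ae ?_).le.trans
      (lintegral_liminf_le' fun n => (hg n).1.enorm)
    filter_upwards [hlim] with t ht
    exact (ht.enorm.liminf_eq).symm
  refine lt_of_le_of_lt (h1.trans (liminf_le_of_le (a := ENNReal.ofReal C) (by isBoundedDefault) ?_))
    ENNReal.ofReal_lt_top
  intro b hb
  obtain ⟨n, hn⟩ := hb.exists
  refine hn.trans ?_
  have : ∫⁻ t, ‖g n t‖ₑ ∂κ = ENNReal.ofReal (∫ t, g n t ∂κ) := by
    rw [ofReal_integral_eq_lintegral_ofReal (hg n) (h0 n)]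
    refine lintegral_congr_ae ?_
    filter_upwards [h0 n] with t ht
    exact Real.enorm_of_nonneg ht
  rw [this]
  exact ENNReal.ofReal_le_ofReal (hC n)

section StieltjesTransform

variable {κ : Measure ℝ} [IsFiniteMeasure κ]

theorem integrable_one_div_add (hκ : κ (Set.Iic 0) = 0) {θ : ℝ} (hθ : 0 < θ) :
    Integrable (fun t => 1 / (θ + t)) κ := by
  refine Integrable.of_bound (C := 1 / θ) (by fun_prop : Measurable _).aestronglyMeasurable ?_
  filter_upwards [ae_pos_of_Iic_zero hκ] with t ht
  rw [Real.norm_eq_abs, abs_of_pos (by positivity)]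
  exact one_div_le_one_div_of_le hθ (by linarith)

theorem continuousOn_integral_one_div_add (hκ : κ (Set.Iic 0) = 0) :
    ContinuousOn (fun θ => ∫ t, 1 / (θ + t) ∂κ) (Set.Ioi 0) := by
  intro θ hθ
  have hθ' : 0 < θ := hθ
  refine ContinuousAt.continuousWithinAt ?_
  refine continuousAt_of_dominated (bound := fun _ => 1 / (θ / 2)) ?_ ?_ (integrable_const _) ?_
  · exact Eventually.of_forall fun x => (by fun_prop : Measurable _).aestronglyMeasurable
  · filter_upwards [Ioi_mem_nhds (half_lt_self hθ')] with x hx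
    filter_upwards [ae_pos_of_Iic_zero hκ] with t ht
    have hx' : θ / 2 < x := hx
    have : 0 < θ / 2 := by positivity
    rw [Real.norm_eq_abs, abs_of_pos (by have := this.trans hx'; positivity)]
    exact one_div_le_one_div_of_le this (by linarith)
  · filter_upwards [ae_pos_of_Iic_zero hκ] with t ht
    exact ContinuousAt.div continuousAt_const (by fun_prop) (by positivity)

/-- Reads masses and moments of a measure off the behaviour of its Stieltjes transform at infinity.
-/
theorem mul_integral_div_add_tendsto {κ : Measure ℝ} (hκ : κ (Set.Iic 0) = 0) {g : ℝ → ℝ} (hg : Integrable g κ) :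
    Tendsto (fun n : ℕ => ((n : ℝ) + 1) * ∫ t, g t / ((n : ℝ) + 1 + t) ∂κ) atTop
      (𝓝 (∫ t, g t ∂κ)) := by
  simp_rw [← integral_const_mul]
  refine tendsto_integral_of_dominated_convergence (fun t => ‖g t‖) ?_ hg.norm ?_ ?_
  · exact fun n => (hg.1.aemeasurable.div
      (by fun_prop : AEMeasurable (fun t : ℝ => (n : ℝ) + 1 + t) κ)).aestronglyMeasurable.const_mul _
  · intro n
    filter_upwards [ae_pos_of_Iic_zero hκ] with t ht
    rw [norm_mul, norm_div, Real.norm_of_nonneg (by positivity : (0 : ℝ) ≤ (n : ℝ) + 1),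
      Real.norm_of_nonneg (by positivity : (0 : ℝ) ≤ (n : ℝ) + 1 + t), mul_div_assoc',
      div_le_iff₀ (by positivity), mul_comm]
    exact mul_le_mul_of_nonneg_left (by linarith) (norm_nonneg _)
  · filter_upwards [ae_pos_of_Iic_zero hκ] with t ht
    have h1 : Tendsto (fun n : ℕ => (n : ℝ) + 1) atTop atTop :=
      tendsto_atTop_add_const_right _ _ tendsto_natCast_atTop_atTop
    have h2 : Tendsto (fun n : ℕ => t / ((n : ℝ) + 1 + t)) atTop (𝓝 0) :=
      tendsto_const_nhds.div_atTop (tendsto_atTop_add_const_right _ _ h1)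
    have h3 : Tendsto (fun n : ℕ => g t * (1 - t / ((n : ℝ) + 1 + t))) atTop (𝓝 (g t)) := by
      simpa using (h2.const_sub 1).const_mul (g t)
    refine h3.congr fun n => ?_
    have : (n : ℝ) + 1 + t ≠ 0 := by positivity
    field_simp
    ring

end StieltjesTransform

section Exponent

variable {γ σ : ℝ} {ν : Measure ℝ} [IsFiniteMeasure ν]

/-- For a finite jump measure the compensator is integrable by itself and can be moved into the
drift. -/
theorem laplaceExponent_eq (θ : ℝ) (hθ : 0 ≤ θ) :
    laplaceExponent γ σ ν θ = (γ + ∫ z in Set.Ioo (0 : ℝ) 1, z ∂ν) * θ + 1 / 2 * σ ^ 2 * θ ^ 2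
      - ∫ z in Set.Ioi (0 : ℝ), (1 - Real.exp (-θ * z)) ∂ν := by
  have h1 : Integrable (fun z => 1 - Real.exp (-θ * z)) (ν.restrict (Set.Ioi 0)) := by
    refine Integrable.of_bound (C := 1) (by fun_prop) ?_
    refine (ae_restrict_iff' measurableSet_Ioi).2 (Eventually.of_forall fun z hz => ?_)
    have : Real.exp (-θ * z) ≤ 1 := Real.exp_le_one_iff.2 (by nlinarith [Set.mem_Ioi.1 hz])
    have := Real.exp_pos (-θ * z)
    rw [Real.norm_eq_abs, abs_le]; constructor <;> linarith
  have h2 : Integrable (fun z => θ * (Set.Ioo (0 : ℝ) 1).indicator (fun y => y) z)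
      (ν.restrict (Set.Ioi 0)) := by
    refine Integrable.const_mul (Integrable.of_bound (C := 1)
      (measurable_id.indicator measurableSet_Ioo).aestronglyMeasurable ?_) θ
    refine Eventually.of_forall fun z => ?_
    by_cases hz : z ∈ Set.Ioo (0 : ℝ) 1
    · rw [Set.indicator_of_mem hz, Real.norm_eq_abs, id, abs_of_pos hz.1]; exact hz.2.le
    · rw [Set.indicator_of_notMem hz]; simp
  rw [laplaceExponent, integral_sub h1 h2, integral_const_mul,
    setIntegral_indicator measurableSet_Ioo, Set.inter_eq_right.2 Set.Ioo_subset_Ioi_self]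
  ring

/-- Layer-cake formula with `1 - e^{-θz} = ∫_0^z θ e^{-θy} dy`, then Tonelli for the mixture
representing the tail, then `∫_0^∞ θ e^{-(θ + t)y} dy = θ/(θ + t)`. -/
theorem integral_one_sub_exp_eq {μ : Measure ℝ} [IsFiniteMeasure μ] (hμ : μ (Set.Iic 0) = 0)
    (h : ∀ x > 0, ν.real (Set.Ioi x) = ∫ t, Real.exp (-x * t) ∂μ) {θ : ℝ} (hθ : 0 < θ) :
    ∫ z in Set.Ioi (0 : ℝ), (1 - Real.exp (-θ * z)) ∂ν = θ * ∫ t, 1 / (θ + t) ∂μ := by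
  have hpos := ae_pos_of_Iic_zero hμ
  have e1 : ∀ z : ℝ, ∫ y in (0 : ℝ)..z, θ * Real.exp (-θ * y) = 1 - Real.exp (-θ * z) := by
    intro z
    have := intervalIntegral.integral_eq_sub_of_hasDerivAt (a := 0) (b := z)
      (f := fun y => -Real.exp (-θ * y)) (f' := fun y => θ * Real.exp (-θ * y))
      (fun y _ => (((hasDerivAt_id y).const_mul (-θ)).exp.neg).congr_deriv (by simp; ring))
      ((by fun_prop : Continuous _).intervalIntegrable _ _)
    rw [this]; simp
    ring
  have nn : ∀ z ∈ Set.Ioi (0 : ℝ), 0 ≤ 1 - Real.exp (-θ * z) := by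
    intro z hz
    have : Real.exp (-θ * z) ≤ 1 := Real.exp_le_one_iff.2 (by nlinarith [Set.mem_Ioi.1 hz])
    linarith
  have hexp : ∀ y > 0, ν (Set.Ioi y) = ∫⁻ t, ENNReal.ofReal (Real.exp (-y * t)) ∂μ := by
    intro y hy
    rw [← ofReal_integral_eq_lintegral_ofReal, ← h y hy, ofReal_measureReal]
    · refine Integrable.of_bound (C := 1) (by fun_prop) ?_
      filter_upwards [hpos] with t ht
      rw [Real.norm_eq_abs, abs_of_pos (Real.exp_pos _), Real.exp_le_one_iff]
      nlinarith
    · exact Eventually.of_forall fun t => (Real.exp_pos _).le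
  have main : ∫⁻ z in Set.Ioi (0 : ℝ), ENNReal.ofReal (1 - Real.exp (-θ * z)) ∂ν
      = ∫⁻ t, ENNReal.ofReal (θ * (1 / (θ + t))) ∂μ := by
    have lc := lintegral_comp_eq_lintegral_meas_lt_mul (ν.restrict (Set.Ioi 0)) (f := fun z => z)
      (g := fun y => θ * Real.exp (-θ * y))
      ((ae_restrict_iff' measurableSet_Ioi).2 (Eventually.of_forall fun z hz => le_of_lt hz))
      measurable_id.aemeasurable
      (fun t _ => (by fun_prop : Continuous _).intervalIntegrable _ _)
      (Eventually.of_forall fun y => by positivity)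
    simp_rw [e1] at lc
    rw [lc]
    calc ∫⁻ y in Set.Ioi (0 : ℝ), (ν.restrict (Set.Ioi 0)) {a | y < a}
          * ENNReal.ofReal (θ * Real.exp (-θ * y))
        = ∫⁻ y in Set.Ioi (0 : ℝ), ∫⁻ t, ENNReal.ofReal (Real.exp (-y * t))
          * ENNReal.ofReal (θ * Real.exp (-θ * y)) ∂μ := by
          refine setLIntegral_congr_fun measurableSet_Ioi fun y hy => ?_
          have : {a | y < a} = Set.Ioi y := rfl
          rw [lintegral_mul_const _ (by fun_prop), ← hexp y hy, this,
            Measure.restrict_apply measurableSet_Ioi,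
            Set.inter_eq_left.2 (Set.Ioi_subset_Ioi (le_of_lt hy))]
      _ = ∫⁻ t, (∫⁻ y in Set.Ioi (0 : ℝ), ENNReal.ofReal (Real.exp (-y * t))
          * ENNReal.ofReal (θ * Real.exp (-θ * y))) ∂μ := by
          refine lintegral_lintegral_swap (Measurable.aemeasurable ?_)
          fun_prop
      _ = _ := by
          refine lintegral_congr_ae ?_
          filter_upwards [hpos] with t ht
          have e2 : ∀ y : ℝ, ENNReal.ofReal (Real.exp (-y * t))
              * ENNReal.ofReal (θ * Real.exp (-θ * y))
              = ENNReal.ofReal (θ * Real.exp (-(θ + t) * y)) := by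
            intro y
            rw [← ENNReal.ofReal_mul (Real.exp_pos _).le, mul_left_comm, ← Real.exp_add]
            congr 3; ring
          simp_rw [e2]
          have hi : IntegrableOn (fun y => Real.exp (-(θ + t) * y)) (Set.Ioi 0) :=
            integrableOn_exp_mul_Ioi (by linarith) 0
          rw [← ofReal_integral_eq_lintegral_ofReal (hi.const_mul θ)
            (Eventually.of_forall fun y => by positivity), integral_const_mul,
            integral_exp_mul_Ioi (by linarith)]
          congr 2
          rw [mul_zero, Real.exp_zero, div_neg, neg_div, neg_neg]
  have hR : AEStronglyMeasurable (fun t : ℝ => θ * (1 / (θ + t))) μ :=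
    (by fun_prop : Measurable _).aestronglyMeasurable
  rw [← integral_const_mul, integral_eq_lintegral_of_nonneg_ae
    ((ae_restrict_iff' measurableSet_Ioi).2 (Eventually.of_forall nn)) (by fun_prop), main,
    integral_eq_lintegral_of_nonneg_ae _ hR]
  filter_upwards [hpos] with t ht
  simp only [Pi.zero_apply]; positivity

theorem tendsto_laplaceExponent_atTop (hσ : 0 < σ) : Tendsto (laplaceExponent γ σ ν) atTop atTop := by
  set c := γ + ∫ z in Set.Ioo (0 : ℝ) 1, z ∂ν with hc
  have h1 : Tendsto (fun θ : ℝ => θ * (c + 1 / 2 * σ ^ 2 * θ)) atTop atTop := by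
    refine tendsto_id.atTop_mul_atTop₀ (tendsto_atTop_add_const_left _ _ ?_)
    exact tendsto_id.const_mul_atTop (by positivity)
  refine tendsto_atTop_mono' _ ?_ (tendsto_atTop_add_const_right _ (-ν.real (Set.Ioi 0)) h1)
  filter_upwards [eventually_ge_atTop 0] with θ hθ
  rw [laplaceExponent_eq θ hθ]
  have : ∫ z in Set.Ioi (0 : ℝ), (1 - Real.exp (-θ * z)) ∂ν ≤ ν.real (Set.Ioi 0) := by
    have h2 : Integrable (fun z => 1 - Real.exp (-θ * z)) (ν.restrict (Set.Ioi 0)) := by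
      refine Integrable.of_bound (C := 1) (by fun_prop) ?_
      refine (ae_restrict_iff' measurableSet_Ioi).2 (Eventually.of_forall fun z hz => ?_)
      have : Real.exp (-θ * z) ≤ 1 := Real.exp_le_one_iff.2 (by nlinarith [Set.mem_Ioi.1 hz])
      have := Real.exp_pos (-θ * z)
      rw [Real.norm_eq_abs, abs_le]; constructor <;> linarith
    calc ∫ z in Set.Ioi (0 : ℝ), (1 - Real.exp (-θ * z)) ∂ν
        ≤ ∫ z in Set.Ioi (0 : ℝ), (1 : ℝ) ∂ν :=
          integral_mono h2 (integrable_const _) fun z => by linarith [Real.exp_pos (-θ * z)]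
      _ = _ := by simp
  linarith

theorem laplaceExponent_zero : laplaceExponent γ σ ν 0 = 0 := by
  rw [laplaceExponent_eq 0 le_rfl]; simp

theorem continuousOn_laplaceExponent : ContinuousOn (laplaceExponent γ σ ν) (Set.Ici 0) := by
  refine ContinuousOn.congr (f := fun θ => (γ + ∫ z in Set.Ioo (0 : ℝ) 1, z ∂ν) * θ
    + 1 / 2 * σ ^ 2 * θ ^ 2 - ∫ z in Set.Ioi (0 : ℝ), (1 - Real.exp (-θ * z)) ∂ν) ?_
    (fun θ hθ => laplaceExponent_eq θ hθ)
  refine ContinuousOn.sub (by fun_prop) ?_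
  intro θ hθ
  refine continuousWithinAt_of_dominated (bound := fun _ => 1) ?_ ?_ (integrable_const _) ?_
  · exact Eventually.of_forall fun x => (by fun_prop : Continuous _).aestronglyMeasurable
  · filter_upwards [self_mem_nhdsWithin] with x hx
    refine (ae_restrict_iff' measurableSet_Ioi).2 (Eventually.of_forall fun z hz => ?_)
    have : Real.exp (-x * z) ≤ 1 := Real.exp_le_one_iff.2 (by
      have := mul_nonneg (Set.mem_Ici.1 hx) (le_of_lt (Set.mem_Ioi.1 hz)); linarith)
    have := Real.exp_pos (-x * z)
    rw [Real.norm_eq_abs, abs_le]; constructor <;> linarith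
  · exact Eventually.of_forall fun z => (by fun_prop : Continuous _).continuousWithinAt

/-- Factorisation of `ψ - r` at its positive root. -/
theorem exists_factorization (hσ : 0 < σ) (hν : HasCompletelyMonotoneDensity ν) {r : ℝ} (hr : 0 < r) :
    ∃ φ > 0, ∃ η : Measure ℝ, IsFiniteMeasure η ∧ η (Set.Iic 0) = 0 ∧
      Integrable (fun t => 1 / t) η ∧
      ∫ t, 1 / t ∂η < φ + 2 * (γ + ∫ z in Set.Ioo (0 : ℝ) 1, z ∂ν) / σ ^ 2 ∧
      ∀ θ > 0, laplaceExponent γ σ ν θ - r = (θ - φ) * (σ ^ 2 / 2 *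
        (θ + (φ + 2 * (γ + ∫ z in Set.Ioo (0 : ℝ) 1, z ∂ν) / σ ^ 2) - ∫ t, 1 / (θ + t) ∂η)) := by
  obtain ⟨μ, hμf, hμ, hμt⟩ := hν.exists_tail_eq
  have hpos := ae_pos_of_Iic_zero hμ
  set c := γ + ∫ z in Set.Ioo (0 : ℝ) 1, z ∂ν with hc
  have hψ : ∀ θ > 0, laplaceExponent γ σ ν θ
      = c * θ + 1 / 2 * σ ^ 2 * θ ^ 2 - θ * ∫ t, 1 / (θ + t) ∂μ := fun θ hθ => by
    rw [laplaceExponent_eq θ hθ.le, integral_one_sub_exp_eq hμ hμt hθ]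
  obtain ⟨N, hN0, hN⟩ : ∃ N > 0, r ≤ laplaceExponent γ σ ν N :=
    ((eventually_gt_atTop 0).and
      ((tendsto_laplaceExponent_atTop (γ := γ) (ν := ν) hσ).eventually_ge_atTop r)).exists
  obtain ⟨φ, hφmem, hφ⟩ : r ∈ laplaceExponent γ σ ν '' Set.Icc 0 N :=
    intermediate_value_Icc hN0.le (continuousOn_laplaceExponent.mono Set.Icc_subset_Ici_self)
      ⟨by rw [laplaceExponent_zero]; exact hr.le, hN⟩
  have hφ0 : 0 < φ := by
    rcases eq_or_lt_of_le hφmem.1 with h | h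
    · rw [← h, laplaceExponent_zero] at hφ; linarith
    · exact h
  -- From `θ/(θ + t) - φ/(φ + t) = (θ - φ) t / ((θ + t)(φ + t))`: after division by `θ - φ` a
  -- Stieltjes kernel with this weight is left.
  set w : ℝ → ℝ := fun t => 2 / σ ^ 2 * (t / (φ + t)) with hw
  have mw : Measurable w := by fun_prop
  have hw0 : ∀ᵐ t ∂μ, 0 ≤ w t := by
    filter_upwards [hpos] with t ht; simp only [hw]; positivity
  set η : Measure ℝ := μ.withDensity fun t => ENNReal.ofReal (w t) with hη
  have hwb : Integrable w μ := by
    refine Integrable.of_bound (C := 2 / σ ^ 2) mw.aestronglyMeasurable ?_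
    filter_upwards [hpos] with t ht
    rw [Real.norm_of_nonneg (by simp only [hw]; positivity)]
    refine mul_le_of_le_one_right (by positivity) ?_
    rw [div_le_one (by positivity)]; linarith
  have hηfin : IsFiniteMeasure η := isFiniteMeasure_withDensity_ofReal hwb.2
  have hη0 : η (Set.Iic 0) = 0 := withDensity_absolutelyContinuous _ _ hμ
  have hiφ := integrable_one_div_add hμ hφ0
  have e0 : ∀ᵐ t ∂μ, 2 / σ ^ 2 * (1 / (φ + t)) = w t * (1 / t) := by
    filter_upwards [hpos] with t ht
    simp only [hw]; field_simp
  have hηinv : ∫ t, 1 / t ∂η = 2 / σ ^ 2 * ∫ t, 1 / (φ + t) ∂μ := by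
    rw [hη, integral_withDensity_ofReal mw hw0, ← integral_congr_ae e0, integral_const_mul]
  refine ⟨φ, hφ0, η, hηfin, hη0, ?_, ?_, ?_⟩
  · rw [hη, integrable_withDensity_ofReal mw hw0]
    exact (hiφ.const_mul _).congr e0
  · rw [hηinv]
    rw [hψ φ hφ0] at hφ
    -- Strict because `ψ(φ) = r > 0`. This is what keeps the second factor bounded away from zero on
    -- all of `(0, ∞)`.
    have h1 : φ * ∫ t, 1 / (φ + t) ∂μ < φ * (c + 1 / 2 * σ ^ 2 * φ) := by nlinarith
    have h2 := lt_of_mul_lt_mul_left h1 hφ0.le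
    have h3 : φ + 2 * c / σ ^ 2 = 2 / σ ^ 2 * (c + 1 / 2 * σ ^ 2 * φ) := by field_simp; ring
    rw [h3]
    exact mul_lt_mul_of_pos_left h2 (by positivity)
  · intro θ hθ
    have hiθ := integrable_one_div_add hμ hθ
    have e1 : (θ - φ) * ∫ t, 1 / (θ + t) ∂η
        = 2 / σ ^ 2 * (θ * ∫ t, 1 / (θ + t) ∂μ - φ * ∫ t, 1 / (φ + t) ∂μ) := by
      rw [hη, integral_withDensity_ofReal mw hw0, ← integral_const_mul, ← integral_const_mul,
        ← integral_const_mul, ← integral_sub (hiθ.const_mul _) (hiφ.const_mul _),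
        ← integral_const_mul]
      refine integral_congr_ae ?_
      filter_upwards [hpos] with t ht
      simp only [hw]
      have h1 : θ + t ≠ 0 := by positivity
      have h2 : φ + t ≠ 0 := by positivity
      field_simp
      ring
    have e2 : (θ - φ) * (σ ^ 2 / 2 * (θ + (φ + 2 * c / σ ^ 2) - ∫ t, 1 / (θ + t) ∂η))
        = (θ - φ) * (σ ^ 2 / 2 * (θ + (φ + 2 * c / σ ^ 2)))
          - σ ^ 2 / 2 * ((θ - φ) * ∫ t, 1 / (θ + t) ∂η) := by ring
    rw [e2, e1, ← hφ, hψ θ hθ, hψ φ hφ0]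
    field_simp
    ring

end Exponent

section RightInverse

variable {γ σ : ℝ} {ν : Measure ℝ} [IsFiniteMeasure ν]

theorem integral_one_div_add_le {η : Measure ℝ} [IsFiniteMeasure η] (hη : η (Set.Iic 0) = 0)
    (hi : Integrable (fun t => 1 / t) η) {θ : ℝ} (hθ : 0 < θ) :
    ∫ t, 1 / (θ + t) ∂η ≤ ∫ t, 1 / t ∂η := by
  refine integral_mono_ae (integrable_one_div_add hη hθ) hi ?_
  filter_upwards [ae_pos_of_Iic_zero hη] with t ht
  exact one_div_le_one_div_of_le ht (by linarith)

/-- A positive cofactor leaves a single root, and `θ = 0` is excluded by `ψ(0) = 0 < r`; the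
supremum is over a singleton. -/
theorem eq_rightInverse_of_factorization {r φ : ℝ} (hr : 0 < r) (hφ : 0 < φ) {D : ℝ → ℝ}
    (hD : ∀ θ > 0, 0 < D θ)
    (h : ∀ θ > 0, laplaceExponent γ σ ν θ - r = (θ - φ) * D θ) :
    rightInverse γ σ ν r = φ := by
  have : {θ : ℝ | 0 ≤ θ ∧ laplaceExponent γ σ ν θ = r} = {φ} := by
    ext θ
    simp only [Set.mem_ofPred_eq, Set.mem_singleton_iff]
    constructor
    · rintro ⟨h0, h1⟩
      rcases eq_or_lt_of_le h0 with h2 | h2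
      · rw [← h2, laplaceExponent_zero] at h1; linarith
      · have := h θ h2
        rw [h1, sub_self] at this
        rcases mul_eq_zero.1 this.symm with h3 | h3
        · linarith
        · exact absurd h3 (hD θ h2).ne'
    · rintro rfl
      refine ⟨hφ.le, ?_⟩
      have := h θ hφ
      rw [sub_self, zero_mul] at this
      linarith
  rw [rightInverse, this, csSup_singleton]

theorem rightInverse_spec (hσ : 0 < σ) (hν : HasCompletelyMonotoneDensity ν) {r : ℝ} (hr : 0 < r) :
    0 < rightInverse γ σ ν r ∧ laplaceExponent γ σ ν (rightInverse γ σ ν r) = r ∧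
      (∀ θ > 0, θ < rightInverse γ σ ν r → laplaceExponent γ σ ν θ < r) ∧
      ∀ θ > rightInverse γ σ ν r, r < laplaceExponent γ σ ν θ := by
  obtain ⟨φ, hφ, η, hηf, hη, hi, ha, hfac⟩ := exists_factorization (γ := γ) hσ hν hr
  have hD : ∀ θ > 0, 0 < σ ^ 2 / 2 * (θ + (φ + 2 * (γ + ∫ z in Set.Ioo (0 : ℝ) 1, z ∂ν) / σ ^ 2)
      - ∫ t, 1 / (θ + t) ∂η) := fun θ hθ => by
    have := integral_one_div_add_le hη hi hθ
    exact mul_pos (by positivity) (by linarith)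
  rw [eq_rightInverse_of_factorization hr hφ hD hfac]
  refine ⟨hφ, ?_, fun θ hθ hlt => ?_, fun θ hθ => ?_⟩
  · have := hfac φ hφ
    rw [sub_self, zero_mul] at this
    linarith
  · have := hfac θ hθ
    have := mul_neg_of_neg_of_pos (sub_neg.2 hlt) (hD θ hθ)
    linarith
  · have h0 : 0 < θ := hφ.trans hθ
    have := hfac θ h0
    have := mul_pos (sub_pos.2 hθ) (hD θ h0)
    linarith

theorem continuousAt_rightInverse (hσ : 0 < σ) (hν : HasCompletelyMonotoneDensity ν) {q : ℝ}
    (hq : 0 < q) : ContinuousAt (rightInverse γ σ ν) q := by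
  obtain ⟨hφ, hφq, hlt, hgt⟩ := rightInverse_spec (γ := γ) hσ hν hq
  set φ := rightInverse γ σ ν q
  rw [Metric.continuousAt_iff']
  intro ε hε
  -- The sign of `ψ - r` at the two test points traps the root for nearby `r`. The maximum with `φ /
  -- 2` keeps the lower test point positive.
  have hlow : laplaceExponent γ σ ν (max (φ - ε) (φ / 2)) < q :=
    hlt _ (lt_max_of_lt_right (by linarith)) (max_lt (by linarith) (by linarith))
  have hhigh : q < laplaceExponent γ σ ν (φ + ε) := hgt _ (by linarith)
  filter_upwards [Ioi_mem_nhds hlow, Iio_mem_nhds hhigh, Ioi_mem_nhds hq] with r h1 h2 h3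
  obtain ⟨-, -, hl, hg⟩ := rightInverse_spec (γ := γ) hσ hν (show 0 < r from h3)
  have h1' : laplaceExponent γ σ ν (max (φ - ε) (φ / 2)) < r := h1
  have h2' : r < laplaceExponent γ σ ν (φ + ε) := h2
  rw [Real.dist_eq, abs_lt]
  obtain ⟨h0, hr, -, -⟩ := rightInverse_spec (γ := γ) hσ hν (show 0 < r from h3)
  have A : max (φ - ε) (φ / 2) < rightInverse γ σ ν r := by
    by_contra hc
    rcases eq_or_lt_of_le (not_lt.1 hc) with h | h
    · rw [← h, hr] at h1'; exact lt_irrefl _ h1'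
    · exact absurd (hg _ h) (not_lt.2 h1'.le)
  have B : rightInverse γ σ ν r < φ + ε := by
    by_contra hc
    rcases eq_or_lt_of_le (not_lt.1 hc) with h | h
    · rw [h, hr] at h2'; exact lt_irrefl _ h2'
    · exact absurd (hl _ (by linarith) h) (not_lt.2 h2'.le)
  have := (le_max_left (φ - ε) (φ / 2)).trans_lt A
  constructor <;> linarith

theorem hasDerivAt_rightInverse (hσ : 0 < σ) (hν : HasCompletelyMonotoneDensity ν) {q G : ℝ}
    (hq : 0 < q) (hG : G ≠ 0) (hψ : HasDerivAt (laplaceExponent γ σ ν) G (rightInverse γ σ ν q)) :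
    HasDerivAt (rightInverse γ σ ν) G⁻¹ q := by
  refine HasDerivAt.of_local_left_inverse (continuousAt_rightInverse hσ hν hq) hψ hG ?_
  filter_upwards [Ioi_mem_nhds hq] with r hr
  exact (rightInverse_spec hσ hν hr).2.1

end RightInverse

/-- `ξ` is the measure representing the `q`-scale function as
`ξ(0, ∞) e^{φx} - ∫ e^{-xt} ξ(dt)`, where `φ` is the positive root of `ψ = q`. -/
structure ScaleRepr (γ σ : ℝ) (ν : Measure ℝ) (q φ : ℝ) (ξ : Measure ℝ) : Prop where
  φ_pos : 0 < φ
  rightInverse_eq : rightInverse γ σ ν q = φ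
  deriv_rightInverse : deriv (rightInverse γ σ ν) q = ξ.real Set.univ
  fin : IsFiniteMeasure ξ
  Iic_zero : ξ (Set.Iic 0) = 0
  integrable_inv : Integrable (fun t => 1 / t) ξ
  integrable_pow : ∀ k ≤ 3, Integrable (fun t => t ^ k) ξ
  first : ξ.real Set.univ * φ + ∫ t, t ∂ξ = 2 / σ ^ 2
  second : ξ.real Set.univ * φ ^ 2 - ∫ t, t ^ 2 ∂ξ
    = -(4 * (γ + ∫ z in Set.Ioo (0 : ℝ) 1, z ∂ν) / σ ^ 4)
  ne_zero : 0 < ξ.real Set.univ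
  lt_laplaceExponent : ∀ θ > φ, q < laplaceExponent γ σ ν θ
  transform : ∀ θ > φ, 1 / (laplaceExponent γ σ ν θ - q)
    = ξ.real Set.univ / (θ - φ) - ∫ t, 1 / (θ + t) ∂ξ

/-- The moments come from expanding `1/(θ + a - E(θ))` at infinity, where `θ E(θ)` tends to the mass
of `η`: mass `1`, mean `a`, and a finite second moment. Integrability of `1/t` comes from the
opposite limit `θ ↓ 0`. -/
theorem exists_stieltjes_inverse_moments {η : Measure ℝ} [IsFiniteMeasure η]
    (hη : η (Set.Iic 0) = 0) {a : ℝ} (hi : Integrable (fun t => 1 / t) η)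
    (ha : ∫ t, 1 / t ∂η < a) :
    ∃ κ : Measure ℝ, IsFiniteMeasure κ ∧ κ (Set.Iic 0) = 0 ∧
      (∀ θ > 0, ∫ t, 1 / (θ + t) ∂κ = 1 / (θ + a - ∫ t, 1 / (θ + t) ∂η)) ∧
      κ.real Set.univ = 1 ∧ Integrable (fun t => 1 / t) κ ∧ Integrable (fun t => t) κ ∧
      ∫ t, t ∂κ = a ∧ Integrable (fun t => t ^ 2) κ := by
  obtain ⟨κ, hκf, hκ, hκint⟩ := exists_stieltjes_inverse hη hi ha
  have hpos := ae_pos_of_Iic_zero hκ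
  have hηpos := ae_pos_of_Iic_zero hη
  have hD : ∀ θ > 0, 0 < θ + a - ∫ t, 1 / (θ + t) ∂η := fun θ hθ => by
    linarith [integral_one_div_add_le hη hi hθ]
  set E : ℕ → ℝ := fun n => ∫ t, 1 / ((n : ℝ) + 1 + t) ∂η with hE
  have hn : ∀ n : ℕ, (0 : ℝ) < (n : ℝ) + 1 := fun n => by positivity
  have hnt : Tendsto (fun n : ℕ => (n : ℝ) + 1) atTop atTop :=
    tendsto_atTop_add_const_right _ _ tendsto_natCast_atTop_atTop
  have hE1 : Tendsto (fun n : ℕ => ((n : ℝ) + 1) * E n) atTop (𝓝 (η.real Set.univ)) := by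
    have := mul_integral_div_add_tendsto hη (integrable_const (1 : ℝ))
    rwa [integral_const, smul_eq_mul, mul_one] at this
  have hE0 : Tendsto E atTop (𝓝 0) := by
    refine (hE1.div_atTop hnt).congr fun n => ?_
    have := (hn n).ne'
    field_simp
  have hDn : ∀ n : ℕ, 0 < (n : ℝ) + 1 + a - E n := fun n => hD _ (hn n)
  have hDt : Tendsto (fun n : ℕ => (n : ℝ) + 1 + a - E n) atTop atTop := by
    have := (tendsto_atTop_add_const_right _ a hnt).atTop_add hE0.neg
    simpa [sub_eq_add_neg] using this
  have hQ : Tendsto (fun n : ℕ => ((n : ℝ) + 1) / ((n : ℝ) + 1 + a - E n)) atTop (𝓝 1) := by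
    have h1 : Tendsto (fun n : ℕ => 1 - (a - E n) / ((n : ℝ) + 1 + a - E n)) atTop (𝓝 (1 - 0)) :=
      ((hE0.const_sub a).div_atTop hDt).const_sub 1
    rw [sub_zero] at h1
    refine h1.congr fun n => ?_
    have := (hDn n).ne'
    field_simp
    ring
  have hmass : κ.real Set.univ = 1 := by
    have h1 : Tendsto (fun n : ℕ => ((n : ℝ) + 1) * ∫ t, 1 / ((n : ℝ) + 1 + t) ∂κ) atTop
        (𝓝 (κ.real Set.univ)) := by
      simpa using mul_integral_div_add_tendsto hκ (integrable_const (1 : ℝ))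
    refine tendsto_nhds_unique h1 (hQ.congr fun n => ?_)
    rw [hκint _ (hn n), mul_one_div]
  have hq1 : ∀ n : ℕ, Integrable (fun t => t / ((n : ℝ) + 1 + t)) κ := by
    intro n
    refine Integrable.of_bound (C := 1) (by fun_prop : Measurable _).aestronglyMeasurable ?_
    filter_upwards [hpos] with t ht
    have := hn n
    rw [Real.norm_of_nonneg (by positivity), div_le_one (by positivity)]
    linarith
  have hv1 : ∀ n : ℕ, ((n : ℝ) + 1) * ∫ t, t / ((n : ℝ) + 1 + t) ∂κ
      = ((n : ℝ) + 1) / ((n : ℝ) + 1 + a - E n) * (a - E n) := by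
    intro n
    have h1 : ∫ t, t / ((n : ℝ) + 1 + t) ∂κ
        = 1 - ((n : ℝ) + 1) * ∫ t, 1 / ((n : ℝ) + 1 + t) ∂κ := by
      have e1 : ∫ t, (1 : ℝ) ∂κ = 1 := by simp [hmass]
      have e2 := integral_sub (integrable_const (1 : ℝ))
        ((integrable_one_div_add hκ (hn n)).const_mul ((n : ℝ) + 1))
      rw [e1, integral_const_mul] at e2
      rw [← e2]
      refine integral_congr_ae ?_
      filter_upwards [hpos] with t ht
      have := hn n
      have : (n : ℝ) + 1 + t ≠ 0 := by positivity
      field_simp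
      ring
    rw [h1, hκint _ (hn n)]
    have h2 := (hDn n).ne'
    have h3 : (n : ℝ) + 1 + a - ∫ t, 1 / ((n : ℝ) + 1 + t) ∂η ≠ 0 := h2
    change _ = _ / (_ - ∫ t, 1 / ((n : ℝ) + 1 + t) ∂η) * (a - ∫ t, 1 / ((n : ℝ) + 1 + t) ∂η)
    field_simp
    ring
  have hv1lim : Tendsto (fun n : ℕ => ((n : ℝ) + 1) * ∫ t, t / ((n : ℝ) + 1 + t) ∂κ) atTop
      (𝓝 a) := by
    simp_rw [hv1]
    simpa using hQ.mul (hE0.const_sub a)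
  -- Moments are not known to exist beforehand; convergence of the truncated integrals yields
  -- integrability, one power after the other.
  have fatou : ∀ g : ℝ → ℝ, (∀ t > 0, 0 ≤ g t) → (∀ n : ℕ, Integrable (fun t => g t / ((n : ℝ) + 1 + t)) κ) →
      ∀ l : ℝ, Tendsto (fun n : ℕ => ((n : ℝ) + 1) * ∫ t, g t / ((n : ℝ) + 1 + t) ∂κ) atTop (𝓝 l) →
      Integrable g κ := by
    intro g hg0 hgi l hl
    obtain ⟨C, hC⟩ := hl.bddAbove_range
    refine integrable_of_tendsto_of_integral_le
      (g := fun n t => ((n : ℝ) + 1) * (g t / ((n : ℝ) + 1 + t))) (C := C)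
      (fun n => (hgi n).const_mul _) ?_ ?_ ?_
    · intro n
      filter_upwards [hpos] with t ht
      have := hn n
      have := hg0 t ht
      positivity
    · intro n
      rw [integral_const_mul]
      exact hC ⟨n, rfl⟩
    · filter_upwards [hpos] with t ht
      have h2 : Tendsto (fun n : ℕ => t / ((n : ℝ) + 1 + t)) atTop (𝓝 0) :=
        tendsto_const_nhds.div_atTop (tendsto_atTop_add_const_right _ _ hnt)
      have h3 : Tendsto (fun n : ℕ => g t * (1 - t / ((n : ℝ) + 1 + t))) atTop (𝓝 (g t)) := by
        simpa using (h2.const_sub 1).const_mul (g t)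
      refine h3.congr fun n => ?_
      have : (n : ℝ) + 1 + t ≠ 0 := by have := hn n; positivity
      field_simp
      ring
  have hi1 : Integrable (fun t => t) κ := fatou _ (fun t ht => ht.le) hq1 a hv1lim
  have hmean : ∫ t, t ∂κ = a :=
    tendsto_nhds_unique (mul_integral_div_add_tendsto hκ hi1) hv1lim
  have hq2 : ∀ n : ℕ, Integrable (fun t => t ^ 2 / ((n : ℝ) + 1 + t)) κ := by
    intro n
    refine hi1.mono (by fun_prop : Measurable _).aestronglyMeasurable ?_
    filter_upwards [hpos] with t ht
    have := hn n
    rw [Real.norm_of_nonneg (by positivity), Real.norm_of_nonneg ht.le, div_le_iff₀ (by positivity)]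
    nlinarith
  have hv2 : ∀ n : ℕ, ((n : ℝ) + 1) * ∫ t, t ^ 2 / ((n : ℝ) + 1 + t) ∂κ
      = ((n : ℝ) + 1) / ((n : ℝ) + 1 + a - E n) * (a * (a - E n) + ((n : ℝ) + 1) * E n) := by
    intro n
    have h1 : ∫ t, t ^ 2 / ((n : ℝ) + 1 + t) ∂κ
        = a - ((n : ℝ) + 1) * ∫ t, t / ((n : ℝ) + 1 + t) ∂κ := by
      rw [← integral_const_mul, ← hmean, ← integral_sub hi1 ((hq1 n).const_mul _)]
      refine integral_congr_ae ?_
      filter_upwards [hpos] with t ht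
      have := hn n
      have : (n : ℝ) + 1 + t ≠ 0 := by positivity
      field_simp
      ring
    rw [h1, hv1 n]
    have h2 := (hDn n).ne'
    field_simp
    ring
  have hi2 : Integrable (fun t => t ^ 2) κ := by
    refine fatou _ (fun t ht => by positivity) hq2 (1 * (a * (a - 0) + η.real Set.univ)) ?_
    simp_rw [hv2]
    exact hQ.mul (((hE0.const_sub a).const_mul a).add hE1)
  have hiinv : Integrable (fun t => 1 / t) κ := by
    have hn' : ∀ n : ℕ, (0 : ℝ) < 1 / ((n : ℝ) + 1) := fun n => by positivity
    refine integrable_of_tendsto_of_integral_le (g := fun n t => 1 / (1 / ((n : ℝ) + 1) + t))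
      (C := 1 / (a - ∫ t, 1 / t ∂η)) (fun n => integrable_one_div_add hκ (hn' n)) ?_ ?_ ?_
    · intro n
      filter_upwards [hpos] with t ht
      positivity
    · intro n
      rw [hκint _ (hn' n)]
      exact one_div_le_one_div_of_le (by linarith)
        (by linarith [integral_one_div_add_le hη hi (hn' n), hn' n])
    · filter_upwards [hpos] with t ht
      have : Tendsto (fun n : ℕ => 1 / ((n : ℝ) + 1) + t) atTop (𝓝 (0 + t)) :=
        tendsto_one_div_add_atTop_nhds_zero_nat.add_const t
      rw [zero_add] at this
      exact tendsto_const_nhds.div this ht.ne'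
  exact ⟨κ, hκf, hκ, hκint, hmass, hiinv, hi1, hmean, hi2⟩

/-- Partial fractions: `1/((θ - φ)(θ + t)) = (1/(φ + t)) (1/(θ - φ) - 1/(θ + t))`, so `ξ` has
density `(2/σ²)/(φ + t)` with respect to the measure of the reciprocal cofactor. The extra
denominator gains one moment, whence the third. The identities `first` and `second` come from mass
`1` and mean `a`. -/
theorem exists_scaleRepr {γ σ : ℝ} {ν : Measure ℝ} [IsFiniteMeasure ν] (hσ : 0 < σ)
    (hν : HasCompletelyMonotoneDensity ν) {q : ℝ} (hq : 0 < q) :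
    ∃ φ ξ, ScaleRepr γ σ ν q φ ξ := by
  obtain ⟨φ, hφ, η, hηf, hη, hi, ha, hfac⟩ := exists_factorization (γ := γ) hσ hν hq
  set c := γ + ∫ z in Set.Ioo (0 : ℝ) 1, z ∂ν with hc
  set a := φ + 2 * c / σ ^ 2 with hadef
  obtain ⟨κ, hκf, hκ, hκint, hmass, hiinv, hi1, hmean, hi2⟩ :=
    exists_stieltjes_inverse_moments hη hi ha
  have hpos := ae_pos_of_Iic_zero hκ
  have hD : ∀ θ > 0, 0 < σ ^ 2 / 2 * (θ + a - ∫ t, 1 / (θ + t) ∂η) := fun θ hθ => by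
    have := integral_one_div_add_le hη hi hθ
    exact mul_pos (by positivity) (by linarith)
  have hD' : ∀ θ > 0, 0 < θ + a - ∫ t, 1 / (θ + t) ∂η := fun θ hθ => by
    have := integral_one_div_add_le hη hi hθ
    linarith
  have hright := eq_rightInverse_of_factorization hq hφ hD hfac
  set w : ℝ → ℝ := fun t => 2 / σ ^ 2 * (1 / (φ + t)) with hw
  have mw : Measurable w := by fun_prop
  have hw0 : ∀ᵐ t ∂κ, 0 ≤ w t := by
    filter_upwards [hpos] with t ht; simp only [hw]; positivity
  have hwb : ∀ᵐ t ∂κ, ‖w t‖ ≤ 2 / σ ^ 2 * (1 / φ) := by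
    filter_upwards [hpos] with t ht
    rw [Real.norm_of_nonneg (by simp only [hw]; positivity)]
    exact mul_le_mul_of_nonneg_left (one_div_le_one_div_of_le hφ (by linarith)) (by positivity)
  have hwi : Integrable w κ := Integrable.of_bound mw.aestronglyMeasurable _ hwb
  set ξ : Measure ℝ := κ.withDensity fun t => ENNReal.ofReal (w t) with hξ
  have hξfin : IsFiniteMeasure ξ := isFiniteMeasure_withDensity_ofReal hwi.2
  have hξ0 : ξ (Set.Iic 0) = 0 := withDensity_absolutelyContinuous _ _ hκ
  have hξi : ∀ g : ℝ → ℝ, Integrable g κ → Integrable g ξ := fun g hg => by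
    rw [hξ, integrable_withDensity_ofReal mw hw0]
    exact hg.bdd_mul mw.aestronglyMeasurable hwb
  have hm : ξ.real Set.univ = 2 / σ ^ 2 * ∫ t, 1 / (φ + t) ∂κ := by
    have := integral_withDensity_ofReal mw hw0 (fun _ => 1)
    simp only [integral_const, smul_eq_mul, mul_one] at this
    rw [hξ, this, hw, integral_const_mul]
  have hm' : ξ.real Set.univ = (σ ^ 2 / 2 * (φ + a - ∫ t, 1 / (φ + t) ∂η))⁻¹ := by
    rw [hm, hκint φ hφ]
    have := hD' φ hφ
    field_simp
  -- At its root the slope of `ψ` is the cofactor itself, whose reciprocal is the mass of `ξ`; the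
  -- derivative of the inverse function then identifies this mass with `φ'(q)`.
  have hderiv : HasDerivAt (laplaceExponent γ σ ν)
      (σ ^ 2 / 2 * (φ + a - ∫ t, 1 / (φ + t) ∂η)) φ := by
    rw [hasDerivAt_iff_tendsto_slope]
    have hG : ContinuousOn (fun θ => σ ^ 2 / 2 * (θ + a - ∫ t, 1 / (θ + t) ∂η)) (Set.Ioi 0) :=
      continuousOn_const.mul ((continuousOn_id.add continuousOn_const).sub
        (continuousOn_integral_one_div_add hη))
    have hG' := (hG.continuousAt (Ioi_mem_nhds hφ)).tendsto.mono_left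
      (nhdsWithin_le_nhds (s := {φ}ᶜ))
    refine hG'.congr' ?_
    filter_upwards [self_mem_nhdsWithin, nhdsWithin_le_nhds (Ioi_mem_nhds hφ)] with θ h1 h2
    have h3 : θ - φ ≠ 0 := sub_ne_zero.2 h1
    have e1 := hfac θ h2
    have e2 := hfac φ hφ
    rw [sub_self, zero_mul] at e2
    rw [slope_def_field, eq_div_iff h3]
    linarith
  have hit : Integrable (fun t => t) ξ := hξi _ hi1
  have hit2 : Integrable (fun t => t ^ 2) ξ := hξi _ hi2
  have hfirst : ξ.real Set.univ * φ + ∫ t, t ∂ξ = 2 / σ ^ 2 := by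
    have h1 : ξ.real Set.univ * φ = ∫ t, φ ∂ξ := by simp
    rw [h1, ← integral_add (integrable_const _) hit, hξ, integral_withDensity_ofReal mw hw0]
    have : ∫ t, w t * (φ + t) ∂κ = ∫ t, 2 / σ ^ 2 ∂κ := by
      refine integral_congr_ae ?_
      filter_upwards [hpos] with t ht
      have : φ + t ≠ 0 := by positivity
      simp only [hw]; field_simp
    rw [this]; simp [hmass]
  have hsecond : ξ.real Set.univ * φ ^ 2 - ∫ t, t ^ 2 ∂ξ = -(4 * c / σ ^ 4) := by
    have h2 : φ * ∫ t, t ∂ξ + ∫ t, t ^ 2 ∂ξ = 2 / σ ^ 2 * a := by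
      rw [← integral_const_mul, ← integral_add (hit.const_mul _) hit2, hξ,
        integral_withDensity_ofReal mw hw0, ← hmean, ← integral_const_mul]
      refine integral_congr_ae ?_
      filter_upwards [hpos] with t ht
      have : φ + t ≠ 0 := by positivity
      simp only [hw]; field_simp
    have h3 : ξ.real Set.univ * φ ^ 2 - ∫ t, t ^ 2 ∂ξ
        = φ * (ξ.real Set.univ * φ + ∫ t, t ∂ξ) - (φ * ∫ t, t ∂ξ + ∫ t, t ^ 2 ∂ξ) := by ring
    rw [h3, hfirst, h2, hadef]
    field_simp
    ring
  refine ⟨φ, ξ, ⟨hφ, hright, ?_, hξfin, hξ0, hξi _ hiinv, ?_, hfirst, hsecond, ?_, ?_, ?_⟩⟩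
  · rw [← hright] at hderiv
    rw [(hasDerivAt_rightInverse hσ hν hq (by rw [hright]; exact (hD φ hφ).ne') hderiv).deriv, hm',
      hright]
  · intro k hk
    interval_cases k
    · simp
    · simpa using hit
    · exact hit2
    · rw [hξ, integrable_withDensity_ofReal mw hw0]
      refine (hi2.const_mul (2 / σ ^ 2)).mono (by fun_prop : Measurable _).aestronglyMeasurable ?_
      filter_upwards [hpos] with t ht
      simp only [hw]
      rw [Real.norm_of_nonneg (by positivity), Real.norm_of_nonneg (by positivity), mul_assoc]
      refine mul_le_mul_of_nonneg_left ?_ (by positivity)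
      rw [one_div, inv_mul_le_iff₀ (by positivity)]
      nlinarith [pow_pos ht 2]
  · rw [hm']
    exact inv_pos.2 (hD φ hφ)
  · intro θ hθ
    rw [← hright] at hθ
    exact (rightInverse_spec hσ hν hq).2.2.2 θ hθ
  · intro θ hθ
    have hθ0 : 0 < θ := hφ.trans hθ
    have h1 : θ - φ ≠ 0 := by linarith
    have hib : ∀ x > 0, ∀ᵐ t ∂κ, ‖(1 : ℝ) / (x + t)‖ ≤ 1 / x := by
      intro x hx
      filter_upwards [hpos] with t ht
      rw [Real.norm_of_nonneg (by positivity)]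
      exact one_div_le_one_div_of_le hx (by linarith)
    have hiw : Integrable (fun t => w t * (1 / (θ + t))) κ :=
      (integrable_one_div_add hκ hθ0).bdd_mul mw.aestronglyMeasurable hwb
    rw [hξ, integral_withDensity_ofReal mw hw0, ← hξ, hm, ← integral_const_mul,
      div_eq_mul_one_div (∫ t, 2 / σ ^ 2 * (1 / (φ + t)) ∂κ), ← integral_mul_const,
      ← integral_sub (hwi.mul_const _) hiw, hfac θ hθ0]
    have e1 : ∫ t, (w t * (1 / (θ - φ)) - w t * (1 / (θ + t))) ∂κ
        = 2 / σ ^ 2 * (1 / (θ - φ)) * ∫ t, 1 / (θ + t) ∂κ := by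
      rw [← integral_const_mul]
      refine integral_congr_ae ?_
      filter_upwards [hpos] with t ht
      have h2 : φ + t ≠ 0 := by positivity
      have h3 : θ + t ≠ 0 := by positivity
      simp only [hw]
      field_simp
      ring
    refine Eq.trans ?_ e1.symm
    rw [hκint θ hθ0]
    have := (hD' θ hθ0).ne'
    field_simp

/-! ### Calculus of Laplace transforms and half-line convolutions. -/

theorem LaplaceIntegrable.of_exp_bound {f : ℝ → ℝ} {C K θ : ℝ} (hf : ContinuousOn f (Set.Ici 0))
    (hb : ∀ x ≥ 0, |f x| ≤ C * Real.exp (K * x)) (hθ : K < θ) : LaplaceIntegrable f θ := by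
  have h1 : IntegrableOn (fun x : ℝ => C * Real.exp (-(θ - K) * x)) (Set.Ioi 0) :=
    (exp_neg_integrableOn_Ioi 0 (sub_pos.2 hθ)).const_mul C
  refine Integrable.mono' h1 ?_ ?_
  · exact (ContinuousOn.mul (by fun_prop) (hf.mono Set.Ioi_subset_Ici_self)).aestronglyMeasurable
      measurableSet_Ioi
  · filter_upwards [ae_restrict_mem measurableSet_Ioi] with x hx
    rw [norm_mul, Real.norm_eq_abs, Real.norm_eq_abs, Real.abs_exp]
    calc Real.exp (-θ * x) * |f x| ≤ Real.exp (-θ * x) * (C * Real.exp (K * x)) :=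
          mul_le_mul_of_nonneg_left (hb x (le_of_lt hx)) (Real.exp_pos _).le
      _ = C * Real.exp (-(θ - K) * x) := by
          rw [mul_left_comm, ← Real.exp_add]; ring_nf

theorem LaplaceIntegrable.add {f g : ℝ → ℝ} {θ : ℝ} (hf : LaplaceIntegrable f θ)
    (hg : LaplaceIntegrable g θ) : LaplaceIntegrable (fun x => f x + g x) θ := by
  unfold LaplaceIntegrable at *
  simp_rw [mul_add]
  exact Integrable.add hf hg

theorem LaplaceIntegrable.const_mul {f : ℝ → ℝ} {θ : ℝ} (hf : LaplaceIntegrable f θ) (a : ℝ) :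
    LaplaceIntegrable (fun x => a * f x) θ := by
  unfold LaplaceIntegrable at *
  simp_rw [mul_left_comm]
  exact Integrable.const_mul hf a

theorem laplaceTransform_add {f g : ℝ → ℝ} {θ : ℝ} (hf : LaplaceIntegrable f θ)
    (hg : LaplaceIntegrable g θ) :
    laplaceTransform (fun x => f x + g x) θ = laplaceTransform f θ + laplaceTransform g θ := by
  unfold laplaceTransform
  simp_rw [mul_add]
  exact integral_add hf hg

theorem laplaceTransform_const_mul (f : ℝ → ℝ) (θ a : ℝ) :
    laplaceTransform (fun x => a * f x) θ = a * laplaceTransform f θ := by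
  unfold laplaceTransform
  simp_rw [mul_left_comm]
  exact integral_const_mul _ _

theorem laplaceIntegrable_const {θ : ℝ} (hθ : 0 < θ) (a : ℝ) : LaplaceIntegrable (fun _ => a) θ :=
  Integrable.mul_const (exp_neg_integrableOn_Ioi 0 hθ) a

theorem laplaceTransform_const {θ : ℝ} (hθ : 0 < θ) (a : ℝ) :
    laplaceTransform (fun _ => a) θ = a / θ := by
  unfold laplaceTransform
  rw [integral_mul_const, integral_exp_mul_Ioi (by linarith)]
  simp
  ring

theorem continuous_comp_max {g : ℝ → ℝ} (hg : ContinuousOn g (Set.Ici 0)) :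
    Continuous fun y => g (max y 0) :=
  hg.comp_continuous (by fun_prop) fun x => Set.mem_Ici.2 (le_max_right _ _)

/-- The half-line convolution with a locally integrable kernel preserves continuity. -/
theorem continuousOn_halfConv {f g : ℝ → ℝ} (hf : ∀ x, IntegrableOn f (Set.Ioc 0 x))
    (hg : ContinuousOn g (Set.Ici 0)) : ContinuousOn (halfConv f g) (Set.Ici 0) := by
  have hgc := continuous_comp_max hg
  have key : ∀ x ≥ 0, halfConv f g x
      = ∫ t in Set.Ioi (0 : ℝ), (Set.Iic x).indicator (fun t => f t * g (max (x - t) 0)) t := by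
    intro x hx
    rw [setIntegral_indicator measurableSet_Iic, halfConv, intervalIntegral.integral_of_le hx,
      Set.Ioi_inter_Iic]
    refine setIntegral_congr_fun measurableSet_Ioc fun t ht => ?_
    simp only [max_eq_left (sub_nonneg.2 ht.2)]
  intro x₀ hx₀
  have hx₀' : (0 : ℝ) ≤ x₀ := hx₀
  obtain ⟨M, hM⟩ := (isCompact_Icc (a := (0 : ℝ)) (b := x₀ + 1)).exists_bound_of_continuousOn
    hgc.continuousOn
  refine ContinuousWithinAt.congr ?_ (fun x hx => key x hx) (key x₀ hx₀)
  refine ContinuousAt.continuousWithinAt ?_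
  have hfm : ∀ x, AEStronglyMeasurable f (volume.restrict (Set.Ioc 0 x)) := fun x => (hf x).1
  have hfm' : AEStronglyMeasurable f (volume.restrict (Set.Ioi 0)) := by
    have : Set.Ioi (0 : ℝ) = ⋃ n : ℕ, Set.Ioc (0 : ℝ) n := by
      ext y
      simp only [Set.mem_Ioi, Set.mem_iUnion, Set.mem_Ioc]
      exact ⟨fun h => (exists_nat_ge y).imp fun n hn => ⟨h, hn⟩, fun ⟨n, h⟩ => h.1⟩
    rw [this]
    exact AEStronglyMeasurable.iUnion fun n => hfm n
  refine tendsto_integral_filter_of_dominated_convergence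
    ((Set.Iic (x₀ + 1)).indicator fun t => M * |f t|) ?_ ?_ ?_ ?_
  · refine Eventually.of_forall fun x => ?_
    exact (hfm'.mul (hgc.comp (continuous_const.sub continuous_id)).aestronglyMeasurable).indicator
      measurableSet_Iic
  · filter_upwards [Iio_mem_nhds (lt_add_one x₀)] with x hx
    filter_upwards [ae_restrict_mem measurableSet_Ioi] with t ht
    have hx' : x < x₀ + 1 := hx
    by_cases h : t ≤ x
    · rw [Set.indicator_of_mem (show t ∈ Set.Iic x from h),
        Set.indicator_of_mem (show t ∈ Set.Iic (x₀ + 1) from h.trans hx'.le), norm_mul, mul_comm]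
      have h1 := hM (x - t) ⟨sub_nonneg.2 h, by linarith [show (0 : ℝ) < t from ht]⟩
      exact mul_le_mul_of_nonneg_right h1 (abs_nonneg _)
    · rw [Set.indicator_of_notMem (show t ∉ Set.Iic x from h), norm_zero]
      refine Set.indicator_nonneg (fun s _ => ?_) _
      exact mul_nonneg ((norm_nonneg _).trans (hM 0 ⟨le_rfl, by linarith⟩)) (abs_nonneg _)
  · refine IntegrableOn.integrable_indicator ?_ measurableSet_Iic |>.mono_measure le_rfl
    have h1 : IntegrableOn (fun t => M * |f t|) (Set.Ioc 0 (x₀ + 1)) := (hf _).abs.const_mul M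
    unfold IntegrableOn
    rw [Measure.restrict_restrict measurableSet_Iic, Set.inter_comm, Set.Ioi_inter_Iic]
    exact h1
  · have hne : ∀ᵐ t ∂(volume.restrict (Set.Ioi (0 : ℝ))), t ≠ x₀ :=
      ae_restrict_of_ae (Measure.ae_ne volume x₀)
    -- The indicator jumps only at `t = x₀`, a null set; elsewhere the integrand converges.
    filter_upwards [hne] with t ht
    rcases lt_or_gt_of_ne ht with h | h
    · have h2 : Tendsto (fun x => f t * g (max (x - t) 0)) (𝓝 x₀)
          (𝓝 (f t * g (max (x₀ - t) 0))) :=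
        (continuous_const.mul (hgc.comp (continuous_id.sub continuous_const))).tendsto x₀
      rw [Set.indicator_of_mem (show t ∈ Set.Iic x₀ from h.le)]
      refine h2.congr' ?_
      filter_upwards [Ioi_mem_nhds h] with x hx
      rw [Set.indicator_of_mem (Set.mem_Iic.2 (le_of_lt hx))]
    · rw [Set.indicator_of_notMem (show t ∉ Set.Iic x₀ from not_le.2 h)]
      refine tendsto_const_nhds.congr' ?_
      filter_upwards [Iio_mem_nhds h] with x hx
      rw [Set.indicator_of_notMem (fun h' => absurd hx (not_lt.2 (Set.mem_Iic.1 h')))]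

theorem LaplaceIntegrable.integrableOn_Ioc {f : ℝ → ℝ} {θ : ℝ} (hf : LaplaceIntegrable f θ)
    (x : ℝ) : IntegrableOn f (Set.Ioc 0 x) := by
  have h1 : IntegrableOn (fun t => Real.exp (-θ * t) * f t) (Set.Ioc 0 x) :=
    IntegrableOn.mono_set hf Set.Ioc_subset_Ioi_self
  have h2 : IntegrableOn (fun t => Real.exp (θ * t) * (Real.exp (-θ * t) * f t)) (Set.Ioc 0 x) :=
    h1.continuousOn_mul_of_subset (K := Set.Icc 0 x) (g := fun t => Real.exp (θ * t)) (by fun_prop)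
      isCompact_Icc measurableSet_Ioc Set.Ioc_subset_Icc_self
  refine h2.congr (Eventually.of_forall fun t => ?_)
  simp only []
  rw [← mul_assoc, ← Real.exp_add]
  simp

theorem halfConv_zero_right (f g : ℝ → ℝ) : halfConv f g 0 = 0 := by simp [halfConv]

/-- Differentiation under the integral would need regularity of `f'`. Instead, the convolution and
the primitive of its expected derivative are continuous with equal Laplace transforms, so they
coincide, and the primitive is differentiable. -/
theorem hasDerivAt_halfConv {f f' r : ℝ → ℝ} {θ : ℝ} (hf : ContinuousOn f (Set.Ici 0))
    (hd : ∀ x > 0, HasDerivAt f (f' x) x)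
    (hr : ContinuousOn r (Set.Ici 0)) (if0 : LaplaceIntegrable f θ) (if1 : LaplaceIntegrable f' θ)
    (ir : LaplaceIntegrable r θ) {x : ℝ} (hx : 0 < x) :
    HasDerivAt (halfConv f r) (f 0 * r x + halfConv f' r x) x := by
  -- The primitive is a convolution with the constant `1`, whose transform requires a positive
  -- argument.
  wlog hθ : 0 < θ generalizing θ
  · exact this (if0.mono (by linarith [not_lt.1 hθ] : θ ≤ 1)) (if1.mono (by linarith [not_lt.1 hθ]))
      (ir.mono (by linarith [not_lt.1 hθ])) one_pos
  set h : ℝ → ℝ := fun x => f 0 * r x + halfConv f' r x with hh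
  have hhc : ContinuousOn h (Set.Ici 0) :=
    (continuousOn_const.mul hr).add (continuousOn_halfConv (fun x => if1.integrableOn_Ioc x) hr)
  have hhi : LaplaceIntegrable h θ := (ir.const_mul _).add (if1.halfConv ir)
  set H : ℝ → ℝ := halfConv h (fun _ => 1) with hH
  have hHi : LaplaceIntegrable H θ := hhi.halfConv (laplaceIntegrable_const hθ 1)
  have hHc : ContinuousOn H (Set.Ici 0) :=
    continuousOn_halfConv (fun x => hhi.integrableOn_Ioc x) continuousOn_const
  have hEq : Set.EqOn (halfConv f r) H (Set.Ioi 0) := by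
    refine eqOn_of_laplaceTransform_eq (θ₀ := θ)
      ((continuousOn_halfConv (fun x => if0.integrableOn_Ioc x) hr).mono Set.Ioi_subset_Ici_self)
      (hHc.mono Set.Ioi_subset_Ici_self) (if0.halfConv ir) hHi fun s hs => ?_
    have hs0 : 0 < s := hθ.trans hs
    have j0 := if0.mono hs.le
    have j1 := if1.mono hs.le
    have jr := ir.mono hs.le
    rw [laplaceTransform_halfConv j0 jr, hH,
      laplaceTransform_halfConv (hhi.mono hs.le) (laplaceIntegrable_const hs0 1),
      laplaceTransform_const hs0, hh, laplaceTransform_add (jr.const_mul _) (j1.halfConv jr),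
      laplaceTransform_const_mul, laplaceTransform_halfConv j1 jr,
      laplaceTransform_deriv (hf 0 Set.self_mem_Ici) hd j0 j1]
    field_simp
    ring
  have hHeq : ∀ y, H y = ∫ t in (0 : ℝ)..y, h t := fun y => by simp [hH, halfConv]
  have hHd : HasDerivAt H (h x) x := by
    have : HasDerivAt (fun y => ∫ t in (0 : ℝ)..y, h t) (h x) x := by
      refine intervalIntegral.integral_hasDerivAt_right ?_ ?_ ?_
      · rw [intervalIntegrable_iff_integrableOn_Ioc_of_le hx.le]
        exact hhi.integrableOn_Ioc x
      · exact (hhc.mono Set.Ioi_subset_Ici_self).stronglyMeasurableAtFilter isOpen_Ioi x hx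
      · exact (hhc x hx.le).continuousAt (Ici_mem_nhds hx)
    exact this.congr_of_eventuallyEq (Eventually.of_forall hHeq)
  exact hHd.congr_of_eventuallyEq (hEq.eventuallyEq_of_mem (Ioi_mem_nhds hx))

/-- Extension by the boundary value to the left of `0` preserves differentiability when the
derivative vanishes at `0`. -/
theorem hasDerivAt_comp_max {u u' : ℝ → ℝ} (hu : ContinuousOn u (Set.Ici 0))
    (hd : ∀ x > 0, HasDerivAt u (u' x) x) (hu' : ContinuousOn u' (Set.Ici 0)) (h0 : u' 0 = 0)
    (x : ℝ) : HasDerivAt (fun y => u (max y 0)) (u' (max x 0)) x := by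
  rcases lt_trichotomy x 0 with hx | rfl | hx
  · rw [max_eq_right hx.le, h0]
    refine (hasDerivAt_const x (u 0)).congr_of_eventuallyEq ?_
    filter_upwards [Iio_mem_nhds hx] with y hy
    rw [max_eq_right (le_of_lt hy)]
  · rw [max_self, h0]
    have h1 : HasDerivWithinAt (fun y => u (max y 0)) 0 (Set.Iic 0) 0 := by
      refine (hasDerivWithinAt_const (0 : ℝ) _ (u 0)).congr (fun y hy => ?_) (by simp)
      rw [max_eq_right hy]
    have h2 : HasDerivWithinAt (fun y => u (max y 0)) 0 (Set.Ici 0) 0 := by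
      have hev : ∀ᶠ y in 𝓝[>] (0 : ℝ), HasDerivAt (fun y => u (max y 0)) (u' y) y := by
        filter_upwards [self_mem_nhdsWithin] with y hy
        refine (hd y hy).congr_of_eventuallyEq ?_
        filter_upwards [Ioi_mem_nhds hy] with z hz
        rw [max_eq_left (le_of_lt hz)]
      refine hasDerivWithinAt_Ici_of_tendsto_deriv (s := Set.Ioi 0) ?_
        (continuous_comp_max hu).continuousWithinAt self_mem_nhdsWithin ?_
      · intro y hy
        have : HasDerivAt (fun y => u (max y 0)) (u' y) y := by
          refine (hd y hy).congr_of_eventuallyEq ?_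
          filter_upwards [Ioi_mem_nhds hy] with z hz
          rw [max_eq_left (le_of_lt hz)]
        exact this.differentiableAt.differentiableWithinAt
      · have h3 : Tendsto u' (𝓝[>] 0) (𝓝 0) := by
          have := (hu' 0 Set.self_mem_Ici).mono Set.Ioi_subset_Ici_self
          rwa [ContinuousWithinAt, h0] at this
        exact h3.congr' (hev.mono fun y hy => hy.deriv.symm)
    have := h1.union h2
    rwa [Set.Iic_union_Ici, hasDerivWithinAt_univ] at this
  · rw [max_eq_left hx.le]
    refine (hd x hx).congr_of_eventuallyEq ?_
    filter_upwards [Ioi_mem_nhds hx] with z hz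
    rw [max_eq_left (le_of_lt hz)]

/-! ### Scale functions as mixtures of exponentials. -/

/-- The `k`-th derivative of `ξ(0, ∞) e^{φx} - ∫ e^{-xt} ξ(dt)`. -/
def expMix (φ : ℝ) (ξ : Measure ℝ) (k : ℕ) (x : ℝ) : ℝ :=
  ξ.real Set.univ * φ ^ k * Real.exp (φ * x) - ∫ t, (-t) ^ k * Real.exp (-x * t) ∂ξ

namespace ScaleRepr

variable {γ σ : ℝ} {ν : Measure ℝ} {q φ : ℝ} {ξ : Measure ℝ}

theorem ae_pos (R : ScaleRepr γ σ ν q φ ξ) : ∀ᵐ t ∂ξ, 0 < t := ae_pos_of_Iic_zero R.Iic_zero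

theorem integrable_abs_pow (R : ScaleRepr γ σ ν q φ ξ) {k : ℕ} (hk : k ≤ 3) :
    Integrable (fun t : ℝ => |t| ^ k) ξ := by
  refine (R.integrable_pow k hk).abs.congr (Eventually.of_forall fun t => ?_)
  simp [abs_pow]

theorem norm_pow_mul_exp_le {t x : ℝ} (k : ℕ) (ht : 0 < t) (hx : 0 ≤ x) :
    ‖(-t) ^ k * Real.exp (-x * t)‖ ≤ |t| ^ k := by
  rw [norm_mul, norm_pow, norm_neg, Real.norm_eq_abs, Real.norm_eq_abs, Real.abs_exp]
  refine mul_le_of_le_one_right (by positivity) (Real.exp_le_one_iff.2 ?_)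
  nlinarith

theorem integrable_pow_mul_exp (R : ScaleRepr γ σ ν q φ ξ) {k : ℕ} (hk : k ≤ 3) {x : ℝ}
    (hx : 0 ≤ x) : Integrable (fun t => (-t) ^ k * Real.exp (-x * t)) ξ := by
  refine (R.integrable_abs_pow hk).mono' (by fun_prop : Continuous _).aestronglyMeasurable ?_
  filter_upwards [R.ae_pos] with t ht
  exact norm_pow_mul_exp_le k ht hx

theorem continuousOn_expMix (R : ScaleRepr γ σ ν q φ ξ) {k : ℕ} (hk : k ≤ 3) :
    ContinuousOn (expMix φ ξ k) (Set.Ici 0) := by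
  refine ContinuousOn.sub (by fun_prop) ?_
  refine continuousOn_of_dominated (bound := fun t => |t| ^ k) ?_ ?_ (R.integrable_abs_pow hk) ?_
  · exact fun x _ => (by fun_prop : Continuous _).aestronglyMeasurable
  · intro x hx
    filter_upwards [R.ae_pos] with t ht
    exact norm_pow_mul_exp_le k ht hx
  · exact Eventually.of_forall fun t => by fun_prop

theorem hasDerivAt_expMix (R : ScaleRepr γ σ ν q φ ξ) {k : ℕ} (hk : k ≤ 2) {x : ℝ} (hx : 0 < x) :
    HasDerivAt (expMix φ ξ k) (expMix φ ξ (k + 1) x) x := by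
  have h1 : HasDerivAt (fun x => ξ.real Set.univ * φ ^ k * Real.exp (φ * x))
      (ξ.real Set.univ * φ ^ (k + 1) * Real.exp (φ * x)) x := by
    have := (((hasDerivAt_id x).const_mul φ).exp).const_mul (ξ.real Set.univ * φ ^ k)
    exact this.congr_deriv (by simp; ring)
  have h2 := hasDerivAt_integral_of_dominated_loc_of_deriv_le (μ := ξ) (𝕜 := ℝ)
    (F := fun x t => (-t) ^ k * Real.exp (-x * t))
    (F' := fun x t => (-t) ^ (k + 1) * Real.exp (-x * t)) (x₀ := x)
    (bound := fun t => |t| ^ (k + 1)) (s := Set.Ioi 0) (Ioi_mem_nhds hx)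
    (Eventually.of_forall fun y => (by fun_prop : Continuous _).aestronglyMeasurable)
    (R.integrable_pow_mul_exp (by omega) hx.le) (by fun_prop : Continuous _).aestronglyMeasurable
    (by
      filter_upwards [R.ae_pos] with t ht y hy
      exact norm_pow_mul_exp_le (k + 1) ht (le_of_lt hy))
    (R.integrable_abs_pow (by omega))
    (by
      refine Eventually.of_forall fun t y _ => ?_
      have := (((hasDerivAt_neg y).mul_const t).exp).const_mul ((-t) ^ k)
      exact this.congr_deriv (by ring))
  exact h1.sub h2.2

theorem abs_expMix_le (R : ScaleRepr γ σ ν q φ ξ) {k : ℕ} (hk : k ≤ 3) :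
    ∃ C, ∀ x ≥ 0, |expMix φ ξ k x| ≤ C * Real.exp (φ * x) := by
  refine ⟨ξ.real Set.univ * φ ^ k + ∫ t, |t| ^ k ∂ξ, fun x hx => ?_⟩
  have hφ := R.φ_pos
  have h1 : |∫ t, (-t) ^ k * Real.exp (-x * t) ∂ξ| ≤ ∫ t, |t| ^ k ∂ξ := by
    rw [← Real.norm_eq_abs]
    refine norm_integral_le_of_norm_le (R.integrable_abs_pow hk) ?_
    filter_upwards [R.ae_pos] with t ht
    exact norm_pow_mul_exp_le k ht hx
  have h2 : 1 ≤ Real.exp (φ * x) := Real.one_le_exp (by positivity)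
  have h3 : 0 ≤ ∫ t, |t| ^ k ∂ξ := integral_nonneg fun t => by positivity
  have h4 : 0 ≤ ξ.real Set.univ * φ ^ k * Real.exp (φ * x) := by positivity
  refine (abs_sub _ _).trans ?_
  rw [abs_of_nonneg h4, add_mul]
  nlinarith

theorem laplaceIntegrable_expMix (R : ScaleRepr γ σ ν q φ ξ) {k : ℕ} (hk : k ≤ 3) {θ : ℝ}
    (hθ : φ < θ) : LaplaceIntegrable (expMix φ ξ k) θ := by
  obtain ⟨C, hC⟩ := R.abs_expMix_le hk
  exact LaplaceIntegrable.of_exp_bound (R.continuousOn_expMix hk) hC hθ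

theorem expMix_zero_zero (R : ScaleRepr γ σ ν q φ ξ) : expMix φ ξ 0 0 = 0 := by
  have := R.fin
  simp [expMix]

/-- The fields `first` and `second` of `ScaleRepr` are the values of `W'` and `W''` at `0+`. They
supply the boundary terms when derivatives are transformed. -/
theorem expMix_one_zero (R : ScaleRepr γ σ ν q φ ξ) : expMix φ ξ 1 0 = 2 / σ ^ 2 := by
  rw [← R.first]
  simp only [expMix, pow_one, mul_zero, Real.exp_zero, mul_one, neg_zero, zero_mul,
    show ∫ t, -t ∂ξ = -∫ t, t ∂ξ from integral_neg _]
  ring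

theorem expMix_two_zero (R : ScaleRepr γ σ ν q φ ξ) :
    expMix φ ξ 2 0 = -(4 * (γ + ∫ z in Set.Ioo (0 : ℝ) 1, z ∂ν) / σ ^ 4) := by
  rw [← R.second]
  simp [expMix]

theorem laplaceTransform_expMix_zero (R : ScaleRepr γ σ ν q φ ξ) {θ : ℝ} (hθ : φ < θ) :
    laplaceTransform (expMix φ ξ 0) θ = 1 / (laplaceExponent γ σ ν θ - q) := by
  have := R.fin
  have hθ0 : 0 < θ := R.φ_pos.trans hθ
  rw [R.transform θ hθ]
  have hmeas : AEStronglyMeasurable (Function.uncurry fun (x t : ℝ) => Real.exp (-θ * x) * Real.exp (-x * t))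
      ((volume.restrict (Set.Ioi 0)).prod ξ) :=
    (by fun_prop : Continuous _).aestronglyMeasurable
  have hexp := exp_neg_integrableOn_Ioi 0 hθ0
  have hint : Integrable (Function.uncurry fun (x t : ℝ) => Real.exp (-θ * x) * Real.exp (-x * t))
      ((volume.restrict (Set.Ioi 0)).prod ξ) := by
    have h1 : Integrable (fun p : ℝ × ℝ => Real.exp (-θ * p.1) * 1)
        ((volume.restrict (Set.Ioi 0)).prod ξ) :=
      Integrable.mul_prod hexp (integrable_const (1 : ℝ))
    refine h1.mono' hmeas ?_
    have h2 : ∀ᵐ p ∂((volume.restrict (Set.Ioi (0 : ℝ))).prod ξ), 0 < p.1 ∧ 0 < p.2 := by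
      have ha : ∀ᵐ p ∂((volume.restrict (Set.Ioi (0 : ℝ))).prod ξ), 0 < p.1 :=
        Measure.quasiMeasurePreserving_fst.ae (ae_restrict_mem measurableSet_Ioi)
      have hb : ∀ᵐ p ∂((volume.restrict (Set.Ioi (0 : ℝ))).prod ξ), 0 < p.2 :=
        Measure.quasiMeasurePreserving_snd.ae R.ae_pos
      exact ha.and hb
    filter_upwards [h2] with p hp
    simp only [Function.uncurry]
    rw [Real.norm_of_nonneg (by positivity)]
    refine mul_le_mul_of_nonneg_left (Real.exp_le_one_iff.2 ?_) (Real.exp_pos _).le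
    nlinarith [hp.1, hp.2]
  have h1 : LaplaceIntegrable (fun x => ξ.real Set.univ * Real.exp (φ * x)) θ :=
    LaplaceIntegrable.of_exp_bound (by fun_prop) (C := ξ.real Set.univ) (K := φ) (fun x _ => by
      rw [abs_of_nonneg (by positivity)]) hθ
  have h2 : IntegrableOn (fun x => ∫ t, Real.exp (-θ * x) * Real.exp (-x * t) ∂ξ) (Set.Ioi 0) :=
    hint.integral_prod_left
  have e1 : laplaceTransform (expMix φ ξ 0) θ = (∫ x in Set.Ioi (0 : ℝ),
      Real.exp (-θ * x) * (ξ.real Set.univ * Real.exp (φ * x)))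
      - ∫ x in Set.Ioi (0 : ℝ), ∫ t, Real.exp (-θ * x) * Real.exp (-x * t) ∂ξ := by
    rw [← integral_sub h1 h2]
    refine setIntegral_congr_fun measurableSet_Ioi fun x _ => ?_
    simp [expMix, mul_sub, integral_const_mul]
  rw [e1, integral_integral_swap hint]
  congr 1
  · have : ∀ x : ℝ, Real.exp (-θ * x) * (ξ.real Set.univ * Real.exp (φ * x))
        = ξ.real Set.univ * Real.exp ((φ - θ) * x) := fun x => by
      rw [mul_left_comm, ← Real.exp_add]; ring_nf
    simp_rw [this]
    rw [integral_const_mul, integral_exp_mul_Ioi (by linarith)]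
    have : φ - θ ≠ 0 := by linarith
    have : θ - φ ≠ 0 := by linarith
    simp
    field_simp
    ring
  · refine integral_congr_ae ?_
    filter_upwards [R.ae_pos] with t ht
    have : ∀ x : ℝ, Real.exp (-θ * x) * Real.exp (-x * t) = Real.exp (-(θ + t) * x) := fun x => by
      rw [← Real.exp_add]; ring_nf
    simp_rw [this]
    rw [integral_exp_mul_Ioi (by linarith)]
    rw [mul_zero, Real.exp_zero, neg_div_neg_eq]

theorem laplaceTransform_expMix_one (R : ScaleRepr γ σ ν q φ ξ) {θ : ℝ} (hθ : φ < θ) :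
    laplaceTransform (expMix φ ξ 1) θ = θ / (laplaceExponent γ σ ν θ - q) := by
  rw [laplaceTransform_deriv (f := expMix φ ξ 0)
    (R.continuousOn_expMix (by norm_num) 0 Set.self_mem_Ici)
    (fun x hx => R.hasDerivAt_expMix (k := 0) (by norm_num) hx)
    (R.laplaceIntegrable_expMix (by norm_num) hθ) (R.laplaceIntegrable_expMix (by norm_num) hθ),
    R.laplaceTransform_expMix_zero hθ, R.expMix_zero_zero]
  ring

theorem laplaceTransform_expMix_two (R : ScaleRepr γ σ ν q φ ξ) {θ : ℝ} (hθ : φ < θ) :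
    laplaceTransform (expMix φ ξ 2) θ = θ ^ 2 / (laplaceExponent γ σ ν θ - q) - 2 / σ ^ 2 := by
  rw [laplaceTransform_deriv (f := expMix φ ξ 1)
    (R.continuousOn_expMix (by norm_num) 0 Set.self_mem_Ici)
    (fun x hx => R.hasDerivAt_expMix (k := 1) (by norm_num) hx)
    (R.laplaceIntegrable_expMix (by norm_num) hθ) (R.laplaceIntegrable_expMix (by norm_num) hθ),
    R.laplaceTransform_expMix_one hθ, R.expMix_one_zero]
  ring

theorem expMix_one_pos (R : ScaleRepr γ σ ν q φ ξ) (x : ℝ) : 0 < expMix φ ξ 1 x := by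
  have h1 : 0 < ξ.real Set.univ * φ ^ 1 * Real.exp (φ * x) := by
    have := R.ne_zero
    have := R.φ_pos
    positivity
  have h2 : ∫ t, (-t) ^ 1 * Real.exp (-x * t) ∂ξ ≤ 0 := by
    refine integral_nonpos_of_ae ?_
    filter_upwards [R.ae_pos] with t ht
    have := Real.exp_pos (-x * t)
    simp only [pow_one, Pi.zero_apply]
    nlinarith
  rw [expMix]
  linarith

theorem strictMonoOn_expMix (R : ScaleRepr γ σ ν q φ ξ) :
    StrictMonoOn (expMix φ ξ 0) (Set.Ici 0) := by
  refine strictMonoOn_of_deriv_pos (convex_Ici 0) (R.continuousOn_expMix (by norm_num)) ?_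
  intro x hx
  rw [interior_Ici] at hx
  rw [(R.hasDerivAt_expMix (k := 0) (by norm_num) hx).deriv]
  exact R.expMix_one_pos x

theorem isScaleFunction (R : ScaleRepr γ σ ν q φ ξ) :
    IsScaleFunction γ σ ν q ((Set.Ici 0).indicator (expMix φ ξ 0)) where
  eq_zero x hx := Set.indicator_of_notMem (not_le.2 hx) _
  nonneg x := by
    refine Set.indicator_nonneg (fun x hx => ?_) x
    rw [← R.expMix_zero_zero]
    exact R.strictMonoOn_expMix.monotoneOn Set.self_mem_Ici hx hx
  continuousOn := (R.continuousOn_expMix (by norm_num)).congr (Set.eqOn_indicator)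
  strictMonoOn := R.strictMonoOn_expMix.congr fun x hx => (Set.indicator_of_mem hx _).symm
  laplace θ hθ := by
    rw [R.rightInverse_eq] at hθ
    rw [← R.laplaceTransform_expMix_zero hθ]
    refine setIntegral_congr_fun measurableSet_Ioi fun x hx => ?_
    simp only [Set.indicator_of_mem (Set.mem_Ici.2 (le_of_lt (Set.mem_Ioi.1 hx)))]

theorem eqOn_of_isScaleFunction (R : ScaleRepr γ σ ν q φ ξ) {W : ℝ → ℝ}
    (hW : IsScaleFunction γ σ ν q W) : Set.EqOn W (expMix φ ξ 0) (Set.Ici 0) := by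
  have hi : ∀ θ > φ, LaplaceIntegrable W θ := by
    intro θ hθ
    -- The definition of a scale function does not state convergence, but a divergent integral is
    -- `0` by convention, whereas the prescribed transform is positive.
    by_contra hn
    have h1 := hW.laplace θ (by rwa [R.rightInverse_eq])
    rw [integral_undef hn] at h1
    have h2 := R.lt_laplaceExponent θ hθ
    have : 0 < 1 / (laplaceExponent γ σ ν θ - q) := by
      rw [one_div]; exact inv_pos.2 (sub_pos.2 h2)
    linarith
  have h1 : Set.EqOn W (expMix φ ξ 0) (Set.Ioi 0) := by
    refine eqOn_of_laplaceTransform_eq (θ₀ := φ + 1)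
      (hW.continuousOn.mono Set.Ioi_subset_Ici_self)
      ((R.continuousOn_expMix (by norm_num)).mono Set.Ioi_subset_Ici_self) (hi _ (by linarith))
      (R.laplaceIntegrable_expMix (by norm_num) (by linarith)) fun θ hθ => ?_
    rw [R.laplaceTransform_expMix_zero (by linarith)]
    exact hW.laplace θ (by rw [R.rightInverse_eq]; linarith)
  have h2 : Set.EqOn W (expMix φ ξ 0) (closure (Set.Ioi 0) ∩ Set.Ici 0) := by
    have hc : closure (Set.Ioi (0 : ℝ)) = Set.Ici 0 := closure_Ioi 0
    rw [hc, Set.inter_self]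
    exact h1.of_subset_closure hW.continuousOn (R.continuousOn_expMix (by norm_num))
      Set.Ioi_subset_Ici_self hc.ge
  rwa [closure_Ioi, Set.inter_self] at h2

theorem scaleFunction_eq (R : ScaleRepr γ σ ν q φ ξ) {x : ℝ} (hx : 0 ≤ x) :
    scaleFunction γ σ ν q x = expMix φ ξ 0 x :=
  R.eqOn_of_isScaleFunction (Classical.epsilon_spec ⟨_, R.isScaleFunction⟩) hx

theorem deriv_scaleFunction (R : ScaleRepr γ σ ν q φ ξ) {x : ℝ} (hx : 0 < x) :
    deriv (scaleFunction γ σ ν q) x = expMix φ ξ 1 x := by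
  have : scaleFunction γ σ ν q =ᶠ[𝓝 x] expMix φ ξ 0 := by
    filter_upwards [Ioi_mem_nhds hx] with y hy
    exact R.scaleFunction_eq (le_of_lt hy)
  rw [this.deriv_eq, (R.hasDerivAt_expMix (k := 0) (by norm_num) hx).deriv]

theorem deriv_deriv_scaleFunction (R : ScaleRepr γ σ ν q φ ξ) {x : ℝ} (hx : 0 < x) :
    deriv (deriv (scaleFunction γ σ ν q)) x = expMix φ ξ 2 x := by
  have : deriv (scaleFunction γ σ ν q) =ᶠ[𝓝 x] expMix φ ξ 1 := by
    filter_upwards [Ioi_mem_nhds hx] with y hy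
    exact R.deriv_scaleFunction hy
  rw [this.deriv_eq, (R.hasDerivAt_expMix (k := 1) (by norm_num) hx).deriv]

end ScaleRepr

/-! ### The integro-differential equation on the transform side. -/

/-- `ρ` is a density of the finite jump measure `ν` on the half line. -/
structure IsJumpDensity (ν : Measure ℝ) (ρ : ℝ → ℝ) : Prop where
  integrable : IntegrableOn ρ (Set.Ioi 0)
  integral_eq : ∀ g : ℝ → ℝ, ∫ z in Set.Ioi (0 : ℝ), g z ∂ν = ∫ z in Set.Ioi (0 : ℝ), ρ z * g z

/-- The density is smooth only on the open half-line, so it is cut off by `0` elsewhere to be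
globally measurable. -/
theorem HasCompletelyMonotoneDensity.exists_isJumpDensity {ν : Measure ℝ} [IsFiniteMeasure ν]
    (h : HasCompletelyMonotoneDensity ν) : ∃ ρ, IsJumpDensity ν ρ := by
  obtain ⟨ρ, hρc, hρ, hν⟩ := h
  have h0 : ∀ x > 0, 0 ≤ ρ x := fun x hx => by simpa using hρ 0 x hx
  set w : ℝ → ℝ := (Set.Ioi (0 : ℝ)).indicator ρ with hw
  have mw : Measurable w := by
    have := hρc.continuousOn.measurable_piecewise
      (g := 0) continuousOn_const measurableSet_Ioi
    rwa [Set.piecewise_eq_indicator] at this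
  have hw0 : ∀ x, 0 ≤ w x := Set.indicator_nonneg fun x hx => h0 x hx
  have hν' : ν = (volume.restrict (Set.Ioi (0 : ℝ))).withDensity
      fun x => ENNReal.ofReal (w x) := by
    rw [hν]
    refine withDensity_congr_ae ?_
    filter_upwards [ae_restrict_mem measurableSet_Ioi] with x hx
    rw [hw, Set.indicator_of_mem hx]
  have hrestr : ν.restrict (Set.Ioi 0) = ν := by
    rw [hν', restrict_withDensity measurableSet_Ioi, Measure.restrict_restrict measurableSet_Ioi,
      Set.inter_self]
  refine ⟨w, ?_, fun g => ?_⟩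
  · have : Integrable (fun _ => (1 : ℝ)) ν := integrable_const _
    rw [hν', integrable_withDensity_ofReal mw (Eventually.of_forall hw0)] at this
    simpa [IntegrableOn] using this
  · rw [hrestr]
    conv_lhs => rw [hν']
    exact integral_withDensity_ofReal mw (Eventually.of_forall hw0) g

section Generator

variable {ν : Measure ℝ} {ρ : ℝ → ℝ}

theorem IsJumpDensity.laplaceIntegrable (h : IsJumpDensity ν ρ) {θ : ℝ} (hθ : 0 ≤ θ) :
    LaplaceIntegrable ρ θ := by
  have : LaplaceIntegrable ρ 0 := by
    have := h.integrable
    simpa [LaplaceIntegrable] using this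
  exact this.mono hθ

theorem IsJumpDensity.halfConv_eq (h : IsJumpDensity ν ρ) (f : ℝ → ℝ) {x : ℝ} (hx : 0 ≤ x) :
    ∫ z in Set.Ioi (0 : ℝ), (Set.Ici 0).indicator f (x - z) ∂ν = halfConv ρ f x := by
  rw [h.integral_eq, halfConv, intervalIntegral.integral_of_le hx, ← Set.Ioi_inter_Iic,
    ← setIntegral_indicator measurableSet_Iic]
  refine setIntegral_congr_fun measurableSet_Ioi fun z _ => ?_
  by_cases hz : z ≤ x
  · simp only [Set.indicator_of_mem (Set.mem_Iic.2 hz),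
      Set.indicator_of_mem (Set.mem_Ici.2 (sub_nonneg.2 hz))]
  · have h1 : z ∉ Set.Iic x := fun h' => hz h'
    have h2 : x - z ∉ Set.Ici (0 : ℝ) := fun h' => hz (sub_nonneg.1 (Set.mem_Ici.1 h'))
    simp only [Set.indicator_of_notMem h1, Set.indicator_of_notMem h2, mul_zero]

theorem IsJumpDensity.laplaceExponent_eq [IsFiniteMeasure ν] (h : IsJumpDensity ν ρ) {γ σ θ : ℝ}
    (hθ : 0 ≤ θ) : laplaceExponent γ σ ν θ = (γ + ∫ z in Set.Ioo (0 : ℝ) 1, z ∂ν) * θ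
      + σ ^ 2 / 2 * θ ^ 2 - ν.real (Set.Ioi 0) + laplaceTransform ρ θ := by
  have hi : IntegrableOn (fun z => Real.exp (-θ * z)) (Set.Ioi 0) ν := by
    refine Integrable.of_bound (C := 1) (by fun_prop : Continuous _).aestronglyMeasurable ?_
    filter_upwards [ae_restrict_mem measurableSet_Ioi] with z hz
    have hz' : (0 : ℝ) < z := hz
    rw [Real.norm_eq_abs, Real.abs_exp]
    exact Real.exp_le_one_iff.2 (by nlinarith)
  rw [_root_.laplaceExponent_eq θ hθ, integral_sub (integrable_const _) hi, h.integral_eq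
    (fun z => Real.exp (-θ * z)), laplaceTransform]
  simp_rw [mul_comm (ρ _)]
  simp
  ring

/-- A function whose Laplace transform solves the transformed equation solves the
integro-differential equation `c f' + σ²/2 f'' - (λ + q) f + ρ * f = g` on the half line. -/
theorem IsJumpDensity.generator_eq [IsFiniteMeasure ν] (h : IsJumpDensity ν ρ)
    {γ σ q θ₀ : ℝ} {f f' f'' g : ℝ → ℝ} (hθ₀ : 0 < θ₀)
    (hf : ContinuousOn f (Set.Ici 0)) (hf' : ContinuousOn f' (Set.Ici 0))
    (hf'' : ContinuousOn f'' (Set.Ici 0)) (hg : ContinuousOn g (Set.Ici 0))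
    (hd : ∀ x > 0, HasDerivAt f (f' x) x) (hd' : ∀ x > 0, HasDerivAt f' (f'' x) x)
    (i0 : LaplaceIntegrable f θ₀) (i1 : LaplaceIntegrable f' θ₀) (i2 : LaplaceIntegrable f'' θ₀)
    (ig : LaplaceIntegrable g θ₀)
    (hL : ∀ θ > θ₀, (laplaceExponent γ σ ν θ - q) * laplaceTransform f θ
      = (γ + ∫ z in Set.Ioo (0 : ℝ) 1, z ∂ν) * f 0 + σ ^ 2 / 2 * (θ * f 0 + f' 0)
        + laplaceTransform g θ) {x : ℝ} (hx : 0 < x) :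
    (γ + ∫ z in Set.Ioo (0 : ℝ) 1, z ∂ν) * f' x + σ ^ 2 / 2 * f'' x
      - (ν.real (Set.Ioi 0) + q) * f x + halfConv ρ f x = g x := by
  have iρ : LaplaceIntegrable ρ θ₀ := h.laplaceIntegrable hθ₀.le
  set c := γ + ∫ z in Set.Ioo (0 : ℝ) 1, z ∂ν with hc
  have hcρ := continuousOn_halfConv (fun x => iρ.integrableOn_Ioc x) hf
  have key : Set.EqOn (fun x => c * f' x + (σ ^ 2 / 2 * f'' x
      + (-(ν.real (Set.Ioi 0) + q) * f x + halfConv ρ f x))) g (Set.Ioi 0) := by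
    refine eqOn_of_laplaceTransform_eq (θ₀ := θ₀) ?_ (hg.mono Set.Ioi_subset_Ici_self)
      ((i1.const_mul _).add ((i2.const_mul _).add ((i0.const_mul _).add (iρ.halfConv i0)))) ig ?_
    · exact ((continuousOn_const.mul hf').add ((continuousOn_const.mul hf'').add
        ((continuousOn_const.mul hf).add hcρ))).mono Set.Ioi_subset_Ici_self
    · intro θ hθ
      have j0 := i0.mono hθ.le
      have j1 := i1.mono hθ.le
      have j2 := i2.mono hθ.le
      have jρ := iρ.mono hθ.le
      rw [laplaceTransform_add (j1.const_mul _)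
          ((j2.const_mul _).add ((j0.const_mul _).add (jρ.halfConv j0))),
        laplaceTransform_add (j2.const_mul _) ((j0.const_mul _).add (jρ.halfConv j0)),
        laplaceTransform_add (j0.const_mul _) (jρ.halfConv j0), laplaceTransform_halfConv jρ j0,
        laplaceTransform_const_mul, laplaceTransform_const_mul, laplaceTransform_const_mul,
        laplaceTransform_deriv (hf' 0 Set.self_mem_Ici) hd' j1 j2,
        laplaceTransform_deriv (hf 0 Set.self_mem_Ici) hd j0 j1]
      -- The values `f 0` and `f' 0` produced by transforming the derivatives are the boundary terms
      -- appearing in `hL`.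
      have e := hL θ hθ
      rw [h.laplaceExponent_eq (hθ₀.trans hθ).le] at e
      linear_combination e
  have := key hx
  simp only at this
  linarith

end Generator

theorem laplaceExponent_sub {γ σ δ : ℝ} {ν : Measure ℝ} (θ : ℝ) :
    laplaceExponent (γ - δ) σ ν θ = laplaceExponent γ σ ν θ - δ * θ := by
  unfold laplaceExponent
  ring

/-- The `k`-th derivative of `S σ²/2 W' + A W`. -/
def baseValue (S σ A Φ : ℝ) (ζ : Measure ℝ) (k : ℕ) (x : ℝ) : ℝ :=
  S * (σ ^ 2 / 2) * expMix Φ ζ (k + 1) x + A * expMix Φ ζ k x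

section BaseValue

variable {γ σ : ℝ} {ν : Measure ℝ} {q Φ : ℝ} {ζ : Measure ℝ} {S A : ℝ}

theorem continuousOn_baseValue (R : ScaleRepr γ σ ν q Φ ζ) {k : ℕ} (hk : k ≤ 2) :
    ContinuousOn (baseValue S σ A Φ ζ k) (Set.Ici 0) :=
  (continuousOn_const.mul (R.continuousOn_expMix (by omega))).add
    (continuousOn_const.mul (R.continuousOn_expMix (by omega)))

theorem hasDerivAt_baseValue (R : ScaleRepr γ σ ν q Φ ζ) {k : ℕ} (hk : k ≤ 1) {x : ℝ}
    (hx : 0 < x) : HasDerivAt (baseValue S σ A Φ ζ k) (baseValue S σ A Φ ζ (k + 1) x) x :=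
  ((R.hasDerivAt_expMix (by omega) hx).const_mul _).add
    ((R.hasDerivAt_expMix (by omega) hx).const_mul _)

theorem abs_baseValue_le (R : ScaleRepr γ σ ν q Φ ζ) {k : ℕ} (hk : k ≤ 2) :
    ∃ C, ∀ x ≥ 0, |baseValue S σ A Φ ζ k x| ≤ C * Real.exp (Φ * x) := by
  obtain ⟨C₁, h₁⟩ := R.abs_expMix_le (k := k + 1) (by omega)
  obtain ⟨C₂, h₂⟩ := R.abs_expMix_le (k := k) (by omega)
  refine ⟨|S * (σ ^ 2 / 2)| * C₁ + |A| * C₂, fun x hx => (abs_add_le _ _).trans ?_⟩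
  rw [abs_mul (S * (σ ^ 2 / 2)), abs_mul A, add_mul, mul_assoc _ C₁, mul_assoc _ C₂]
  exact add_le_add (mul_le_mul_of_nonneg_left (h₁ x hx) (abs_nonneg _))
    (mul_le_mul_of_nonneg_left (h₂ x hx) (abs_nonneg _))

theorem laplaceIntegrable_baseValue (R : ScaleRepr γ σ ν q Φ ζ) {k : ℕ} (hk : k ≤ 2) {θ : ℝ}
    (hθ : Φ < θ) : LaplaceIntegrable (baseValue S σ A Φ ζ k) θ :=
  ((R.laplaceIntegrable_expMix (by omega) hθ).const_mul _).add
    ((R.laplaceIntegrable_expMix (by omega) hθ).const_mul _)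

theorem baseValue_zero_zero (R : ScaleRepr γ σ ν q Φ ζ) (hσ : 0 < σ) :
    baseValue S σ A Φ ζ 0 0 = S := by
  rw [baseValue, R.expMix_zero_zero, R.expMix_one_zero]
  field_simp
  simp

theorem laplaceTransform_baseValue_zero (R : ScaleRepr γ σ ν q Φ ζ) {θ : ℝ} (hθ : Φ < θ) :
    laplaceTransform (baseValue S σ A Φ ζ 0) θ
      = (S * (σ ^ 2 / 2) * θ + A) / (laplaceExponent γ σ ν θ - q) := by
  unfold baseValue
  rw [laplaceTransform_add ((R.laplaceIntegrable_expMix (by omega) hθ).const_mul _)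
    ((R.laplaceIntegrable_expMix (by omega) hθ).const_mul _), laplaceTransform_const_mul,
    laplaceTransform_const_mul, R.laplaceTransform_expMix_zero hθ, R.laplaceTransform_expMix_one hθ]
  ring

theorem laplaceTransform_baseValue_one (R : ScaleRepr γ σ ν q Φ ζ) (hσ : 0 < σ) {θ : ℝ}
    (hθ : Φ < θ) : laplaceTransform (baseValue S σ A Φ ζ 1) θ
      = θ * (S * (σ ^ 2 / 2) * θ + A) / (laplaceExponent γ σ ν θ - q) - S := by
  rw [laplaceTransform_deriv (continuousOn_baseValue R (by omega) 0 Set.self_mem_Ici)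
    (fun x hx => hasDerivAt_baseValue R (k := 0) (by omega) hx)
    (laplaceIntegrable_baseValue R (by omega) hθ) (laplaceIntegrable_baseValue R (by omega) hθ),
    laplaceTransform_baseValue_zero R hθ, baseValue_zero_zero R hσ]
  ring

/-- The transform is `(Sσ²/2 · θ + A)/(ψ - q)`; multiplied by `ψ - q` it becomes affine in `θ`, and
the boundary values of `W'` and `W''` at `0` match that polynomial exactly, for every `A`. -/
theorem baseValue_equation [IsFiniteMeasure ν] {ρ : ℝ → ℝ} (hρ : IsJumpDensity ν ρ)
    (R : ScaleRepr γ σ ν q Φ ζ) (hσ : 0 < σ) {x : ℝ} (hx : 0 < x) :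
    (γ + ∫ z in Set.Ioo (0 : ℝ) 1, z ∂ν) * baseValue S σ A Φ ζ 1 x
      + σ ^ 2 / 2 * baseValue S σ A Φ ζ 2 x
      - (ν.real (Set.Ioi 0) + q) * baseValue S σ A Φ ζ 0 x
      + halfConv ρ (baseValue S σ A Φ ζ 0) x = 0 := by
  have hΦ : Φ < Φ + 1 := lt_add_one Φ
  refine hρ.generator_eq (g := fun _ => 0) (θ₀ := Φ + 1) (by linarith [R.φ_pos])
    (continuousOn_baseValue R (by omega)) (continuousOn_baseValue R (by omega))
    (continuousOn_baseValue R (by omega)) continuousOn_const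
    (fun x hx => hasDerivAt_baseValue R (by omega) hx)
    (fun x hx => hasDerivAt_baseValue R (by omega) hx)
    (laplaceIntegrable_baseValue R (by omega) hΦ) (laplaceIntegrable_baseValue R (by omega) hΦ)
    (laplaceIntegrable_baseValue R (by omega) hΦ)
    (laplaceIntegrable_const (by linarith [R.φ_pos]) 0) ?_ hx
  intro θ hθ
  have hθ' : Φ < θ := hΦ.trans hθ
  have hne : laplaceExponent γ σ ν θ - q ≠ 0 := (sub_pos.2 (R.lt_laplaceExponent θ hθ')).ne'
  rw [laplaceTransform_baseValue_zero R hθ', mul_div_cancel₀ _ hne, baseValue_zero_zero R hσ,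
    laplaceTransform_const (R.φ_pos.trans hθ')]
  simp only [baseValue]
  rw [R.expMix_one_zero, R.expMix_two_zero]
  field_simp
  ring

end BaseValue

/-! ### The candidate value function and its equation. -/

/-- The data describing the candidate value function with a smooth fit at the level `b`. -/
structure SmoothFit (γ σ : ℝ) (ν : Measure ℝ) (q δ S A b Φ φ : ℝ) (ζ ξ : Measure ℝ) : Prop where
  reprX : ScaleRepr γ σ ν q Φ ζ
  reprY : ScaleRepr (γ - δ) σ ν q φ ξ
  σ_pos : 0 < σ
  δ_pos : 0 < δ
  b_pos : 0 < b
  lt : Φ < φ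
  fit : baseValue S σ A Φ ζ 1 b = 1
  root : laplaceExponent γ σ ν φ = q + δ * φ
  tail : ∫ y in Set.Ioi b, Real.exp (-φ * y) * (1 - baseValue S σ A Φ ζ 1 y) = 0

/-- The function `δ · (W_Y * r)` and its first two derivatives. -/
def correction (δ σ φ : ℝ) (ξ : Measure ℝ) (r : ℝ → ℝ) : ℕ → ℝ → ℝ
  | 0, y => δ * halfConv (expMix φ ξ 0) r y
  | 1, y => δ * halfConv (expMix φ ξ 1) r y
  -- The boundary term carries the initial slope `2/σ²` of the scale function; at order one there is
  -- none because the scale function vanishes at `0`.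
  | _, y => δ * (2 / σ ^ 2 * r y + halfConv (expMix φ ξ 2) r y)

/-- The candidate value function of the threshold strategy and its first two derivatives. -/
def thresholdValue (S σ A δ b Φ φ : ℝ) (ζ ξ : Measure ℝ) (k : ℕ) (x : ℝ) : ℝ :=
  baseValue S σ A Φ ζ k x
    + correction δ σ φ ξ (fun y => baseValue S σ A Φ ζ 1 (b + y) - 1) k (max (x - b) 0)

/-- The kernel in the representation of the derivative above the threshold. -/
def thresholdKernel (S σ A δ b Φ : ℝ) (ζ : Measure ℝ) (z : ℝ) : ℝ :=
  -S * (σ ^ 2 / 2) * (z ^ 2 + δ * (2 / σ ^ 2) * z) + δ * Real.exp (b * z) + A * z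
    - δ * z * ∫ y in (0 : ℝ)..b, Real.exp (z * y) * baseValue S σ A Φ ζ 1 y

namespace SmoothFit

variable {γ σ : ℝ} {ν : Measure ℝ} {q δ S A b Φ φ : ℝ} {ζ ξ : Measure ℝ}

local notation "v₀" => baseValue S σ A Φ ζ
local notation "r₀" => fun y : ℝ => baseValue S σ A Φ ζ 1 (b + y) - 1
local notation "u₀" => correction δ σ φ ξ (fun y => baseValue S σ A Φ ζ 1 (b + y) - 1)
local notation "v₁" => thresholdValue S σ A δ b Φ φ ζ ξ

theorem continuousOn_excess (H : SmoothFit γ σ ν q δ S A b Φ φ ζ ξ) :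
    ContinuousOn r₀ (Set.Ici 0) := by
  refine ContinuousOn.sub ?_ continuousOn_const
  refine (continuousOn_baseValue H.reprX (by omega)).comp (by fun_prop) fun y hy => ?_
  exact Set.mem_Ici.2 (add_nonneg H.b_pos.le hy)

theorem laplaceIntegrable_excess (H : SmoothFit γ σ ν q δ S A b Φ φ ζ ξ) {θ : ℝ} (hθ : Φ < θ) :
    LaplaceIntegrable r₀ θ := by
  obtain ⟨C, hC⟩ := abs_baseValue_le (S := S) (A := A) H.reprX (k := 1) (by omega)
  refine LaplaceIntegrable.of_exp_bound (C := C * Real.exp (Φ * b) + 1) (K := Φ)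
    H.continuousOn_excess (fun x hx => ?_) hθ
  refine (abs_sub _ _).trans ?_
  have h1 := hC (b + x) (add_nonneg H.b_pos.le hx)
  have h2 : 1 ≤ Real.exp (Φ * x) := Real.one_le_exp (mul_nonneg H.reprX.φ_pos.le hx)
  rw [mul_add, Real.exp_add] at h1
  rw [abs_one, add_mul, one_mul, mul_assoc]
  exact add_le_add h1 h2

theorem continuousOn_correction (H : SmoothFit γ σ ν q δ S A b Φ φ ζ ξ) {k : ℕ} (hk : k ≤ 2) :
    ContinuousOn (u₀ k) (Set.Ici 0) := by
  have h : ∀ j ≤ 3, ContinuousOn (halfConv (expMix φ ξ j) r₀) (Set.Ici 0) := fun j hj =>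
    continuousOn_halfConv (fun x => (H.reprY.laplaceIntegrable_expMix hj
      (lt_add_one φ)).integrableOn_Ioc x) H.continuousOn_excess
  interval_cases k
  · exact continuousOn_const.mul (h 0 (by omega))
  · exact continuousOn_const.mul (h 1 (by omega))
  · exact continuousOn_const.mul ((continuousOn_const.mul H.continuousOn_excess).add
      (h 2 (by omega)))

theorem hasDerivAt_correction (H : SmoothFit γ σ ν q δ S A b Φ φ ζ ξ) {k : ℕ} (hk : k ≤ 1) {y : ℝ}
    (hy : 0 < y) : HasDerivAt (u₀ k) (u₀ (k + 1) y) y := by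
  have hr := H.continuousOn_excess
  have hlt : φ < φ + 1 := lt_add_one φ
  have h : ∀ j ≤ 2, HasDerivAt (halfConv (expMix φ ξ j) r₀)
      (expMix φ ξ j 0 * r₀ y + halfConv (expMix φ ξ (j + 1)) r₀ y) y := fun j hj =>
    hasDerivAt_halfConv (H.reprY.continuousOn_expMix (by omega))
      (fun x hx => H.reprY.hasDerivAt_expMix hj hx) hr
      (H.reprY.laplaceIntegrable_expMix (by omega) hlt)
      (H.reprY.laplaceIntegrable_expMix (by omega) hlt)
      (H.laplaceIntegrable_excess (H.lt.trans hlt)) hy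
  interval_cases k
  · refine ((h 0 (by omega)).const_mul δ).congr_deriv ?_
    rw [H.reprY.expMix_zero_zero]
    simp [correction]
  · refine ((h 1 (by omega)).const_mul δ).congr_deriv ?_
    rw [H.reprY.expMix_one_zero]
    simp [correction]

/-- Orders zero and one are empty convolutions. At order two the term `r 0 = v₀'(b) - 1` is killed
by the smooth fit: this is what makes the candidate twice continuously differentiable across `b`. -/
theorem correction_zero (H : SmoothFit γ σ ν q δ S A b Φ φ ζ ξ) {k : ℕ} (hk : k ≤ 2) :
    u₀ k 0 = 0 := by
  have := H.fit
  interval_cases k <;> simp [correction, halfConv_zero_right, this]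

theorem continuousOn_thresholdValue (H : SmoothFit γ σ ν q δ S A b Φ φ ζ ξ) {k : ℕ} (hk : k ≤ 2) :
    ContinuousOn (v₁ k) (Set.Ici 0) := by
  refine (continuousOn_baseValue H.reprX hk).add ?_
  exact ((continuous_comp_max (H.continuousOn_correction hk)).comp
    (continuous_id.sub continuous_const)).continuousOn

theorem hasDerivAt_thresholdValue (H : SmoothFit γ σ ν q δ S A b Φ φ ζ ξ) {k : ℕ} (hk : k ≤ 1)
    {x : ℝ} (hx : 0 < x) : HasDerivAt (v₁ k) (v₁ (k + 1) x) x := by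
  refine (hasDerivAt_baseValue H.reprX hk hx).add ?_
  have h := hasDerivAt_comp_max (H.continuousOn_correction (k := k) (by omega))
    (fun y hy => H.hasDerivAt_correction hk hy) (H.continuousOn_correction (k := k + 1) (by omega))
    (H.correction_zero (by omega)) (x - b)
  exact h.comp_sub_const x b

theorem thresholdValue_of_le (H : SmoothFit γ σ ν q δ S A b Φ φ ζ ξ) {k : ℕ} (hk : k ≤ 2) {x : ℝ}
    (hx : x ≤ b) : v₁ k x = v₀ k x := by
  rw [thresholdValue, max_eq_right (by linarith), H.correction_zero hk, add_zero]

theorem thresholdValue_zero_zero (H : SmoothFit γ σ ν q δ S A b Φ φ ζ ξ) : v₁ 0 0 = S := by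
  rw [H.thresholdValue_of_le (by omega) H.b_pos.le, baseValue_zero_zero H.reprX H.σ_pos]

/-- Convolution with the scale function of `Y` divides the transform by `ψ_Y - q`, and all boundary
values vanish. The equation is therefore that of `Y`, with drift reduced by `δ` and source `δ r`. -/
theorem correction_equation [IsFiniteMeasure ν] {ρ : ℝ → ℝ} (hρ : IsJumpDensity ν ρ)
    (H : SmoothFit γ σ ν q δ S A b Φ φ ζ ξ) {y : ℝ} (hy : 0 < y) :
    (γ - δ + ∫ z in Set.Ioo (0 : ℝ) 1, z ∂ν) * u₀ 1 y + σ ^ 2 / 2 * u₀ 2 y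
      - (ν.real (Set.Ioi 0) + q) * u₀ 0 y + halfConv ρ (u₀ 0) y = δ * r₀ y := by
  have hlt : φ < φ + 1 := lt_add_one φ
  have hr : ∀ θ > φ, LaplaceIntegrable r₀ θ := fun θ hθ =>
    H.laplaceIntegrable_excess (H.lt.trans hθ)
  have hu : ∀ k ≤ 2, ∀ θ > φ, LaplaceIntegrable (u₀ k) θ := by
    intro k hk θ hθ
    have h : ∀ j ≤ 3, LaplaceIntegrable (halfConv (expMix φ ξ j) r₀) θ := fun j hj =>
      (H.reprY.laplaceIntegrable_expMix hj hθ).halfConv (hr θ hθ)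
    interval_cases k
    · exact (h 0 (by omega)).const_mul δ
    · exact (h 1 (by omega)).const_mul δ
    · exact (((hr θ hθ).const_mul _).add (h 2 (by omega))).const_mul δ
  refine hρ.generator_eq (θ₀ := φ + 1) (g := fun y => δ * r₀ y) (by linarith [H.reprY.φ_pos])
    (H.continuousOn_correction (by omega)) (H.continuousOn_correction (by omega))
    (H.continuousOn_correction (by omega)) (continuousOn_const.mul H.continuousOn_excess)
    (fun x hx => H.hasDerivAt_correction (by omega) hx)
    (fun x hx => H.hasDerivAt_correction (by omega) hx)
    (hu _ (by omega) _ hlt) (hu _ (by omega) _ hlt) (hu _ (by omega) _ hlt)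
    ((hr _ hlt).const_mul δ) ?_ hy
  intro θ hθ
  have hθ' : φ < θ := hlt.trans hθ
  have hne : laplaceExponent (γ - δ) σ ν θ - q ≠ 0 :=
    (sub_pos.2 (H.reprY.lt_laplaceExponent θ hθ')).ne'
  have e : laplaceTransform (u₀ 0) θ = δ * (1 / (laplaceExponent (γ - δ) σ ν θ - q)
      * laplaceTransform r₀ θ) := by
    rw [← H.reprY.laplaceTransform_expMix_zero hθ', ← laplaceTransform_halfConv
      (H.reprY.laplaceIntegrable_expMix (by omega) hθ') (hr θ hθ'), ← laplaceTransform_const_mul]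
    rfl
  rw [e, H.correction_zero (by omega), H.correction_zero (by omega), laplaceTransform_const_mul]
  field_simp
  ring

/-- The integro-differential equation of the threshold strategy. -/
theorem thresholdValue_equation [IsFiniteMeasure ν] {ρ : ℝ → ℝ} (hρ : IsJumpDensity ν ρ)
    (H : SmoothFit γ σ ν q δ S A b Φ φ ζ ξ) {x : ℝ} (hx : 0 < x) :
    (γ + ∫ z in Set.Ioo (0 : ℝ) 1, z ∂ν) * v₁ 1 x + σ ^ 2 / 2 * v₁ 2 x
      - (ν.real (Set.Ioi 0) + q) * v₁ 0 x
      + ∫ z in Set.Ioi (0 : ℝ), (Set.Ici 0).indicator (v₁ 0) (x - z) ∂ν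
      = (if b < x then δ else 0) * (v₁ 1 x - 1) := by
  have hbase := baseValue_equation (S := S) (A := A) hρ H.reprX H.σ_pos hx
  rw [hρ.halfConv_eq _ hx.le]
  rcases le_or_gt x b with h | h
  · rw [if_neg (not_lt.2 h), zero_mul, H.thresholdValue_of_le (by omega) h,
      H.thresholdValue_of_le (by omega) h, H.thresholdValue_of_le (by omega) h]
    have e : halfConv ρ (v₁ 0) x = halfConv ρ (v₀ 0) x := by
      refine intervalIntegral.integral_congr (μ := volume) fun t ht => ?_
      rw [Set.uIcc_of_le hx.le] at ht
      simp only [H.thresholdValue_of_le (k := 0) (by omega) (show x - t ≤ b by linarith [ht.1])]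
    rw [e, hbase]
  · have hy : 0 < x - b := sub_pos.2 h
    have hcor := H.correction_equation hρ hy
    -- The correction is zero below `b`, so only jumps of size up to `x - b` see it and its
    -- convolution shortens.
    have hconv : halfConv ρ (v₁ 0) x = halfConv ρ (v₀ 0) x + halfConv ρ (u₀ 0) (x - b) := by
      have hρi : IntervalIntegrable ρ volume 0 x := by
        rw [intervalIntegrable_iff_integrableOn_Ioc_of_le hx.le]
        exact hρ.integrable.mono_set Set.Ioc_subset_Ioi_self
      have hc0 : ContinuousOn (fun t => v₀ 0 (x - t)) (Set.uIcc 0 x) := by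
        refine (continuousOn_baseValue H.reprX (by omega)).comp (by fun_prop) fun t ht => ?_
        rw [Set.uIcc_of_le hx.le] at ht
        exact Set.mem_Ici.2 (sub_nonneg.2 ht.2)
      have hc1 : Continuous fun t => u₀ 0 (max (x - t - b) 0) :=
        (continuous_comp_max (H.continuousOn_correction (k := 0) (by omega))).comp
          ((continuous_const.sub continuous_id).sub continuous_const)
      have i0 := hρi.mul_continuousOn hc0
      have i1 := hρi.mul_continuousOn (hc1.continuousOn (s := Set.uIcc 0 x))
      have e1 : halfConv ρ (v₁ 0) x = (∫ t in (0 : ℝ)..x, ρ t * v₀ 0 (x - t))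
          + ∫ t in (0 : ℝ)..x, ρ t * u₀ 0 (max (x - t - b) 0) := by
        rw [← intervalIntegral.integral_add i0 i1]
        simp only [halfConv, thresholdValue, mul_add]
      rw [e1]
      congr 1
      have hsub : Set.uIcc 0 (x - b) ⊆ Set.uIcc 0 x := by
        rw [Set.uIcc_of_le hx.le, Set.uIcc_of_le hy.le]
        exact Set.Icc_subset_Icc_right (by linarith [H.b_pos])
      have hsub' : Set.uIcc (x - b) x ⊆ Set.uIcc 0 x := by
        rw [Set.uIcc_of_le hx.le, Set.uIcc_of_le (by linarith [H.b_pos])]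
        exact Set.Icc_subset_Icc_left hy.le
      rw [← intervalIntegral.integral_add_adjacent_intervals (i1.mono_set hsub)
        (i1.mono_set hsub')]
      have z2 : ∫ t in (x - b)..x, ρ t * u₀ 0 (max (x - t - b) 0) = 0 := by
        refine (intervalIntegral.integral_congr (g := fun _ => 0) fun t ht => ?_).trans
          intervalIntegral.integral_zero
        rw [Set.uIcc_of_le (by linarith [H.b_pos])] at ht
        have : max (x - t - b) 0 = 0 := max_eq_right (by linarith [ht.1])
        simp only [this, H.correction_zero (k := 0) (by omega), mul_zero]
      rw [z2, add_zero]
      refine intervalIntegral.integral_congr fun t ht => ?_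
      rw [Set.uIcc_of_le hy.le] at ht
      have : max (x - t - b) 0 = x - b - t := by
        rw [max_eq_left (by linarith [ht.2])]; ring
      simp only [this]
    have hm : max (x - b) 0 = x - b := max_eq_left hy.le
    rw [hconv, if_pos h]
    simp only [thresholdValue, hm]
    simp only [add_sub_cancel] at hcor
    -- Adding the equation of `X` for `v₀` to that of `Y` for the correction `u`: the drift
    -- difference `δ u'` and the source `δ (v₀' - 1)` combine into `δ (v' - 1)`.
    linear_combination hbase + hcor

end SmoothFit

/-! ### Laplace representation above the threshold and boundedness. -/

/-- Differentiation of the Laplace integral of a kernel of exponential order `b`. -/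
theorem hasDerivAt_integral_exp_mul {ξ : Measure ℝ} {h : ℝ → ℝ} {b : ℝ} (hξ : ∀ᵐ z ∂ξ, 0 < z)
    (hm : AEStronglyMeasurable h ξ) (h0 : Integrable (fun z => Real.exp (-b * z) * h z) ξ)
    (h1 : Integrable (fun z => Real.exp (-b * z) * (z * h z)) ξ) {x : ℝ} (hx : b < x) :
    HasDerivAt (fun x => ∫ z, Real.exp (-x * z) * h z ∂ξ)
      (∫ z, Real.exp (-x * z) * (-(z * h z)) ∂ξ) x := by
  have hm' : ∀ y, AEStronglyMeasurable (fun z => Real.exp (-y * z) * h z) ξ := fun y =>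
    (by fun_prop : Continuous fun z => Real.exp (-y * z)).aestronglyMeasurable.mul hm
  have hexp : ∀ y ≥ b, ∀ z > 0, Real.exp (-y * z) ≤ Real.exp (-b * z) := fun y hy z hz =>
    Real.exp_le_exp.2 (by nlinarith)
  refine (hasDerivAt_integral_of_dominated_loc_of_deriv_le (μ := ξ) (𝕜 := ℝ)
    (F := fun x z => Real.exp (-x * z) * h z)
    (F' := fun x z => Real.exp (-x * z) * (-(z * h z))) (x₀ := x)
    (bound := fun z => ‖Real.exp (-b * z) * (z * h z)‖) (s := Set.Ioi b) (Ioi_mem_nhds hx)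
    (Eventually.of_forall hm') ?_ ?_ ?_ h1.norm ?_).2
  · refine h0.mono (hm' x) ?_
    filter_upwards [hξ] with z hz
    rw [norm_mul, norm_mul, Real.norm_eq_abs, Real.norm_eq_abs (Real.exp _), Real.abs_exp,
      Real.abs_exp]
    exact mul_le_mul_of_nonneg_right (hexp x hx.le z hz) (norm_nonneg _)
  · exact (by fun_prop : Continuous fun z => Real.exp (-x * z)).aestronglyMeasurable.mul
      (aestronglyMeasurable_id.mul hm).neg
  · filter_upwards [hξ] with z hz y hy
    rw [norm_mul, norm_mul, norm_neg, Real.norm_eq_abs, Real.norm_eq_abs (Real.exp _), Real.abs_exp,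
      Real.abs_exp]
    exact mul_le_mul_of_nonneg_right (hexp y (le_of_lt hy) z hz) (norm_nonneg _)
  · refine Eventually.of_forall fun z y _ => ?_
    have := (((hasDerivAt_neg y).mul_const z).exp).mul_const (h z)
    exact this.congr_deriv (by ring)

theorem abs_integral_exp_mul_le {ξ : Measure ℝ} {h : ℝ → ℝ} {b : ℝ} (hξ : ∀ᵐ z ∂ξ, 0 < z)
    (h0 : Integrable (fun z => Real.exp (-b * z) * h z) ξ) {x : ℝ} (hx : b ≤ x) :
    |∫ z, Real.exp (-x * z) * h z ∂ξ| ≤ ∫ z, ‖Real.exp (-b * z) * h z‖ ∂ξ := by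
  rw [← Real.norm_eq_abs]
  refine norm_integral_le_of_norm_le h0.norm ?_
  filter_upwards [hξ] with z hz
  rw [norm_mul, norm_mul, Real.norm_eq_abs, Real.norm_eq_abs (Real.exp _), Real.abs_exp,
    Real.abs_exp]
  exact mul_le_mul_of_nonneg_right (Real.exp_le_exp.2 (by nlinarith)) (norm_nonneg _)

namespace SmoothFit

variable {γ σ : ℝ} {ν : Measure ℝ} {q δ S A b Φ φ : ℝ} {ζ ξ : Measure ℝ}

local notation "v₀" => baseValue S σ A Φ ζ
local notation "v₁" => thresholdValue S σ A δ b Φ φ ζ ξ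
local notation "K₀" => thresholdKernel S σ A δ b Φ ζ

/-- On the transform side this is `δθ/((ψ_X - q)(ψ_Y - q)) = 1/(ψ_Y - q) - 1/(ψ_X - q)`, since `ψ_X
- ψ_Y = δθ`. The constants cancel because the initial slope of the scale function is `2/σ²`. -/
theorem δ_mul_halfConv (H : SmoothFit γ σ ν q δ S A b Φ φ ζ ξ) {x : ℝ} (hx : 0 < x) :
    δ * halfConv (expMix φ ξ 1) (v₀ 1) x = S * (σ ^ 2 / 2) * expMix φ ξ 2 x
      + ((A - S * δ) * expMix φ ξ 1 x + (-1) * v₀ 1 x) := by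
  have hlt : φ < φ + 1 := lt_add_one φ
  have iy : ∀ k ≤ 3, ∀ θ > φ, LaplaceIntegrable (expMix φ ξ k) θ := fun k hk θ hθ =>
    H.reprY.laplaceIntegrable_expMix hk hθ
  have iv : ∀ θ > φ, LaplaceIntegrable (v₀ 1) θ := fun θ hθ =>
    laplaceIntegrable_baseValue H.reprX (by omega) (H.lt.trans hθ)
  have cy : ∀ k ≤ 3, ContinuousOn (expMix φ ξ k) (Set.Ici 0) := fun k hk =>
    H.reprY.continuousOn_expMix hk
  have cv : ContinuousOn (v₀ 1) (Set.Ici 0) := continuousOn_baseValue H.reprX (by omega)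
  have key : Set.EqOn (fun x => δ * halfConv (expMix φ ξ 1) (v₀ 1) x)
      (fun x => S * (σ ^ 2 / 2) * expMix φ ξ 2 x
        + ((A - S * δ) * expMix φ ξ 1 x + (-1) * v₀ 1 x)) (Set.Ioi 0) := by
    refine eqOn_of_laplaceTransform_eq (θ₀ := φ + 1) ?_ ?_
      (((iy 1 (by omega) _ hlt).halfConv (iv _ hlt)).const_mul _)
      (((iy 2 (by omega) _ hlt).const_mul _).add (((iy 1 (by omega) _ hlt).const_mul _).add
        ((iv _ hlt).const_mul _))) ?_
    · exact (continuousOn_const.mul (continuousOn_halfConv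
        (fun x => (iy 1 (by omega) _ hlt).integrableOn_Ioc x) cv)).mono Set.Ioi_subset_Ici_self
    · exact ((continuousOn_const.mul (cy 2 (by omega))).add ((continuousOn_const.mul
        (cy 1 (by omega))).add (continuousOn_const.mul cv))).mono Set.Ioi_subset_Ici_self
    · intro θ hθ
      have hθ' : φ < θ := hlt.trans hθ
      rw [laplaceTransform_const_mul,
        laplaceTransform_halfConv (iy 1 (by omega) _ hθ') (iv _ hθ'),
        laplaceTransform_add ((iy 2 (by omega) _ hθ').const_mul _)
          (((iy 1 (by omega) _ hθ').const_mul _).add ((iv _ hθ').const_mul _)),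
        laplaceTransform_add ((iy 1 (by omega) _ hθ').const_mul _) ((iv _ hθ').const_mul _),
        laplaceTransform_const_mul, laplaceTransform_const_mul, laplaceTransform_const_mul,
        laplaceTransform_baseValue_one H.reprX H.σ_pos (H.lt.trans hθ'),
        H.reprY.laplaceTransform_expMix_one hθ', H.reprY.laplaceTransform_expMix_two hθ']
      have n1 : laplaceExponent γ σ ν θ - q ≠ 0 :=
        (sub_pos.2 (H.reprX.lt_laplaceExponent θ (H.lt.trans hθ'))).ne'
      have n2 : laplaceExponent (γ - δ) σ ν θ - q ≠ 0 :=
        (sub_pos.2 (H.reprY.lt_laplaceExponent θ hθ')).ne'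
      have n3 := H.σ_pos.ne'
      rw [laplaceExponent_sub] at *
      generalize laplaceExponent γ σ ν θ = ψ at *
      field_simp
      ring
  exact key hx

/-- The transform of `v₀'` at `φ` is known, as `φ > Φ` and `ψ_X(φ) - q = δφ`, and its part beyond
`b` is known from the tail condition; the part on `[0, b]` follows. Its value is the one that
cancels the growing exponential in `thresholdValue_one_eq`. -/
theorem integral_exp_mul_base (H : SmoothFit γ σ ν q δ S A b Φ φ ζ ξ) :
    ∫ y in (0 : ℝ)..b, Real.exp (-φ * y) * v₀ 1 y
      = (S * (σ ^ 2 / 2) * φ + A) / δ - S - Real.exp (-φ * b) / φ := by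
  have hφ := H.reprY.φ_pos
  have hL := laplaceTransform_baseValue_one (S := S) (A := A) H.reprX H.σ_pos H.lt
  have hi : LaplaceIntegrable (v₀ 1) φ := laplaceIntegrable_baseValue H.reprX (by omega) H.lt
  have hib : IntegrableOn (fun y => Real.exp (-φ * y) * v₀ 1 y) (Set.Ioi b) :=
    IntegrableOn.mono_set hi (Set.Ioi_subset_Ioi H.b_pos.le)
  have he : IntegrableOn (fun y => Real.exp (-φ * y)) (Set.Ioi b) := exp_neg_integrableOn_Ioi b hφ
  have ht := H.tail
  simp_rw [mul_sub, mul_one] at ht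
  rw [integral_sub he hib, integral_exp_mul_Ioi (by linarith)] at ht
  rw [laplaceTransform, ← Set.Ioc_union_Ioi_eq_Ioi H.b_pos.le,
    setIntegral_union (Set.Ioc_disjoint_Ioi le_rfl) measurableSet_Ioi
      (IntegrableOn.mono_set hi Set.Ioc_subset_Ioi_self) hib,
    ← intervalIntegral.integral_of_le H.b_pos.le, H.root] at hL
  have hδ := H.δ_pos
  have e1 : φ * (S * (σ ^ 2 / 2) * φ + A) / (q + δ * φ - q) = (S * (σ ^ 2 / 2) * φ + A) / δ := by
    field_simp
    ring
  rw [e1] at hL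
  have e2 : -Real.exp (-φ * b) / -φ = Real.exp (-φ * b) / φ := neg_div_neg_eq _ _
  linarith

theorem continuous_weight (H : SmoothFit γ σ ν q δ S A b Φ φ ζ ξ) :
    Continuous fun z => ∫ y in (0 : ℝ)..b, Real.exp (z * y) * v₀ 1 y := by
  have hc := continuous_comp_max (continuousOn_baseValue (S := S) (A := A) H.reprX (k := 1)
    (by omega))
  have e : (fun z => ∫ y in (0 : ℝ)..b, Real.exp (z * y) * v₀ 1 y)
      = fun z => ∫ y in (0 : ℝ)..b, Real.exp (z * y) * v₀ 1 (max y 0) := by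
    funext z
    refine intervalIntegral.integral_congr fun y hy => ?_
    rw [Set.uIcc_of_le H.b_pos.le] at hy
    simp only [max_eq_left hy.1]
  rw [e]
  refine intervalIntegral.continuous_parametric_intervalIntegral_of_continuous' ?_ 0 b
  exact (by fun_prop : Continuous fun p : ℝ × ℝ => Real.exp (p.1 * p.2)).mul
    (hc.comp continuous_snd)

/-- The order `e^{bz}` is exactly what the factor `e^{-xz}` absorbs for `x ≥ b`. -/
theorem abs_weight_le (H : SmoothFit γ σ ν q δ S A b Φ φ ζ ξ) :
    ∃ C ≥ 0, ∀ z > 0, |∫ y in (0 : ℝ)..b, Real.exp (z * y) * v₀ 1 y| ≤ C * Real.exp (b * z) := by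
  obtain ⟨C, hC⟩ := (isCompact_Icc (a := (0 : ℝ)) (b := b)).exists_bound_of_continuousOn
    ((continuousOn_baseValue (S := S) (A := A) H.reprX (k := 1) (by omega)).mono
      Set.Icc_subset_Ici_self)
  have hC0 : 0 ≤ C := (norm_nonneg _).trans (hC 0 ⟨le_rfl, H.b_pos.le⟩)
  refine ⟨C * b, mul_nonneg hC0 H.b_pos.le, fun z hz => ?_⟩
  have := intervalIntegral.norm_integral_le_of_norm_le_const (a := 0) (b := b)
    (f := fun y => Real.exp (z * y) * v₀ 1 y) (C := C * Real.exp (b * z)) fun y hy => by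
      rw [Set.uIoc_of_le H.b_pos.le] at hy
      rw [norm_mul, Real.norm_eq_abs, Real.abs_exp, mul_comm]
      exact mul_le_mul (hC y ⟨hy.1.le, hy.2⟩) (Real.exp_le_exp.2 (by nlinarith [hy.2]))
        (Real.exp_pos _).le hC0
  rw [sub_zero, abs_of_pos H.b_pos] at this
  rw [← Real.norm_eq_abs]
  linarith

theorem integrable_weight (H : SmoothFit γ σ ν q δ S A b Φ φ ζ ξ) {x : ℝ} (hx : b ≤ x) :
    Integrable (fun z => z * Real.exp (-x * z) * ∫ y in (0 : ℝ)..b, Real.exp (z * y) * v₀ 1 y) ξ := by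
  obtain ⟨C, hC0, hC⟩ := H.abs_weight_le
  have h1 : Integrable (fun z => z) ξ := by simpa using H.reprY.integrable_pow 1 (by omega)
  refine (h1.const_mul C).mono' ((by fun_prop : Continuous fun z : ℝ =>
    z * Real.exp (-x * z)).mul H.continuous_weight).aestronglyMeasurable ?_
  filter_upwards [H.reprY.ae_pos] with z hz
  rw [norm_mul, Real.norm_of_nonneg (by positivity), Real.norm_eq_abs]
  calc _ ≤ z * Real.exp (-x * z) * (C * Real.exp (b * z)) :=
        mul_le_mul_of_nonneg_left (hC z hz) (by positivity)
    _ = C * z * Real.exp ((b - x) * z) := by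
        rw [show (b - x) * z = -x * z + b * z by ring, Real.exp_add]; ring
    _ ≤ C * z * 1 := mul_le_mul_of_nonneg_left
        (Real.exp_le_one_iff.2 (mul_nonpos_of_nonpos_of_nonneg (by linarith) hz.le)) (by positivity)
    _ = C * z := mul_one _

/-- The derivative of the scale function of `Y` is a growing exponential plus a mixture of `z
e^{-xz}`; Fubini moves the integral over `[0, b]` inside the mixture. -/
theorem integral_expMix_mul_base (H : SmoothFit γ σ ν q δ S A b Φ φ ζ ξ) {x : ℝ} (hx : b ≤ x) :
    ∫ s in (0 : ℝ)..b, expMix φ ξ 1 (x - s) * v₀ 1 s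
      = ξ.real Set.univ * φ * Real.exp (φ * x) * (∫ s in (0 : ℝ)..b, Real.exp (-φ * s) * v₀ 1 s)
        + ∫ z, z * Real.exp (-x * z) * (∫ y in (0 : ℝ)..b, Real.exp (z * y) * v₀ 1 y) ∂ξ := by
  have hfin := H.reprY.fin
  have hb := H.b_pos
  have hcv : ContinuousOn (v₀ 1) (Set.Icc 0 b) :=
    (continuousOn_baseValue H.reprX (by omega)).mono Set.Icc_subset_Ici_self
  obtain ⟨C, hC⟩ := isCompact_Icc.exists_bound_of_continuousOn hcv
  have h1 : Integrable (fun z => z) ξ := by simpa using H.reprY.integrable_pow 1 (by omega)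
  set F : ℝ → ℝ → ℝ := fun s z => z * Real.exp (-(x - s) * z) * v₀ 1 s with hF
  have hmv : AEStronglyMeasurable (v₀ 1) (volume.restrict (Set.Ioc 0 b)) :=
    (hcv.mono Set.Ioc_subset_Icc_self).aestronglyMeasurable measurableSet_Ioc
  have hint : Integrable (Function.uncurry F) ((volume.restrict (Set.Ioc 0 b)).prod ξ) := by
    have hg : Integrable (fun p : ℝ × ℝ => C * p.2) ((volume.restrict (Set.Ioc 0 b)).prod ξ) :=
      Integrable.mul_prod (integrable_const C) h1
    refine hg.mono' ?_ ?_
    · exact (by fun_prop : Continuous fun p : ℝ × ℝ =>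
        p.2 * Real.exp (-(x - p.1) * p.2)).aestronglyMeasurable.mul hmv.comp_fst
    · have ha : ∀ᵐ p ∂((volume.restrict (Set.Ioc 0 b)).prod ξ), p.1 ∈ Set.Ioc 0 b :=
        Measure.quasiMeasurePreserving_fst.ae (ae_restrict_mem measurableSet_Ioc)
      have hb' : ∀ᵐ p ∂((volume.restrict (Set.Ioc 0 b)).prod ξ), 0 < p.2 :=
        Measure.quasiMeasurePreserving_snd.ae H.reprY.ae_pos
      filter_upwards [ha, hb'] with p hp1 hp2
      simp only [Function.uncurry, hF]
      rw [norm_mul, Real.norm_of_nonneg (by positivity), mul_comm C]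
      refine mul_le_mul ?_ (hC _ ⟨hp1.1.le, hp1.2⟩) (norm_nonneg _) hp2.le
      refine mul_le_of_le_one_right hp2.le (Real.exp_le_one_iff.2 ?_)
      have := hp1.2
      nlinarith
  have hI1 : IntegrableOn (fun s => ξ.real Set.univ * φ * Real.exp (φ * x)
      * (Real.exp (-φ * s) * v₀ 1 s)) (Set.Ioc 0 b) := by
    refine Integrable.const_mul ?_ _
    exact ((ContinuousOn.mul (by fun_prop) hcv).integrableOn_Icc).mono_set Set.Ioc_subset_Icc_self
  rw [intervalIntegral.integral_of_le hb.le, intervalIntegral.integral_of_le hb.le,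
    ← integral_const_mul]
  have e2 : ∫ z, z * Real.exp (-x * z) * (∫ y in (0 : ℝ)..b, Real.exp (z * y) * v₀ 1 y) ∂ξ
      = ∫ s in Set.Ioc 0 b, ∫ z, F s z ∂ξ := by
    rw [integral_integral_swap hint]
    refine integral_congr_ae (Eventually.of_forall fun z => ?_)
    simp only [hF]
    rw [intervalIntegral.integral_of_le hb.le, ← integral_const_mul]
    refine integral_congr_ae (Eventually.of_forall fun s => ?_)
    simp only
    rw [show -(x - s) * z = -x * z + z * s by ring, Real.exp_add]
    ring
  have hI2 : Integrable (fun s => ∫ z, F s z ∂ξ) (volume.restrict (Set.Ioc 0 b)) :=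
    hint.integral_prod_left
  rw [e2, ← integral_add hI1 hI2]
  refine integral_congr_ae (Eventually.of_forall fun s => ?_)
  simp only [hF]
  rw [integral_mul_const, ← mul_assoc, ← add_mul, expMix]
  congr 1
  have e3 : ∀ z : ℝ, (-z) ^ 1 * Real.exp (-(x - s) * z) = -(z * Real.exp (-(x - s) * z)) :=
    fun z => by ring
  simp_rw [e3]
  rw [integral_neg, sub_neg_eq_add, pow_one, mul_assoc _ (Real.exp (φ * x)), ← Real.exp_add]
  ring_nf

theorem continuous_kernel (H : SmoothFit γ σ ν q δ S A b Φ φ ζ ξ) : Continuous K₀ := by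
  have := H.continuous_weight
  unfold thresholdKernel
  fun_prop

/-- Damping by `e^{-bz}` leaves quadratic growth, which the available moments of `ξ` control. -/
theorem abs_kernel_le (H : SmoothFit γ σ ν q δ S A b Φ φ ζ ξ) :
    ∃ C, ∀ z > 0, |Real.exp (-b * z) * K₀ z| ≤ C * (1 + z + z ^ 2) := by
  obtain ⟨C, hC0, hC⟩ := H.abs_weight_le
  have hδ := H.δ_pos
  refine ⟨|S * (σ ^ 2 / 2)| * (1 + δ * (2 / σ ^ 2)) + δ + |A| + δ * C, fun z hz => ?_⟩
  have hb := H.b_pos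
  have hE : Real.exp (-b * z) ≤ 1 := Real.exp_le_one_iff.2 (by nlinarith)
  have hEp := Real.exp_pos (-b * z)
  have hEE : Real.exp (-b * z) * Real.exp (b * z) = 1 := by
    rw [← Real.exp_add]; simp
  set s := S * (σ ^ 2 / 2)
  set d := δ * (2 / σ ^ 2) with hd
  have hd0 : 0 ≤ d := by positivity
  set I := ∫ y in (0 : ℝ)..b, Real.exp (z * y) * v₀ 1 y with hI
  have hI' : |Real.exp (-b * z) * I| ≤ C := by
    rw [abs_mul, Real.abs_exp]
    calc _ ≤ Real.exp (-b * z) * (C * Real.exp (b * z)) :=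
          mul_le_mul_of_nonneg_left (hC z hz) hEp.le
      _ = C := by rw [mul_left_comm, hEE, mul_one]
  have e : Real.exp (-b * z) * K₀ z = Real.exp (-b * z) * (-s * (z ^ 2 + d * z)) + δ
      + Real.exp (-b * z) * (A * z) - δ * z * (Real.exp (-b * z) * I) := by
    simp only [thresholdKernel]
    linear_combination δ * hEE
  rw [e]
  have a1 : |Real.exp (-b * z) * (-s * (z ^ 2 + d * z))| ≤ |s| * (z ^ 2 + d * z) := by
    rw [abs_mul, abs_mul, abs_neg, Real.abs_exp, abs_of_nonneg (by positivity : 0 ≤ z ^ 2 + d * z)]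
    exact mul_le_of_le_one_left (by positivity) hE
  have a2 : |Real.exp (-b * z) * (A * z)| ≤ |A| * z := by
    rw [abs_mul, abs_mul, Real.abs_exp, abs_of_pos hz]
    exact mul_le_of_le_one_left (by positivity) hE
  have a3 : |δ * z * (Real.exp (-b * z) * I)| ≤ δ * z * C := by
    rw [abs_mul, abs_of_nonneg (by positivity : 0 ≤ δ * z)]
    exact mul_le_mul_of_nonneg_left hI' (by positivity)
  have t1 := abs_sub (Real.exp (-b * z) * (-s * (z ^ 2 + d * z)) + δ
      + Real.exp (-b * z) * (A * z)) (δ * z * (Real.exp (-b * z) * I))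
  have t2 := abs_add_le (Real.exp (-b * z) * (-s * (z ^ 2 + d * z)) + δ)
    (Real.exp (-b * z) * (A * z))
  have t3 := abs_add_le (Real.exp (-b * z) * (-s * (z ^ 2 + d * z))) δ
  rw [abs_of_pos hδ] at t3
  have hs := abs_nonneg s
  have hA := abs_nonneg A
  have p1 : 0 ≤ |s| * d := by positivity
  have p2 : 0 ≤ |s| * d * z := by positivity
  have p3 : 0 ≤ |s| * d * z ^ 2 := by positivity
  have p4 : 0 ≤ |s| * z := by positivity
  have p5 : 0 ≤ δ * z := by positivity
  have p6 : 0 ≤ δ * z ^ 2 := by positivity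
  have p7 : 0 ≤ |A| * z ^ 2 := by positivity
  have p8 : 0 ≤ δ * C := by positivity
  have p9 : 0 ≤ δ * C * z ^ 2 := by positivity
  nlinarith

/-- The weights `1/z`, `1` and `z` serve the antiderivative, `v'` and `v''`, uniformly down to `x =
b`; they require `1/z` and the powers of `z` up to the third to be integrable against `ξ`. -/
theorem integrable_kernel_mul (H : SmoothFit γ σ ν q δ S A b Φ φ ζ ξ) :
    Integrable (fun z => Real.exp (-b * z) * (1 / z * K₀ z)) ξ ∧
      Integrable (fun z => Real.exp (-b * z) * K₀ z) ξ ∧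
      Integrable (fun z => Real.exp (-b * z) * (z * K₀ z)) ξ := by
  obtain ⟨C, hC⟩ := H.abs_kernel_le
  have hfin := H.reprY.fin
  have i0 : Integrable (fun _ : ℝ => (1 : ℝ)) ξ := integrable_const _
  have i1 : Integrable (fun z => z) ξ := by simpa using H.reprY.integrable_pow 1 (by omega)
  have i2 := H.reprY.integrable_pow 2 (by omega)
  have i3 := H.reprY.integrable_pow 3 (by omega)
  have ii := H.reprY.integrable_inv
  have hc := H.continuous_kernel
  have hmE : Continuous fun z : ℝ => Real.exp (-b * z) := by fun_prop
  refine ⟨?_, ?_, ?_⟩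
  · refine (((ii.add i0).add i1).const_mul C).mono' ?_ ?_
    · exact (hmE.measurable.mul ((measurable_const.div measurable_id).mul
        hc.measurable)).aestronglyMeasurable
    · filter_upwards [H.reprY.ae_pos] with z hz
      have e : Real.exp (-b * z) * (1 / z * K₀ z) = 1 / z * (Real.exp (-b * z) * K₀ z) := by ring
      rw [e, norm_mul, Real.norm_of_nonneg (by positivity), Real.norm_eq_abs]
      refine (mul_le_mul_of_nonneg_left (hC z hz) (by positivity)).trans (le_of_eq ?_)
      simp only [Pi.add_apply]
      field_simp
  · refine (((i0.add i1).add i2).const_mul C).mono' (hmE.mul hc).aestronglyMeasurable ?_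
    filter_upwards [H.reprY.ae_pos] with z hz
    exact hC z hz
  · refine (((i1.add i2).add i3).const_mul C).mono'
      (hmE.mul (continuous_id.mul hc)).aestronglyMeasurable ?_
    filter_upwards [H.reprY.ae_pos] with z hz
    rw [mul_left_comm, norm_mul, Real.norm_of_nonneg hz.le, Real.norm_eq_abs]
    refine (mul_le_mul_of_nonneg_left (hC z hz) hz.le).trans (le_of_eq ?_)
    simp only [Pi.add_apply]
    ring

/-- Above the threshold the derivative of the value function is a Laplace integral. -/
theorem thresholdValue_one_eq (H : SmoothFit γ σ ν q δ S A b Φ φ ζ ξ) {x : ℝ} (hx : b < x) :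
    v₁ 1 x = ∫ z, Real.exp (-x * z) * K₀ z ∂ξ := by
  have hfin := H.reprY.fin
  have hb := H.b_pos
  have hx0 : 0 < x := hb.trans hx
  have hy : 0 < x - b := sub_pos.2 hx
  have cv : ContinuousOn (v₀ 1) (Set.Ici 0) := continuousOn_baseValue H.reprX (by omega)
  have cy : ContinuousOn (expMix φ ξ 1) (Set.Ici 0) := H.reprY.continuousOn_expMix (by omega)
  have cyv : ContinuousOn (fun t => expMix φ ξ 1 t * v₀ 1 (x - t)) (Set.Icc 0 x) :=
    (cy.mono Set.Icc_subset_Ici_self).mul (cv.comp (by fun_prop) fun t ht =>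
      Set.mem_Ici.2 (sub_nonneg.2 ht.2))
  have iyv : ∀ a c, 0 ≤ a → a ≤ c → c ≤ x →
      IntervalIntegrable (fun t => expMix φ ξ 1 t * v₀ 1 (x - t)) volume a c := fun a c ha hac hc =>
    (cyv.mono (Set.Icc_subset_Icc ha hc)).intervalIntegrable_of_Icc hac
  have iy : IntervalIntegrable (expMix φ ξ 1) volume 0 (x - b) :=
    (cy.mono Set.Icc_subset_Ici_self).intervalIntegrable_of_Icc hy.le
  have hW : ∫ t in (0 : ℝ)..(x - b), expMix φ ξ 1 t = expMix φ ξ 0 (x - b) := by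
    rw [intervalIntegral.integral_eq_sub_of_hasDerivAt_of_le hy.le
      ((H.reprY.continuousOn_expMix (by omega)).mono Set.Icc_subset_Ici_self)
      (fun t ht => H.reprY.hasDerivAt_expMix (k := 0) (by omega) ht.1) iy,
      H.reprY.expMix_zero_zero, sub_zero]
  -- The convolution starting at `b` is the full one on `[0, x]`, known from `δ_mul_halfConv`, minus
  -- the contribution of arguments of `v₀'` in `[0, b]`.
  have hcor : correction δ σ φ ξ (fun y => v₀ 1 (b + y) - 1) 1 (x - b)
      = δ * halfConv (expMix φ ξ 1) (v₀ 1) x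
        - δ * (∫ s in (0 : ℝ)..b, expMix φ ξ 1 (x - s) * v₀ 1 s) - δ * expMix φ ξ 0 (x - b) := by
    have e1 : halfConv (expMix φ ξ 1) (fun y => v₀ 1 (b + y) - 1) (x - b)
        = (∫ t in (0 : ℝ)..(x - b), expMix φ ξ 1 t * v₀ 1 (x - t)) - expMix φ ξ 0 (x - b) := by
      rw [← hW, ← intervalIntegral.integral_sub (iyv 0 _ le_rfl hy.le (by linarith)) iy]
      refine intervalIntegral.integral_congr fun t _ => ?_
      simp only
      rw [show b + (x - b - t) = x - t by ring]
      ring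
    have e2 : halfConv (expMix φ ξ 1) (v₀ 1) x
        = (∫ t in (0 : ℝ)..(x - b), expMix φ ξ 1 t * v₀ 1 (x - t))
          + ∫ t in (x - b)..x, expMix φ ξ 1 t * v₀ 1 (x - t) :=
      (intervalIntegral.integral_add_adjacent_intervals (iyv 0 _ le_rfl hy.le (by linarith))
        (iyv _ _ hy.le (by linarith) le_rfl)).symm
    have e3 : ∫ t in (x - b)..x, expMix φ ξ 1 t * v₀ 1 (x - t)
        = ∫ s in (0 : ℝ)..b, expMix φ ξ 1 (x - s) * v₀ 1 s := by
      have := intervalIntegral.integral_comp_sub_left (a := 0) (b := b)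
        (fun t => expMix φ ξ 1 t * v₀ 1 (x - t)) x
      simp only [sub_zero, sub_sub_cancel] at this
      exact this.symm
    simp only [correction]
    rw [e1, e2, e3]
    ring
  rw [thresholdValue, max_eq_left hy.le, hcor, H.δ_mul_halfConv hx0, H.integral_expMix_mul_base hx.le,
    H.integral_exp_mul_base]
  have j1 : Integrable (fun z => (-z) ^ 2 * Real.exp (-x * z)) ξ :=
    H.reprY.integrable_pow_mul_exp (by omega) hx0.le
  have j2 : Integrable (fun z => (-z) ^ 1 * Real.exp (-x * z)) ξ :=
    H.reprY.integrable_pow_mul_exp (by omega) hx0.le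
  have j3 := H.integrable_weight hx.le
  have j4 : Integrable (fun z => (-z) ^ 0 * Real.exp (-(x - b) * z)) ξ :=
    H.reprY.integrable_pow_mul_exp (by omega) hy.le
  have hK : ∫ z, Real.exp (-x * z) * K₀ z ∂ξ
      = -(S * (σ ^ 2 / 2)) * (∫ z, (-z) ^ 2 * Real.exp (-x * z) ∂ξ)
        + (-(A - S * δ)) * (∫ z, (-z) ^ 1 * Real.exp (-x * z) ∂ξ)
        + (-δ) * (∫ z, z * Real.exp (-x * z)
            * (∫ y in (0 : ℝ)..b, Real.exp (z * y) * v₀ 1 y) ∂ξ)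
        + δ * (∫ z, (-z) ^ 0 * Real.exp (-(x - b) * z) ∂ξ) := by
    have hσ := H.σ_pos.ne'
    have k1 := j1.const_mul (-(S * (σ ^ 2 / 2)))
    have k2 := j2.const_mul (-(A - S * δ))
    have k3 := j3.const_mul (-δ)
    have k4 := j4.const_mul δ
    have k12 := k1.add k2
    have k123 := k12.add k3
    rw [← integral_const_mul, ← integral_const_mul, ← integral_const_mul, ← integral_const_mul,
      ← integral_add' k1 k2, ← integral_add' k12 k3, ← integral_add' k123 k4]
    refine integral_congr_ae (Eventually.of_forall fun z => ?_)
    simp only [thresholdKernel, Pi.add_apply]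
    rw [show -(x - b) * z = -x * z + b * z by ring, Real.exp_add]
    field_simp
    ring
  -- All Laplace integrals now match. The terms in `e^{φx}` add up to zero by the value from
  -- `integral_exp_mul_base`.
  rw [hK]
  simp only [expMix]
  have hφ := H.reprY.φ_pos.ne'
  have hδ := H.δ_pos.ne'
  have e5 : Real.exp (φ * (x - b)) = Real.exp (φ * x) * Real.exp (-φ * b) := by
    rw [← Real.exp_add]; ring_nf
  rw [e5]
  field_simp
  ring

theorem thresholdValue_two_eq (H : SmoothFit γ σ ν q δ S A b Φ φ ζ ξ) {x : ℝ} (hx : b < x) :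
    v₁ 2 x = ∫ z, Real.exp (-x * z) * (-(z * K₀ z)) ∂ξ := by
  obtain ⟨-, h1, h2⟩ := H.integrable_kernel_mul
  have hd := hasDerivAt_integral_exp_mul H.reprY.ae_pos H.continuous_kernel.aestronglyMeasurable
    h1 h2 hx
  refine (H.hasDerivAt_thresholdValue (k := 1) (by omega) (H.b_pos.trans hx)).unique ?_
  refine hd.congr_of_eventuallyEq ?_
  filter_upwards [Ioi_mem_nhds hx] with y hy
  exact H.thresholdValue_one_eq hy

/-- Continuity handles a compact interval. Beyond it `v'` and `v''` are Laplace integrals,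
decreasing in absolute kernel; `v` itself differs by a constant from the antiderivative of `v'` with
kernel `1/z · p(z)`. -/
theorem exists_abs_thresholdValue_le (H : SmoothFit γ σ ν q δ S A b Φ φ ζ ξ) :
    ∃ C, ∀ k ≤ 2, ∀ x ≥ 0, |v₁ k x| ≤ C := by
  obtain ⟨h0, h1, h2⟩ := H.integrable_kernel_mul
  have hb := H.b_pos
  have hpos := H.reprY.ae_pos
  have compact : ∀ k ≤ 2, ∃ C, ∀ x ∈ Set.Icc 0 (b + 1), |v₁ k x| ≤ C := fun k hk =>
    isCompact_Icc.exists_bound_of_continuousOn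
      ((H.continuousOn_thresholdValue hk).mono Set.Icc_subset_Ici_self)
  have hder : ∀ x > b, HasDerivAt (fun x => ∫ z, Real.exp (-x * z) * (1 / z * K₀ z) ∂ξ)
      (-v₁ 1 x) x := by
    intro x hx
    have hae : ∀ y : ℝ, (fun z => Real.exp (-y * z) * (z * (1 / z * K₀ z)))
        =ᵐ[ξ] fun z => Real.exp (-y * z) * K₀ z := fun y => by
      filter_upwards [hpos] with z hz
      field_simp
    have := hasDerivAt_integral_exp_mul (h := fun z => 1 / z * K₀ z) hpos
      ((measurable_const.div measurable_id).mul
        H.continuous_kernel.measurable).aestronglyMeasurable h0 (h1.congr (hae b).symm) hx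
    refine this.congr_deriv ?_
    rw [H.thresholdValue_one_eq hx, ← integral_neg]
    refine integral_congr_ae ?_
    filter_upwards [hae x] with z hz
    rw [← hz]
    ring
  set Q : ℝ → ℝ := fun x => ∫ z, Real.exp (-x * z) * (1 / z * K₀ z) ∂ξ with hQ
  set CQ : ℝ := ∫ z, ‖Real.exp (-b * z) * (1 / z * K₀ z)‖ ∂ξ with hCQ
  have hQb : ∀ x > b, |Q x| ≤ CQ := fun x hx => abs_integral_exp_mul_le hpos h0 hx.le
  have hconst : ∀ x > b, v₁ 0 x + Q x = v₁ 0 (b + 1) + Q (b + 1) := by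
    intro x hx
    have hd : ∀ y ∈ Set.Ioi b, HasDerivAt (fun x => v₁ 0 x + Q x) 0 y := fun y hy => by
      have := (H.hasDerivAt_thresholdValue (k := 0) (by omega) (hb.trans hy)).add (hder y hy)
      exact this.congr_deriv (by ring)
    exact (isOpen_Ioi (a := b)).is_const_of_deriv_eq_zero isPreconnected_Ioi
      (fun y hy => (hd y hy).differentiableAt.differentiableWithinAt)
      (fun y hy => (hd y hy).deriv) (Set.mem_Ioi.2 hx) (Set.mem_Ioi.2 (by linarith))
  obtain ⟨C₀, hC₀⟩ := compact 0 (by omega)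
  obtain ⟨C₁, hC₁⟩ := compact 1 (by omega)
  obtain ⟨C₂, hC₂⟩ := compact 2 (by omega)
  set D₁ : ℝ := ∫ z, ‖Real.exp (-b * z) * K₀ z‖ ∂ξ with hD₁
  set D₂ : ℝ := ∫ z, ‖Real.exp (-b * z) * (-(z * K₀ z))‖ ∂ξ with hD₂
  have hCQ0 : 0 ≤ CQ := integral_nonneg fun z => norm_nonneg _
  have hD₁0 : 0 ≤ D₁ := integral_nonneg fun z => norm_nonneg _
  have hD₂0 : 0 ≤ D₂ := integral_nonneg fun z => norm_nonneg _
  have hmem : (0 : ℝ) ∈ Set.Icc 0 (b + 1) := ⟨le_rfl, by linarith⟩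
  have n0 := (abs_nonneg _).trans (hC₀ 0 hmem)
  have n1 := (abs_nonneg _).trans (hC₁ 0 hmem)
  have n2 := (abs_nonneg _).trans (hC₂ 0 hmem)
  refine ⟨C₀ + 2 * CQ + (C₁ + D₁) + (C₂ + D₂), fun k hk x hx => ?_⟩
  rcases le_or_gt x (b + 1) with hxb | hxb
  · interval_cases k
    · have := hC₀ x ⟨hx, hxb⟩; linarith
    · have := hC₁ x ⟨hx, hxb⟩; linarith
    · have := hC₂ x ⟨hx, hxb⟩; linarith
  · have hxb' : b < x := by linarith
    interval_cases k
    · have e := hconst x hxb'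
      have a1 := abs_le.1 (hQb x hxb')
      have a2 := abs_le.1 (hQb (b + 1) (by linarith))
      have a3 := abs_le.1 (hC₀ (b + 1) ⟨by linarith, le_rfl⟩)
      rw [abs_le]
      constructor <;> linarith [a1.1, a1.2, a2.1, a2.2, a3.1, a3.2]
    · have := abs_integral_exp_mul_le hpos h1 hxb'.le
      rw [← H.thresholdValue_one_eq hxb'] at this
      linarith
    · have h2' : Integrable (fun z => Real.exp (-b * z) * (-(z * K₀ z))) ξ := by
        refine h2.neg.congr (Eventually.of_forall fun z => ?_)
        simp
      have := abs_integral_exp_mul_le hpos h2' hxb'.le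
      rw [← H.thresholdValue_two_eq hxb'] at this
      linarith

end SmoothFit

/-! ### Taylor estimates for bounded twice differentiable functions. -/

/-- `f` is twice continuously differentiable with derivatives `f'`, `f''`, all bounded by `B`. -/
structure IsBoundedC2 (f f' f'' : ℝ → ℝ) (B : ℝ) : Prop where
  hasDerivAt : ∀ x, HasDerivAt f (f' x) x
  hasDerivAt' : ∀ x, HasDerivAt f' (f'' x) x
  continuous'' : Continuous f''
  abs_le : ∀ x, |f x| ≤ B
  abs_le' : ∀ x, |f' x| ≤ B
  abs_le'' : ∀ x, |f'' x| ≤ B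

namespace IsBoundedC2

variable {f f' f'' : ℝ → ℝ} {B : ℝ}

theorem continuous (h : IsBoundedC2 f f' f'' B) : Continuous f :=
  continuous_iff_continuousAt.2 fun x => (h.hasDerivAt x).continuousAt

theorem continuous' (h : IsBoundedC2 f f' f'' B) : Continuous f' :=
  continuous_iff_continuousAt.2 fun x => (h.hasDerivAt' x).continuousAt

theorem nonneg (h : IsBoundedC2 f f' f'' B) : 0 ≤ B := (abs_nonneg _).trans (h.abs_le 0)

theorem abs_sub_le (h : IsBoundedC2 f f' f'' B) (x y : ℝ) : |f y - f x| ≤ B * |y - x| :=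
  Convex.norm_image_sub_le_of_norm_hasDerivWithin_le (s := Set.univ)
    (fun z _ => (h.hasDerivAt z).hasDerivWithinAt) (fun z _ => h.abs_le' z) convex_univ
    (Set.mem_univ x) (Set.mem_univ y)

theorem abs_sub_le' (h : IsBoundedC2 f f' f'' B) (x y : ℝ) : |f' y - f' x| ≤ B * |y - x| :=
  Convex.norm_image_sub_le_of_norm_hasDerivWithin_le (s := Set.univ)
    (fun z _ => (h.hasDerivAt' z).hasDerivWithinAt) (fun z _ => h.abs_le'' z) convex_univ
    (Set.mem_univ x) (Set.mem_univ y)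

theorem abs_remainder_le (h : IsBoundedC2 f f' f'' B) (y d : ℝ) :
    |f (y + d) - f y - f' y * d| ≤ B * d ^ 2 := by
  have hd : ∀ t ∈ Set.uIcc 0 d, HasDerivWithinAt (fun t => f (y + t) - f' y * t)
      (f' (y + t) - f' y) (Set.uIcc 0 d) t := fun t _ =>
    ((((h.hasDerivAt (y + t)).comp_const_add y t).sub
      ((hasDerivAt_id t).const_mul (f' y))).congr_deriv (by simp)).hasDerivWithinAt
  have hb : ∀ t ∈ Set.uIcc 0 d, ‖f' (y + t) - f' y‖ ≤ B * |d| := fun t ht => by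
    refine (h.abs_sub_le' y (y + t)).trans (mul_le_mul_of_nonneg_left ?_ h.nonneg)
    rw [add_sub_cancel_left]
    simpa using Set.abs_sub_left_of_mem_uIcc ht
  have := Convex.norm_image_sub_le_of_norm_hasDerivWithin_le hd hb (convex_uIcc 0 d)
    Set.left_mem_uIcc Set.right_mem_uIcc
  rw [Real.norm_eq_abs, Real.norm_eq_abs, sub_zero, mul_assoc, ← sq, sq_abs] at this
  refine le_trans (le_of_eq ?_) this
  congr 1
  simp
  ring

theorem tendsto_remainder (h : IsBoundedC2 f f' f'' B) (y : ℝ) :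
    Tendsto (fun d => (f (y + d) - f y - f' y * d) / d ^ 2) (𝓝[≠] 0) (𝓝 (f'' y / 2)) := by
  rw [Metric.tendsto_nhdsWithin_nhds]
  intro ε hε
  have hlo := (h.hasDerivAt' y).isLittleO
  have h1 := hlo.def (half_pos hε)
  rw [Metric.eventually_nhds_iff] at h1
  obtain ⟨η, hη, hη'⟩ := h1
  refine ⟨η, hη, fun d hd0 hd => ?_⟩
  have hd0 : d ≠ 0 := hd0
  have hder : ∀ t ∈ Set.uIcc 0 d, HasDerivWithinAt
      (fun t => f (y + t) - f' y * t - f'' y / 2 * t ^ 2)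
      (f' (y + t) - f' y - f'' y * t) (Set.uIcc 0 d) t := fun t _ => by
    have := (((h.hasDerivAt (y + t)).comp_const_add y t).sub
      ((hasDerivAt_id t).const_mul (f' y))).sub ((hasDerivAt_pow 2 t).const_mul (f'' y / 2))
    exact (this.congr_deriv (by simp; ring)).hasDerivWithinAt
  have hb : ∀ t ∈ Set.uIcc 0 d, ‖f' (y + t) - f' y - f'' y * t‖ ≤ ε / 2 * |d| := fun t ht => by
    have ht' : |t| ≤ |d| := by simpa using Set.abs_sub_left_of_mem_uIcc ht
    have h2 := hη' (y := y + t) (by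
      rw [dist_eq_norm, add_sub_cancel_left]
      refine lt_of_le_of_lt ht' ?_
      simpa using hd)
    simp only [add_sub_cancel_left, smul_eq_mul] at h2
    rw [mul_comm t] at h2
    exact h2.trans (mul_le_mul_of_nonneg_left ht' (by positivity))
  have := Convex.norm_image_sub_le_of_norm_hasDerivWithin_le hder hb (convex_uIcc 0 d)
    Set.left_mem_uIcc Set.right_mem_uIcc
  rw [Real.norm_eq_abs, Real.norm_eq_abs, sub_zero, mul_assoc, ← sq, sq_abs] at this
  have hd2 : 0 < d ^ 2 := by positivity
  rw [dist_eq_norm, Real.norm_eq_abs]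
  have e : (f (y + d) - f y - f' y * d) / d ^ 2 - f'' y / 2
      = (f (y + d) - f y - f' y * d - f'' y / 2 * d ^ 2) / d ^ 2 := by
    field_simp
  rw [e, abs_div, abs_of_pos hd2, div_lt_iff₀ hd2]
  refine lt_of_le_of_lt (b := ε / 2 * d ^ 2) ?_ (by nlinarith)
  refine le_trans (le_of_eq ?_) this
  congr 1
  simp
  ring

theorem comp_const_add (h : IsBoundedC2 f f' f'' B) (y : ℝ) :
    IsBoundedC2 (fun x => f (y + x)) (fun x => f' (y + x)) (fun x => f'' (y + x)) B where
  hasDerivAt x := (h.hasDerivAt (y + x)).comp_const_add y x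
  hasDerivAt' x := (h.hasDerivAt' (y + x)).comp_const_add y x
  continuous'' := h.continuous''.comp (continuous_const.add continuous_id)
  abs_le _ := h.abs_le _
  abs_le' _ := h.abs_le' _
  abs_le'' _ := h.abs_le'' _

end IsBoundedC2

/-! ### Law of an increment: Gaussian convolved with compound Poisson. -/

section Poisson

/-- `G ∗ κ ∗ ⋯ ∗ κ` with `n` convolution factors `κ`. -/
def jumpConv (G κ : Measure ℝ) : ℕ → Measure ℝ
  | 0 => G
  | n + 1 => jumpConv G κ n ∗ κ

/-- The convolution of `G` with the compound Poisson distribution of intensity `h κ`. -/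
def poissonSum (G κ : Measure ℝ) (h : ℝ) : Measure ℝ :=
  Measure.sum fun n => ENNReal.ofReal (Real.exp (-(κ.real Set.univ * h)) * (h ^ n / n.factorial))
    • jumpConv G κ n

variable {G κ : Measure ℝ} [IsFiniteMeasure G] [IsFiniteMeasure κ]

instance (n : ℕ) : IsFiniteMeasure (jumpConv G κ n) := by
  induction n with
  | zero => assumption
  | succ n ih => exact inferInstanceAs (IsFiniteMeasure (jumpConv G κ n ∗ κ))

theorem integrable_exp_conv {μ : Measure ℝ} [IsFiniteMeasure μ] {θ : ℝ}
    (hμ : Integrable (fun x => Real.exp (θ * x)) μ)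
    (hκ : Integrable (fun x => Real.exp (θ * x)) κ) :
    Integrable (fun x => Real.exp (θ * x)) (μ ∗ κ) ∧ ∫ x, Real.exp (θ * x) ∂(μ ∗ κ)
      = (∫ x, Real.exp (θ * x) ∂μ) * ∫ x, Real.exp (θ * x) ∂κ := by
  have h1 : Integrable (fun x => Real.exp (θ * x)) (μ ∗ κ) := by
    rw [integrable_conv_iff (by fun_prop : Continuous _).aestronglyMeasurable]
    simp_rw [mul_add, Real.exp_add, Real.norm_eq_abs, abs_mul, Real.abs_exp, integral_const_mul]
    exact ⟨Eventually.of_forall fun x => hκ.const_mul _, hμ.mul_const _⟩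
  refine ⟨h1, ?_⟩
  rw [integral_conv h1]
  simp_rw [mul_add, Real.exp_add, integral_const_mul]
  exact integral_mul_const _ _

theorem integrable_exp_jumpConv {θ : ℝ} (hG : Integrable (fun x => Real.exp (θ * x)) G)
    (hκ : Integrable (fun x => Real.exp (θ * x)) κ) (n : ℕ) :
    Integrable (fun x => Real.exp (θ * x)) (jumpConv G κ n) ∧ ∫ x, Real.exp (θ * x) ∂(jumpConv G κ n)
      = (∫ x, Real.exp (θ * x) ∂G) * (∫ x, Real.exp (θ * x) ∂κ) ^ n := by
  induction n with
  | zero => simpa [jumpConv] using hG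
  | succ n ih =>
    have := integrable_exp_conv ih.1 hκ
    refine ⟨this.1, ?_⟩
    change ∫ x, Real.exp (θ * x) ∂(jumpConv G κ n ∗ κ) = _
    rw [this.2, ih.2]
    ring

theorem real_jumpConv (n : ℕ) :
    (jumpConv G κ n).real Set.univ = G.real Set.univ * κ.real Set.univ ^ n := by
  have h := (integrable_exp_jumpConv (G := G) (κ := κ) (θ := 0) (by simp) (by simp) n).2
  simpa using h

theorem hasSum_poisson_weight (a lam h : ℝ) :
    HasSum (fun n : ℕ => Real.exp (-(lam * h)) * (h ^ n / n.factorial) * a ^ n)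
      (Real.exp (-(lam * h)) * Real.exp (a * h)) := by
  have := (NormedSpace.expSeries_div_hasSum_exp (a * h)).mul_left (Real.exp (-(lam * h)))
  rw [← Real.exp_eq_exp_ℝ] at this
  have e : (fun n : ℕ => Real.exp (-(lam * h)) * (h ^ n / n.factorial) * a ^ n)
      = fun n : ℕ => Real.exp (-(lam * h)) * ((a * h) ^ n / n.factorial) := by
    funext n
    rw [mul_pow]
    ring
  rw [e]
  exact this

theorem integrable_exp_poissonSum {h θ : ℝ} (hh : 0 ≤ h)
    (hG : Integrable (fun x => Real.exp (θ * x)) G)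
    (hκ : Integrable (fun x => Real.exp (θ * x)) κ) :
    Integrable (fun x => Real.exp (θ * x)) (poissonSum G κ h) ∧
      ∫ x, Real.exp (θ * x) ∂(poissonSum G κ h) = (∫ x, Real.exp (θ * x) ∂G)
        * (Real.exp (-(κ.real Set.univ * h)) * Real.exp ((∫ x, Real.exp (θ * x) ∂κ) * h)) := by
  set w : ℕ → ℝ := fun n => Real.exp (-(κ.real Set.univ * h)) * (h ^ n / n.factorial) with hw
  have hw0 : ∀ n, 0 ≤ w n := fun n => by positivity
  have hs := (hasSum_poisson_weight (∫ x, Real.exp (θ * x) ∂κ) (κ.real Set.univ) h).mul_left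
    (∫ x, Real.exp (θ * x) ∂G)
  have e : ∀ n, ∫ x, Real.exp (θ * x) ∂(ENNReal.ofReal (w n) • jumpConv G κ n)
      = (∫ x, Real.exp (θ * x) ∂G) * (w n * (∫ x, Real.exp (θ * x) ∂κ) ^ n) := fun n => by
    rw [integral_smul_measure, ENNReal.toReal_ofReal (hw0 n), (integrable_exp_jumpConv hG hκ n).2,
      smul_eq_mul]
    ring
  have hi : Integrable (fun x => Real.exp (θ * x)) (poissonSum G κ h) := by
    refine integrable_sum_measure
      (fun n => (integrable_exp_jumpConv hG hκ n).1.smul_measure ENNReal.ofReal_ne_top) ?_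
    simp_rw [Real.norm_eq_abs, Real.abs_exp]
    exact hs.summable.congr fun n => (e n).symm
  refine ⟨hi, ?_⟩
  have := hasSum_integral_measure hi
  rw [← funext e] at hs
  exact this.unique hs

theorem isProbabilityMeasure_poissonSum [IsProbabilityMeasure G] {h : ℝ} (hh : 0 ≤ h) :
    IsProbabilityMeasure (poissonSum G κ h) := by
  obtain ⟨h1, h2⟩ := integrable_exp_poissonSum (G := G) (κ := κ) (θ := 0) hh (by simp) (by simp)
  have hf : IsFiniteMeasure (poissonSum G κ h) := by
    have : Integrable (fun _ => (1 : ℝ)) (poissonSum G κ h) := by simpa using h1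
    exact (integrable_const_iff_isFiniteMeasure one_ne_zero).1 this
  have h3 : (poissonSum G κ h).real Set.univ = 1 := by
    simpa [← Real.exp_add] using h2
  exact ⟨by rwa [Measure.real, ENNReal.toReal_eq_one_iff] at h3⟩

theorem one_sub_exp_mul_le {u : ℝ} (hu : 0 ≤ u) : 1 - Real.exp (-u) * (1 + u) ≤ u ^ 2 := by
  have := Real.add_one_le_exp (-u)
  nlinarith

/-- The first two terms of the compound Poisson series determine it up to second order. -/
theorem abs_integral_poissonSum_sub_le [IsProbabilityMeasure G] {h : ℝ} (hh : 0 ≤ h) {f : ℝ → ℝ}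
    (hf : Measurable f) {B : ℝ} (hB : ∀ x, |f x| ≤ B) :
    |∫ x, f x ∂(poissonSum G κ h) - (Real.exp (-(κ.real Set.univ * h)) * ∫ x, f x ∂G
      + Real.exp (-(κ.real Set.univ * h)) * h * ∫ x, ∫ y, f (x + y) ∂κ ∂G)|
      ≤ B * (κ.real Set.univ * h) ^ 2 := by
  have hprob := isProbabilityMeasure_poissonSum (G := G) (κ := κ) hh
  set lam := κ.real Set.univ with hlam
  set w : ℕ → ℝ := fun n => Real.exp (-(lam * h)) * (h ^ n / n.factorial) with hw
  have hw0 : ∀ n, 0 ≤ w n := fun n => by positivity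
  have hB0 : 0 ≤ B := (abs_nonneg _).trans (hB 0)
  have hi : ∀ μ : Measure ℝ, IsFiniteMeasure μ → Integrable f μ := fun μ _ =>
    Integrable.of_bound hf.aestronglyMeasurable B (Eventually.of_forall hB)
  have hs := hasSum_integral_measure (hi (poissonSum G κ h) inferInstance)
  set a : ℕ → ℝ := fun n => ∫ x, f x ∂(ENNReal.ofReal (w n) • jumpConv G κ n) with ha
  have ha' : ∀ n, a n = w n * ∫ x, f x ∂(jumpConv G κ n) := fun n => by
    rw [ha]
    simp only
    rw [integral_smul_measure, ENNReal.toReal_ofReal (hw0 n), smul_eq_mul]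
  have hle : ∀ n, ‖a n‖ ≤ B * (w n * lam ^ n) := fun n => by
    rw [ha' n, norm_mul, Real.norm_of_nonneg (hw0 n), mul_left_comm]
    refine mul_le_mul_of_nonneg_left ?_ (hw0 n)
    have := norm_integral_le_of_norm_le_const (μ := jumpConv G κ n) (f := f) (Eventually.of_forall hB)
    rwa [real_jumpConv, probReal_univ, one_mul] at this
  -- The terms with at least two jumps weigh `1 - e^{-u}(1 + u) ≤ u²` in total, where `u` is
  -- intensity times `h`.
  have hs2 := (hasSum_nat_add_iff' 2).2 hs
  have hb2 := (hasSum_nat_add_iff' 2).2 ((hasSum_poisson_weight lam lam h).mul_left B)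
  have key := hs2.norm_le_of_bounded hb2 fun n => hle (n + 2)
  have e0 : a 0 = Real.exp (-(lam * h)) * ∫ x, f x ∂G := by
    rw [ha' 0]; simp [hw, jumpConv]
  have e1 : a 1 = Real.exp (-(lam * h)) * h * ∫ x, ∫ y, f (x + y) ∂κ ∂G := by
    rw [ha' 1]
    have : jumpConv G κ 1 = G ∗ κ := rfl
    rw [this, integral_conv (hi _ inferInstance)]
    simp [hw]
  simp only [Finset.sum_range_succ, Finset.sum_range_zero, zero_add] at key
  rw [Real.norm_eq_abs] at key
  change |_ - (a 0 + a 1)| ≤ _ at key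
  rw [e0, e1] at key
  refine key.trans ?_
  have hu := one_sub_exp_mul_le (mul_nonneg (measureReal_nonneg (μ := κ) (s := Set.univ)) hh)
  rw [← Real.exp_add]
  simp only [neg_add_cancel, Real.exp_zero, pow_zero, pow_one, Nat.factorial_zero,
    Nat.factorial_one, Nat.cast_one, div_one, mul_one]
  rw [← hlam] at hu
  nlinarith

end Poisson

section Law

variable {γ σ : ℝ} {ν : Measure ℝ} [IsFiniteMeasure ν]

/-- The distribution of the Brownian part with drift `c` at time `h`. -/
def driftGaussian (c σ h : ℝ) : Measure ℝ :=
  (gaussianReal 0 1).map fun x => c * h + σ * Real.sqrt h * x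

/-- The image of the jump measure under reflection. -/
def reflectedJumps (ν : Measure ℝ) : Measure ℝ := (ν.restrict (Set.Ioi 0)).map fun z => -z

instance (c σ h : ℝ) : IsProbabilityMeasure (driftGaussian c σ h) :=
  Measure.isProbabilityMeasure_map (by fun_prop)

instance : IsFiniteMeasure (reflectedJumps ν) := by
  unfold reflectedJumps
  infer_instance

theorem real_reflectedJumps {ν : Measure ℝ} : (reflectedJumps ν).real Set.univ = ν.real (Set.Ioi 0) := by
  rw [reflectedJumps, map_measureReal_apply measurable_neg MeasurableSet.univ]
  simp [Measure.real]

theorem integrable_exp_driftGaussian {c h θ : ℝ} (hh : 0 ≤ h) :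
    Integrable (fun x => Real.exp (θ * x)) (driftGaussian c σ h) ∧
      ∫ x, Real.exp (θ * x) ∂(driftGaussian c σ h)
        = Real.exp (h * (c * θ + σ ^ 2 / 2 * θ ^ 2)) := by
  have hm : AEMeasurable (fun x => c * h + σ * Real.sqrt h * x) (gaussianReal 0 1) := by fun_prop
  have e : ∀ x, Real.exp (θ * (c * h + σ * Real.sqrt h * x))
      = Real.exp (θ * (c * h)) * Real.exp (θ * σ * Real.sqrt h * x) := fun x => by
    rw [← Real.exp_add]; ring_nf
  constructor
  · rw [driftGaussian, integrable_map_measure (by fun_prop : Continuous _).aestronglyMeasurable hm]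
    have := (integrable_exp_mul_gaussianReal (μ := 0) (v := 1) (θ * σ * Real.sqrt h)).const_mul
      (Real.exp (θ * (c * h)))
    exact this.congr (Eventually.of_forall fun x => (e x).symm)
  · rw [driftGaussian, integral_map hm (by fun_prop : Continuous _).aestronglyMeasurable]
    simp_rw [e]
    rw [integral_const_mul]
    have := congr_fun (mgf_id_gaussianReal (μ := 0) (v := 1)) (θ * σ * Real.sqrt h)
    simp only [mgf, id] at this
    rw [this, ← Real.exp_add]
    congr 1
    have hs := Real.sq_sqrt hh
    simp only [NNReal.coe_one]
    linear_combination (θ ^ 2 * σ ^ 2 / 2) * hs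

theorem integrable_exp_reflectedJumps {θ : ℝ} (hθ : 0 ≤ θ) :
    Integrable (fun x => Real.exp (θ * x)) (reflectedJumps ν) ∧
      ∫ x, Real.exp (θ * x) ∂(reflectedJumps ν) - ν.real (Set.Ioi 0)
        = -∫ z in Set.Ioi (0 : ℝ), (1 - Real.exp (-θ * z)) ∂ν := by
  have hm : AEMeasurable (fun z : ℝ => -z) (ν.restrict (Set.Ioi 0)) := by fun_prop
  have hi : IntegrableOn (fun z => Real.exp (-θ * z)) (Set.Ioi 0) ν := by
    refine Integrable.of_bound (C := 1) (by fun_prop : Continuous _).aestronglyMeasurable ?_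
    filter_upwards [ae_restrict_mem measurableSet_Ioi] with z hz
    have hz' : (0 : ℝ) < z := hz
    rw [Real.norm_eq_abs, Real.abs_exp]
    exact Real.exp_le_one_iff.2 (by nlinarith)
  have e : ∀ z : ℝ, Real.exp (θ * -z) = Real.exp (-θ * z) := fun z => by ring_nf
  constructor
  · rw [reflectedJumps, integrable_map_measure (by fun_prop : Continuous _).aestronglyMeasurable hm]
    exact hi.congr (Eventually.of_forall fun z => (e z).symm)
  · rw [reflectedJumps, integral_map hm (by fun_prop : Continuous _).aestronglyMeasurable,
      integral_sub (integrable_const _) hi]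
    simp_rw [e]
    simp

/-- The one-dimensional distributions are determined by the Laplace exponent. -/
theorem eq_poissonSum_of_laplace {h : ℝ} (hh : 0 ≤ h) {μ : Measure ℝ} [IsProbabilityMeasure μ]
    (hμ : ∀ θ ≥ 0, ∫ x, Real.exp (θ * x) ∂μ = Real.exp (h * laplaceExponent γ σ ν θ)) :
    μ = poissonSum (driftGaussian (γ + ∫ z in Set.Ioo (0 : ℝ) 1, z ∂ν) σ h) (reflectedJumps ν) h := by
  have := isProbabilityMeasure_poissonSum (κ := reflectedJumps ν)
    (G := driftGaussian (γ + ∫ z in Set.Ioo (0 : ℝ) 1, z ∂ν) σ h) hh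
  have hc := fun (θ : ℝ) (hθ : 0 ≤ θ) => integrable_exp_poissonSum hh
    (integrable_exp_driftGaussian (σ := σ) (c := γ + ∫ z in Set.Ioo (0 : ℝ) 1, z ∂ν) (θ := θ) hh).1
    (integrable_exp_reflectedJumps (ν := ν) hθ).1
  refine Measure.ext_of_integral_exp_eq (θ₀ := 0) (fun θ hθ => ?_) (fun θ hθ => (hc θ hθ).1) ?_
  -- A divergent exponential moment would be integrated to `0`, contradicting a positive right-hand
  -- side.
  · by_contra hn
    have := hμ θ hθ
    rw [integral_undef hn] at this
    exact (Real.exp_pos _).ne this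
  · intro θ hθ
    have hθ' : 0 ≤ θ := hθ.le
    rw [hμ θ hθ', (hc θ hθ').2, (integrable_exp_driftGaussian hh).2, ← Real.exp_add,
      ← Real.exp_add, laplaceExponent_eq θ hθ', real_reflectedJumps]
    congr 1
    linear_combination (-h) * (integrable_exp_reflectedJumps (ν := ν) hθ').2

end Law

/-! ### The generator as a small-time limit. -/

/-- The generator `c f' + σ²/2 f'' + ∫ (f(· - z) - f) ν(dz)` of the surplus process. -/
def levyGenerator (c σ : ℝ) (ν : Measure ℝ) (f f' f'' : ℝ → ℝ) (y : ℝ) : ℝ :=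
  c * f' y + σ ^ 2 / 2 * f'' y - ν.real (Set.Ioi 0) * f y + ∫ z in Set.Ioi (0 : ℝ), f (y - z) ∂ν

section Gaussian

variable {f f' f'' : ℝ → ℝ} {B c σ : ℝ}

theorem integral_sq_gaussianReal : ∫ x, x ^ 2 ∂(gaussianReal 0 1) = 1 := by
  have h := variance_eq_sub (memLp_id_gaussianReal (μ := 0) (v := 1) 2)
  rw [variance_id_gaussianReal] at h
  simp only [id, Pi.pow_apply, integral_id_gaussianReal] at h
  simpa using h.symm

theorem integrable_sq_gaussianReal : Integrable (fun x => x ^ 2) (gaussianReal 0 1) := by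
  have := (memLp_id_gaussianReal (μ := 0) (v := 1) 2).integrable_norm_pow (by norm_num)
  simpa using this

theorem integrable_id_gaussianReal : Integrable (fun x : ℝ => x) (gaussianReal 0 1) := by
  have := memLp_id_gaussianReal (μ := 0) (v := 1) 1
  exact memLp_one_iff_integrable.1 (by exact_mod_cast this)

theorem integral_driftGaussian (hf : Continuous f) (h : ℝ) :
    ∫ x, f x ∂(driftGaussian c σ h)
      = ∫ x, f (c * h + σ * Real.sqrt h * x) ∂(gaussianReal 0 1) := by
  rw [driftGaussian, integral_map (by fun_prop) hf.aestronglyMeasurable]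

/-- The increment of `f` along the Brownian part is its first-order term plus a remainder. -/
theorem integral_driftGaussian_sub_div (hf : IsBoundedC2 f f' f'' B) {h : ℝ} (hh : 0 < h) (y : ℝ) :
    (∫ x, f (y + x) ∂(driftGaussian c σ h) - f y) / h = c * f' y
      + ∫ x, (f (y + (c * h + σ * Real.sqrt h * x)) - f y - f' y * (c * h + σ * Real.sqrt h * x)) / h
        ∂(gaussianReal 0 1) := by
  rw [integral_driftGaussian (hf.comp_const_add y).continuous, integral_div]
  have i1 : Integrable (fun x => f (y + (c * h + σ * Real.sqrt h * x))) (gaussianReal 0 1) :=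
    Integrable.of_bound (hf.continuous.comp (by fun_prop)).aestronglyMeasurable B
      (Eventually.of_forall fun x => hf.abs_le _)
  have i2 : Integrable (fun x => f' y * (c * h + σ * Real.sqrt h * x)) (gaussianReal 0 1) :=
    ((integrable_const _).add (integrable_id_gaussianReal.const_mul _)).const_mul _
  have i3 : Integrable (fun x => f (y + (c * h + σ * Real.sqrt h * x)) - f y) (gaussianReal 0 1) :=
    i1.sub (integrable_const _)
  have e : ∫ x, f' y * (c * h + σ * Real.sqrt h * x) ∂(gaussianReal 0 1) = f' y * (c * h) := by
    rw [integral_const_mul, integral_add (integrable_const _)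
      (integrable_id_gaussianReal.const_mul _),
      integral_const_mul (σ * Real.sqrt h) (fun x : ℝ => x), integral_id_gaussianReal]
    simp
  rw [integral_sub i3 i2, integral_sub i1 (integrable_const _), e]
  simp
  field_simp
  ring

/-- The displacement is `√h (c√h + σx)`, so the quadratic remainder over `h` stays bounded uniformly
for `h ≤ 1` by a Gaussian-integrable function. -/
theorem abs_remainder_div_le (hf : IsBoundedC2 f f' f'' B) {h : ℝ} (hh : 0 < h) (h1 : h ≤ 1)
    (y x : ℝ) :
    |(f (y + (c * h + σ * Real.sqrt h * x)) - f y - f' y * (c * h + σ * Real.sqrt h * x)) / h|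
      ≤ B * (|c| + |σ| * |x|) ^ 2 := by
  have hs := Real.sq_sqrt hh.le
  have hs0 := Real.sqrt_pos.2 hh
  rw [abs_div, abs_of_pos hh, div_le_iff₀ hh]
  refine (hf.abs_remainder_le y _).trans ?_
  rw [mul_assoc B]
  refine mul_le_mul_of_nonneg_left ?_ hf.nonneg
  have e : c * h + σ * Real.sqrt h * x = Real.sqrt h * (c * Real.sqrt h + σ * x) := by
    linear_combination (-c) * hs
  rw [e, mul_pow, hs, mul_comm h]
  refine mul_le_mul_of_nonneg_right ?_ hh.le
  rw [← sq_abs (c * Real.sqrt h + σ * x)]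
  refine pow_le_pow_left₀ (abs_nonneg _) ((abs_add_le _ _).trans ?_) 2
  rw [abs_mul, abs_mul, abs_of_pos hs0]
  have : Real.sqrt h ≤ 1 := Real.sqrt_le_one.2 h1
  have := mul_le_of_le_one_right (abs_nonneg c) this
  linarith

/-- The squared displacement divided by `h` tends to `(σx)²`, whose Gaussian mean is `σ²`. -/
theorem tendsto_integral_remainder (hf : IsBoundedC2 f f' f'' B) {h : ℕ → ℝ} (hh : ∀ n, 0 < h n)
    (h1 : ∀ n, h n ≤ 1) (hlim : Tendsto h atTop (𝓝 0)) (y : ℝ) :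
    Tendsto (fun n => ∫ x, (f (y + (c * h n + σ * Real.sqrt (h n) * x)) - f y
      - f' y * (c * h n + σ * Real.sqrt (h n) * x)) / h n ∂(gaussianReal 0 1)) atTop
      (𝓝 (σ ^ 2 / 2 * f'' y)) := by
  have hlim' : Tendsto (fun n => Real.sqrt (h n)) atTop (𝓝 0) := by
    simpa [Function.comp_def] using (Real.continuous_sqrt.tendsto 0).comp hlim
  have e : σ ^ 2 / 2 * f'' y = ∫ x, f'' y / 2 * (σ * x) ^ 2 ∂(gaussianReal 0 1) := by
    simp_rw [mul_pow]
    rw [integral_const_mul, integral_const_mul, integral_sq_gaussianReal]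
    ring
  rw [e]
  refine tendsto_integral_of_dominated_convergence (fun x => B * (|c| + |σ| * |x|) ^ 2) ?_ ?_ ?_ ?_
  · intro n
    refine Continuous.aestronglyMeasurable ?_
    have := hf.continuous
    exact (((this.comp (by fun_prop)).sub continuous_const).sub (by fun_prop)).div_const _
  · have : Integrable (fun x : ℝ => 2 * c ^ 2 + 2 * σ ^ 2 * x ^ 2) (gaussianReal 0 1) :=
      (integrable_const _).add (integrable_sq_gaussianReal.const_mul _)
    refine Integrable.const_mul (this.mono' (by fun_prop : Continuous _).aestronglyMeasurable
      (Eventually.of_forall fun x => ?_)) B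
    rw [Real.norm_of_nonneg (by positivity)]
    have a1 := sq_abs c
    have a2 := sq_abs σ
    have a3 := sq_abs x
    nlinarith [sq_nonneg (|c| - |σ| * |x|)]
  · exact fun n => Eventually.of_forall fun x => abs_remainder_div_le hf (hh n) (h1 n) y x
  · refine Eventually.of_forall fun x => ?_
    -- Continuous completion of the difference quotient, since the displacement may happen to be
    -- zero.
    set k : ℝ → ℝ := fun d => if d = 0 then f'' y / 2 else (f (y + d) - f y - f' y * d) / d ^ 2
      with hk
    have hkc : Tendsto k (𝓝 0) (𝓝 (f'' y / 2)) := by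
      rw [← nhdsNE_sup_pure (0 : ℝ)]
      refine Tendsto.sup ?_ ?_
      · refine (hf.tendsto_remainder y).congr' ?_
        filter_upwards [self_mem_nhdsWithin] with d hd
        rw [hk]
        simp only
        rw [if_neg (by simpa using hd)]
      · rw [tendsto_pure_left]
        intro s hs
        simpa [hk] using mem_of_mem_nhds hs
    have hD : Tendsto (fun n => c * h n + σ * Real.sqrt (h n) * x) atTop (𝓝 0) := by
      simpa using (hlim.const_mul c).add ((hlim'.const_mul σ).mul_const x)
    have hq : Tendsto (fun n => (c * Real.sqrt (h n) + σ * x) ^ 2) atTop (𝓝 ((σ * x) ^ 2)) := by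
      simpa using ((hlim'.const_mul c).add_const (σ * x)).pow 2
    refine ((hkc.comp hD).mul hq).congr fun n => ?_
    have hs := Real.sq_sqrt (hh n).le
    have hn := (hh n).ne'
    simp only [Function.comp, hk]
    set d := c * h n + σ * Real.sqrt (h n) * x with hd
    have ed : d ^ 2 = h n * (c * Real.sqrt (h n) + σ * x) ^ 2 := by
      have : d = Real.sqrt (h n) * (c * Real.sqrt (h n) + σ * x) := by
        rw [hd]; linear_combination (-c) * hs
      rw [this, mul_pow, hs]
    split_ifs with h0
    · have : (c * Real.sqrt (h n) + σ * x) ^ 2 = 0 := by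
        rw [h0] at ed
        have := ed.symm
        simpa [hn] using this
      rw [this, h0]
      simp
    · have h2 : d ^ 2 ≠ 0 := pow_ne_zero 2 h0
      rw [div_mul_eq_mul_div, div_eq_div_iff h2 hn, ed]
      ring

end Gaussian

section Limit

variable {ν : Measure ℝ} [IsFiniteMeasure ν] {f f' f'' : ℝ → ℝ} {B c σ : ℝ}

theorem integral_reflectedJumps {ν : Measure ℝ} (g : ℝ → ℝ) (hg : Continuous g) :
    ∫ x, g x ∂(reflectedJumps ν) = ∫ z in Set.Ioi (0 : ℝ), g (-z) ∂ν := by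
  rw [reflectedJumps, integral_map (by fun_prop) hg.aestronglyMeasurable]

theorem continuous_integral_jumps {g : ℝ → ℝ} (hg : Continuous g) (hB : ∀ x, |g x| ≤ B) :
    Continuous fun y => ∫ z in Set.Ioi (0 : ℝ), g (y - z) ∂ν := by
  refine continuous_of_dominated (bound := fun _ => B) ?_ ?_ (integrable_const _) ?_
  · exact fun y => (hg.comp (by fun_prop)).aestronglyMeasurable
  · exact fun y => Eventually.of_forall fun z => hB _
  · exact Eventually.of_forall fun z => hg.comp (by fun_prop)

theorem abs_integral_jumps_le {g : ℝ → ℝ} (hB : ∀ x, |g x| ≤ B) (y : ℝ) :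
    |∫ z in Set.Ioi (0 : ℝ), g (y - z) ∂ν| ≤ B * ν.real (Set.Ioi 0) := by
  have := norm_integral_le_of_norm_le_const (μ := ν.restrict (Set.Ioi 0))
    (f := fun z => g (y - z)) (Eventually.of_forall fun z => hB _)
  simpa [Measure.real] using this

/-- The first two Poisson terms: no jump gives the Brownian increment and the loss `e^{-λh} - 1`,
one jump gives the integral against `ν`; the rest is of order `h`. -/
theorem generator_increment (hf : IsBoundedC2 f f' f'' B) {h : ℝ} (hh : 0 < h) (y : ℝ) :
    ∃ r, |r| ≤ B * ν.real (Set.Ioi 0) ^ 2 * h ∧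
      (∫ x, f (y + x) ∂(poissonSum (driftGaussian c σ h) (reflectedJumps ν) h) - f y) / h
        = Real.exp (-(ν.real (Set.Ioi 0) * h)) * (c * f' y
            + ∫ x, (f (y + (c * h + σ * Real.sqrt h * x)) - f y
              - f' y * (c * h + σ * Real.sqrt h * x)) / h ∂(gaussianReal 0 1))
          + (Real.exp (-(ν.real (Set.Ioi 0) * h)) - 1) / h * f y
          + Real.exp (-(ν.real (Set.Ioi 0) * h))
            * (∫ x, (∫ z in Set.Ioi (0 : ℝ), f (y + (c * h + σ * Real.sqrt h * x) - z) ∂ν)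
                ∂(gaussianReal 0 1)) + r := by
  have key := abs_integral_poissonSum_sub_le (G := driftGaussian c σ h) (κ := reflectedJumps ν) hh.le
    (hf.comp_const_add y).continuous.measurable (hf.comp_const_add y).abs_le
  rw [real_reflectedJumps] at key
  set lam := ν.real (Set.Ioi 0) with hlam
  set P := ∫ x, f (y + x) ∂(poissonSum (driftGaussian c σ h) (reflectedJumps ν) h) with hP
  have eJ : ∫ x, ∫ w, f (y + (x + w)) ∂(reflectedJumps ν) ∂(driftGaussian c σ h)
      = ∫ x, (∫ z in Set.Ioi (0 : ℝ), f (y + (c * h + σ * Real.sqrt h * x) - z) ∂ν)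
                ∂(gaussianReal 0 1) := by
    have : ∀ x, ∫ w, f (y + (x + w)) ∂(reflectedJumps ν)
        = ∫ z in Set.Ioi (0 : ℝ), f (y + x - z) ∂ν := fun x => by
      rw [integral_reflectedJumps (fun w => f (y + (x + w))) (hf.continuous.comp (by fun_prop))]
      simp_rw [← sub_eq_add_neg, ← add_sub_assoc]
    simp_rw [this]
    exact integral_driftGaussian ((continuous_integral_jumps hf.continuous hf.abs_le).comp
      (continuous_const.add continuous_id)) h
  rw [eJ] at key
  rw [← integral_driftGaussian_sub_div hf hh y]
  set a := ∫ x, f (y + x) ∂(driftGaussian c σ h) with ha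
  set J := ∫ x, (∫ z in Set.Ioi (0 : ℝ), f (y + (c * h + σ * Real.sqrt h * x) - z) ∂ν)
                ∂(gaussianReal 0 1) with hJ
  refine ⟨(P - (Real.exp (-(lam * h)) * a + Real.exp (-(lam * h)) * h * J)) / h, ?_, ?_⟩
  · rw [abs_div, abs_of_pos hh, div_le_iff₀ hh]
    refine key.trans (le_of_eq (by ring))
  · field_simp
    ring

theorem abs_exp_sub_one_div_le {lam h : ℝ} (hl : 0 ≤ lam) (hh : 0 < h) :
    |(Real.exp (-(lam * h)) - 1) / h| ≤ lam := by
  have h1 := Real.add_one_le_exp (-(lam * h))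
  have h2 : Real.exp (-(lam * h)) ≤ 1 := Real.exp_le_one_iff.2 (by nlinarith)
  rw [abs_div, abs_of_pos hh, div_le_iff₀ hh, abs_of_nonpos (by linarith)]
  linarith

/-- Uniformity in `h` and `y` is what allows dominated convergence in Dynkin's formula. -/
theorem exists_generator_bound (hf : IsBoundedC2 f f' f'' B) : ∃ C, ∀ h, 0 < h → h ≤ 1 → ∀ y,
    |(∫ x, f (y + x) ∂(poissonSum (driftGaussian c σ h) (reflectedJumps ν) h) - f y) / h| ≤ C := by
  set lam := ν.real (Set.Ioi 0) with hlam
  have hl : 0 ≤ lam := measureReal_nonneg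
  set Q := ∫ x, B * (|c| + |σ| * |x|) ^ 2 ∂(gaussianReal 0 1) with hQ
  have hQi : Integrable (fun x => B * (|c| + |σ| * |x|) ^ 2) (gaussianReal 0 1) := by
    have : Integrable (fun x : ℝ => 2 * c ^ 2 + 2 * σ ^ 2 * x ^ 2) (gaussianReal 0 1) :=
      (integrable_const _).add (integrable_sq_gaussianReal.const_mul _)
    refine Integrable.const_mul (this.mono' (by fun_prop : Continuous _).aestronglyMeasurable
      (Eventually.of_forall fun x => ?_)) B
    rw [Real.norm_of_nonneg (by positivity)]
    have a1 := sq_abs c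
    have a2 := sq_abs σ
    have a3 := sq_abs x
    nlinarith [sq_nonneg (|c| - |σ| * |x|)]
  have hB := hf.nonneg
  refine ⟨(|c| * B + Q) + lam * B + B * lam + B * lam ^ 2, fun h hh h1 y => ?_⟩
  obtain ⟨r, hr, e⟩ := generator_increment (ν := ν) (c := c) (σ := σ) hf hh y
  rw [← hlam] at hr e
  rw [e]
  have hE0 := Real.exp_pos (-(lam * h))
  have hE1 : Real.exp (-(lam * h)) ≤ 1 := Real.exp_le_one_iff.2 (by nlinarith)
  have b1 : ‖∫ x, (f (y + (c * h + σ * Real.sqrt h * x)) - f y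
      - f' y * (c * h + σ * Real.sqrt h * x)) / h ∂(gaussianReal 0 1)‖ ≤ Q :=
    norm_integral_le_of_norm_le hQi
      (Eventually.of_forall fun x => abs_remainder_div_le hf hh h1 y x)
  have b2 : |c * f' y| ≤ |c| * B := by
    rw [abs_mul]; exact mul_le_mul_of_nonneg_left (hf.abs_le' y) (abs_nonneg c)
  have b3 : |∫ x, (∫ z in Set.Ioi (0 : ℝ), f (y + (c * h + σ * Real.sqrt h * x) - z) ∂ν)
      ∂(gaussianReal 0 1)| ≤ B * lam := by
    have := norm_integral_le_of_norm_le_const (μ := gaussianReal 0 1)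
      (f := fun x => ∫ z in Set.Ioi (0 : ℝ), f (y + (c * h + σ * Real.sqrt h * x) - z) ∂ν)
      (Eventually.of_forall fun x => abs_integral_jumps_le (ν := ν) hf.abs_le _)
    simpa using this
  have b4 : |(Real.exp (-(lam * h)) - 1) / h * f y| ≤ lam * B := by
    rw [abs_mul]
    exact mul_le_mul (abs_exp_sub_one_div_le hl hh) (hf.abs_le y) (abs_nonneg _) hl
  have b5 : |r| ≤ B * lam ^ 2 := hr.trans (mul_le_of_le_one_right (by positivity) h1)
  have m : ∀ u, |Real.exp (-(lam * h)) * u| ≤ |u| := fun u => by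
    rw [abs_mul, Real.abs_exp]; exact mul_le_of_le_one_left (abs_nonneg u) hE1
  refine (abs_add_le _ _).trans (add_le_add ((abs_add_le _ _).trans (add_le_add
    ((abs_add_le _ _).trans (add_le_add ((m _).trans ((abs_add_le _ _).trans (add_le_add b2 b1)))
      b4)) ((m _).trans b3))) b5)

theorem tendsto_generator (hf : IsBoundedC2 f f' f'' B) {h : ℕ → ℝ} (hh : ∀ n, 0 < h n)
    (h1 : ∀ n, h n ≤ 1) (hlim : Tendsto h atTop (𝓝 0)) (y : ℝ) :
    Tendsto (fun n => (∫ x, f (y + x) ∂(poissonSum (driftGaussian c σ (h n)) (reflectedJumps ν) (h n))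
      - f y) / h n) atTop (𝓝 (levyGenerator c σ ν f f' f'' y)) := by
  set lam := ν.real (Set.Ioi 0) with hlam
  choose r hr e using fun n => generator_increment (ν := ν) (c := c) (σ := σ) hf (hh n) y
  simp_rw [e]
  rw [← hlam]
  have hlim' : Tendsto (fun n => Real.sqrt (h n)) atTop (𝓝 0) := by
    simpa [Function.comp_def] using (Real.continuous_sqrt.tendsto 0).comp hlim
  have t1 : Tendsto (fun n => Real.exp (-(lam * h n))) atTop (𝓝 1) := by
    have := (Real.continuous_exp.tendsto _).comp (hlim.const_mul lam).neg
    simpa [Function.comp_def] using this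
  have t2 := tendsto_integral_remainder (c := c) (σ := σ) hf hh h1 hlim y
  have t3 : Tendsto (fun n => (Real.exp (-(lam * h n)) - 1) / h n) atTop (𝓝 (-lam)) := by
    have hd : HasDerivAt (fun t => Real.exp (-(lam * t))) (-lam) 0 := by
      have := ((hasDerivAt_id (0 : ℝ)).const_mul lam).neg.exp
      exact this.congr_deriv (by simp)
    have hw : Tendsto h atTop (𝓝[>] 0) :=
      tendsto_nhdsWithin_iff.2 ⟨hlim, Eventually.of_forall hh⟩
    refine (hd.tendsto_slope_zero_right.comp hw).congr fun n => ?_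
    simp
    ring
  have t4 : Tendsto (fun n => ∫ x, (∫ z in Set.Ioi (0 : ℝ),
      f (y + (c * h n + σ * Real.sqrt (h n) * x) - z) ∂ν) ∂(gaussianReal 0 1)) atTop
      (𝓝 (∫ z in Set.Ioi (0 : ℝ), f (y - z) ∂ν)) := by
    have hc := continuous_integral_jumps (ν := ν) hf.continuous hf.abs_le
    have e0 : ∫ z in Set.Ioi (0 : ℝ), f (y - z) ∂ν
        = ∫ _x, (∫ z in Set.Ioi (0 : ℝ), f (y - z) ∂ν) ∂(gaussianReal 0 1) := by simp
    rw [e0]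
    refine tendsto_integral_of_dominated_convergence (fun _ => B * lam) ?_ (integrable_const _) ?_ ?_
    · exact fun n => (hc.comp (by fun_prop)).aestronglyMeasurable
    · exact fun n => Eventually.of_forall fun x => abs_integral_jumps_le hf.abs_le _
    · refine Eventually.of_forall fun x => ?_
      have hD : Tendsto (fun n => y + (c * h n + σ * Real.sqrt (h n) * x)) atTop (𝓝 y) := by
        simpa using ((hlim.const_mul c).add ((hlim'.const_mul σ).mul_const x)).const_add y
      exact (hc.tendsto y).comp hD
  have t5 : Tendsto r atTop (𝓝 0) := by
    refine squeeze_zero_norm hr ?_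
    simpa using hlim.const_mul (B * lam ^ 2)
  have := (((t1.mul (t2.const_add (c * f' y))).add (t3.mul_const (f y))).add (t1.mul t4)).add t5
  refine this.congr' EventuallyEq.rfl |>.trans ?_
  refine le_of_eq ?_
  congr 1
  simp only [levyGenerator]
  rw [← hlam]
  ring

theorem continuous_levyGenerator (hf : IsBoundedC2 f f' f'' B) :
    Continuous (levyGenerator c σ ν f f' f'') := by
  have h1 := hf.continuous
  have h2 := hf.continuous'
  have h3 := hf.continuous''
  have h4 := continuous_integral_jumps (ν := ν) h1 hf.abs_le
  unfold levyGenerator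
  fun_prop

end Limit

/-! ### Path properties: measurability, surplus equation, ruin time. -/

/-- The smallest multiple of `1 / (n + 1)` exceeding `t`. -/
def gridAbove (n : ℕ) (t : ℝ≥0) : ℝ≥0 :=
  ((⌊((n : ℝ≥0) + 1) * t⌋₊ : ℝ≥0) + 1) / ((n : ℝ≥0) + 1)

theorem le_gridAbove (n : ℕ) (t : ℝ≥0) : t ≤ gridAbove n t := by
  have hn : (0 : ℝ≥0) < (n : ℝ≥0) + 1 := by positivity
  rw [gridAbove, le_div_iff₀ hn, mul_comm]
  exact (Nat.lt_floor_add_one _).le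

theorem gridAbove_le (n : ℕ) (t : ℝ≥0) : gridAbove n t ≤ t + 1 / ((n : ℝ≥0) + 1) := by
  have hn : (0 : ℝ≥0) < (n : ℝ≥0) + 1 := by positivity
  have e : (t + 1 / ((n : ℝ≥0) + 1)) * ((n : ℝ≥0) + 1) = ((n : ℝ≥0) + 1) * t + 1 := by
    rw [add_mul t, one_div, inv_mul_cancel₀ hn.ne', mul_comm t]
  rw [gridAbove, div_le_iff₀ hn, e]
  exact add_le_add (Nat.floor_le zero_le) le_rfl

theorem tendsto_gridAbove (t : ℝ≥0) : Tendsto (fun n => gridAbove n t) atTop (𝓝[≥] t) := by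
  refine tendsto_nhdsWithin_iff.2 ⟨?_, Eventually.of_forall fun n => le_gridAbove n t⟩
  refine tendsto_of_tendsto_of_tendsto_of_le_of_le tendsto_const_nhds ?_
    (fun n => le_gridAbove n t) (fun n => gridAbove_le n t)
  have : Tendsto (fun n : ℕ => 1 / ((n : ℝ≥0) + 1)) atTop (𝓝 0) := by
    rw [← NNReal.tendsto_coe]
    simpa using tendsto_one_div_add_atTop_nhds_zero_nat (𝕜 := ℝ)
  simpa using this.const_add t

theorem measurable_gridAbove (n : ℕ) : Measurable (gridAbove n) := by
  have h2 : Measurable fun t : ℝ≥0 => ⌊((n : ℝ≥0) + 1) * t⌋₊ :=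
    Nat.measurable_floor.comp (measurable_id.const_mul _)
  exact (measurable_from_nat (f := fun k : ℕ => ((k : ℝ≥0) + 1) / ((n : ℝ≥0) + 1))).comp h2

theorem countable_range_gridAbove (n : ℕ) : (Set.range (gridAbove n)).Countable := by
  refine (Set.countable_range fun k : ℕ => ((k : ℝ≥0) + 1) / ((n : ℝ≥0) + 1)).mono ?_
  rintro _ ⟨t, rfl⟩
  exact ⟨_, rfl⟩

theorem measurable_comp_of_countable_range {Ω : Type*} [MeasurableSpace Ω] {Z : ℝ≥0 → Ω → ℝ}
    (hm : ∀ t, Measurable (Z t)) {T : ℝ≥0 → ℝ≥0} (hT : Measurable T) (hc : (Set.range T).Countable) :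
    Measurable fun p : ℝ≥0 × Ω => Z (T p.1) p.2 := by
  intro A hA
  have : (fun p : ℝ≥0 × Ω => Z (T p.1) p.2) ⁻¹' A
      = ⋃ t ∈ Set.range T, (T ⁻¹' {t}) ×ˢ (Z t ⁻¹' A) := by
    ext p
    simp only [Set.mem_preimage, Set.mem_iUnion, Set.mem_prod, Set.mem_singleton_iff, exists_prop,
      Set.mem_range, exists_exists_eq_and]
    exact ⟨fun h => ⟨p.1, rfl, h⟩, fun ⟨t, h1, h2⟩ => by rwa [h1]⟩
  rw [this]
  exact MeasurableSet.biUnion hc fun t _ => (hT (measurableSet_singleton t)).prod (hm t hA)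

/-- A right-continuous process is jointly measurable. -/
theorem measurable_uncurry_of_rightContinuous {Ω : Type*} [MeasurableSpace Ω] {Z : ℝ≥0 → Ω → ℝ}
    (hm : ∀ t, Measurable (Z t))
    (hc : ∀ ω t, ContinuousWithinAt (fun s => Z s ω) (Set.Ici t) t) :
    Measurable fun p : ℝ≥0 × Ω => Z p.1 p.2 := by
  refine measurable_of_tendsto_metrizable (f := fun n (p : ℝ≥0 × Ω) => Z (gridAbove n p.1) p.2)
    (fun n => measurable_comp_of_countable_range hm (measurable_gridAbove n)
      (countable_range_gridAbove n)) (tendsto_pi_nhds.2 fun p => ?_)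
  exact Tendsto.comp (f := fun n => gridAbove n p.1) (g := fun s => Z s p.2)
      (hc p.2 p.1) (tendsto_gridAbove p.1)

theorem measurable_of_rightContinuous {u : ℝ≥0 → ℝ}
    (hc : ∀ t, ContinuousWithinAt u (Set.Ici t) t) : Measurable u :=
  (measurable_uncurry_of_rightContinuous (Ω := Unit) (Z := fun t _ => u t)
    (fun _ => measurable_const) fun _ t => hc t).comp (measurable_id.prodMk (measurable_const (a := ())))

theorem intervalIntegrable_of_bound {a : ℝ → ℝ} (hm : Measurable a) {B : ℝ}
    (hB : ∀ s, |a s| ≤ B) (r s : ℝ) : IntervalIntegrable a volume r s := by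
  rw [intervalIntegrable_iff]
  exact Measure.integrableOn_of_bounded (M := B) (by simp [Set.uIoc]) hm.aestronglyMeasurable
    (Eventually.of_forall hB)

/-- The rate at which dividends are paid along the path `u`. -/
def dividendRate (δ b : ℝ) (u : ℝ≥0 → ℝ) (s : ℝ) : ℝ := if b < u s.toNNReal then δ else 0

theorem dividendRate_nonneg {δ : ℝ} (hδ : 0 < δ) (b : ℝ) (u : ℝ≥0 → ℝ) (s : ℝ) :
    0 ≤ dividendRate δ b u s := by
  unfold dividendRate; split_ifs <;> linarith

theorem dividendRate_le {δ : ℝ} (hδ : 0 < δ) (b : ℝ) (u : ℝ≥0 → ℝ) (s : ℝ) :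
    dividendRate δ b u s ≤ δ := by
  unfold dividendRate; split_ifs <;> linarith

/-- The path properties of the surplus process under the threshold strategy. -/
structure ThresholdPath (δ b x : ℝ) (X u : ℝ≥0 → ℝ) : Prop where
  start : u 0 = x
  right_cont : ∀ t, ContinuousWithinAt u (Set.Ici t) t
  increment : ∀ s h : ℝ≥0, u (s + h) = u s + (X (s + h) - X s)
    - ∫ r in (s : ℝ)..((s : ℝ) + h), dividendRate δ b u r

theorem ThresholdPath.measurable {δ b x : ℝ} {X u : ℝ≥0 → ℝ} (h : ThresholdPath δ b x X u) :
    Measurable u := measurable_of_rightContinuous h.right_cont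

theorem measurable_dividendRate {δ b : ℝ} {u : ℝ≥0 → ℝ} (h : Measurable u) :
    Measurable (dividendRate δ b u) :=
  Measurable.ite (measurableSet_lt measurable_const (h.comp measurable_real_toNNReal))
    measurable_const measurable_const

theorem intervalIntegrable_dividendRate {δ b : ℝ} (hδ : 0 < δ) {u : ℝ≥0 → ℝ} (h : Measurable u)
    (s t : ℝ) : IntervalIntegrable (dividendRate δ b u) volume s t := by
  refine intervalIntegrable_of_bound (B := δ) (measurable_dividendRate h) (fun r => ?_) s t
  rw [abs_of_nonneg (dividendRate_nonneg hδ b u r)]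
  exact dividendRate_le hδ b u r

/-- Measurability of the path is not assumed, so the dividend integral in its equation could be the
default value `0` of a non-integrable function. It must first be shown that `u` is measurable;
right-continuity and the increment equation then follow. -/
theorem ThresholdPath.of_eq {δ b x : ℝ} (hδ : 0 < δ) {X u : ℝ≥0 → ℝ} (h0 : X 0 = 0)
    (hX : ∀ t, ContinuousWithinAt X (Set.Ici t) t)
    (hu : ∀ t : ℝ≥0, u t = x + X t - ∫ s in (0 : ℝ)..t, dividendRate δ b u s) :
    ThresholdPath δ b x X u := by
  set g := dividendRate δ b u with hg
  have hg0 := dividendRate_nonneg hδ b u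
  set I : ℝ≥0 → ℝ := fun t => ∫ s in (0 : ℝ)..t, g s with hI
  have hI0 : ∀ t, 0 ≤ I t := fun t =>
    intervalIntegral.integral_nonneg t.2 fun s _ => hg0 s
  have hIm : Measurable I := by
    refine measurable_of_Ioi fun a => ?_
    rcases lt_or_ge a 0 with ha | ha
    · have : I ⁻¹' Set.Ioi a = Set.univ := Set.eq_univ_of_forall fun t => lt_of_lt_of_le ha (hI0 t)
      rw [this]
      exact MeasurableSet.univ
    -- A value above `a ≥ 0` is nonzero, hence the integral up to that time genuinely exists and is
    -- monotone before it. Superlevel sets are therefore order-connected, so measurable.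
    · refine Set.OrdConnected.measurableSet ⟨fun t₁ h₁ t₂ h₂ t ht => ?_⟩
      have h₁' : a < I t₁ := h₁
      have h₂' : a < I t₂ := h₂
      have hint : IntervalIntegrable g volume 0 t₂ := by
        by_contra hn
        have : I t₂ = 0 := intervalIntegral.integral_undef hn
        linarith
      have ht' : (t : ℝ) ≤ t₂ := ht.2
      have hint' : IntervalIntegrable g volume 0 t := by
        refine hint.mono_set ?_
        rw [Set.uIcc_of_le t.coe_nonneg, Set.uIcc_of_le t₂.coe_nonneg]
        exact Set.Icc_subset_Icc_right ht'
      have : I t₁ ≤ I t :=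
        intervalIntegral.integral_mono_interval le_rfl t₁.2 ht.1 (Eventually.of_forall hg0) hint'
      exact lt_of_lt_of_le h₁' this
  have hum : Measurable u := by
    have : u = fun t => x + X t - I t := funext hu
    rw [this]
    exact ((measurable_of_rightContinuous hX).const_add x).sub hIm
  have hint := intervalIntegrable_dividendRate (b := b) hδ hum
  have hIc : Continuous I := by
    have h1 : Continuous fun t : ℝ => ∫ s in (0 : ℝ)..t, g s :=
      intervalIntegral.continuous_primitive hint 0
    exact h1.comp NNReal.continuous_coe
  refine ⟨?_, fun t => ?_, fun s h => ?_⟩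
  · rw [hu 0, h0]; simp
  · have : u = fun t => x + X t - I t := funext hu
    rw [this]
    exact (continuousWithinAt_const.add (hX t)).sub hIc.continuousWithinAt
  · rw [hu (s + h), hu s, ← intervalIntegral.integral_add_adjacent_intervals (hint 0 s)
      (hint s ((s + h : ℝ≥0) : ℝ))]
    push_cast
    ring

theorem IsThresholdSurplus.ae_thresholdPath {Ω : Type*} {mΩ : MeasurableSpace Ω} {P : Measure Ω}
    {𝓕 : Filtration ℝ≥0 mΩ} {γ σ : ℝ} {ν : Measure ℝ} {X : ℝ≥0 → Ω → ℝ} {δ b x : ℝ} (hδ : 0 < δ)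
    (hX : IsSpectrallyNegativeLevy P 𝓕 γ σ ν X) {U : ℝ≥0 → Ω → ℝ}
    (hU : IsThresholdSurplus P 𝓕 X δ b x U) :
    ∀ᵐ ω ∂P, ThresholdPath δ b x (fun t => X t ω) (fun t => U t ω) := by
  filter_upwards [hX.zero, hX.right_cont, hU.eq] with ω h0 hr he
  exact ThresholdPath.of_eq hδ h0 hr he

/-- The path `u` has not been ruined strictly before time `s`. -/
def Alive (u : ℝ≥0 → ℝ) (s : ℝ) : Prop := ∀ r : ℚ, 0 < (r : ℝ) → (r : ℝ) < s → 0 ≤ u (r : ℝ).toNNReal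

/-- A path negative at `t` stays negative just after `t`, hence at a rational time before `s`. The
reduction to rational times makes the event measurable with respect to the information at time `s`.
-/
theorem alive_iff {u : ℝ≥0 → ℝ} (hc : ∀ t, ContinuousWithinAt u (Set.Ici t) t) {s : ℝ} : Alive u s ↔ ENNReal.ofReal s ≤ ruinTime u := by
  constructor
  · intro h
    refine le_iInf₂ fun t ht => ?_
    by_contra hlt
    rw [not_le] at hlt
    have hts : (t : ℝ) < s := by
      have : t < s.toNNReal := ENNReal.coe_lt_coe.1 hlt
      exact (Real.lt_toNNReal_iff_coe_lt).1 this
    have hev : ∀ᶠ r in 𝓝[≥] t, u r < 0 := (hc t).eventually_lt_const ht.2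
    rw [eventually_nhdsWithin_iff, Metric.eventually_nhds_iff] at hev
    obtain ⟨ε, hε, hev⟩ := hev
    obtain ⟨r, hr1, hr2⟩ := exists_rat_btwn (lt_min hts (lt_add_of_pos_right (t : ℝ) hε))
    have hr0 : 0 < (r : ℝ) := lt_of_le_of_lt t.2 hr1
    have h1 := h r hr0 (hr2.trans_le (min_le_left _ _))
    have h2 : (((r : ℝ).toNNReal : ℝ≥0) : ℝ) = r := Real.coe_toNNReal _ hr0.le
    have h3 := hev (y := (r : ℝ).toNNReal) (by
      rw [NNReal.dist_eq, h2, abs_of_pos (sub_pos.2 hr1)]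
      linarith [hr2.trans_le (min_le_right _ _)]) (by
      rw [Set.mem_Ici, ← NNReal.coe_le_coe, h2]
      exact hr1.le)
    linarith
  · intro h r hr0 hrs
    by_contra hn
    rw [not_le] at hn
    have h1 : ruinTime u ≤ ((r : ℝ).toNNReal : ℝ≥0∞) :=
      iInf₂_le _ ⟨Real.toNNReal_pos.2 hr0, hn⟩
    have h2 := h.trans h1
    have h3 : s ≤ r := by
      rw [ENNReal.ofReal, ENNReal.coe_le_coe, Real.toNNReal_le_toNNReal_iff hr0.le] at h2
      exact h2
    linarith

theorem nonneg_of_lt_ruinTime {u : ℝ≥0 → ℝ} {s : ℝ≥0} (hs : 0 < s) (h : (s : ℝ≥0∞) < ruinTime u) :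
    0 ≤ u s := by
  by_contra hn
  rw [not_le] at hn
  exact absurd h (not_lt.2 (iInf₂_le s ⟨hs, hn⟩))

/-- Positivity at the ruin time would persist to the right and postpone ruin. Hence ruin occurs
either at level `0` or strictly below. -/
theorem apply_ruinTime_nonpos {u : ℝ≥0 → ℝ} (hc : ∀ t, ContinuousWithinAt u (Set.Ici t) t)
    (h : ruinTime u < ⊤) : u (ruinTime u).toNNReal ≤ 0 := by
  by_contra hn
  rw [not_le] at hn
  set t := (ruinTime u).toNNReal with ht
  have hte : (t : ℝ≥0∞) = ruinTime u := ENNReal.coe_toNNReal h.ne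
  have hev : ∀ᶠ r in 𝓝[≥] t, 0 < u r := (hc t).eventually_const_lt hn
  rw [eventually_nhdsWithin_iff, Metric.eventually_nhds_iff] at hev
  obtain ⟨ε, hε, hev⟩ := hev
  have hlt : ruinTime u < ((t + ε.toNNReal : ℝ≥0) : ℝ≥0∞) := by
    rw [← hte]
    exact_mod_cast lt_add_of_pos_right t (Real.toNNReal_pos.2 hε)
  rw [ruinTime, iInf_lt_iff] at hlt
  obtain ⟨r, hr⟩ := hlt
  rw [iInf_lt_iff] at hr
  obtain ⟨⟨hr0, hru⟩, hr⟩ := hr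
  have hr1 : t ≤ r := by
    have : ruinTime u ≤ r := iInf₂_le r ⟨hr0, hru⟩
    rw [← hte] at this
    exact_mod_cast this
  have hr2 : r < t + ε.toNNReal := by exact_mod_cast hr
  have := hev (y := r) (by
    rw [NNReal.dist_eq, abs_of_nonneg (sub_nonneg.2 (NNReal.coe_le_coe.2 hr1))]
    have : (r : ℝ) < t + ε.toNNReal := by exact_mod_cast hr2
    rw [Real.coe_toNNReal _ hε.le] at this
    linarith) hr1
  linarith

/-! ### Dynkin's formula up to ruin. -/

section ExitIntegral

theorem tendsto_average_right {a : ℝ → ℝ} (hm : Measurable a) {B : ℝ} (hB : ∀ s, |a s| ≤ B) {t : ℝ}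
    (hc : ContinuousWithinAt a (Set.Ici t) t) {h : ℕ → ℝ} (hh : ∀ n, 0 < h n)
    (hlim : Tendsto h atTop (𝓝 0)) :
    Tendsto (fun n => (h n)⁻¹ * ∫ s in t..(t + h n), a s) atTop (𝓝 (a t)) := by
  have hint := intervalIntegrable_of_bound hm hB
  have hd : HasDerivWithinAt (fun u => ∫ s in t..u, a s) (a t) (Set.Ici t) t :=
    intervalIntegral.integral_hasDerivWithinAt_right (hint t t)
      (t := Set.Ioi t) ⟨Set.univ, univ_mem, hm.aestronglyMeasurable⟩
      (hc.mono Set.Ioi_subset_Ici_self)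
  rw [hasDerivWithinAt_iff_tendsto_slope, Set.Ici_sdiff_left] at hd
  have hw : Tendsto (fun n => t + h n) atTop (𝓝[>] t) :=
    tendsto_nhdsWithin_iff.2 ⟨by simpa using hlim.const_add t,
      Eventually.of_forall fun n => by simpa using hh n⟩
  refine (hd.comp hw).congr fun n => ?_
  simp [slope_def_field, div_eq_inv_mul]

/-- The difference quotients of the integral of `a` up to `τ`. -/
theorem exit_integral {a : ℝ → ℝ} (hm : Measurable a) {B q : ℝ} (hq : 0 < q)
    (hB : ∀ s, 0 ≤ s → |a s| ≤ B * Real.exp (-q * s)) (hB' : ∀ s, |a s| ≤ B)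
    (h0 : ContinuousWithinAt a (Set.Ici 0) 0) (τ : ℝ≥0∞)
    (hτ : τ < ⊤ → ContinuousWithinAt a (Set.Ici τ.toReal) τ.toReal) :
    (∀ h, 0 < h → |h⁻¹ * ∫ s in {s : ℝ | 0 ≤ s ∧ ENNReal.ofReal s ≤ τ}, (a (s + h) - a s)| ≤ 2 * B) ∧
    ∀ h : ℕ → ℝ, (∀ n, 0 < h n) → Tendsto h atTop (𝓝 0) →
      Tendsto (fun n => (h n)⁻¹ * ∫ s in {s : ℝ | 0 ≤ s ∧ ENNReal.ofReal s ≤ τ},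
        (a (s + h n) - a s)) atTop (𝓝 ((if τ < ⊤ then a τ.toReal else 0) - a 0)) := by
  have hint := intervalIntegrable_of_bound hm hB'
  have hav : ∀ t h, 0 < h → |h⁻¹ * ∫ s in t..(t + h), a s| ≤ B := fun t h hh => by
    have := intervalIntegral.norm_integral_le_of_norm_le_const (a := t) (b := t + h)
      (f := a) (fun s _ => hB' s)
    rw [Real.norm_eq_abs, add_sub_cancel_left, abs_of_pos hh] at this
    rw [abs_mul, abs_of_pos (inv_pos.2 hh), inv_mul_le_iff₀ hh]
    linarith
  have hB0 : 0 ≤ B := (abs_nonneg _).trans (hB' 0)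
  rcases eq_or_ne τ ⊤ with rfl | hτt
  · have hset : {s : ℝ | 0 ≤ s ∧ ENNReal.ofReal s ≤ ⊤} = Set.Ici 0 := by ext s; simp
    have hai : IntegrableOn a (Set.Ioi 0) := by
      refine Integrable.mono' ((exp_neg_integrableOn_Ioi 0 hq).const_mul B)
        hm.aestronglyMeasurable ?_
      filter_upwards [ae_restrict_mem measurableSet_Ioi] with s hs
      exact hB s (le_of_lt hs)
    -- Translation by `h` cancels everything except the initial stretch; with no ruin the
    -- discounting leaves nothing at infinity.
    have key : ∀ h > 0, ∫ s in {s : ℝ | 0 ≤ s ∧ ENNReal.ofReal s ≤ ⊤}, (a (s + h) - a s)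
        = -∫ s in (0 : ℝ)..(0 + h), a s := fun h hh => by
      have hfun : (Set.Ioi (0 : ℝ)).indicator (fun s => a (s + h))
          = fun s => (Set.Ioi h).indicator a (s + h) := by
        funext s
        simp [Set.indicator_apply]
      have e1 : ∫ s in Set.Ioi (0 : ℝ), a (s + h) = ∫ s in Set.Ioi h, a s := by
        rw [← integral_indicator measurableSet_Ioi, ← integral_indicator measurableSet_Ioi, hfun]
        exact integral_add_right_eq_self _ h
      have i1 : IntegrableOn (fun s => a (s + h)) (Set.Ioi 0) := by
        rw [← integrable_indicator_iff measurableSet_Ioi, hfun]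
        exact ((integrable_indicator_iff measurableSet_Ioi).2
          (hai.mono_set (Set.Ioi_subset_Ioi hh.le))).comp_add_right h
      rw [hset, integral_Ici_eq_integral_Ioi, integral_sub i1 hai, e1, zero_add,
        intervalIntegral.integral_of_le hh.le, ← Set.Ioc_union_Ioi_eq_Ioi hh.le,
        setIntegral_union (Set.Ioc_disjoint_Ioi le_rfl) measurableSet_Ioi
          (hai.mono_set Set.Ioc_subset_Ioi_self) (hai.mono_set (Set.Ioi_subset_Ioi hh.le))]
      ring
    refine ⟨fun h hh => ?_, fun h hh hlim => ?_⟩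
    · rw [key h hh, mul_neg, abs_neg]
      linarith [hav 0 h hh]
    · have := (tendsto_average_right hm hB' h0 hh hlim).neg
      simp only [lt_self_iff_false, if_false, zero_sub]
      refine this.congr fun n => ?_
      rw [key _ (hh n), mul_neg]
  · set T := τ.toReal with hT
    have hT0 : 0 ≤ T := ENNReal.toReal_nonneg
    have hset : {s : ℝ | 0 ≤ s ∧ ENNReal.ofReal s ≤ τ} = Set.Icc 0 T := by
      ext s
      rw [Set.mem_ofPred_eq, Set.mem_Icc]
      exact and_congr_right fun hs => ENNReal.ofReal_le_iff_le_toReal hτt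
    -- The same cancellation leaves two stretches of length `h`, after `τ` and after `0`, so
    -- right-continuity at these times suffices.
    have key : ∀ h > 0, ∫ s in {s : ℝ | 0 ≤ s ∧ ENNReal.ofReal s ≤ τ}, (a (s + h) - a s)
        = (∫ s in T..(T + h), a s) - ∫ s in (0 : ℝ)..(0 + h), a s := fun h hh => by
      have i1 : IntervalIntegrable (fun s => a (s + h)) volume 0 T := by
        have := (hint (0 + h) (T + h)).comp_add_right h
        simpa using this
      rw [hset, integral_Icc_eq_integral_Ioc, ← intervalIntegral.integral_of_le hT0,
        intervalIntegral.integral_sub i1 (hint 0 T), intervalIntegral.integral_comp_add_right]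
      have e1 := intervalIntegral.integral_add_adjacent_intervals (hint 0 T) (hint T (T + h))
      have e2 := intervalIntegral.integral_add_adjacent_intervals (hint 0 (0 + h))
        (hint (0 + h) (T + h))
      linarith
    refine ⟨fun h hh => ?_, fun h hh hlim => ?_⟩
    · rw [key h hh, mul_sub]
      refine (abs_sub _ _).trans ?_
      linarith [hav 0 h hh, hav T h hh]
    · have hlt : τ < ⊤ := lt_top_iff_ne_top.2 hτt
      rw [if_pos hlt]
      refine ((tendsto_average_right hm hB' (hτ hlt) hh hlim).sub
        (tendsto_average_right hm hB' h0 hh hlim)).congr fun n => ?_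
      rw [key _ (hh n), mul_sub]

end ExitIntegral

section Product

variable {Ω : Type*} {mΩ : MeasurableSpace Ω} {P : Measure Ω} [IsProbabilityMeasure P]

theorem integrable_prod_of_abs_le_exp {F : ℝ × Ω → ℝ} (hF : Measurable F) {q C : ℝ} (hq : 0 < q)
    (hb : ∀ᵐ ω ∂P, ∀ s > 0, |F (s, ω)| ≤ C * Real.exp (-q * s)) :
    Integrable F ((volume.restrict (Set.Ioi 0)).prod P) := by
  have h1 : Integrable (fun p : ℝ × Ω => C * Real.exp (-q * p.1) * 1)
      ((volume.restrict (Set.Ioi 0)).prod P) :=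
    Integrable.mul_prod ((exp_neg_integrableOn_Ioi 0 hq).const_mul C) (integrable_const (1 : ℝ))
  refine h1.mono' hF.aestronglyMeasurable ?_
  have ha : ∀ᵐ p ∂((volume.restrict (Set.Ioi (0 : ℝ))).prod P), p.1 ∈ Set.Ioi (0 : ℝ) :=
    Measure.quasiMeasurePreserving_fst.ae (ae_restrict_mem measurableSet_Ioi)
  have hb' : ∀ᵐ p ∂((volume.restrict (Set.Ioi (0 : ℝ))).prod P),
      ∀ s > 0, |F (s, p.2)| ≤ C * Real.exp (-q * s) :=
    Measure.quasiMeasurePreserving_snd.ae hb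
  filter_upwards [ha, hb'] with p hp1 hp2
  rw [mul_one]
  exact hp2 p.1 hp1

/-- Dominated convergence on the product, with pointwise convergence along almost every path. -/
theorem tendsto_integral_prod {F : ℕ → ℝ × Ω → ℝ} {L : Ω → ℝ → ℝ} (hF : ∀ n, Measurable (F n))
    {q C : ℝ} (hq : 0 < q)
    (hb : ∀ᵐ ω ∂P, ∀ n, ∀ s > 0, |F n (s, ω)| ≤ C * Real.exp (-q * s))
    (hl : ∀ᵐ ω ∂P, ∀ᵐ s ∂(volume.restrict (Set.Ioi (0 : ℝ))),
      Tendsto (fun n => F n (s, ω)) atTop (𝓝 (L ω s))) :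
    Integrable (fun ω => ∫ s in Set.Ioi (0 : ℝ), L ω s) P ∧
    Tendsto (fun n => ∫ p, F n p ∂((volume.restrict (Set.Ioi 0)).prod P)) atTop
      (𝓝 (∫ ω, (∫ s in Set.Ioi (0 : ℝ), L ω s) ∂P)) := by
  have hexp : IntegrableOn (fun s : ℝ => C * Real.exp (-q * s)) (Set.Ioi 0) :=
    (exp_neg_integrableOn_Ioi 0 hq).const_mul C
  have hi : ∀ n, Integrable (F n) ((volume.restrict (Set.Ioi 0)).prod P) := fun n =>
    integrable_prod_of_abs_le_exp (hF n) hq (hb.mono fun ω h => h n)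
  have hin : ∀ᵐ ω ∂P, ∀ n, |∫ s in Set.Ioi (0 : ℝ), F n (s, ω)|
      ≤ ∫ s in Set.Ioi (0 : ℝ), C * Real.exp (-q * s) := by
    filter_upwards [hb] with ω hω n
    rw [← Real.norm_eq_abs]
    refine norm_integral_le_of_norm_le hexp ?_
    filter_upwards [ae_restrict_mem measurableSet_Ioi] with s hs
    exact hω n s hs
  have hlim : ∀ᵐ ω ∂P, Tendsto (fun n => ∫ s in Set.Ioi (0 : ℝ), F n (s, ω)) atTop
      (𝓝 (∫ s in Set.Ioi (0 : ℝ), L ω s)) := by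
    filter_upwards [hb, hl] with ω h1 h2
    refine tendsto_integral_of_dominated_convergence (fun s => C * Real.exp (-q * s)) ?_ hexp ?_ h2
    · exact fun n => ((hF n).comp (measurable_id.prodMk measurable_const)).aestronglyMeasurable
    · intro n
      filter_upwards [ae_restrict_mem measurableSet_Ioi] with s hs
      exact h1 n s hs
  have hmeas : ∀ n, AEStronglyMeasurable (fun ω => ∫ s in Set.Ioi (0 : ℝ), F n (s, ω)) P := fun n =>
    (hi n).integral_prod_right.aestronglyMeasurable
  refine ⟨?_, ?_⟩
  · refine Integrable.of_bound (C := ∫ s in Set.Ioi (0 : ℝ), C * Real.exp (-q * s))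
      (aestronglyMeasurable_of_tendsto_ae atTop hmeas hlim) ?_
    filter_upwards [hin, hlim] with ω h1 h2
    exact le_of_tendsto h2.norm (Eventually.of_forall h1)
  · simp_rw [fun n => integral_prod_symm _ (hi n)]
    exact tendsto_integral_of_dominated_convergence
      (fun _ => ∫ s in Set.Ioi (0 : ℝ), C * Real.exp (-q * s)) hmeas (integrable_const _)
      (fun n => hin.mono fun ω h => h n) hlim

end Product

section Version

variable {Ω : Type*} {mΩ : MeasurableSpace Ω} {P : Measure Ω}

/-- A process with almost surely right-continuous paths has a jointly measurable version. -/
theorem exists_measurable_version {Y : ℝ≥0 → Ω → ℝ} (hm : ∀ t, Measurable (Y t))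
    (hc : ∀ᵐ ω ∂P, ∀ t, ContinuousWithinAt (fun s => Y s ω) (Set.Ici t) t) :
    ∃ Z : ℝ≥0 → Ω → ℝ, Measurable (fun p : ℝ≥0 × Ω => Z p.1 p.2) ∧
      (∀ ω t, ContinuousWithinAt (fun s => Z s ω) (Set.Ici t) t) ∧ ∀ᵐ ω ∂P, ∀ t, Z t ω = Y t ω := by
  set N := toMeasurable P {ω | ¬ ∀ t, ContinuousWithinAt (fun s => Y s ω) (Set.Ici t) t} with hN
  have hN0 : P N = 0 := by rw [hN, measure_toMeasurable]; exact hc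
  have hNm : MeasurableSet N := measurableSet_toMeasurable _ _
  set Z : ℝ≥0 → Ω → ℝ := fun t => Nᶜ.indicator (Y t) with hZ
  have hZc : ∀ ω t, ContinuousWithinAt (fun s => Z s ω) (Set.Ici t) t := by
    intro ω t
    by_cases hω : ω ∈ N
    · have : (fun s => Z s ω) = fun _ => 0 := by
        funext s
        simp [hZ, hω]
      rw [this]
      exact continuousWithinAt_const
    · have e : (fun s => Z s ω) = fun s => Y s ω := by
        funext s
        simp [hZ, hω]
      rw [e]
      by_contra hn
      exact hω (subset_toMeasurable P _ fun h => hn (h t))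
  refine ⟨Z, measurable_uncurry_of_rightContinuous (fun t => (hm t).indicator hNm.compl) hZc, hZc,
    ?_⟩
  have : ∀ᵐ ω ∂P, ω ∉ N := measure_eq_zero_iff_ae_notMem.1 hN0
  filter_upwards [this] with ω hω t
  simp [hZ, hω]

end Version

section Increment

variable {Ω : Type*} {mΩ : MeasurableSpace Ω} {P : Measure Ω} [IsProbabilityMeasure P]
  {𝓕 : Filtration ℝ≥0 mΩ} {γ σ : ℝ} {ν : Measure ℝ} {X : ℝ≥0 → Ω → ℝ}

theorem IsSpectrallyNegativeLevy.map_increment [IsFiniteMeasure ν]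
    (hX : IsSpectrallyNegativeLevy P 𝓕 γ σ ν X) (s h : ℝ≥0) :
    P.map (fun ω => X (s + h) ω - X s ω)
      = poissonSum (driftGaussian (γ + ∫ z in Set.Ioo (0 : ℝ) 1, z ∂ν) σ h) (reflectedJumps ν) h := by
  have hm : Measurable (X h) := (hX.adapted h).mono (𝓕.le h) le_rfl
  have := Measure.isProbabilityMeasure_map (μ := P) hm.aemeasurable
  rw [(hX.stationary s h).map_eq]
  refine eq_poissonSum_of_laplace h.2 fun θ hθ => ?_
  rw [integral_map hm.aemeasurable (by fun_prop : Continuous _).aestronglyMeasurable]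
  exact hX.laplace h θ hθ

/-- Averaging over an increment that is independent of the past. -/
theorem IsSpectrallyNegativeLevy.integral_increment [IsFiniteMeasure ν]
    (hX : IsSpectrallyNegativeLevy P 𝓕 γ σ ν X) (s h : ℝ≥0) {Y : Ω → ℝ} (hY : Measurable[𝓕 s] Y)
    {E : Set Ω} (hE : MeasurableSet[𝓕 s] E) {f : ℝ → ℝ} (hf : Continuous f) {B : ℝ}
    (hB : ∀ x, |f x| ≤ B) :
    ∫ ω, E.indicator (fun ω => f (Y ω + (X (s + h) ω - X s ω))) ω ∂P
      = ∫ ω, E.indicator (fun ω => ∫ d, f (Y ω + d) ∂(poissonSum (driftGaussian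
        (γ + ∫ z in Set.Ioo (0 : ℝ) 1, z ∂ν) σ h) (reflectedJumps ν) h)) ω ∂P := by
  set D : Ω → ℝ := fun ω => X (s + h) ω - X s ω with hD
  have hDm : Measurable D := ((hX.adapted (s + h)).mono (𝓕.le _) le_rfl).sub
    ((hX.adapted s).mono (𝓕.le _) le_rfl)
  -- The event and the past value are packed into one vector, so that a single independence
  -- statement and one Fubini suffice.
  set A : Ω → ℝ × ℝ := fun ω => (E.indicator (fun _ => 1) ω, Y ω) with hA
  have hAs : Measurable[𝓕 s] A := (measurable_const.indicator hE).prodMk hY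
  have hAm : Measurable A := hAs.mono (𝓕.le s) le_rfl
  have hind : IndepFun A D P := by
    have h1 := (hX.indep s (s + h) le_self_add).symm
    exact indep_of_indep_of_le_left h1 hAs.comap_le
  have hmap := (indepFun_iff_map_prod_eq_prod_map_map hAm.aemeasurable hDm.aemeasurable).1 hind
  rw [← hX.map_increment s h, ← hD]
  set F : (ℝ × ℝ) × ℝ → ℝ := fun p => p.1.1 * f (p.1.2 + p.2) with hF
  have hFc : Continuous F := (continuous_fst.comp continuous_fst).mul
    (hf.comp ((continuous_snd.comp continuous_fst).add continuous_snd))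
  have e1 : ∀ ω, E.indicator (fun ω => f (Y ω + D ω)) ω = F (A ω, D ω) := fun ω => by
    by_cases hω : ω ∈ E <;> simp [hF, hA, hω]
  have e2 : ∀ ω, E.indicator (fun ω => ∫ d, f (Y ω + d) ∂(P.map D)) ω = ∫ d, F (A ω, d) ∂(P.map D) :=
    fun ω => by
      by_cases hω : ω ∈ E <;> simp [hF, hA, hω]
  have hprob := Measure.isProbabilityMeasure_map (μ := P) hDm.aemeasurable
  have hprob' := Measure.isProbabilityMeasure_map (μ := P) hAm.aemeasurable
  have hB0 : 0 ≤ B := (abs_nonneg _).trans (hB 0)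
  have hFi : Integrable F ((P.map A).prod (P.map D)) := by
    rw [← hmap, integrable_map_measure hFc.aestronglyMeasurable (hAm.prodMk hDm).aemeasurable]
    refine Integrable.of_bound (C := B)
      (hFc.measurable.comp (hAm.prodMk hDm)).aestronglyMeasurable (Eventually.of_forall fun ω => ?_)
    change ‖F (A ω, D ω)‖ ≤ B
    rw [← e1 ω]
    by_cases hω : ω ∈ E
    · simpa [hω] using hB _
    · simpa [hω] using hB0
  refine (integral_congr_ae (Eventually.of_forall e1)).trans
    (Eq.trans ?_ (integral_congr_ae (Eventually.of_forall e2)).symm)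
  rw [← integral_map (hAm.prodMk hDm).aemeasurable (f := F) hFc.aestronglyMeasurable, hmap,
    integral_prod _ hFi, integral_map hAm.aemeasurable hFi.integral_prod_left.aestronglyMeasurable]

end Increment

theorem measurableSet_alive {Ω : Type*} {m : MeasurableSpace Ω} {U : ℝ≥0 → Ω → ℝ} {s : ℝ≥0}
    (hU : ∀ t ≤ s, Measurable[m] (U t)) : MeasurableSet[m] {ω | Alive (fun t => U t ω) s} := by
  have : {ω | Alive (fun t => U t ω) s} = ⋂ r : ℚ, {ω | 0 < (r : ℝ) → (r : ℝ) < s →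
      0 ≤ U (r : ℝ).toNNReal ω} := by
    ext ω
    simp [Alive]
  rw [this]
  refine MeasurableSet.iInter fun r => ?_
  by_cases h0 : 0 < (r : ℝ)
  · by_cases h1 : (r : ℝ) < s
    · have hr : (r : ℝ).toNNReal ≤ s := Real.toNNReal_le_iff_le_coe.2 h1.le
      simpa [h0, h1] using measurableSet_le (measurable_const (a := (0 : ℝ))) (hU _ hr)
    · simp only [h1, false_imp_iff, imp_true_iff]
      exact MeasurableSet.univ
  · simp only [h0, false_imp_iff]
    exact MeasurableSet.univ

theorem measurableSet_alive_prod {Ω : Type*} {m : MeasurableSpace Ω} {U : ℝ≥0 → Ω → ℝ}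
    (hU : ∀ t, Measurable (U t)) : MeasurableSet {p : ℝ × Ω | Alive (fun t => U t p.2) p.1} := by
  have : {p : ℝ × Ω | Alive (fun t => U t p.2) p.1} = ⋂ r : ℚ, {p : ℝ × Ω | 0 < (r : ℝ) →
      (r : ℝ) < p.1 → 0 ≤ U (r : ℝ).toNNReal p.2} := by
    ext p
    simp [Alive]
  rw [this]
  refine MeasurableSet.iInter fun r => ?_
  by_cases h0 : 0 < (r : ℝ)
  · have e : {p : ℝ × Ω | 0 < (r : ℝ) → (r : ℝ) < p.1 → 0 ≤ U (r : ℝ).toNNReal p.2}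
        = {p : ℝ × Ω | p.1 ≤ r} ∪ {p : ℝ × Ω | 0 ≤ U (r : ℝ).toNNReal p.2} := by
      ext p
      simp only [Set.mem_ofPred_eq, Set.mem_union, h0, true_imp_iff]
      rw [imp_iff_not_or, not_lt]
    rw [e]
    exact (measurableSet_le measurable_fst measurable_const).union
      (measurableSet_le measurable_const ((hU _).comp measurable_snd))
  · simp only [h0, false_imp_iff]
    exact MeasurableSet.univ

theorem setIntegral_indicator_alive {u : ℝ≥0 → ℝ}
    (hc : ∀ t, ContinuousWithinAt u (Set.Ici t) t) (v : ℝ → ℝ) :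
    ∫ s in Set.Ioi (0 : ℝ), {s | Alive u s}.indicator v s
      = ∫ s in {s : ℝ | 0 ≤ s ∧ ENNReal.ofReal s ≤ ruinTime u}, v s := by
  have e : {s : ℝ | Alive u s} = {s | ENNReal.ofReal s ≤ ruinTime u} := by
    ext s
    exact alive_iff hc
  have hm : MeasurableSet {s : ℝ | ENNReal.ofReal s ≤ ruinTime u} :=
    measurableSet_le ENNReal.measurable_ofReal measurable_const
  rw [e, setIntegral_indicator hm]
  refine setIntegral_congr_set ?_
  exact (Ioi_ae_eq_Ici (a := (0 : ℝ)) (μ := volume)).inter (ae_eq_refl _)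

section Parts

/-- Change of the discounted functional along a path, over a time `h`, due to the dividends. -/
def dividendPart (q : ℝ) (f : ℝ → ℝ) (u X : ℝ≥0 → ℝ) (h : ℝ≥0) (s : ℝ) : ℝ :=
  Real.exp (-q * (s + h)) * ((f (u (s.toNNReal + h))
    - f (u s.toNNReal + (X (s.toNNReal + h) - X s.toNNReal))) / h)

/-- Change of the discounted functional due to the driving process. -/
def levyPart (q : ℝ) (f : ℝ → ℝ) (u X : ℝ≥0 → ℝ) (h : ℝ≥0) (s : ℝ) : ℝ :=
  Real.exp (-q * (s + h)) * ((f (u s.toNNReal + (X (s.toNNReal + h) - X s.toNNReal))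
    - f (u s.toNNReal)) / h)

/-- Mean change of the discounted functional due to an increment with law `μ`. -/
def levyMeanPart (q : ℝ) (f : ℝ → ℝ) (μ : Measure ℝ) (u : ℝ≥0 → ℝ) (h : ℝ≥0) (s : ℝ) : ℝ :=
  Real.exp (-q * (s + h)) * ((∫ d, f (u s.toNNReal + d) ∂μ - f (u s.toNNReal)) / h)

/-- Change of the discounted functional due to discounting. -/
def discountPart (q : ℝ) (f : ℝ → ℝ) (u : ℝ≥0 → ℝ) (h : ℝ≥0) (s : ℝ) : ℝ :=
  (Real.exp (-q * (s + h)) - Real.exp (-q * s)) / h * f (u s.toNNReal)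

variable {q δ b x B : ℝ} {f f' f'' : ℝ → ℝ} {u X : ℝ≥0 → ℝ} {h : ℝ≥0} {s : ℝ}

/-- The intermediate point is the current surplus moved by the increment of `X` alone. Of the three
parts only the middle one needs averaging; the other two converge along each path. -/
theorem parts_sum (q : ℝ) (f : ℝ → ℝ) (u X : ℝ≥0 → ℝ) (h : ℝ≥0) (hs : 0 < s) :
    dividendPart q f u X h s + levyPart q f u X h s + discountPart q f u h s
      = (h : ℝ)⁻¹ * (Real.exp (-q * (s + h).toNNReal) * f (u (s + h).toNNReal)
        - Real.exp (-q * s.toNNReal) * f (u s.toNNReal)) := by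
  have e1 : (s + (h : ℝ)).toNNReal = s.toNNReal + h := by
    rw [Real.toNNReal_add hs.le h.coe_nonneg, Real.toNNReal_coe]
  rw [e1, NNReal.coe_add, Real.coe_toNNReal s hs.le, dividendPart, levyPart, discountPart]
  ring

theorem exp_add_le (hq : 0 < q) (s : ℝ) (h : ℝ≥0) :
    Real.exp (-q * (s + h)) ≤ Real.exp (-q * s) := by
  refine Real.exp_le_exp.2 ?_
  have : 0 ≤ q * (h : ℝ) := mul_nonneg hq.le h.coe_nonneg
  linarith

theorem abs_exp_mul_le (hq : 0 < q) (s : ℝ) (h : ℝ≥0) {r C : ℝ} (hr : |r| ≤ C) :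
    |Real.exp (-q * (s + h)) * r| ≤ C * Real.exp (-q * s) := by
  rw [abs_mul, Real.abs_exp, mul_comm]
  exact mul_le_mul hr (exp_add_le hq s h) (Real.exp_pos _).le ((abs_nonneg _).trans hr)

theorem abs_discountPart_le (hq : 0 < q) (hf : IsBoundedC2 f f' f'' B) (hh : 0 < h) :
    |discountPart q f u h s| ≤ q * B * Real.exp (-q * s) := by
  have h1 : |(Real.exp (-q * (s + h)) - Real.exp (-q * s)) / h| ≤ q * Real.exp (-q * s) := by
    have := abs_exp_sub_one_div_le hq.le (NNReal.coe_pos.2 hh)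
    have e : (Real.exp (-q * (s + h)) - Real.exp (-q * s)) / h
        = Real.exp (-q * s) * ((Real.exp (-(q * h)) - 1) / h) := by
      rw [mul_add, Real.exp_add, neg_mul q (h : ℝ)]
      ring
    rw [e, abs_mul, Real.abs_exp, mul_comm]
    exact mul_le_mul_of_nonneg_right this (Real.exp_pos _).le
  rw [discountPart, abs_mul]
  calc _ ≤ q * Real.exp (-q * s) * B := mul_le_mul h1 (hf.abs_le _) (abs_nonneg _) (by positivity)
    _ = _ := by ring

theorem ThresholdPath.increment_eq (hu : ThresholdPath δ b x X u) (s h : ℝ≥0) :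
    u s + (X (s + h) - X s) = u (s + h) + ∫ r in (s : ℝ)..((s : ℝ) + h), dividendRate δ b u r := by
  rw [hu.increment s h]
  ring

theorem abs_integral_dividendRate_le (hδ : 0 < δ) (s : ℝ) (h : ℝ≥0) :
    |∫ r in s..(s + h), dividendRate δ b u r| ≤ δ * h := by
  have := intervalIntegral.norm_integral_le_of_norm_le_const (a := s) (b := s + h)
    (f := dividendRate δ b u) (C := δ) (fun r _ => by
      rw [Real.norm_eq_abs, abs_of_nonneg (dividendRate_nonneg hδ b u r)]
      exact dividendRate_le hδ b u r)
  rwa [add_sub_cancel_left, abs_of_nonneg h.coe_nonneg] at this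

theorem abs_dividendPart_le (hq : 0 < q) (hδ : 0 < δ) (hf : IsBoundedC2 f f' f'' B)
    (hu : ThresholdPath δ b x X u) (hh : 0 < h) :
    |dividendPart q f u X h s| ≤ B * δ * Real.exp (-q * s) := by
  refine abs_exp_mul_le hq s h ?_
  have hh' : (0 : ℝ) < h := NNReal.coe_pos.2 hh
  rw [hu.increment_eq, abs_div, abs_of_pos hh', div_le_iff₀ hh']
  refine (hf.abs_sub_le _ _).trans ?_
  rw [sub_add_cancel_left, abs_neg, mul_assoc]
  exact mul_le_mul_of_nonneg_left (abs_integral_dividendRate_le hδ _ h) hf.nonneg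

theorem tendsto_exp_add {h : ℕ → ℝ≥0} (hlim : Tendsto h atTop (𝓝 0)) (q s : ℝ) :
    Tendsto (fun n => Real.exp (-q * (s + h n))) atTop (𝓝 (Real.exp (-q * s))) := by
  have h1 : Tendsto (fun n => ((h n : ℝ≥0) : ℝ)) atTop (𝓝 0) := by
    simpa using NNReal.tendsto_coe.2 hlim
  have := (Real.continuous_exp.tendsto (-q * (s + 0))).comp ((h1.const_add s).const_mul (-q))
  simpa [Function.comp_def] using this

theorem tendsto_discountPart {h : ℕ → ℝ≥0} (hh : ∀ n, 0 < h n) (hlim : Tendsto h atTop (𝓝 0)) :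
    Tendsto (fun n => discountPart q f u (h n) s) atTop
      (𝓝 (-q * Real.exp (-q * s) * f (u s.toNNReal))) := by
  have hd : HasDerivAt (fun t => Real.exp (-q * t)) (Real.exp (-q * s) * (-q * 1)) s :=
    ((hasDerivAt_id s).const_mul (-q)).exp
  have h1 : Tendsto (fun n => ((h n : ℝ≥0) : ℝ)) atTop (𝓝[≠] 0) :=
    tendsto_nhdsWithin_iff.2 ⟨by simpa using NNReal.tendsto_coe.2 hlim,
      Eventually.of_forall fun n => by simpa using (hh n).ne'⟩
  have h2 := hd.tendsto_slope_zero.comp h1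
  have e : -q * Real.exp (-q * s) = Real.exp (-q * s) * (-q * 1) := by ring
  rw [e]
  refine (h2.mul_const _).congr fun n => ?_
  simp only [Function.comp, smul_eq_mul, discountPart]
  ring

/-- The dividend rate may jump as a function of time, so convergence is claimed only at Lebesgue
points. Taylor expansion is made at the later point `u(s + h)`, with a remainder of order `h`. -/
theorem tendsto_dividendPart (hδ : 0 < δ) (hf : IsBoundedC2 f f' f'' B)
    (hu : ThresholdPath δ b x X u) {h : ℕ → ℝ≥0} (hh : ∀ n, 0 < h n)
    (hlim : Tendsto h atTop (𝓝 0)) :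
    ∀ᵐ s ∂(volume.restrict (Set.Ioi (0 : ℝ))), Tendsto (fun n => dividendPart q f u X (h n) s) atTop
      (𝓝 (-(Real.exp (-q * s) * (dividendRate δ b u s * f' (u s.toNNReal))))) := by
  have hloc : LocallyIntegrable (dividendRate δ b u) volume := by
    have h1 : LocallyIntegrable (fun _ : ℝ => δ) volume := continuous_const.locallyIntegrable
    refine h1.mono (measurable_dividendRate hu.measurable).aestronglyMeasurable
      (Eventually.of_forall fun s => ?_)
    rw [Real.norm_eq_abs, abs_of_nonneg (dividendRate_nonneg hδ b u s), Real.norm_eq_abs]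
    exact (dividendRate_le hδ b u s).trans (le_abs_self δ)
  filter_upwards [ae_restrict_of_ae (_root_.LocallyIntegrable.ae_hasDerivAt_integral hloc),
    ae_restrict_mem measurableSet_Ioi] with s hs hs0
  have hs0' : (s.toNNReal : ℝ) = s := Real.coe_toNNReal s (le_of_lt hs0)
  have hR : Tendsto (fun n => ((h n : ℝ≥0) : ℝ)) atTop (𝓝 0) := by
    simpa using NNReal.tendsto_coe.2 hlim
  have h1 : Tendsto (fun n => ((h n : ℝ≥0) : ℝ)) atTop (𝓝[≠] 0) :=
    tendsto_nhdsWithin_iff.2 ⟨hR, Eventually.of_forall fun n => by simpa using (hh n).ne'⟩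
  set J : ℕ → ℝ := fun n => ∫ r in s..(s + h n), dividendRate δ b u r with hJ
  have hJlim : Tendsto (fun n => J n / h n) atTop (𝓝 (dividendRate δ b u s)) := by
    refine ((hs s).tendsto_slope_zero.comp h1).congr fun n => ?_
    simp [hJ, div_eq_inv_mul]
  have hw : Tendsto (fun n => u (s.toNNReal + h n)) atTop (𝓝 (u s.toNNReal)) := by
    have h3 : Tendsto (fun n => s.toNNReal + h n) atTop (𝓝[≥] s.toNNReal) :=
      tendsto_nhdsWithin_iff.2 ⟨by simpa using hlim.const_add s.toNNReal,
        Eventually.of_forall fun n => by simp⟩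
    exact (hu.right_cont s.toNNReal).tendsto.comp h3
  have hr : Tendsto (fun n => (f (u (s.toNNReal + h n) + J n) - f (u (s.toNNReal + h n))
      - f' (u (s.toNNReal + h n)) * J n) / h n) atTop (𝓝 0) := by
    have hz : Tendsto (fun n => B * δ ^ 2 * (h n : ℝ)) atTop (𝓝 0) := by
      simpa using hR.const_mul (B * δ ^ 2)
    refine squeeze_zero_norm (fun n => ?_) hz
    have hn : (0 : ℝ) < h n := NNReal.coe_pos.2 (hh n)
    rw [Real.norm_eq_abs, abs_div, abs_of_pos hn, div_le_iff₀ hn]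
    refine (hf.abs_remainder_le _ _).trans ?_
    have : J n ^ 2 ≤ (δ * h n) ^ 2 :=
      sq_le_sq' (neg_le_of_abs_le (abs_integral_dividendRate_le hδ s (h n)))
        (le_of_abs_le (abs_integral_dividendRate_le hδ s (h n)))
    nlinarith [mul_le_mul_of_nonneg_left this hf.nonneg]
  have hf'lim : Tendsto (fun n => f' (u (s.toNNReal + h n))) atTop (𝓝 (f' (u s.toNNReal))) :=
    (hf.continuous'.tendsto _).comp hw
  have := (tendsto_exp_add hlim q s).mul (((hf'lim.mul hJlim).add hr).neg)
  have e : -(Real.exp (-q * s) * (dividendRate δ b u s * f' (u s.toNNReal)))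
      = Real.exp (-q * s) * -(f' (u s.toNNReal) * dividendRate δ b u s + 0) := by ring
  rw [e]
  refine this.congr fun n => ?_
  rw [dividendPart, hu.increment_eq, hs0']
  ring

end Parts

section Dynkin

variable {Ω : Type*} {mΩ : MeasurableSpace Ω} {P : Measure Ω} [IsProbabilityMeasure P]
  {𝓕 : Filtration ℝ≥0 mΩ} {γ σ : ℝ} {ν : Measure ℝ} {X : ℝ≥0 → Ω → ℝ}

theorem measurable_comp_time {Z : ℝ≥0 → Ω → ℝ} (hZ : Measurable fun p : ℝ≥0 × Ω => Z p.1 p.2)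
    {T : ℝ → ℝ≥0} (hT : Measurable T) : Measurable fun p : ℝ × Ω => Z (T p.1) p.2 :=
  hZ.comp ((hT.comp measurable_fst).prodMk measurable_snd)

theorem continuous_integral_translate {f : ℝ → ℝ} (hf : Continuous f) {B : ℝ} (hB : ∀ x, |f x| ≤ B)
    (μ : Measure ℝ) [IsFiniteMeasure μ] : Continuous fun y => ∫ d, f (y + d) ∂μ := by
  refine continuous_of_dominated (bound := fun _ => B) ?_ ?_ (integrable_const _) ?_
  · exact fun y => (hf.comp (by fun_prop)).aestronglyMeasurable
  · exact fun y => Eventually.of_forall fun z => hB _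
  · exact Eventually.of_forall fun z => hf.comp (by fun_prop)

theorem measurable_parts {Zu Zx : ℝ≥0 → Ω → ℝ}
    (hu : Measurable fun p : ℝ≥0 × Ω => Zu p.1 p.2) (hx : Measurable fun p : ℝ≥0 × Ω => Zx p.1 p.2)
    (q : ℝ) {f : ℝ → ℝ} (hf : Continuous f) {B : ℝ} (hB : ∀ x, |f x| ≤ B)
    (μ : Measure ℝ) [IsFiniteMeasure μ] (h : ℝ≥0) :
    Measurable (fun p : ℝ × Ω => dividendPart q f (fun t => Zu t p.2) (fun t => Zx t p.2) h p.1) ∧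
    Measurable (fun p : ℝ × Ω => levyPart q f (fun t => Zu t p.2) (fun t => Zx t p.2) h p.1) ∧
    Measurable (fun p : ℝ × Ω => levyMeanPart q f μ (fun t => Zu t p.2) h p.1) ∧
    Measurable (fun p : ℝ × Ω => discountPart q f (fun t => Zu t p.2) h p.1) := by
  have t0 : Measurable fun s : ℝ => s.toNNReal := measurable_real_toNNReal
  have t1 : Measurable fun s : ℝ => s.toNNReal + h := t0.add_const h
  have u0 := measurable_comp_time hu t0
  have u1 := measurable_comp_time hu t1
  have x0 := measurable_comp_time hx t0
  have x1 := measurable_comp_time hx t1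
  have m1 := hf.measurable.comp u1
  have m0 := hf.measurable.comp u0
  have m2 := hf.measurable.comp (u0.add (x1.sub x0))
  have m3 := (continuous_integral_translate hf hB μ).measurable.comp u0
  have e1 : Measurable fun p : ℝ × Ω => Real.exp (-q * (p.1 + h)) :=
    Real.measurable_exp.comp ((measurable_fst.add_const _).const_mul _)
  have e0 : Measurable fun p : ℝ × Ω => Real.exp (-q * p.1) :=
    Real.measurable_exp.comp (measurable_fst.const_mul _)
  exact ⟨e1.mul ((m1.sub m2).div_const _), e1.mul ((m2.sub m0).div_const _),
    e1.mul ((m3.sub m0).div_const _), ((e1.sub e0).div_const _).mul m0⟩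

/-- Before an independent increment, the change due to the driving process may be averaged. -/
theorem IsSpectrallyNegativeLevy.integral_levyPart [IsFiniteMeasure ν]
    (hX : IsSpectrallyNegativeLevy P 𝓕 γ σ ν X) {U : ℝ≥0 → Ω → ℝ} (hU : ∀ t, Measurable[𝓕 t] (U t))
    (q : ℝ) {f : ℝ → ℝ} (hf : Continuous f) {B : ℝ} (hB : ∀ x, |f x| ≤ B) (h : ℝ≥0) {s : ℝ} :
    ∫ ω, ({ω | Alive (fun t => U t ω) s}.indicator
        (fun ω => levyPart q f (fun t => U t ω) (fun t => X t ω) h s) ω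
      - {ω | Alive (fun t => U t ω) s}.indicator (fun ω => levyMeanPart q f (poissonSum (driftGaussian
        (γ + ∫ z in Set.Ioo (0 : ℝ) 1, z ∂ν) σ h) (reflectedJumps ν) h) (fun t => U t ω) h s) ω) ∂P
      = 0 := by
  have hB0 : 0 ≤ B := (abs_nonneg _).trans (hB 0)
  set μ := poissonSum (driftGaussian (γ + ∫ z in Set.Ioo (0 : ℝ) 1, z ∂ν) σ h) (reflectedJumps ν) h
    with hμ
  have hprob : IsProbabilityMeasure μ := isProbabilityMeasure_poissonSum h.2
  set E : Set Ω := {ω | Alive (fun t => U t ω) s} with hE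
  have hEm : MeasurableSet[𝓕 s.toNNReal] E := by
    -- Only positive rational times enter `Alive`, so a negative `s` may be replaced by `0`.
    have e : E = {ω | Alive (fun t => U t ω) s.toNNReal} := by
      ext ω
      simp only [hE, Set.mem_ofPred_eq, Alive]
      refine forall_congr' fun r => forall_congr' fun hr => ?_
      rw [Real.coe_toNNReal', lt_max_iff]
      exact ⟨fun H h1 => H (h1.resolve_right (not_lt.2 hr.le)), fun H h1 => H (Or.inl h1)⟩
    rw [e]
    exact measurableSet_alive fun t ht => (hU t).mono (𝓕.mono ht) le_rfl
  have hEm' : MeasurableSet E := 𝓕.le _ _ hEm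
  have hUm : Measurable (U s.toNNReal) := (hU _).mono (𝓕.le _) le_rfl
  have hDm : Measurable fun ω => X (s.toNNReal + h) ω - X s.toNNReal ω :=
    ((hX.adapted _).mono (𝓕.le _) le_rfl).sub ((hX.adapted _).mono (𝓕.le _) le_rfl)
  have key := hX.integral_increment s.toNNReal h (hU s.toNNReal) hEm hf hB
  have i1 : Integrable (fun ω => E.indicator
      (fun ω => f (U s.toNNReal ω + (X (s.toNNReal + h) ω - X s.toNNReal ω))) ω) P := by
    refine (Integrable.of_bound (C := B)
      (hf.measurable.comp (hUm.add hDm)).aestronglyMeasurable ?_).indicator hEm'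
    exact Eventually.of_forall fun ω => hB _
  have i2 : Integrable (fun ω => E.indicator (fun ω => ∫ d, f (U s.toNNReal ω + d) ∂μ) ω) P := by
    refine (Integrable.of_bound (C := B) ((continuous_integral_translate hf hB μ).measurable.comp
      hUm).aestronglyMeasurable (Eventually.of_forall fun ω => ?_)).indicator hEm'
    have := norm_integral_le_of_norm_le_const (μ := μ) (f := fun d => f (U s.toNNReal ω + d))
      (Eventually.of_forall fun z => hB _)
    simpa using this
  have e : ∀ ω, E.indicator (fun ω => levyPart q f (fun t => U t ω) (fun t => X t ω) h s) ω
      - E.indicator (fun ω => levyMeanPart q f μ (fun t => U t ω) h s) ω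
      = Real.exp (-q * (s + h)) / h * (E.indicator
        (fun ω => f (U s.toNNReal ω + (X (s.toNNReal + h) ω - X s.toNNReal ω))) ω
        - E.indicator (fun ω => ∫ d, f (U s.toNNReal ω + d) ∂μ) ω) := fun ω => by
    by_cases hω : ω ∈ E
    · simp only [Set.indicator_of_mem hω, levyPart, levyMeanPart]
      ring
    · simp [Set.indicator_of_notMem hω]
  rw [integral_congr_ae (Eventually.of_forall e), integral_const_mul, integral_sub i1 i2, key,
    sub_self, mul_zero]

/-- Dynkin's formula for the surplus process up to ruin. -/
theorem IsThresholdSurplus.dynkin [IsFiniteMeasure ν] (hX : IsSpectrallyNegativeLevy P 𝓕 γ σ ν X)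
    {δ b x q : ℝ} (hδ : 0 < δ) (hq : 0 < q) {U : ℝ≥0 → Ω → ℝ} (hU : IsThresholdSurplus P 𝓕 X δ b x U)
    {f f' f'' : ℝ → ℝ} {B : ℝ} (hf : IsBoundedC2 f f' f'' B) :
    Integrable (fun ω => if ruinTime (fun t => U t ω) < ⊤ then
      Real.exp (-q * (ruinTime fun t => U t ω).toReal) * f (U (ruinTime fun t => U t ω).toNNReal ω)
        else 0) P ∧
    Integrable (fun ω => ∫ s in {s : ℝ | 0 ≤ s ∧ ENNReal.ofReal s ≤ ruinTime (fun t => U t ω)},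
      Real.exp (-q * s) * (levyGenerator (γ + ∫ z in Set.Ioo (0 : ℝ) 1, z ∂ν) σ ν f f' f''
        (U s.toNNReal ω) - q * f (U s.toNNReal ω)
        - dividendRate δ b (fun t => U t ω) s * f' (U s.toNNReal ω))) P ∧
    f x = (∫ ω, (if ruinTime (fun t => U t ω) < ⊤ then
      Real.exp (-q * (ruinTime fun t => U t ω).toReal) * f (U (ruinTime fun t => U t ω).toNNReal ω)
        else 0) ∂P)
      - ∫ ω, (∫ s in {s : ℝ | 0 ≤ s ∧ ENNReal.ofReal s ≤ ruinTime (fun t => U t ω)},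
      Real.exp (-q * s) * (levyGenerator (γ + ∫ z in Set.Ioo (0 : ℝ) 1, z ∂ν) σ ν f f' f''
        (U s.toNNReal ω) - q * f (U s.toNNReal ω)
        - dividendRate δ b (fun t => U t ω) s * f' (U s.toNNReal ω))) ∂P := by
  set c := γ + ∫ z in Set.Ioo (0 : ℝ) 1, z ∂ν with hc
  have hB0 := hf.nonneg
  have hUm : ∀ t, Measurable (U t) := fun t => (hU.adapted t).mono (𝓕.le t) le_rfl
  have hXm : ∀ t, Measurable (X t) := fun t => (hX.adapted t).mono (𝓕.le t) le_rfl
  have hpath := hU.ae_thresholdPath hδ hX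
  -- Joint measurability needs right-continuity of every path, hence the versions; the original
  -- adapted processes are kept where the filtration matters.
  obtain ⟨Zu, hZu, hZuc, hZue⟩ := exists_measurable_version hUm
    (hpath.mono fun ω h => h.right_cont)
  obtain ⟨Zx, hZx, hZxc, hZxe⟩ := exists_measurable_version hXm hX.right_cont
  set h : ℕ → ℝ≥0 := fun n => 1 / ((n : ℝ≥0) + 1) with hh
  have hpos : ∀ n, 0 < h n := fun n => by positivity
  have hle : ∀ n, h n ≤ 1 := fun n => div_le_one_of_le₀ (by simp) (by positivity)
  have hlim : Tendsto h atTop (𝓝 0) := by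
    rw [← NNReal.tendsto_coe]
    simpa [hh] using tendsto_one_div_add_atTop_nhds_zero_nat (𝕜 := ℝ)
  have hposR : ∀ n, 0 < ((h n : ℝ≥0) : ℝ) := fun n => NNReal.coe_pos.2 (hpos n)
  have hleR : ∀ n, ((h n : ℝ≥0) : ℝ) ≤ 1 := fun n => by exact_mod_cast hle n
  have hlimR : Tendsto (fun n => ((h n : ℝ≥0) : ℝ)) atTop (𝓝 0) := by
    simpa using NNReal.tendsto_coe.2 hlim
  set μ : ℕ → Measure ℝ := fun n => poissonSum (driftGaussian c σ (h n)) (reflectedJumps ν) (h n)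
    with hμ
  have hprob : ∀ n, IsProbabilityMeasure (μ n) := fun n => isProbabilityMeasure_poissonSum (h n).2
  set S : Set (ℝ × Ω) := {p | Alive (fun t => U t p.2) p.1} with hS
  have hSm : MeasurableSet S := measurableSet_alive_prod hUm
  have hmeas := fun n => measurable_parts hZu hZx q hf.continuous hf.abs_le (μ n) (h n)
  obtain ⟨C, hC⟩ := exists_generator_bound (c := c) (σ := σ) (ν := ν) hf
  set D1 : ℕ → ℝ × Ω → ℝ := fun n p =>
    dividendPart q f (fun t => Zu t p.2) (fun t => Zx t p.2) (h n) p.1 with hD1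
  set D2 : ℕ → ℝ × Ω → ℝ := fun n p =>
    levyPart q f (fun t => Zu t p.2) (fun t => Zx t p.2) (h n) p.1 with hD2
  set D2' : ℕ → ℝ × Ω → ℝ := fun n p =>
    levyMeanPart q f (μ n) (fun t => Zu t p.2) (h n) p.1 with hD2'
  set D3 : ℕ → ℝ × Ω → ℝ := fun n p =>
    discountPart q f (fun t => Zu t p.2) (h n) p.1 with hD3
  set F : ℕ → ℝ × Ω → ℝ := fun n => S.indicator fun p => D1 n p + D2 n p + D3 n p with hF
  -- `F` leaves only boundary stretches along each path, but its process part has merely the bound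
  -- `2B/h`. In `F'` that part is replaced by its mean, which is bounded uniformly and converges to
  -- the generator. The two have the same integral for each `n`.
  set F' : ℕ → ℝ × Ω → ℝ := fun n => S.indicator fun p => D1 n p + D2' n p + D3 n p with hF'
  have hFm : ∀ n, Measurable (F n) := fun n =>
    (((hmeas n).1.add (hmeas n).2.1).add (hmeas n).2.2.2).indicator hSm
  have hFm' : ∀ n, Measurable (F' n) := fun n =>
    (((hmeas n).1.add (hmeas n).2.2.1).add (hmeas n).2.2.2).indicator hSm
  have hind : ∀ (G : ℝ × Ω → ℝ) (p : ℝ × Ω) (K : ℝ), |G p| ≤ K → |S.indicator G p| ≤ K :=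
    fun G p K hK => by
      by_cases hp : p ∈ S
      · simpa [hp] using hK
      · simpa [hp] using (abs_nonneg _).trans hK
  have hD1b : ∀ᵐ ω ∂P, ∀ n, ∀ s > 0, |D1 n (s, ω)| ≤ B * δ * Real.exp (-q * s) := by
    filter_upwards [hpath, hZue, hZxe] with ω h1 h2 h3 n s hs
    simp only [hD1, h2, h3]
    exact abs_dividendPart_le hq hδ hf h1 (hpos n)
  have hD2b : ∀ ω n, ∀ s > 0, |D2 n (s, ω)| ≤ 2 * B / h n * Real.exp (-q * s) := fun ω n s hs => by
    refine abs_exp_mul_le hq s (h n) ?_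
    rw [abs_div, abs_of_pos (hposR n)]
    refine div_le_div_of_nonneg_right ((abs_sub _ _).trans ?_) (hposR n).le
    linarith [hf.abs_le (Zu s.toNNReal ω + (Zx (s.toNNReal + h n) ω - Zx s.toNNReal ω)),
      hf.abs_le (Zu s.toNNReal ω)]
  have hD2b' : ∀ ω n, ∀ s > 0, |D2' n (s, ω)| ≤ C * Real.exp (-q * s) := fun ω n s hs =>
    abs_exp_mul_le hq s (h n) (hC _ (hposR n) (hleR n) _)
  have hD3b : ∀ ω n, ∀ s > 0, |D3 n (s, ω)| ≤ q * B * Real.exp (-q * s) := fun ω n s hs =>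
    abs_discountPart_le hq hf (hpos n)
  have hFb : ∀ n, ∀ᵐ ω ∂P, ∀ s > 0,
      |F n (s, ω)| ≤ (B * δ + 2 * B / h n + q * B) * Real.exp (-q * s) := fun n => by
    filter_upwards [hD1b] with ω h1 s hs
    refine hind _ _ _ ((abs_add_three _ _ _).trans ?_)
    have := h1 n s hs
    have := hD2b ω n s hs
    have := hD3b ω n s hs
    rw [add_mul, add_mul]
    linarith
  have hFb' : ∀ᵐ ω ∂P, ∀ n, ∀ s > 0,
      |F' n (s, ω)| ≤ (B * δ + C + q * B) * Real.exp (-q * s) := by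
    filter_upwards [hD1b] with ω h1 n s hs
    refine hind _ _ _ ((abs_add_three _ _ _).trans ?_)
    have := h1 n s hs
    have := hD2b' ω n s hs
    have := hD3b ω n s hs
    rw [add_mul, add_mul]
    linarith
  have hFi : ∀ n, Integrable (F n) ((volume.restrict (Set.Ioi 0)).prod P) := fun n =>
    integrable_prod_of_abs_le_exp (hFm n) hq (hFb n)
  have hFi' : ∀ n, Integrable (F' n) ((volume.restrict (Set.Ioi 0)).prod P) := fun n =>
    integrable_prod_of_abs_le_exp (hFm' n) hq (hFb'.mono fun ω h => h n)
  have hFF' : ∀ n, ∫ p, F n p ∂((volume.restrict (Set.Ioi 0)).prod P)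
      = ∫ p, F' n p ∂((volume.restrict (Set.Ioi 0)).prod P) := fun n => by
    rw [← sub_eq_zero, ← integral_sub (hFi n) (hFi' n), integral_prod (fun p => F n p - F' n p) ((hFi n).sub (hFi' n))]
    refine integral_eq_zero_of_ae ?_
    filter_upwards with s
    refine Eq.trans (integral_congr_ae ?_)
      (hX.integral_levyPart hU.adapted q hf.continuous hf.abs_le (h n) (s := s))
    filter_upwards [hZue, hZxe] with ω h2 h3
    by_cases hp : Alive (fun t => U t ω) s
    · have hp' : (s, ω) ∈ S := hp
      have hp'' : ω ∈ {ω | Alive (fun t => U t ω) s} := hp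
      simp only [hF, hF', Set.indicator_of_mem hp', Set.indicator_of_mem hp'', hD2, hD2', h2, h3,
        hμ, hc]
      ring
    · have hp' : (s, ω) ∉ S := hp
      have hp'' : ω ∉ {ω | Alive (fun t => U t ω) s} := hp
      simp only [hF, hF', Set.indicator_of_notMem hp', Set.indicator_of_notMem hp'']
  set L : Ω → ℝ → ℝ := fun ω => {s | Alive (fun t => U t ω) s}.indicator fun s =>
    Real.exp (-q * s) * (levyGenerator c σ ν f f' f'' (U s.toNNReal ω) - q * f (U s.toNNReal ω)
        - dividendRate δ b (fun t => U t ω) s * f' (U s.toNNReal ω)) with hL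
  have hF'lim : ∀ᵐ ω ∂P, ∀ᵐ s ∂(volume.restrict (Set.Ioi (0 : ℝ))),
      Tendsto (fun n => F' n (s, ω)) atTop (𝓝 (L ω s)) := by
    filter_upwards [hpath, hZue, hZxe] with ω h1 h2 h3
    filter_upwards [tendsto_dividendPart (q := q) hδ hf h1 hpos hlim,
      ae_restrict_mem measurableSet_Ioi] with s hs hs0
    by_cases hp : Alive (fun t => U t ω) s
    · have hp' : (s, ω) ∈ S := hp
      have hp'' : s ∈ {s | Alive (fun t => U t ω) s} := hp
      simp only [hF', hL, Set.indicator_of_mem hp', Set.indicator_of_mem hp'', hD1, hD2', hD3, h2, h3]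
      have l2 : Tendsto (fun n => levyMeanPart q f (μ n) (fun t => U t ω) (h n) s) atTop
          (𝓝 (Real.exp (-q * s) * levyGenerator c σ ν f f' f'' (U s.toNNReal ω))) :=
        (tendsto_exp_add hlim q s).mul (tendsto_generator hf hposR hleR hlimR _)
      have := (hs.add l2).add (tendsto_discountPart (q := q) (f := f) (u := fun t => U t ω)
        (s := s) hpos hlim)
      refine (congrArg (fun r => Tendsto _ atTop (𝓝 r)) ?_).mp this
      ring
    · have hp' : (s, ω) ∉ S := hp
      have hp'' : s ∉ {s | Alive (fun t => U t ω) s} := hp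
      simp only [hF', hL, Set.indicator_of_notMem hp', Set.indicator_of_notMem hp'']
      exact tendsto_const_nhds
  obtain ⟨hLi, hLlim⟩ := tendsto_integral_prod hFm' hq hFb' hF'lim
  set Φ : Ω → ℝ := fun ω => if ruinTime (fun t => U t ω) < ⊤ then
      Real.exp (-q * (ruinTime fun t => U t ω).toReal) * f (U (ruinTime fun t => U t ω).toNNReal ω)
        else 0 with hΦ
  -- After integration in time the bound is uniform, in contrast to the one for the integrand.
  have hexit : ∀ᵐ ω ∂P, (∀ n, |∫ s in Set.Ioi (0 : ℝ), F n (s, ω)| ≤ 2 * B) ∧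
      Tendsto (fun n => ∫ s in Set.Ioi (0 : ℝ), F n (s, ω)) atTop (𝓝 (Φ ω - f x)) := by
    filter_upwards [hpath, hZue, hZxe] with ω h1 h2 h3
    set a : ℝ → ℝ := fun s => Real.exp (-q * s.toNNReal) * f (U s.toNNReal ω) with ha
    have ham : Measurable a := (Real.measurable_exp.comp
      ((measurable_real_toNNReal.coe_nnreal_real).const_mul _)).mul
        (hf.continuous.measurable.comp (h1.measurable.comp measurable_real_toNNReal))
    have hab : ∀ s, |a s| ≤ B * Real.exp (-q * s.toNNReal) := fun s => by
      rw [ha, abs_mul, Real.abs_exp, mul_comm]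
      exact mul_le_mul_of_nonneg_right (hf.abs_le _) (Real.exp_pos _).le
    have hab1 : ∀ s, 0 ≤ s → |a s| ≤ B * Real.exp (-q * s) := fun s hs => by
      simpa [Real.coe_toNNReal s hs] using hab s
    have hab2 : ∀ s, |a s| ≤ B := fun s => by
      refine (hab s).trans (mul_le_of_le_one_right hB0 (Real.exp_le_one_iff.2 ?_))
      have : 0 ≤ q * (s.toNNReal : ℝ) := mul_nonneg hq.le (NNReal.coe_nonneg _)
      linarith
    have hac : ∀ s, 0 ≤ s → ContinuousWithinAt a (Set.Ici s) s := fun s hs => by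
      have hU1 : ContinuousWithinAt (fun s : ℝ => U s.toNNReal ω) (Set.Ici s) s :=
        ContinuousWithinAt.comp (g := fun t => U t ω) (t := Set.Ici s.toNNReal)
          (h1.right_cont s.toNNReal) continuous_real_toNNReal.continuousWithinAt
          fun r hr => Real.toNNReal_le_toNNReal hr
      have hE1 : Continuous fun s : ℝ => Real.exp (-q * s.toNNReal) := by fun_prop
      exact hE1.continuousWithinAt.mul
        (hf.continuous.continuousAt.comp_continuousWithinAt hU1)
    have key := exit_integral ham hq hab1 hab2 (hac 0 le_rfl) (ruinTime fun t => U t ω)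
      (fun _ => hac _ ENNReal.toReal_nonneg)
    have e : ∀ n, ∫ s in Set.Ioi (0 : ℝ), F n (s, ω) = (h n : ℝ)⁻¹ *
        ∫ s in {s : ℝ | 0 ≤ s ∧ ENNReal.ofReal s ≤ ruinTime fun t => U t ω}, (a (s + h n) - a s) :=
      fun n => by
        rw [← integral_const_mul, ← setIntegral_indicator_alive h1.right_cont]
        refine setIntegral_congr_fun measurableSet_Ioi fun s hs => ?_
        by_cases hp : Alive (fun t => U t ω) s
        · have hp' : (s, ω) ∈ S := hp
          have hp'' : s ∈ {s | Alive (fun t => U t ω) s} := hp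
          simp only [hF, Set.indicator_of_mem hp', Set.indicator_of_mem hp'', hD1, hD2, hD3, h2, h3]
          exact parts_sum q f _ _ _ hs
        · have hp' : (s, ω) ∉ S := hp
          have hp'' : s ∉ {s | Alive (fun t => U t ω) s} := hp
          simp only [hF, Set.indicator_of_notMem hp', Set.indicator_of_notMem hp'']
    have ha0 : a 0 = f x := by simp [ha, h1.start]
    have hΦa : (if ruinTime (fun t => U t ω) < ⊤ then a (ruinTime fun t => U t ω).toReal else 0)
        = Φ ω := by
      have : ((ruinTime fun t => U t ω).toReal).toNNReal = (ruinTime fun t => U t ω).toNNReal := by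
        rw [ENNReal.toReal, Real.toNNReal_coe]
      simp only [hΦ, ha, this]
      rfl
    refine ⟨fun n => ?_, ?_⟩
    · rw [e]
      exact key.1 _ (hposR n)
    · simp_rw [e]
      have := key.2 _ hposR hlimR
      rwa [ha0, hΦa] at this
  have hΦi : Integrable (fun ω => Φ ω - f x) P := by
    refine Integrable.of_bound (C := 2 * B) (aestronglyMeasurable_of_tendsto_ae atTop
      (fun n => (hFi n).integral_prod_right.aestronglyMeasurable) (hexit.mono fun ω h => h.2)) ?_
    filter_upwards [hexit] with ω h1
    exact le_of_tendsto h1.2.norm (Eventually.of_forall h1.1)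
  have hΦi' : Integrable Φ P := by
    have := hΦi.add (integrable_const (f x))
    refine this.congr (Eventually.of_forall fun ω => ?_)
    simp
  have hlim1 : Tendsto (fun n => ∫ p, F n p ∂((volume.restrict (Set.Ioi 0)).prod P)) atTop
      (𝓝 (∫ ω, (Φ ω - f x) ∂P)) := by
    simp_rw [fun n => integral_prod_symm _ (hFi n)]
    exact tendsto_integral_of_dominated_convergence (fun _ => 2 * B)
      (fun n => (hFi n).integral_prod_right.aestronglyMeasurable) (integrable_const _)
      (fun n => hexit.mono fun ω h => h.1 n) (hexit.mono fun ω h => h.2)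
  have hLe : ∀ᵐ ω ∂P, ∫ s in Set.Ioi (0 : ℝ), L ω s
      = ∫ s in {s : ℝ | 0 ≤ s ∧ ENNReal.ofReal s ≤ ruinTime (fun t => U t ω)},
      Real.exp (-q * s) * (levyGenerator c σ ν f f' f'' (U s.toNNReal ω) - q * f (U s.toNNReal ω)
        - dividendRate δ b (fun t => U t ω) s * f' (U s.toNNReal ω)) := by
    filter_upwards [hpath] with ω h1
    exact setIntegral_indicator_alive h1.right_cont _
  refine ⟨hΦi', hLi.congr hLe, ?_⟩
  rw [← integral_congr_ae hLe]
  simp_rw [hFF'] at hlim1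
  have := tendsto_nhds_unique hlim1 hLlim
  rw [integral_sub hΦi' (integrable_const _)] at this
  simp only [integral_const, probReal_univ, smul_eq_mul, one_mul] at this
  linarith

end Dynkin

/-! ### Twice differentiable extension to the negative axis. -/

section Extension

/-- A rapidly decaying function on the negative half-line with prescribed value and first two
derivatives `s₀`, `s₁`, `s₂` at `0`, and its derivatives. -/
def decayingTail (s₀ s₁ s₂ N : ℝ) (k : ℕ) (x : ℝ) : ℝ :=
  (3 * s₀ - 5 / 2 * s₁ / N + s₂ / (2 * N ^ 2)) * N ^ k * Real.exp (N * x)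
    + (-3 * s₀ + 4 * s₁ / N - s₂ / N ^ 2) * (2 * N) ^ k * Real.exp (2 * N * x)
    + (s₀ - 3 / 2 * s₁ / N + s₂ / (2 * N ^ 2)) * (3 * N) ^ k * Real.exp (3 * N * x)

variable {s₀ s₁ s₂ N : ℝ}

theorem hasDerivAt_decayingTail (s₀ s₁ s₂ N : ℝ) (k : ℕ) (x : ℝ) :
    HasDerivAt (decayingTail s₀ s₁ s₂ N k) (decayingTail s₀ s₁ s₂ N (k + 1) x) x := by
  have h : ∀ a c : ℝ, HasDerivAt (fun x => a * c ^ k * Real.exp (c * x))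
      (a * c ^ (k + 1) * Real.exp (c * x)) x := fun a c =>
    ((((hasDerivAt_id x).const_mul c).exp.const_mul (a * c ^ k))).congr_deriv (by simp; ring)
  exact ((h _ N).add (h _ (2 * N))).add (h _ (3 * N))

/-- The three coefficients in `decayingTail` solve the Vandermonde system for the rates `N`, `2N`,
`3N`. -/
theorem decayingTail_zero (hN : N ≠ 0) : decayingTail s₀ s₁ s₂ N 0 0 = s₀ ∧
    decayingTail s₀ s₁ s₂ N 1 0 = s₁ ∧ decayingTail s₀ s₁ s₂ N 2 0 = s₂ := by
  refine ⟨?_, ?_, ?_⟩ <;>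
  · simp only [decayingTail, mul_zero, Real.exp_zero, mul_one]
    field_simp
    ring

theorem abs_exp_combination_le {N x : ℝ} (hN : 0 ≤ N) (hx : x ≤ 0) (a b c : ℝ) :
    |a * Real.exp (N * x) + b * Real.exp (2 * N * x) + c * Real.exp (3 * N * x)|
      ≤ (|a| + |b| + |c|) * Real.exp (N * x) := by
  have hNx : N * x ≤ 0 := mul_nonpos_of_nonneg_of_nonpos hN hx
  have h2 : Real.exp (2 * N * x) ≤ Real.exp (N * x) := Real.exp_le_exp.2 (by linarith)
  have h3 : Real.exp (3 * N * x) ≤ Real.exp (N * x) := Real.exp_le_exp.2 (by linarith)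
  refine (abs_add_three _ _ _).trans ?_
  rw [abs_mul, abs_mul, abs_mul, Real.abs_exp, Real.abs_exp, Real.abs_exp, add_mul, add_mul]
  have := mul_le_mul_of_nonneg_left h2 (abs_nonneg b)
  have := mul_le_mul_of_nonneg_left h3 (abs_nonneg c)
  linarith

/-- For `N ≥ 1` the coefficients are bounded independently of `N`, so the extension is uniformly
bounded and tends to `0` at each negative point. The constants sum the coefficients: `3 + 3 + 1`,
`5/2 + 4 + 3/2`, `1/2 + 1 + 1/2`. -/
theorem abs_decayingTail_zero_le (hN : 1 ≤ N) {x : ℝ} (hx : x ≤ 0) :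
    |decayingTail s₀ s₁ s₂ N 0 x| ≤ (7 * |s₀| + 8 * |s₁| + 2 * |s₂|) * Real.exp (N * x) := by
  have hN0 : 0 < N := by linarith
  simp only [decayingTail, pow_zero, mul_one]
  refine (abs_exp_combination_le hN0.le hx _ _ _).trans ?_
  refine mul_le_mul_of_nonneg_right ?_ (Real.exp_pos _).le
  have d1 : |s₁ / N| ≤ |s₁| := by
    rw [abs_div, abs_of_pos hN0]
    exact div_le_self (abs_nonneg _) hN
  have d2 : |s₂ / N ^ 2| ≤ |s₂| := by
    have hN2 : 1 ≤ N ^ 2 := by nlinarith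
    rw [abs_div, abs_of_nonneg (sq_nonneg N)]
    exact div_le_self (abs_nonneg _) hN2
  have e : ∀ k : ℝ, k * s₁ / N = k * (s₁ / N) := fun k => mul_div_assoc _ _ _
  have e2 : s₂ / (2 * N ^ 2) = 1 / 2 * (s₂ / N ^ 2) := by ring
  rw [e, e, e, e2]
  have b : ∀ k l m r s t : ℝ, |k * r + l * s + m * t| ≤ |k| * |r| + |l| * |s| + |m| * |t| :=
    fun k l m r s t => (abs_add_three _ _ _).trans_eq (by rw [abs_mul, abs_mul, abs_mul])
  have b1 := b 3 (-5 / 2) (1 / 2) s₀ (s₁ / N) (s₂ / N ^ 2)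
  have b2 := b (-3) 4 (-1) s₀ (s₁ / N) (s₂ / N ^ 2)
  have b3 := b 1 (-3 / 2) (1 / 2) s₀ (s₁ / N) (s₂ / N ^ 2)
  have a1 : |(3 : ℝ)| = 3 := by norm_num
  have a2 : |(-5 / 2 : ℝ)| = 5 / 2 := by rw [abs_of_neg] <;> norm_num
  have a3 : |(1 / 2 : ℝ)| = 1 / 2 := by rw [abs_of_pos]; norm_num
  have a4 : |(-3 : ℝ)| = 3 := by norm_num
  have a5 : |(4 : ℝ)| = 4 := by norm_num
  have a6 : |(-3 / 2 : ℝ)| = 3 / 2 := by rw [abs_of_neg] <;> norm_num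
  have a7 : |(-1 : ℝ)| = 1 := by norm_num
  rw [a1, a2, a3] at b1
  rw [a4, a5, a7] at b2
  rw [abs_one, a6, a3] at b3
  have f1 : 3 * s₀ - 5 / 2 * (s₁ / N) + 1 / 2 * (s₂ / N ^ 2)
    = 3 * s₀ + -5 / 2 * (s₁ / N) + 1 / 2 * (s₂ / N ^ 2) := by ring
  have f2 : -3 * s₀ + 4 * (s₁ / N) - s₂ / N ^ 2
    = -3 * s₀ + 4 * (s₁ / N) + -1 * (s₂ / N ^ 2) := by ring
  have f3 : s₀ - 3 / 2 * (s₁ / N) + 1 / 2 * (s₂ / N ^ 2)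
    = 1 * s₀ + -3 / 2 * (s₁ / N) + 1 / 2 * (s₂ / N ^ 2) := by ring
  rw [f1, f2, f3]
  linarith

theorem exists_abs_decayingTail_le (s₀ s₁ s₂ : ℝ) (hN : 0 ≤ N) (k : ℕ) :
    ∃ C, ∀ x ≤ 0, |decayingTail s₀ s₁ s₂ N k x| ≤ C := by
  refine ⟨_, fun x hx => (abs_exp_combination_le hN hx _ _ _).trans
    (mul_le_of_le_one_right (by positivity) (Real.exp_le_one_iff.2
      (mul_nonpos_of_nonneg_of_nonpos hN hx)))⟩

/-- The function equal to `v` on `[0, ∞)` and to `g` on `(-∞, 0)`. -/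
def glue (v g : ℝ → ℝ) (x : ℝ) : ℝ := if 0 ≤ x then v x else g x

variable {v g : ℝ → ℝ}

theorem glue_of_nonneg {x : ℝ} (hx : 0 ≤ x) : glue v g x = v x := if_pos hx

theorem glue_of_neg {x : ℝ} (hx : x < 0) : glue v g x = g x := if_neg (not_le.2 hx)

theorem continuous_glue (hv : ContinuousOn v (Set.Ici 0)) (hg : Continuous g) (h0 : v 0 = g 0) :
    Continuous (glue v g) := by
  refine continuous_if_le continuous_const continuous_id hv hg.continuousOn fun x hx => ?_
  rw [← show (0 : ℝ) = x from hx, h0]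

theorem hasDerivAt_glue_of_ne {v' g' : ℝ → ℝ} (hv : ∀ x > 0, HasDerivAt v (v' x) x)
    (hg : ∀ x, HasDerivAt g (g' x) x) {x : ℝ} (hx : x ≠ 0) :
    HasDerivAt (glue v g) (glue v' g' x) x := by
  rcases lt_or_gt_of_ne hx with h | h
  · rw [glue_of_neg h]
    refine (hg x).congr_of_eventuallyEq ?_
    filter_upwards [Iio_mem_nhds h] with y hy using glue_of_neg hy
  · rw [glue_of_nonneg h.le]
    refine (hv x h).congr_of_eventuallyEq ?_
    filter_upwards [Ioi_mem_nhds h] with y hy using glue_of_nonneg (le_of_lt hy)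

theorem isBoundedC2_glue {v : ℕ → ℝ → ℝ} {K : ℝ} (hc : ∀ k ≤ 2, ContinuousOn (v k) (Set.Ici 0))
    (hd : ∀ k ≤ 1, ∀ x > 0, HasDerivAt (v k) (v (k + 1) x) x) (hb : ∀ k ≤ 2, ∀ x ≥ 0, |v k x| ≤ K)
    (hN : 0 < N) : ∃ B, IsBoundedC2
      (glue (v 0) (decayingTail (v 0 0) (v 1 0) (v 2 0) N 0))
      (glue (v 1) (decayingTail (v 0 0) (v 1 0) (v 2 0) N 1))
      (glue (v 2) (decayingTail (v 0 0) (v 1 0) (v 2 0) N 2)) B := by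
  set g := decayingTail (v 0 0) (v 1 0) (v 2 0) N with hg
  obtain ⟨z0, z1, z2⟩ := decayingTail_zero (s₀ := v 0 0) (s₁ := v 1 0) (s₂ := v 2 0) hN.ne'
  have hgc : ∀ k, Continuous (g k) := fun k => continuous_iff_continuousAt.2 fun x =>
    (hasDerivAt_decayingTail _ _ _ _ _ x).continuousAt
  have c0 := continuous_glue (hc 0 (by omega)) (hgc 0) z0.symm
  have c1 := continuous_glue (hc 1 (by omega)) (hgc 1) z1.symm
  have c2 := continuous_glue (hc 2 (by omega)) (hgc 2) z2.symm
  have d : ∀ k ≤ 1, Continuous (glue (v k) (g k)) → Continuous (glue (v (k + 1)) (g (k + 1))) →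
      ∀ x, HasDerivAt (glue (v k) (g k)) (glue (v (k + 1)) (g (k + 1)) x) x := fun k hk h h' x => by
    have hne : ∀ y, y ≠ 0 → HasDerivAt (glue (v k) (g k)) (glue (v (k + 1)) (g (k + 1)) y) y :=
      fun y hy => hasDerivAt_glue_of_ne (hd k hk) (hasDerivAt_decayingTail _ _ _ _ _) hy
    -- At the junction differentiability follows from the derivatives elsewhere and the continuity
    -- of their glued extension.
    by_cases hx : x = 0
    · subst hx
      exact hasDerivAt_of_hasDerivAt_of_ne hne h.continuousAt h'.continuousAt
    · exact hne x hx
  choose C hC using fun k => exists_abs_decayingTail_le (v 0 0) (v 1 0) (v 2 0) hN.le k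
  have hB : ∀ k ≤ 2, ∀ x, |glue (v k) (g k) x| ≤ |K| + |C 0| + |C 1| + |C 2| := fun k hk x => by
    rcases le_or_gt 0 x with h | h
    · rw [glue_of_nonneg h]
      have := hb k hk x h
      have := le_abs_self K
      have := abs_nonneg (C 0)
      have := abs_nonneg (C 1)
      have := abs_nonneg (C 2)
      linarith
    · rw [glue_of_neg h]
      have h1 := hC k x h.le
      have := abs_nonneg K
      have := abs_nonneg (C 0)
      have := abs_nonneg (C 1)
      have := abs_nonneg (C 2)
      have := le_abs_self (C k)
      interval_cases k <;> linarith
  exact ⟨_, d 0 (by omega) c0 c1, d 1 (by omega) c1 c2, c2, hB 0 (by omega), hB 1 (by omega),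
    hB 2 (by omega)⟩

end Extension

/-! ### Identification of the value function. -/

section Verification

/-- A bounded solution, with value `S` at `0`, of the equation for the value function of the
threshold strategy at level `b`: `v k` is the `k`-th derivative. -/
structure IsThresholdSolution (c σ : ℝ) (ν : Measure ℝ) (q δ S b : ℝ) (v : ℕ → ℝ → ℝ) (K : ℝ) :
    Prop where
  continuousOn : ∀ k ≤ 2, ContinuousOn (v k) (Set.Ici 0)
  hasDerivAt : ∀ k ≤ 1, ∀ x > 0, HasDerivAt (v k) (v (k + 1) x) x
  abs_le : ∀ k ≤ 2, ∀ x ≥ 0, |v k x| ≤ K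
  zero : v 0 0 = S
  equation : ∀ x > 0, c * v 1 x + σ ^ 2 / 2 * v 2 x - (ν.real (Set.Ioi 0) + q) * v 0 x
    + ∫ z in Set.Ioi (0 : ℝ), (Set.Ici 0).indicator (v 0) (x - z) ∂ν
    = (if b < x then δ else 0) * (v 1 x - 1)

namespace IsThresholdSolution

variable {c σ : ℝ} {ν : Measure ℝ} {q δ S b : ℝ} {v : ℕ → ℝ → ℝ} {K : ℝ}

theorem nonneg (H : IsThresholdSolution c σ ν q δ S b v K) : 0 ≤ K :=
  (abs_nonneg _).trans (H.abs_le 0 (by omega) 0 le_rfl)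

theorem measurable_indicator (H : IsThresholdSolution c σ ν q δ S b v K) :
    Measurable ((Set.Ici 0).indicator (v 0)) := by
  have e : (Set.Ici 0).indicator (v 0) = (Set.Ici 0).indicator fun x => v 0 (max x 0) := by
    funext x
    by_cases hx : x ∈ Set.Ici (0 : ℝ)
    · rw [Set.indicator_of_mem hx, Set.indicator_of_mem hx, max_eq_left hx]
    · rw [Set.indicator_of_notMem hx, Set.indicator_of_notMem hx]
  rw [e]
  exact (continuous_comp_max (H.continuousOn 0 (by omega))).measurable.indicator measurableSet_Ici

theorem abs_indicator_le (H : IsThresholdSolution c σ ν q δ S b v K) (x : ℝ) :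
    |(Set.Ici 0).indicator (v 0) x| ≤ K := by
  by_cases hx : x ∈ Set.Ici (0 : ℝ)
  · rw [Set.indicator_of_mem hx]
    exact H.abs_le 0 (by omega) x hx
  · rw [Set.indicator_of_notMem hx, abs_zero]
    exact H.nonneg

theorem integrable_indicator [IsFiniteMeasure ν] (H : IsThresholdSolution c σ ν q δ S b v K)
    (x : ℝ) : IntegrableOn (fun z => (Set.Ici 0).indicator (v 0) (x - z)) (Set.Ioi 0) ν :=
  Integrable.of_bound (C := K)
    (H.measurable_indicator.comp (measurable_const.sub measurable_id)).aestronglyMeasurable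
    (Eventually.of_forall fun _ => H.abs_indicator_le _)

/-- Limit `x ↓ 0` of the equation: a jump of any fixed size eventually leads below `0`, and no
dividends are paid near `0` since `b > 0`. -/
theorem equation_zero [IsFiniteMeasure ν] (H : IsThresholdSolution c σ ν q δ S b v K) (hb : 0 < b) :
    c * v 1 0 + σ ^ 2 / 2 * v 2 0 - (ν.real (Set.Ioi 0) + q) * v 0 0 = 0 := by
  have hv : ∀ k ≤ 2, Tendsto (v k) (𝓝[>] 0) (𝓝 (v k 0)) := fun k hk =>
    ((H.continuousOn k hk) 0 Set.self_mem_Ici).mono_left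
      (nhdsWithin_mono _ Set.Ioi_subset_Ici_self)
  have hJ : Tendsto (fun x => ∫ z in Set.Ioi (0 : ℝ), (Set.Ici 0).indicator (v 0) (x - z) ∂ν)
      (𝓝[>] 0) (𝓝 (∫ z in Set.Ioi (0 : ℝ), (0 : ℝ) ∂ν)) := by
    refine tendsto_integral_filter_of_dominated_convergence (fun _ => K) ?_ ?_
      (integrable_const _) ?_
    · exact Eventually.of_forall fun x =>
        (H.integrable_indicator x).aestronglyMeasurable
    · exact Eventually.of_forall fun x => Eventually.of_forall fun z => H.abs_indicator_le _
    · filter_upwards [ae_restrict_mem measurableSet_Ioi] with z hz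
      refine tendsto_const_nhds.congr' ?_
      filter_upwards [nhdsWithin_le_nhds (Iio_mem_nhds (show (0 : ℝ) < z from hz))] with x hx
      have hx' : x < z := hx
      rw [Set.indicator_of_notMem]
      rw [Set.mem_Ici, not_le]
      linarith
  rw [integral_zero] at hJ
  have hlim := ((((hv 1 (by omega)).const_mul c).add ((hv 2 le_rfl).const_mul (σ ^ 2 / 2))).sub
    ((hv 0 (by omega)).const_mul (ν.real (Set.Ioi 0) + q))).add hJ
  rw [add_zero] at hlim
  refine tendsto_nhds_unique hlim (tendsto_const_nhds.congr' ?_)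
  filter_upwards [self_mem_nhdsWithin, nhdsWithin_le_nhds (Iio_mem_nhds hb)] with x hx hxb
  have hxb' : x < b := hxb
  rw [H.equation x hx, if_neg (not_lt.2 hxb'.le), zero_mul]

/-- The contribution of jumps below `0` to the generator of the extended function. -/
def jumpError (ν : Measure ℝ) (v : ℕ → ℝ → ℝ) (N y : ℝ) : ℝ :=
  ∫ z in Set.Ioi (0 : ℝ), (Set.Iio 0).indicator (decayingTail (v 0 0) (v 1 0) (v 2 0) N 0) (y - z) ∂ν

theorem abs_decayingTail_le (H : IsThresholdSolution c σ ν q δ S b v K) {N : ℝ} (hN : 1 ≤ N) {x : ℝ}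
    (hx : x ≤ 0) : |decayingTail (v 0 0) (v 1 0) (v 2 0) N 0 x| ≤ 17 * K * Real.exp (N * x) := by
  refine (abs_decayingTail_zero_le hN hx).trans
    (mul_le_mul_of_nonneg_right ?_ (Real.exp_pos _).le)
  linarith [H.abs_le 0 (by omega) 0 le_rfl, H.abs_le 1 (by omega) 0 le_rfl,
    H.abs_le 2 (by omega) 0 le_rfl]

theorem abs_decayingTail_le_const (H : IsThresholdSolution c σ ν q δ S b v K) {N : ℝ} (hN : 1 ≤ N)
    {x : ℝ} (hx : x ≤ 0) : |decayingTail (v 0 0) (v 1 0) (v 2 0) N 0 x| ≤ 17 * K :=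
  (H.abs_decayingTail_le hN hx).trans (mul_le_of_le_one_right (by linarith [H.nonneg])
    (Real.exp_le_one_iff.2 (mul_nonpos_of_nonneg_of_nonpos (by linarith) hx)))

theorem tendsto_decayingTail (H : IsThresholdSolution c σ ν q δ S b v K) {x : ℝ} (hx : x < 0) :
    Tendsto (fun n : ℕ => decayingTail (v 0 0) (v 1 0) (v 2 0) (n + 1) 0 x) atTop (𝓝 0) := by
  have h1 : Tendsto (fun n : ℕ => ((n : ℝ) + 1) * x) atTop atBot :=
    (tendsto_atTop_add_const_right _ 1 tendsto_natCast_atTop_atTop).atTop_mul_const_of_neg hx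
  have h2 : Tendsto (fun n : ℕ => 17 * K * Real.exp (((n : ℝ) + 1) * x)) atTop (𝓝 0) := by
    simpa [Function.comp_def] using (Real.tendsto_exp_atBot.comp h1).const_mul (17 * K)
  exact squeeze_zero_norm (fun n => H.abs_decayingTail_le (by simp) hx.le) h2

theorem abs_indicator_decayingTail_le (H : IsThresholdSolution c σ ν q δ S b v K) {N : ℝ}
    (hN : 1 ≤ N) (x : ℝ) :
    |(Set.Iio 0).indicator (decayingTail (v 0 0) (v 1 0) (v 2 0) N 0) x| ≤ 17 * K := by
  by_cases hx : x ∈ Set.Iio (0 : ℝ)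
  · rw [Set.indicator_of_mem hx]
    exact H.abs_decayingTail_le_const hN (le_of_lt hx)
  · rw [Set.indicator_of_notMem hx, abs_zero]
    linarith [H.nonneg]

theorem measurable_indicator_decayingTail (v : ℕ → ℝ → ℝ) (N : ℝ) :
    Measurable ((Set.Iio 0).indicator (decayingTail (v 0 0) (v 1 0) (v 2 0) N 0)) :=
  (continuous_iff_continuousAt.2 fun x =>
    (hasDerivAt_decayingTail _ _ _ _ _ x).continuousAt).measurable.indicator measurableSet_Iio

theorem integrable_indicator_decayingTail [IsFiniteMeasure ν]
    (H : IsThresholdSolution c σ ν q δ S b v K) {N : ℝ} (hN : 1 ≤ N) (y : ℝ) :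
    IntegrableOn (fun z => (Set.Iio 0).indicator (decayingTail (v 0 0) (v 1 0) (v 2 0) N 0) (y - z))
      (Set.Ioi 0) ν :=
  Integrable.of_bound (C := 17 * K) ((measurable_indicator_decayingTail v N).comp
    (measurable_const.sub measurable_id)).aestronglyMeasurable
    (Eventually.of_forall fun _ => H.abs_indicator_decayingTail_le hN _)

theorem abs_jumpError_le [IsFiniteMeasure ν] (H : IsThresholdSolution c σ ν q δ S b v K) {N : ℝ}
    (hN : 1 ≤ N) (y : ℝ) : |jumpError ν v N y| ≤ 17 * K * ν.real (Set.Ioi 0) :=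
  abs_integral_jumps_le (H.abs_indicator_decayingTail_le hN) y

theorem tendsto_jumpError [IsFiniteMeasure ν] (H : IsThresholdSolution c σ ν q δ S b v K) (y : ℝ) :
    Tendsto (fun n : ℕ => jumpError ν v (n + 1) y) atTop (𝓝 0) := by
  have : Tendsto (fun n : ℕ => jumpError ν v (n + 1) y) atTop
      (𝓝 (∫ z in Set.Ioi (0 : ℝ), (0 : ℝ) ∂ν)) := by
    refine tendsto_integral_of_dominated_convergence (fun _ => 17 * K)
      (fun n => (H.integrable_indicator_decayingTail (by simp) y).aestronglyMeasurable)
      (integrable_const _) (fun n => Eventually.of_forall fun z =>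
        H.abs_indicator_decayingTail_le (by simp) _) (Eventually.of_forall fun z => ?_)
    by_cases hz : y - z ∈ Set.Iio (0 : ℝ)
    · simp only [Set.indicator_of_mem hz]
      exact H.tendsto_decayingTail hz
    · simp only [Set.indicator_of_notMem hz]
      exact tendsto_const_nhds
  rwa [integral_zero] at this

/-- On `[0, ∞)` the extension enters the generator only through jumps below `0`, where the equation
counts zero and the extension counts its tail. -/
theorem generator_glue [IsFiniteMeasure ν] (H : IsThresholdSolution c σ ν q δ S b v K) (hb : 0 < b)
    {N : ℝ} (hN : 1 ≤ N) {y : ℝ} (hy : 0 ≤ y) :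
    levyGenerator c σ ν (glue (v 0) (decayingTail (v 0 0) (v 1 0) (v 2 0) N 0))
      (glue (v 1) (decayingTail (v 0 0) (v 1 0) (v 2 0) N 1))
      (glue (v 2) (decayingTail (v 0 0) (v 1 0) (v 2 0) N 2)) y
      - q * glue (v 0) (decayingTail (v 0 0) (v 1 0) (v 2 0) N 0) y
      - (if b < y then δ else 0) * glue (v 1) (decayingTail (v 0 0) (v 1 0) (v 2 0) N 1) y
      = -(if b < y then δ else 0) + jumpError ν v N y := by
  have e : ∫ z in Set.Ioi (0 : ℝ), glue (v 0) (decayingTail (v 0 0) (v 1 0) (v 2 0) N 0) (y - z) ∂ν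
      = (∫ z in Set.Ioi (0 : ℝ), (Set.Ici 0).indicator (v 0) (y - z) ∂ν) + jumpError ν v N y := by
    rw [jumpError, ← integral_add (H.integrable_indicator y)
      (H.integrable_indicator_decayingTail hN y)]
    refine integral_congr_ae (Eventually.of_forall fun z => ?_)
    rcases le_or_gt 0 (y - z) with h | h
    · have h1 : y - z ∈ Set.Ici (0 : ℝ) := h
      have h2 : y - z ∉ Set.Iio (0 : ℝ) := not_lt.2 h
      simp only [glue_of_nonneg h, Set.indicator_of_mem h1, Set.indicator_of_notMem h2, add_zero]
    · have h1 : y - z ∉ Set.Ici (0 : ℝ) := not_le.2 h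
      have h2 : y - z ∈ Set.Iio (0 : ℝ) := h
      simp only [glue_of_neg h, Set.indicator_of_mem h2, Set.indicator_of_notMem h1, zero_add]
  rw [levyGenerator, e, glue_of_nonneg hy, glue_of_nonneg hy, glue_of_nonneg hy]
  rcases hy.eq_or_lt with rfl | hy
  · have h1 := H.equation_zero hb
    have h2 : ∫ z in Set.Ioi (0 : ℝ), (Set.Ici 0).indicator (v 0) (0 - z) ∂ν = 0 := by
      refine setIntegral_eq_zero_of_forall_eq_zero fun z hz => Set.indicator_of_notMem ?_ _
      have hz' : 0 < z := hz
      rw [Set.mem_Ici, not_le]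
      linarith
    rw [h2, if_neg (not_lt.2 hb.le)]
    linarith
  · have := H.equation y hy
    linarith

end IsThresholdSolution

/-- A bounded solution of the equation is the value function of the threshold strategy. -/
theorem DividendData.value_eq (M : DividendData) [IsFiniteMeasure M.ν] (hq : 0 < M.q)
    (hδ : 0 < M.δ) {Ω : Type*} {mΩ : MeasurableSpace Ω} {P : Measure Ω} [IsProbabilityMeasure P]
    {𝓕 : Filtration ℝ≥0 mΩ} {X : ℝ≥0 → Ω → ℝ} (hX : IsSpectrallyNegativeLevy P 𝓕 M.γ M.σ M.ν X)
    {b : ℝ} (hb : 0 < b) {U : ℝ → ℝ≥0 → Ω → ℝ}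
    (hU : ∀ x, IsThresholdSurplus P 𝓕 X M.δ b x (U x)) {v : ℕ → ℝ → ℝ} {K : ℝ}
    (H : IsThresholdSolution M.c M.σ M.ν M.q M.δ M.S b v K) {x : ℝ} (hx : 0 ≤ x) :
    M.value P b U x = v 0 x := by
  have hK := H.nonneg
  set f : ℕ → ℕ → ℝ → ℝ := fun n k =>
    glue (v k) (decayingTail (v 0 0) (v 1 0) (v 2 0) ((n : ℝ) + 1) k) with hf
  have hN : ∀ n : ℕ, (1 : ℝ) ≤ (n : ℝ) + 1 := fun n => by simp
  choose B hB using fun n : ℕ => isBoundedC2_glue H.continuousOn H.hasDerivAt H.abs_le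
    (N := (n : ℝ) + 1) (by positivity)
  have hB' : ∀ n, IsBoundedC2 (f n 0) (f n 1) (f n 2) (B n) := hB
  have hpath := (hU x).ae_thresholdPath hδ hX
  set τ : Ω → ℝ≥0∞ := fun ω => ruinTime fun t => U x t ω with hτ
  set D : Ω → Set ℝ := fun ω => {s : ℝ | 0 ≤ s ∧ ENNReal.ofReal s ≤ τ ω} with hD
  set Φ : ℕ → Ω → ℝ := fun n ω => if τ ω < ⊤ then
    Real.exp (-M.q * (τ ω).toReal) * f n 0 (U x (τ ω).toNNReal ω) else 0 with hΦ
  set G : ℕ → Ω → ℝ → ℝ := fun n ω s => Real.exp (-M.q * s) *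
    (levyGenerator M.c M.σ M.ν (f n 0) (f n 1) (f n 2) (U x s.toNNReal ω)
      - M.q * f n 0 (U x s.toNNReal ω)
      - dividendRate M.δ b (fun t => U x t ω) s * f n 1 (U x s.toNNReal ω)) with hG
  have dyn : ∀ n, Integrable (Φ n) P ∧ Integrable (fun ω => ∫ s in D ω, G n ω s) P ∧
      f n 0 x = (∫ ω, Φ n ω ∂P) - ∫ ω, (∫ s in D ω, G n ω s) ∂P := fun n =>
    (hU x).dynkin hX hδ hq (hB' n)
  set Φ₀ : Ω → ℝ := fun ω => if τ ω < ⊤ ∧ U x (τ ω).toNNReal ω = 0 then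
    M.S * Real.exp (-M.q * (τ ω).toReal) else 0 with hΦ₀
  set G₀ : Ω → ℝ → ℝ := fun ω s =>
    Real.exp (-M.q * s) * dividendRate M.δ b (fun t => U x t ω) s with hG₀
  have hΦlim : ∀ᵐ ω ∂P, (∀ n, |Φ n ω| ≤ 17 * K) ∧
      Tendsto (fun n => Φ n ω) atTop (𝓝 (Φ₀ ω)) := by
    filter_upwards [hpath] with ω h1
    by_cases ht : τ ω < ⊤
    · have hle : U x (τ ω).toNNReal ω ≤ 0 := apply_ruinTime_nonpos h1.right_cont ht
      have hexp : Real.exp (-M.q * (τ ω).toReal) ≤ 1 := by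
        have := mul_nonneg hq.le (ENNReal.toReal_nonneg (a := τ ω))
        exact Real.exp_le_one_iff.2 (by linarith)
      simp only [hΦ, hΦ₀, if_pos ht, ht, true_and]
      -- Creeping yields `S` for every `N`; an overshoot yields the decaying tail, which vanishes in
      -- the limit.
      rcases hle.eq_or_lt with h0 | h0
      · have e : ∀ n, f n 0 0 = M.S := fun n => by
          rw [hf]
          simp only [glue_of_nonneg le_rfl, H.zero]
        rw [if_pos h0]
        simp only [h0, e]
        refine ⟨fun n => ?_, ?_⟩
        · have := H.abs_le 0 (by omega) 0 le_rfl
          rw [H.zero] at this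
          rw [abs_mul, Real.abs_exp]
          calc _ ≤ 1 * K := mul_le_mul hexp this (abs_nonneg _) zero_le_one
            _ ≤ _ := by linarith
        · rw [mul_comm]
          exact tendsto_const_nhds
      · rw [if_neg h0.ne]
        simp only [hf, glue_of_neg h0]
        refine ⟨fun n => ?_, ?_⟩
        · rw [abs_mul, Real.abs_exp]
          calc _ ≤ 1 * (17 * K) := mul_le_mul hexp (H.abs_decayingTail_le_const (hN n) h0.le)
                (abs_nonneg _) zero_le_one
            _ = _ := one_mul _
        · simpa using (H.tendsto_decayingTail h0).const_mul (Real.exp (-M.q * (τ ω).toReal))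
    · simp only [hΦ, hΦ₀, if_neg ht, ht, false_and, if_false, abs_zero]
      exact ⟨fun _ => by positivity, tendsto_const_nhds⟩
  set C := M.δ + 17 * K * M.ν.real (Set.Ioi 0) with hC
  have hexpi : IntegrableOn (fun s => C * Real.exp (-M.q * s)) (Set.Ici 0) :=
    (integrableOn_Ici_iff_integrableOn_Ioi (by simp)).2 ((exp_neg_integrableOn_Ioi 0 hq).const_mul C)
  have hDm : ∀ ω, MeasurableSet (D ω) := fun ω =>
    measurableSet_Ici.inter (measurableSet_le ENNReal.measurable_ofReal measurable_const)
  have hDs : ∀ ω, D ω ⊆ Set.Ici 0 := fun ω s hs => hs.1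
  have hG' : ∀ᵐ ω ∂P, (∀ n, ∀ᵐ s ∂(volume.restrict (D ω)), |G n ω s| ≤ C * Real.exp (-M.q * s)) ∧
      ∀ᵐ s ∂(volume.restrict (D ω)), Tendsto (fun n => G n ω s) atTop (𝓝 (-G₀ ω s)) := by
    filter_upwards [hpath] with ω h1
    -- Before ruin the path is nonnegative; the times `0` and `τ` form a null set.
    have hae : ∀ᵐ s ∂(volume.restrict (D ω)), 0 ≤ U x s.toNNReal ω := by
      filter_upwards [ae_restrict_mem (hDm ω), ae_restrict_of_ae (Measure.ae_ne volume 0),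
        ae_restrict_of_ae (Measure.ae_ne volume (τ ω).toReal)] with s hs h0 hst
      have hs0 : 0 < s := lt_of_le_of_ne hs.1 (Ne.symm h0)
      refine nonneg_of_lt_ruinTime (u := fun t => U x t ω) (Real.toNNReal_pos.2 hs0)
        (lt_of_le_of_ne hs.2 fun he => hst ?_)
      change ENNReal.ofReal s = τ ω at he
      rw [← he, ENNReal.toReal_ofReal hs0.le]
    have hGe : ∀ᵐ s ∂(volume.restrict (D ω)), ∀ n, G n ω s = Real.exp (-M.q * s) *
        (-dividendRate M.δ b (fun t => U x t ω) s
          + IsThresholdSolution.jumpError M.ν v ((n : ℝ) + 1) (U x s.toNNReal ω)) := by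
      filter_upwards [hae] with s hs n
      exact congrArg (Real.exp (-M.q * s) * ·) (H.generator_glue hb (hN n) hs)
    refine ⟨fun n => ?_, ?_⟩
    · filter_upwards [hGe] with s hs
      rw [hs n, abs_mul, Real.abs_exp, mul_comm]
      refine mul_le_mul_of_nonneg_right ((abs_add_le _ _).trans (add_le_add ?_
        (H.abs_jumpError_le (hN n) _))) (Real.exp_pos _).le
      rw [abs_neg, abs_of_nonneg (dividendRate_nonneg hδ _ _ _)]
      exact dividendRate_le hδ _ _ _
    · filter_upwards [hGe] with s hs
      simp only [hs, hG₀]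
      have := ((H.tendsto_jumpError (U x s.toNNReal ω)).const_add
        (-dividendRate M.δ b (fun t => U x t ω) s)).const_mul (Real.exp (-M.q * s))
      rwa [add_zero, mul_neg] at this
  have hGm : ∀ᵐ ω ∂P, ∀ n, Measurable (G n ω) := by
    filter_upwards [hpath] with ω h1 n
    have m := h1.measurable.comp measurable_real_toNNReal
    have e : Measurable fun s : ℝ => Real.exp (-M.q * s) := by fun_prop
    exact e.mul ((((continuous_levyGenerator (hB' n)).measurable.comp m).sub
      (((hB' n).continuous.measurable.comp m).const_mul _)).sub
      ((measurable_dividendRate h1.measurable).mul ((hB' n).continuous'.measurable.comp m)))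
  have hbound : ∀ᵐ ω ∂P, ∀ n, |∫ s in D ω, G n ω s| ≤ ∫ s in Set.Ici 0, C * Real.exp (-M.q * s) := by
    filter_upwards [hG'] with ω h n
    rw [← Real.norm_eq_abs]
    refine (norm_integral_le_of_norm_le (hexpi.mono_set (hDs ω)) (h.1 n)).trans ?_
    refine setIntegral_mono_set hexpi (Eventually.of_forall fun s => ?_) (hDs ω).eventuallyLE
    have : 0 ≤ M.ν.real (Set.Ioi 0) := measureReal_nonneg
    change (0 : ℝ) ≤ C * Real.exp (-M.q * s)
    positivity
  have hlimG : ∀ᵐ ω ∂P, Tendsto (fun n => ∫ s in D ω, G n ω s) atTop (𝓝 (∫ s in D ω, -G₀ ω s)) := by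
    filter_upwards [hG', hGm] with ω h hm
    exact tendsto_integral_of_dominated_convergence (fun s => C * Real.exp (-M.q * s))
      (fun n => (hm n).aestronglyMeasurable) (hexpi.mono_set (hDs ω)) h.1 h.2
  have l1 : Tendsto (fun n => ∫ ω, Φ n ω ∂P) atTop (𝓝 (∫ ω, Φ₀ ω ∂P)) :=
    tendsto_integral_of_dominated_convergence (fun _ => 17 * K)
      (fun n => (dyn n).1.aestronglyMeasurable) (integrable_const _)
      (fun n => hΦlim.mono fun ω h => h.1 n) (hΦlim.mono fun ω h => h.2)
  have l2 : Tendsto (fun n => ∫ ω, (∫ s in D ω, G n ω s) ∂P) atTop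
      (𝓝 (∫ ω, (∫ s in D ω, -G₀ ω s) ∂P)) :=
    tendsto_integral_of_dominated_convergence (fun _ => ∫ s in Set.Ici 0, C * Real.exp (-M.q * s))
      (fun n => (dyn n).2.1.aestronglyMeasurable) (integrable_const _)
      (fun n => hbound.mono fun ω h => h n) hlimG
  have i1 : Integrable Φ₀ P := Integrable.of_bound (C := 17 * K)
    (aestronglyMeasurable_of_tendsto_ae atTop (fun n => (dyn n).1.aestronglyMeasurable)
      (hΦlim.mono fun ω h => h.2))
    (hΦlim.mono fun ω h => le_of_tendsto h.2.norm (Eventually.of_forall h.1))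
  have i2 : Integrable (fun ω => ∫ s in D ω, -G₀ ω s) P := by
    refine Integrable.of_bound (C := ∫ s in Set.Ici 0, C * Real.exp (-M.q * s))
      (aestronglyMeasurable_of_tendsto_ae atTop (fun n => (dyn n).2.1.aestronglyMeasurable) hlimG) ?_
    filter_upwards [hbound, hlimG] with ω h1 h2
    exact le_of_tendsto h2.norm (Eventually.of_forall h1)
  have hfx : ∀ n, f n 0 x = v 0 x := fun n => glue_of_nonneg hx
  -- At `x ≥ 0` the extended functions do not depend on `n`, so the limit of Dynkin's formulas is
  -- the value of `v 0` itself.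
  have key := tendsto_nhds_unique (l1.sub l2)
    (tendsto_const_nhds.congr fun n => ((hfx n).symm.trans (dyn n).2.2))
  rw [← key, ← integral_sub i1 i2]
  refine integral_congr_ae (Eventually.of_forall fun ω => ?_)
  simp only [integral_neg, sub_neg_eq_add]
  rw [add_comm]
  rfl

end Verification

/-! ### The level `b*` through tail ratios. -/

section TailRatio

variable {f g : ℝ → ℝ}

theorem hasDerivWithinAt_integral_Ioi (hf : ContinuousOn f (Set.Ici 0))
    (hi : IntegrableOn f (Set.Ioi 0)) {b : ℝ} (hb : 0 ≤ b) :
    HasDerivWithinAt (fun b => ∫ y in Set.Ioi b, f y) (-f b) (Set.Ici 0) b := by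
  have hc := continuous_comp_max hf
  have h1 : HasDerivAt (fun b => ∫ y in (0 : ℝ)..b, f (max y 0)) (f (max b 0)) b :=
    intervalIntegral.integral_hasDerivAt_right (hc.intervalIntegrable _ _)
      (hc.stronglyMeasurableAtFilter _ _) hc.continuousAt
  have h2 := (h1.const_sub (∫ y in Set.Ioi (0 : ℝ), f y)).hasDerivWithinAt (s := Set.Ici 0)
  rw [max_eq_left hb] at h2
  have e : ∀ c ∈ Set.Ici (0 : ℝ), ∫ y in Set.Ioi c, f y
      = (∫ y in Set.Ioi (0 : ℝ), f y) - ∫ y in (0 : ℝ)..c, f (max y 0) := fun c hc => by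
    have hc0 : 0 ≤ c := hc
    have e1 : ∫ y in (0 : ℝ)..c, f (max y 0) = ∫ y in Set.Ioc 0 c, f y := by
      rw [intervalIntegral.integral_of_le hc0]
      exact setIntegral_congr_fun measurableSet_Ioc fun y hy => by
        simp only [max_eq_left hy.1.le]
    rw [e1, ← Set.Ioc_union_Ioi_eq_Ioi hc0, setIntegral_union (Set.Ioc_disjoint_Ioi le_rfl)
      measurableSet_Ioi (hi.mono_set Set.Ioc_subset_Ioi_self)
      (hi.mono_set (Set.Ioi_subset_Ioi hc0))]
    ring
  exact h2.congr e (e b hb)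

theorem integral_Ioi_pos (hg : ∀ y ≥ 0, 0 < g y) (hi : IntegrableOn g (Set.Ioi 0)) {b : ℝ}
    (hb : 0 ≤ b) : 0 < ∫ y in Set.Ioi b, g y := by
  have hpos : ∀ y ∈ Set.Ioi b, 0 < g y := fun y hy => hg y (hb.trans (le_of_lt hy))
  rw [setIntegral_pos_iff_support_of_nonneg_ae
    ((ae_restrict_mem measurableSet_Ioi).mono fun y hy => (hpos y hy).le)
    (hi.mono_set (Set.Ioi_subset_Ioi hb))]
  have : Function.support g ∩ Set.Ioi b = Set.Ioi b :=
    Set.inter_eq_right.2 fun y hy => (hpos y hy).ne'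
  rw [this, Real.volume_Ioi]
  exact ENNReal.zero_lt_top

/-- The quotient rule arranged so that the sign is that of the tail ratio minus the pointwise ratio.
-/
theorem hasDerivWithinAt_tailRatio (hf : ContinuousOn f (Set.Ici 0))
    (hfi : IntegrableOn f (Set.Ioi 0)) (hg : ContinuousOn g (Set.Ici 0))
    (hgi : IntegrableOn g (Set.Ioi 0)) (hpos : ∀ y ≥ 0, 0 < g y) {b : ℝ} (hb : 0 ≤ b) :
    HasDerivWithinAt (fun b => (∫ y in Set.Ioi b, f y) / ∫ y in Set.Ioi b, g y)
      (g b / (∫ y in Set.Ioi b, g y) * ((∫ y in Set.Ioi b, f y) / (∫ y in Set.Ioi b, g y)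
        - f b / g b)) (Set.Ici 0) b := by
  have hG := integral_Ioi_pos hpos hgi hb
  have hgb := hpos b hb
  refine ((hasDerivWithinAt_integral_Ioi hf hfi hb).div (hasDerivWithinAt_integral_Ioi hg hgi hb)
    hG.ne').congr_deriv ?_
  field_simp
  ring

/-- If the ratio of the densities attains a maximum, the ratio of the tails is somewhere below
it. -/
theorem tailRatio_le (hfi : IntegrableOn f (Set.Ioi 0)) (hgi : IntegrableOn g (Set.Ioi 0))
    (hpos : ∀ y ≥ 0, 0 < g y) {b : ℝ} (hb : 0 ≤ b) (hmax : ∀ y ≥ b, f y / g y ≤ f b / g b) :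
    (∫ y in Set.Ioi b, f y) / (∫ y in Set.Ioi b, g y) ≤ f b / g b := by
  rw [div_le_iff₀ (integral_Ioi_pos hpos hgi hb), ← integral_const_mul]
  refine setIntegral_mono_on (hfi.mono_set (Set.Ioi_subset_Ioi hb))
    ((hgi.mono_set (Set.Ioi_subset_Ioi hb)).const_mul _) measurableSet_Ioi fun y hy => ?_
  exact (div_le_iff₀ (hpos y (hb.trans (le_of_lt hy)))).1 (hmax y (le_of_lt hy))

/-- The first point where the derivative `k · (T - r)` of `T` is nonpositive. -/
theorem first_nonpos_deriv {T r k : ℝ → ℝ} (hk : ∀ b ≥ 0, 0 < k b)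
    (hT : ∀ b ≥ 0, HasDerivWithinAt T (k b * (T b - r b)) (Set.Ici 0) b)
    (hr : ContinuousOn r (Set.Ici 0)) (hex : ∃ b ≥ 0, T b ≤ r b) {B : ℝ≥0∞}
    (hB : B = ⨅ (b : ℝ≥0) (_ : derivWithin T (Set.Ici 0) b ≤ 0), (b : ℝ≥0∞)) (h0 : 0 < B) :
    B ≠ ⊤ ∧ T B.toReal = r B.toReal ∧ ∀ y, 0 ≤ y → y ≤ B.toReal → r y ≤ T B.toReal := by
  have hiff : ∀ b : ℝ≥0, derivWithin T (Set.Ici 0) b ≤ 0 ↔ T b ≤ r b := fun b => by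
    rw [(hT b b.2).derivWithin (uniqueDiffOn_Ici 0 _ b.2)]
    constructor
    · intro h
      by_contra hn
      exact absurd h (not_le.2 (mul_pos (hk b b.2) (by linarith [not_le.1 hn])))
    · intro h
      exact mul_nonpos_of_nonneg_of_nonpos (hk b b.2).le (by linarith)
  simp_rw [hiff] at hB
  have hTc : ContinuousOn T (Set.Ici 0) := fun b hb => (hT b hb).continuousWithinAt
  obtain ⟨b₁, hb₁, hTb₁⟩ := hex
  have hBt : B ≠ ⊤ := by
    refine ne_top_of_le_ne_top (ENNReal.coe_ne_top (r := ⟨b₁, hb₁⟩)) ?_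
    rw [hB]
    exact iInf₂_le (⟨b₁, hb₁⟩ : ℝ≥0) hTb₁
  set β := B.toReal with hβ
  have hβ0 : 0 < β := ENNReal.toReal_pos h0.ne' hBt
  have hbelow : ∀ y, 0 ≤ y → y < β → r y < T y := fun y hy hyβ => by
    lift y to ℝ≥0 using hy
    by_contra hn
    have h1 : B ≤ (y : ℝ≥0∞) := by
      have hn' : T y ≤ r y := not_lt.1 hn
      rw [hB]
      exact iInf₂_le (f := fun (b : ℝ≥0) (_ : T b ≤ r b) => (b : ℝ≥0∞)) y hn'
    exact absurd hyβ (not_lt.2 (ENNReal.toReal_mono ENNReal.coe_ne_top h1))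
  have hle : r β ≤ T β := by
    have hmem : β ∈ closure (Set.Ico 0 β) := by
      rw [closure_Ico hβ0.ne]
      exact Set.right_mem_Icc.2 hβ0.le
    have hsub : closure (Set.Ico 0 β) ⊆ Set.Ici 0 := by
      rw [closure_Ico hβ0.ne]
      exact Set.Icc_subset_Ici_self
    exact le_on_closure (fun y hy => (hbelow y hy.1 hy.2).le) (hr.mono hsub) (hTc.mono hsub) hmem
  -- Otherwise `T > r` would persist just beyond `β`, and no admissible point could come close to
  -- the infimum.
  have hge : T β ≤ r β := by
    by_contra hn
    rw [not_le] at hn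
    have hev' : ∀ᶠ y in 𝓝 β, r y < T y := by
      have c1 := (hr.continuousAt (Ici_mem_nhds hβ0)).tendsto
      have c2 := (hTc.continuousAt (Ici_mem_nhds hβ0)).tendsto
      exact c1.eventually_lt c2 hn
    obtain ⟨ε, hε, hev'⟩ := Metric.eventually_nhds_iff.1 hev'
    have hlt : B < B + ENNReal.ofReal ε :=
      ENNReal.lt_add_right hBt (ENNReal.ofReal_pos.2 hε).ne'
    nth_rewrite 1 [hB] at hlt
    rw [iInf_lt_iff] at hlt
    obtain ⟨y, hy⟩ := hlt
    rw [iInf_lt_iff] at hy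
    obtain ⟨hTy, hy⟩ := hy
    have hyB : B ≤ y := by
      rw [hB]
      exact iInf₂_le y hTy
    have h1 : β ≤ y := ENNReal.toReal_mono ENNReal.coe_ne_top hyB
    have h2 : (y : ℝ) < β + ε := by
      have := (ENNReal.toReal_lt_toReal ENNReal.coe_ne_top
        (ENNReal.add_ne_top.2 ⟨hBt, ENNReal.ofReal_ne_top⟩)).2 hy
      rwa [ENNReal.toReal_add hBt ENNReal.ofReal_ne_top, ENNReal.toReal_ofReal hε.le] at this
    have := hev' (y := y) (by
      rw [Real.dist_eq, abs_of_nonneg (by linarith)]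
      linarith)
    linarith
  refine ⟨hBt, le_antisymm hge hle, fun y hy hyβ => ?_⟩
  rcases hyβ.eq_or_lt with rfl | hlt
  · exact hle
  · refine (hbelow y hy hlt).le.trans ?_
    -- As long as `T > r` the derivative is positive, so `T` is largest at `β` and dominates all
    -- earlier values of `r`.
    have hmono : MonotoneOn T (Set.Icc 0 β) := by
      refine monotoneOn_of_deriv_nonneg (convex_Icc 0 β) (hTc.mono Set.Icc_subset_Ici_self) ?_ ?_
      · intro z hz
        rw [interior_Icc] at hz
        exact ((hT z hz.1.le).hasDerivAt (Ici_mem_nhds hz.1)).differentiableAt.differentiableWithinAt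
      · intro z hz
        rw [interior_Icc] at hz
        rw [((hT z hz.1.le).hasDerivAt (Ici_mem_nhds hz.1)).deriv]
        exact mul_nonneg (hk z hz.1.le).le (by linarith [hbelow z hz.1.le hz.2])
    exact hmono ⟨hy, hyβ⟩ ⟨hβ0.le, le_rfl⟩ hyβ

end TailRatio

namespace ScaleRepr

variable {γ σ : ℝ} {ν : Measure ℝ} {q Φ : ℝ} {ζ : Measure ℝ}

/-- The growing exponentials cancel in `ΦW' - W'' = ∫ (t² + Φt) e^{-yt} ζ(dt)`, which is nonnegative
and bounded, while `W' → ∞`. -/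
theorem expMix_two_sub (R : ScaleRepr γ σ ν q Φ ζ) {y : ℝ} (hy : 0 ≤ y) :
    0 ≤ Φ * expMix Φ ζ 1 y - expMix Φ ζ 2 y ∧
      Φ * expMix Φ ζ 1 y - expMix Φ ζ 2 y ≤ (∫ t, t ^ 2 ∂ζ) + Φ * ∫ t, t ∂ζ := by
  have hΦ := R.φ_pos
  have i1 := R.integrable_pow_mul_exp (k := 1) (by omega) hy
  have i2 := R.integrable_pow_mul_exp (k := 2) (by omega) hy
  have e : Φ * expMix Φ ζ 1 y - expMix Φ ζ 2 y
      = (∫ t, (-t) ^ 2 * Real.exp (-y * t) ∂ζ) + Φ * -∫ t, (-t) ^ 1 * Real.exp (-y * t) ∂ζ := by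
    simp only [expMix]
    ring
  have hle : ∀ t > 0, Real.exp (-y * t) ≤ 1 := fun t ht =>
    Real.exp_le_one_iff.2 (by nlinarith)
  have a1 : 0 ≤ -∫ t, (-t) ^ 1 * Real.exp (-y * t) ∂ζ := by
    rw [← integral_neg]
    refine integral_nonneg_of_ae ?_
    filter_upwards [R.ae_pos] with t ht
    have := Real.exp_pos (-y * t)
    simp only [Pi.zero_apply]
    nlinarith
  have a2 : -∫ t, (-t) ^ 1 * Real.exp (-y * t) ∂ζ ≤ ∫ t, t ∂ζ := by
    rw [← integral_neg]
    refine integral_mono_ae i1.neg (by simpa using R.integrable_pow 1 (by omega)) ?_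
    filter_upwards [R.ae_pos] with t ht
    have := hle t ht
    simp only [pow_one]
    nlinarith
  have b1 : 0 ≤ ∫ t, (-t) ^ 2 * Real.exp (-y * t) ∂ζ :=
    integral_nonneg fun t => mul_nonneg (sq_nonneg _) (Real.exp_pos _).le
  have b2 : ∫ t, (-t) ^ 2 * Real.exp (-y * t) ∂ζ ≤ ∫ t, t ^ 2 ∂ζ := by
    refine integral_mono_ae i2 (R.integrable_pow 2 (by omega)) ?_
    filter_upwards [R.ae_pos] with t ht
    have := hle t ht
    simp only [neg_sq]
    exact mul_le_of_le_one_right (sq_nonneg t) this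
  rw [e]
  refine ⟨add_nonneg b1 (mul_nonneg hΦ.le a1), add_le_add b2 (mul_le_mul_of_nonneg_left a2 hΦ.le)⟩

theorem tendsto_expMix_one (R : ScaleRepr γ σ ν q Φ ζ) : Tendsto (expMix Φ ζ 1) atTop atTop := by
  have hm := R.ne_zero
  have hΦ := R.φ_pos
  have h1 : Tendsto (fun y => ζ.real Set.univ * Φ ^ 1 * Real.exp (Φ * y)) atTop atTop :=
    (Real.tendsto_exp_atTop.comp (tendsto_id.const_mul_atTop hΦ)).const_mul_atTop (by positivity)
  refine tendsto_atTop_mono (fun y => ?_) h1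
  have : ∫ t, (-t) ^ 1 * Real.exp (-y * t) ∂ζ ≤ 0 := by
    refine integral_nonpos_of_ae ?_
    filter_upwards [R.ae_pos] with t ht
    have := Real.exp_pos (-y * t)
    simp only [Pi.zero_apply]
    nlinarith
  simp only [expMix]
  linarith

/-- The ratio `(1 - s W'') / W'` attains its maximum on `[0, ∞)`. -/
theorem exists_max_ratio (R : ScaleRepr γ σ ν q Φ ζ) {s : ℝ} (hs : 0 < s) :
    ∃ b ≥ 0, ∀ y ≥ 0, (1 - s * expMix Φ ζ 2 y) / expMix Φ ζ 1 y
      ≤ (1 - s * expMix Φ ζ 2 b) / expMix Φ ζ 1 b := by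
  set r : ℝ → ℝ := fun y => (1 - s * expMix Φ ζ 2 y) / expMix Φ ζ 1 y with hr
  set C := (∫ t, t ^ 2 ∂ζ) + Φ * ∫ t, t ∂ζ with hC
  -- In this form `r` is strictly above `-sΦ` at `0` and is bounded above by a function tending to
  -- `-sΦ`; a maximum over a compact interval is therefore global.
  have e : ∀ y, r y = -(s * Φ)
      + (1 + s * (Φ * expMix Φ ζ 1 y - expMix Φ ζ 2 y)) / expMix Φ ζ 1 y := fun y => by
    have := (R.expMix_one_pos y).ne'
    simp only [hr]
    field_simp
    ring
  have hrc : ContinuousOn r (Set.Ici 0) :=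
    (continuousOn_const.sub (continuousOn_const.mul (R.continuousOn_expMix (by omega)))).div
      (R.continuousOn_expMix (by omega)) fun y _ => (R.expMix_one_pos y).ne'
  have h0 : -(s * Φ) < r 0 := by
    have h1 := (R.expMix_two_sub le_rfl).1
    have : 0 < (1 + s * (Φ * expMix Φ ζ 1 0 - expMix Φ ζ 2 0)) / expMix Φ ζ 1 0 :=
      div_pos (by positivity) (R.expMix_one_pos 0)
    rw [e]
    linarith
  have hlim : Tendsto (fun y => -(s * Φ) + (1 + s * C) / expMix Φ ζ 1 y) atTop
      (𝓝 (-(s * Φ) + 0)) :=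
    (tendsto_const_nhds.div_atTop R.tendsto_expMix_one).const_add _
  rw [add_zero] at hlim
  obtain ⟨Y, hY⟩ := eventually_atTop.1 (hlim.eventually_lt_const h0)
  obtain ⟨b, hb, hmax⟩ := isCompact_Icc.exists_isMaxOn (s := Set.Icc 0 (max Y 0)) (f := r)
    ⟨0, Set.left_mem_Icc.2 (le_max_right _ _)⟩ (hrc.mono Set.Icc_subset_Ici_self)
  refine ⟨b, hb.1, fun y hy => ?_⟩
  rcases le_or_gt y (max Y 0) with h | h
  · exact hmax ⟨hy, h⟩
  · have h1 : r y ≤ -(s * Φ) + (1 + s * C) / expMix Φ ζ 1 y := by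
      rw [e]
      have := (R.expMix_two_sub hy).2
      have := mul_le_mul_of_nonneg_left this hs.le
      have := div_le_div_of_nonneg_right (show 1 + s * (Φ * expMix Φ ζ 1 y - expMix Φ ζ 2 y)
        ≤ 1 + s * C by linarith) (R.expMix_one_pos y).le
      linarith
    exact (h1.trans (hY y ((le_max_left _ _).trans h.le)).le).trans
      (hmax (Set.left_mem_Icc.2 (le_max_right _ _)))

end ScaleRepr

/-! ### Concavity of the kernel and exponential decay. -/

theorem convexOn_mul_exp {y : ℝ} (hy : 0 ≤ y) :
    ConvexOn ℝ (Set.Ici 0) fun z => z * Real.exp (z * y) := by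
  have h1 : ConvexOn ℝ (Set.Ici (0 : ℝ)) fun z => z := convexOn_id (convex_Ici 0)
  have h2 : ConvexOn ℝ (Set.Ici (0 : ℝ)) fun z => Real.exp (z * y) := by
    have := (convexOn_exp.comp_linearMap (LinearMap.mulRight ℝ y)).subset (Set.subset_univ _)
      (convex_Ici (0 : ℝ))
    exact this
  refine h1.mul h2 (fun z hz => hz) (fun z _ => (Real.exp_pos _).le) ?_
  intro z _ w _ h
  have : Real.exp (z * y) < Real.exp (w * y) := h
  have h3 := Real.exp_lt_exp.1 this
  by_contra hn
  rw [not_le] at hn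
  have : w * y ≤ z * y := mul_le_mul_of_nonneg_right hn.le hy
  linarith

/-- A concave function that is positive at `0` and somewhere negative changes sign once. -/
theorem exists_sign_change {p : ℝ → ℝ} (hp : ConcaveOn ℝ (Set.Ici 0) p) (hc : Continuous p)
    (h0 : 0 < p 0) {z₁ : ℝ} (hz₁ : 0 ≤ z₁) (h1 : p z₁ < 0) :
    ∃ β > 0, (∀ z, 0 ≤ z → z ≤ β → 0 ≤ p z) ∧ ∀ z, β ≤ z → p z ≤ 0 := by
  obtain ⟨β, hβ, hpβ⟩ := intermediate_value_Icc' hz₁ hc.continuousOn ⟨h1.le, h0.le⟩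
  have hβ0 : 0 < β := lt_of_le_of_ne hβ.1 fun h => by
    rw [← h] at hpβ
    exact h0.ne' hpβ
  refine ⟨β, hβ0, fun z hz hzβ => ?_, fun z hz => ?_⟩
  · have := hp.2 (Set.mem_Ici.2 le_rfl) (Set.mem_Ici.2 hβ0.le)
      (show 0 ≤ 1 - z / β by rw [sub_nonneg, div_le_one hβ0]; exact hzβ)
      (show 0 ≤ z / β by positivity) (by ring)
    simp only [smul_eq_mul, mul_zero, zero_add, div_mul_cancel₀ _ hβ0.ne', hpβ, add_zero] at this
    refine le_trans (mul_nonneg ?_ h0.le) this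
    rw [sub_nonneg, div_le_one hβ0]
    exact hzβ
  · by_contra hn
    rw [not_le] at hn
    have hz0 : 0 < z := hβ0.trans_le hz
    have := hp.2 (Set.mem_Ici.2 le_rfl) (Set.mem_Ici.2 hz0.le)
      (show 0 ≤ 1 - β / z by rw [sub_nonneg, div_le_one hz0]; exact hz)
      (show 0 ≤ β / z by positivity) (by ring)
    simp only [smul_eq_mul, mul_zero, zero_add, div_mul_cancel₀ _ hz0.ne', hpβ] at this
    have h2 : 0 ≤ (1 - β / z) * p 0 := mul_nonneg (by
      rw [sub_nonneg, div_le_one hz0]; exact hz) h0.le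
    have h3 : 0 < β / z * p z := by positivity
    linarith

namespace SmoothFit

variable {γ σ : ℝ} {ν : Measure ℝ} {q δ S A b Φ φ : ℝ} {ζ ξ : Measure ℝ}

theorem thresholdKernel_zero (S σ A δ b Φ : ℝ) (ζ : Measure ℝ) :
    thresholdKernel S σ A δ b Φ ζ 0 = δ := by simp [thresholdKernel]

theorem continuousOn_exp_mul_baseValue (H : SmoothFit γ σ ν q δ S A b Φ φ ζ ξ) (z : ℝ) :
    ContinuousOn (fun y => Real.exp (z * y) * (1 - baseValue S σ A Φ ζ 1 y)) (Set.uIcc 0 b) := by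
  rw [Set.uIcc_of_le H.b_pos.le]
  exact ContinuousOn.mul (by fun_prop) (continuousOn_const.sub
    ((continuousOn_baseValue H.reprX (by omega)).mono Set.Icc_subset_Ici_self))

/-- Replacing `e^{bz} - 1` by `∫_0^b z e^{zy} dy` merges both exponential terms into one integral
with weight `1 - v₀'`, whose sign is known. -/
theorem thresholdKernel_eq (H : SmoothFit γ σ ν q δ S A b Φ φ ζ ξ) (z : ℝ) :
    thresholdKernel S σ A δ b Φ ζ z = δ + (A - S * δ) * z - S * (σ ^ 2 / 2) * z ^ 2
      + δ * ∫ y in (0 : ℝ)..b, z * Real.exp (z * y) * (1 - baseValue S σ A Φ ζ 1 y) := by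
  have hσ := H.σ_pos
  have e1 : ∫ y in (0 : ℝ)..b, z * Real.exp (z * y) = Real.exp (b * z) - 1 := by
    have hd : ∀ y ∈ Set.uIcc 0 b, HasDerivAt (fun y => Real.exp (z * y)) (z * Real.exp (z * y)) y :=
      fun y _ => (((hasDerivAt_id y).const_mul z).exp).congr_deriv (by simp; ring)
    rw [intervalIntegral.integral_eq_sub_of_hasDerivAt hd
      ((by fun_prop : Continuous fun y => z * Real.exp (z * y)).intervalIntegrable _ _)]
    simp [mul_comm]
  have i1 : IntervalIntegrable (fun y => z * Real.exp (z * y)) volume 0 b :=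
    (by fun_prop : Continuous fun y => z * Real.exp (z * y)).intervalIntegrable _ _
  have i2 : IntervalIntegrable (fun y => z * (Real.exp (z * y) * baseValue S σ A Φ ζ 1 y))
      volume 0 b := by
    refine ContinuousOn.intervalIntegrable ?_
    rw [Set.uIcc_of_le H.b_pos.le]
    exact continuousOn_const.mul (ContinuousOn.mul (by fun_prop)
      ((continuousOn_baseValue H.reprX (by omega)).mono Set.Icc_subset_Ici_self))
  have e2 : ∫ y in (0 : ℝ)..b, z * Real.exp (z * y) * (1 - baseValue S σ A Φ ζ 1 y)
      = (Real.exp (b * z) - 1)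
        - z * ∫ y in (0 : ℝ)..b, Real.exp (z * y) * baseValue S σ A Φ ζ 1 y := by
    rw [← e1, ← intervalIntegral.integral_const_mul, ← intervalIntegral.integral_sub i1 i2]
    exact intervalIntegral.integral_congr fun y _ => by ring
  rw [e2, thresholdKernel]
  field_simp
  ring

/-- If the slope below the threshold is at least one, the kernel is concave. -/
theorem concaveOn_thresholdKernel (H : SmoothFit γ σ ν q δ S A b Φ φ ζ ξ) (hS : 0 ≤ S)
    (hge : ∀ y, 0 ≤ y → y ≤ b → 1 ≤ baseValue S σ A Φ ζ 1 y) :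
    ConcaveOn ℝ (Set.Ici 0) (thresholdKernel S σ A δ b Φ ζ) := by
  have hb := H.b_pos
  have hint : ∀ z, IntervalIntegrable
      (fun y => z * Real.exp (z * y) * (1 - baseValue S σ A Φ ζ 1 y)) volume 0 b := fun z => by
    refine ContinuousOn.intervalIntegrable ?_
    refine ((continuousOn_const (c := z)).mul (H.continuousOn_exp_mul_baseValue z)).congr fun y _ => ?_
    simp only [Pi.mul_apply]
    ring
  have hI : ConcaveOn ℝ (Set.Ici 0) fun z =>
      ∫ y in (0 : ℝ)..b, z * Real.exp (z * y) * (1 - baseValue S σ A Φ ζ 1 y) := by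
    refine ⟨convex_Ici 0, fun z hz w hw a c ha hc hac => ?_⟩
    simp only [smul_eq_mul]
    rw [← intervalIntegral.integral_const_mul, ← intervalIntegral.integral_const_mul,
      ← intervalIntegral.integral_add ((hint z).const_mul a) ((hint w).const_mul c)]
    refine intervalIntegral.integral_mono_on hb.le
      (((hint z).const_mul a).add ((hint w).const_mul c)) (hint _) fun y hy => ?_
    have h1 := (convexOn_mul_exp hy.1).2 hz hw ha hc hac
    simp only [smul_eq_mul] at h1
    have h2 := hge y hy.1 hy.2
    nlinarith [mul_le_mul_of_nonneg_right h1 (show 0 ≤ baseValue S σ A Φ ζ 1 y - 1 by linarith)]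
  have hq : ConcaveOn ℝ (Set.Ici 0) fun z : ℝ => δ + (A - S * δ) * z - S * (σ ^ 2 / 2) * z ^ 2 := by
    refine ⟨convex_Ici 0, fun z _ w _ a c ha hc hac => ?_⟩
    simp only [smul_eq_mul]
    have hc' : c = 1 - a := by linarith
    subst hc'
    have h3 : 0 ≤ S * (σ ^ 2 / 2) := by positivity
    nlinarith [mul_nonneg h3 (mul_nonneg (mul_nonneg ha hc) (sq_nonneg (z - w)))]
  refine (hq.add (hI.smul H.δ_pos.le)).congr fun z _ => ?_
  simp only [Pi.add_apply, smul_eq_mul]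
  exact (H.thresholdKernel_eq z).symm

theorem exists_thresholdKernel_neg (H : SmoothFit γ σ ν q δ S A b Φ φ ζ ξ) (hS : 0 < S)
    (hge : ∀ y, 0 ≤ y → y ≤ b → 1 ≤ baseValue S σ A Φ ζ 1 y) :
    ∃ z ≥ 0, thresholdKernel S σ A δ b Φ ζ z < 0 := by
  have hσ := H.σ_pos
  have hδ := H.δ_pos
  set k := S * (σ ^ 2 / 2) with hk
  have hk0 : 0 < k := by positivity
  set m := |A - S * δ| with hm
  have hm0 : 0 ≤ m := abs_nonneg _
  -- Chosen so that `k z = m + δ + k`: the quadratic term then outweighs both the linear term and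
  -- `δ`, and the integral only helps.
  refine ⟨(m + δ) / k + 1, by positivity, ?_⟩
  set z := (m + δ) / k + 1 with hz
  have hz1 : 1 ≤ z := by
    have : 0 ≤ (m + δ) / k := by positivity
    linarith
  have hkz : k * z = m + δ + k := by
    rw [hz]
    field_simp
  have hI : ∫ y in (0 : ℝ)..b, z * Real.exp (z * y) * (1 - baseValue S σ A Φ ζ 1 y) ≤ 0 := by
    have : 0 ≤ ∫ y in (0 : ℝ)..b, -(z * Real.exp (z * y) * (1 - baseValue S σ A Φ ζ 1 y)) := by
      refine intervalIntegral.integral_nonneg H.b_pos.le fun y hy => ?_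
      have h1 : 0 ≤ z * Real.exp (z * y) := by positivity
      have h2 := hge y hy.1 hy.2
      nlinarith
    rw [intervalIntegral.integral_neg] at this
    linarith
  rw [H.thresholdKernel_eq, ← hk]
  have h1 : (A - S * δ) * z ≤ m * z :=
    mul_le_mul_of_nonneg_right (le_abs_self _) (by linarith)
  have h2 : k * z ^ 2 = m * z + δ * z + k * z := by
    calc k * z ^ 2 = k * z * z := by ring
      _ = (m + δ + k) * z := by rw [hkz]
      _ = _ := by ring
  have h3 : δ * 1 ≤ δ * z := mul_le_mul_of_nonneg_left hz1 hδ.le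
  have h4 : 0 < k * z := by positivity
  have h5 := mul_nonpos_of_nonneg_of_nonpos hδ.le hI
  linarith

/-- Exponential decay of the second derivative above the threshold. -/
theorem exists_decay (H : SmoothFit γ σ ν q δ S A b Φ φ ζ ξ) (hS : 0 < S)
    (hge : ∀ y, 0 ≤ y → y ≤ b → 1 ≤ baseValue S σ A Φ ζ 1 y) :
    ∃ β > 0, ∀ x > b, thresholdValue S σ A δ b Φ φ ζ ξ 2 x
      ≤ Real.exp (-(x - b) * β) * thresholdValue S σ A δ b Φ φ ζ ξ 2 b := by
  obtain ⟨z₁, hz₁, hneg⟩ := H.exists_thresholdKernel_neg hS hge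
  obtain ⟨β, hβ, hlo, hhi⟩ := exists_sign_change (H.concaveOn_thresholdKernel hS.le hge)
    H.continuous_kernel (by rw [thresholdKernel_zero]; exact H.δ_pos) hz₁ hneg
  refine ⟨β, hβ, fun x hx => ?_⟩
  obtain ⟨-, -, h2⟩ := H.integrable_kernel_mul
  have hint : ∀ x > b, Integrable
      (fun z => Real.exp (-x * z) * (-(z * thresholdKernel S σ A δ b Φ ζ z))) ξ := fun x hx => by
    have hK := H.continuous_kernel
    refine h2.mono (by fun_prop : Continuous _).aestronglyMeasurable ?_
    filter_upwards [H.reprY.ae_pos] with z hz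
    simp only [norm_mul, norm_neg, Real.norm_eq_abs, Real.abs_exp]
    refine mul_le_mul_of_nonneg_right (Real.exp_le_exp.2 ?_) (by positivity)
    nlinarith
  -- Below `β` the factor `-z p(z)` is nonpositive and `e^{-(x - x')z}` is the larger exponential;
  -- above `β` both comparisons reverse. Replacing `z` by `β` in that exponential thus increases the
  -- integrand everywhere.
  have key : ∀ x' ∈ Set.Ioo b x, thresholdValue S σ A δ b Φ φ ζ ξ 2 x
      ≤ Real.exp (-(x - x') * β) * thresholdValue S σ A δ b Φ φ ζ ξ 2 x' := fun x' hx' => by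
    rw [H.thresholdValue_two_eq hx, H.thresholdValue_two_eq hx'.1, ← integral_const_mul]
    refine integral_mono_ae (hint x hx) ((hint x' hx'.1).const_mul _) ?_
    filter_upwards [H.reprY.ae_pos] with z hz
    have e : Real.exp (-x * z) = Real.exp (-(x - x') * z) * Real.exp (-x' * z) := by
      rw [← Real.exp_add]
      congr 1
      ring
    rw [e, mul_assoc]
    have hxx : 0 < x - x' := sub_pos.2 hx'.2
    have hE := Real.exp_pos (-x' * z)
    rcases le_total z β with h | h
    · have hp := hlo z hz.le h
      have hle : Real.exp (-(x - x') * β) ≤ Real.exp (-(x - x') * z) :=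
        Real.exp_le_exp.2 (by nlinarith)
      refine mul_le_mul_of_nonpos_right hle ?_
      exact mul_nonpos_of_nonneg_of_nonpos hE.le (neg_nonpos.2 (mul_nonneg hz.le hp))
    · have hp := hhi z h
      have hle : Real.exp (-(x - x') * z) ≤ Real.exp (-(x - x') * β) :=
        Real.exp_le_exp.2 (by nlinarith)
      refine mul_le_mul_of_nonneg_right hle ?_
      exact mul_nonneg hE.le (neg_nonneg.2 (mul_nonpos_of_nonneg_of_nonpos hz.le hp))
  -- The integral formula is available only above `b`; continuity of the second derivative carries
  -- the bound to the limit `x' ↓ b`.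
  have hlim : Tendsto (fun x' => Real.exp (-(x - x') * β) * thresholdValue S σ A δ b Φ φ ζ ξ 2 x')
      (𝓝[>] b) (𝓝 (Real.exp (-(x - b) * β) * thresholdValue S σ A δ b Φ φ ζ ξ 2 b)) := by
    have c1 : Tendsto (fun x' => Real.exp (-(x - x') * β)) (𝓝[>] b)
        (𝓝 (Real.exp (-(x - b) * β))) :=
      ((by fun_prop : Continuous fun x' => Real.exp (-(x - x') * β)).tendsto b).mono_left
        nhdsWithin_le_nhds
    have c2 := ((H.continuousOn_thresholdValue le_rfl).continuousAt (Ici_mem_nhds H.b_pos)).tendsto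
    exact c1.mul (c2.mono_left nhdsWithin_le_nhds)
  refine ge_of_tendsto hlim ?_
  filter_upwards [Ioo_mem_nhdsGT hx] with x' hx' using key x' hx'

/-- The candidate solves the equation of the threshold strategy. -/
theorem exists_isThresholdSolution [IsFiniteMeasure ν] {ρ : ℝ → ℝ} (hρ : IsJumpDensity ν ρ)
    (H : SmoothFit γ σ ν q δ S A b Φ φ ζ ξ) :
    ∃ K, IsThresholdSolution (γ + ∫ z in Set.Ioo (0 : ℝ) 1, z ∂ν) σ ν q δ S b
      (thresholdValue S σ A δ b Φ φ ζ ξ) K := by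
  obtain ⟨K, hK⟩ := H.exists_abs_thresholdValue_le
  exact ⟨K, fun k hk => H.continuousOn_thresholdValue hk,
    fun k hk x hx => H.hasDerivAt_thresholdValue hk hx, hK, H.thresholdValue_zero_zero,
    fun x hx => H.thresholdValue_equation hρ hx⟩

end SmoothFit

/-! ### From the data to smooth fit, and the theorem. -/

namespace DividendData

variable {M : DividendData}

theorem A_eq {Φ : ℝ} {ζ : Measure ℝ} (R : ScaleRepr M.γ M.σ M.ν M.q Φ ζ) {b : ℝ} (hb : 0 ≤ b) :
    M.A b = (∫ y in Set.Ioi b, Real.exp (-M.φ M.q * y)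
        * (1 - M.S * (M.σ ^ 2 / 2) * expMix Φ ζ 2 y))
      / ∫ y in Set.Ioi b, Real.exp (-M.φ M.q * y) * expMix Φ ζ 1 y := by
  have h : ∀ y ∈ Set.Ioi b, deriv M.W y = expMix Φ ζ 1 y ∧ deriv (deriv M.W) y = expMix Φ ζ 2 y :=
    fun y hy => ⟨R.deriv_scaleFunction (hb.trans_lt hy), R.deriv_deriv_scaleFunction (hb.trans_lt hy)⟩
  rw [A]
  congr 1
  · exact setIntegral_congr_fun measurableSet_Ioi fun y hy => by simp only [(h y hy).2]
  · exact setIntegral_congr_fun measurableSet_Ioi fun y hy => by simp only [(h y hy).1]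

theorem p_eq {Φ : ℝ} {ζ : Measure ℝ} (R : ScaleRepr M.γ M.σ M.ν M.q Φ ζ) {b : ℝ} (hb : 0 ≤ b) :
    M.p b = thresholdKernel M.S M.σ (M.A b) M.δ b Φ ζ := by
  funext z
  have h : ∀ y ∈ Set.Ioc 0 b, deriv M.W y = expMix Φ ζ 1 y ∧ deriv (deriv M.W) y = expMix Φ ζ 2 y :=
    fun y hy => ⟨R.deriv_scaleFunction hy.1, R.deriv_deriv_scaleFunction hy.1⟩
  have e1 : ∫ y in (0 : ℝ)..b, Real.exp (z * y) * deriv M.W y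
      = ∫ y in (0 : ℝ)..b, Real.exp (z * y) * expMix Φ ζ 1 y := by
    rw [intervalIntegral.integral_of_le hb, intervalIntegral.integral_of_le hb]
    exact setIntegral_congr_fun measurableSet_Ioc fun y hy => by simp only [(h y hy).1]
  have e2 : ∫ y in (0 : ℝ)..b, Real.exp (z * y) * deriv (deriv M.W) y
      = ∫ y in (0 : ℝ)..b, Real.exp (z * y) * expMix Φ ζ 2 y := by
    rw [intervalIntegral.integral_of_le hb, intervalIntegral.integral_of_le hb]
    exact setIntegral_congr_fun measurableSet_Ioc fun y hy => by simp only [(h y hy).2]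
  have hi : ∀ k ≤ 3, IntervalIntegrable (fun y => Real.exp (z * y) * expMix Φ ζ k y) volume 0 b :=
    fun k hk => by
      refine ContinuousOn.intervalIntegrable ?_
      rw [Set.uIcc_of_le hb]
      exact ContinuousOn.mul (by fun_prop) ((R.continuousOn_expMix hk).mono Set.Icc_subset_Ici_self)
  have e3 : ∫ y in (0 : ℝ)..b, Real.exp (z * y) * baseValue M.S M.σ (M.A b) Φ ζ 1 y
      = M.S * (M.σ ^ 2 / 2) * (∫ y in (0 : ℝ)..b, Real.exp (z * y) * expMix Φ ζ 2 y)
        + M.A b * ∫ y in (0 : ℝ)..b, Real.exp (z * y) * expMix Φ ζ 1 y := by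
    rw [← intervalIntegral.integral_const_mul, ← intervalIntegral.integral_const_mul,
      ← intervalIntegral.integral_add ((hi 2 (by omega)).const_mul _)
        ((hi 1 (by omega)).const_mul _)]
    exact intervalIntegral.integral_congr fun y _ => by simp only [baseValue]; ring
  rw [p, thresholdKernel, e1, e2, e3]
  ring

/-- At `b*` the smooth fit condition holds. -/
theorem Standing.exists_smoothFit (hM : M.Standing) (hb : 0 < M.bStar) :
    M.bStar ≠ ⊤ ∧ ∃ (Φ : ℝ) (ζ ξ : Measure ℝ), SmoothFit M.γ M.σ M.ν M.q M.δ M.S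
        (M.A M.bStar.toReal) M.bStar.toReal Φ (M.φ M.q) ζ ξ ∧
      ∀ y, 0 ≤ y → y ≤ M.bStar.toReal →
        1 ≤ baseValue M.S M.σ (M.A M.bStar.toReal) Φ ζ 1 y := by
  have := hM.finite
  have hδ := hM.δ_pos
  have hσ := hM.σ_pos
  obtain ⟨Φ, ζ, R⟩ := exists_scaleRepr (γ := M.γ) hσ hM.density hM.q_pos
  obtain ⟨φ, ξ, RY⟩ := exists_scaleRepr (γ := M.γ - M.δ) hσ hM.density hM.q_pos
  have hφe : M.φ M.q = φ := RY.rightInverse_eq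
  have hφ0 := RY.φ_pos
  have hroot : laplaceExponent M.γ M.σ M.ν φ = M.q + M.δ * φ := by
    have := (rightInverse_spec (γ := M.γ - M.δ) hσ hM.density hM.q_pos).2.1
    rw [RY.rightInverse_eq, laplaceExponent_sub] at this
    linarith
  -- `ψ_X` exceeds `q` by `δφ > 0` at `φ`. Hence the weighted tails of `W'` and `W''` defining `A`
  -- converge.
  have hlt : Φ < φ := by
    obtain ⟨-, h1, h2, -⟩ := rightInverse_spec (γ := M.γ) hσ hM.density hM.q_pos
    rw [R.rightInverse_eq] at h1 h2
    have hpos : 0 < M.δ * φ := mul_pos hδ hφ0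
    rcases lt_trichotomy φ Φ with h | h | h
    · have := h2 φ hφ0 h
      linarith
    · rw [h, h1] at hroot
      rw [h] at hpos
      linarith
    · exact h
  set s := M.S * (M.σ ^ 2 / 2) with hs
  have hs0 : 0 < s := by have := hM.S_pos; positivity
  set w1 := expMix Φ ζ 1 with hw1
  set w2 := expMix Φ ζ 2 with hw2
  set f : ℝ → ℝ := fun y => Real.exp (-M.φ M.q * y) * (1 - s * w2 y) with hf
  set g : ℝ → ℝ := fun y => Real.exp (-M.φ M.q * y) * w1 y with hg
  set r : ℝ → ℝ := fun y => (1 - s * w2 y) / w1 y with hr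
  have hw1c : ContinuousOn w1 (Set.Ici 0) := R.continuousOn_expMix (by omega)
  have hw2c : ContinuousOn w2 (Set.Ici 0) := R.continuousOn_expMix (by omega)
  have hw1p := R.expMix_one_pos
  have hfc : ContinuousOn f (Set.Ici 0) :=
    ContinuousOn.mul (by fun_prop) (continuousOn_const.sub (continuousOn_const.mul hw2c))
  have hgc : ContinuousOn g (Set.Ici 0) := ContinuousOn.mul (by fun_prop) hw1c
  have hgi : IntegrableOn g (Set.Ioi 0) := by
    have := R.laplaceIntegrable_expMix (k := 1) (by omega) hlt
    rw [← hφe] at this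
    exact this
  have hfi : IntegrableOn f (Set.Ioi 0) := by
    have h1 := R.laplaceIntegrable_expMix (k := 2) (by omega) hlt
    rw [← hφe] at h1
    have h2 : IntegrableOn (fun y => Real.exp (-M.φ M.q * y)) (Set.Ioi 0) :=
      exp_neg_integrableOn_Ioi 0 (by rw [hφe]; exact hφ0)
    refine (h2.sub (Integrable.const_mul h1 s)).congr (Eventually.of_forall fun y => ?_)
    simp only [hf, hw2, Pi.sub_apply]
    ring
  have hgp : ∀ y ≥ 0, 0 < g y := fun y _ => mul_pos (Real.exp_pos _) (hw1p y)
  have hfg : ∀ y, f y / g y = r y := fun y =>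
    mul_div_mul_left _ _ (Real.exp_pos _).ne'
  have hrc : ContinuousOn r (Set.Ici 0) :=
    (continuousOn_const.sub (continuousOn_const.mul hw2c)).div hw1c fun y _ => (hw1p y).ne'
  have hA : ∀ b ≥ 0, M.A b = (∫ y in Set.Ioi b, f y) / ∫ y in Set.Ioi b, g y := fun b hb =>
    A_eq R hb
  have hT : ∀ b ≥ 0, HasDerivWithinAt M.A (g b / (∫ y in Set.Ioi b, g y) * (M.A b - r b))
      (Set.Ici 0) b := fun b hb => by
    have := hasDerivWithinAt_tailRatio hfc hfi hgc hgi hgp hb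
    rw [hfg, ← hA b hb] at this
    exact this.congr (fun y hy => hA y hy) (hA b hb)
  -- `A b` is a weighted mean of `r` over `(b, ∞)`, so it cannot exceed `r` at a maximum point of
  -- `r`.
  have hex : ∃ b ≥ 0, M.A b ≤ r b := by
    obtain ⟨b, hb, hmax⟩ := R.exists_max_ratio hs0
    refine ⟨b, hb, ?_⟩
    rw [hA b hb, ← hfg]
    refine tailRatio_le hfi hgi hgp hb fun y hy => ?_
    rw [hfg, hfg]
    exact hmax y (hb.trans hy)
  obtain ⟨h1, h2, h3⟩ := first_nonpos_deriv (T := M.A) (r := r) (B := M.bStar)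
    (k := fun b => g b / ∫ y in Set.Ioi b, g y)
    (fun b hb => div_pos (hgp b hb) (integral_Ioi_pos hgp hgi hb)) hT hrc hex rfl hb
  set β := M.bStar.toReal with hβ
  have hβ0 : 0 < β := ENNReal.toReal_pos hb.ne' h1
  refine ⟨h1, Φ, ζ, ξ, ?_, fun y hy hyβ => ?_⟩
  · rw [hφe]
    refine ⟨R, RY, hσ, hδ, hβ0, hlt, ?_, hroot, ?_⟩
    · rw [h2, baseValue, ← hs, ← hw1, ← hw2]
      simp only [hr]
      rw [div_mul_cancel₀ _ (hw1p β).ne']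
      ring
    -- The tail condition is the definition of `A` at `b*`, cleared of its denominator.
    · have hG := integral_Ioi_pos hgp hgi hβ0.le
      have e : ∀ y, Real.exp (-φ * y) * (1 - baseValue M.S M.σ (M.A β) Φ ζ 1 y)
          = f y - M.A β * g y := fun y => by
        simp only [hf, hg, baseValue, hφe, ← hs]
        ring
      simp_rw [e]
      rw [integral_sub (hfi.mono_set (Set.Ioi_subset_Ioi hβ0.le))
        ((hgi.mono_set (Set.Ioi_subset_Ioi hβ0.le)).const_mul _), integral_const_mul,
        hA β hβ0.le, div_mul_cancel₀ _ hG.ne', sub_self]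
  · have := (div_le_iff₀ (hw1p y)).1 (h3 y hy hyβ)
    simp only [baseValue, ← hs]
    linarith

end DividendData

end

theorem lemma3p8 (M : DividendData) (hM : M.Standing)
    {Ω : Type*} {mΩ : MeasurableSpace Ω} (P : Measure Ω) [IsProbabilityMeasure P]
    (𝓕 : Filtration ℝ≥0 mΩ) (X : ℝ≥0 → Ω → ℝ)
    (hX : IsSpectrallyNegativeLevy P 𝓕 M.γ M.σ M.ν X)
    (hb : 0 < M.bStar)
    (U : ℝ → ℝ≥0 → Ω → ℝ)
    (hU : ∀ x, IsThresholdSurplus P 𝓕 X M.δ M.bStar.toReal x (U x)) :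
    M.bStar ≠ ⊤ ∧
    (∃ ξ : Measure ℝ, IsFiniteMeasure ξ ∧ ξ (Set.Iic 0) = 0 ∧
      (∀ x > 0, M.WY x = deriv M.φ M.q * Real.exp (M.φ M.q * x)
        - ∫ t in Set.Ioi (0 : ℝ), Real.exp (-x * t) ∂ξ) ∧
      ∀ x > M.bStar.toReal,
        IntegrableOn (fun z => Real.exp (-x * z) * M.p M.bStar.toReal z) (Set.Ioi 0) ξ ∧
        HasDerivAt (M.value P M.bStar.toReal U)
          (∫ z in Set.Ioi (0 : ℝ), Real.exp (-x * z) * M.p M.bStar.toReal z ∂ξ) x) ∧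
    ConcaveOn ℝ (Set.Ici 0) (M.p M.bStar.toReal) ∧
    (∀ x > M.bStar.toReal, DifferentiableAt ℝ (deriv (M.value P M.bStar.toReal U)) x) ∧
    ∃ β : ℝ, 0 < β ∧ ∃ l : ℝ,
      Tendsto (deriv (deriv (M.value P M.bStar.toReal U))) (𝓝[>] M.bStar.toReal) (𝓝 l) ∧
      ∀ x > M.bStar.toReal, deriv (deriv (M.value P M.bStar.toReal U)) x
        ≤ Real.exp (-(x - M.bStar.toReal) * β) * l := by
  have hfin := hM.finite
  obtain ⟨htop, Φ, ζ, ξ, H, hge⟩ := hM.exists_smoothFit hb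
  obtain ⟨ρ, hρ⟩ := hM.density.exists_isJumpDensity
  obtain ⟨K, hK⟩ := H.exists_isThresholdSolution hρ
  have hp := DividendData.p_eq H.reprX H.b_pos.le
  set b := M.bStar.toReal with hbdef
  have hb0 : 0 < b := H.b_pos
  set v := thresholdValue M.S M.σ (M.A b) M.δ b Φ (M.φ M.q) ζ ξ with hv
  have hval : ∀ x, 0 ≤ x → M.value P b U x = v 0 x := fun x hx =>
    M.value_eq hM.q_pos hM.δ_pos hX hb0 hU hK hx
  have hd0 : ∀ x > 0, HasDerivAt (M.value P b U) (v 1 x) x := fun x hx => by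
    refine (H.hasDerivAt_thresholdValue (k := 0) (by omega) hx).congr_of_eventuallyEq ?_
    filter_upwards [Ioi_mem_nhds hx] with y hy using hval y (le_of_lt hy)
  have hd1 : ∀ x > 0, HasDerivAt (deriv (M.value P b U)) (v 2 x) x := fun x hx => by
    refine (H.hasDerivAt_thresholdValue (k := 1) (by omega) hx).congr_of_eventuallyEq ?_
    filter_upwards [Ioi_mem_nhds hx] with y hy using (hd0 y hy).deriv
  have hres : ξ.restrict (Set.Ioi 0) = ξ := Measure.restrict_eq_self_of_ae_mem H.reprY.ae_pos
  refine ⟨htop, ⟨ξ, H.reprY.fin, H.reprY.Iic_zero, fun x hx => ?_, fun x hx => ⟨?_, ?_⟩⟩, ?_,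
    fun x hx => (hd1 x (hb0.trans hx)).differentiableAt, ?_⟩
  · have hder : deriv M.φ M.q = ξ.real Set.univ := H.reprY.deriv_rightInverse
    rw [hres, hder]
    simpa [expMix, DividendData.WY] using H.reprY.scaleFunction_eq hx.le
  · rw [IntegrableOn, hres, hp]
    have hKc := H.continuous_kernel
    refine H.integrable_kernel_mul.2.1.mono (by fun_prop : Continuous _).aestronglyMeasurable ?_
    filter_upwards [H.reprY.ae_pos] with z hz
    simp only [norm_mul, Real.norm_eq_abs, Real.abs_exp]
    refine mul_le_mul_of_nonneg_right (Real.exp_le_exp.2 ?_) (abs_nonneg _)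
    have : b * z ≤ x * z := mul_le_mul_of_nonneg_right (le_of_lt hx) hz.le
    linarith
  · rw [hres, hp, ← H.thresholdValue_one_eq hx]
    exact hd0 x (hb0.trans hx)
  · rw [hp]
    exact H.concaveOn_thresholdKernel hM.S_pos.le hge
  · obtain ⟨β, hβ, hdecay⟩ := H.exists_decay hM.S_pos hge
    -- The limit is the second derivative of the candidate at `b` itself, continuous there by smooth
    -- fit.
    refine ⟨β, hβ, v 2 b, ?_, fun x hx => ?_⟩
    · have hc := ((H.continuousOn_thresholdValue le_rfl).continuousAt (Ici_mem_nhds hb0)).tendsto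
      refine (hc.mono_left nhdsWithin_le_nhds).congr' ?_
      filter_upwards [self_mem_nhdsWithin] with x hx using (hd1 x (hb0.trans hx)).deriv.symm
    · rw [(hd1 x (hb0.trans hx)).deriv]
      exact hdecay x hx
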